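/- **Setting.** Let $d\in\{2,3\}$, let $\Omega\subset\Omega^\star\subset\mathbb R^d$ be nonempty bounded convex domains, $\Gamma=\partial\Omega$ with outer unit normal $\mathbf n$, and assume that $\partial^\star\Omega^\star=\partial\Omega^\star\setminus\Gamma$ has positive surface measure. Write $\langle\cdot,\cdot\rangle$ for the inner product of $L^2(\Omega)$ and $[\cdot,\cdot]$ for that of $L^2(\Gamma)$; norms are over $\Omega$ unless another set is shown. Put $\mathbf v_\tau=\mathbf v|_\Gamma-(\mathbf v|_\Gamma\cdot\mathbf n)\mathbf n$, $\mathbf V=\{\mathbf v\in H^1(\Omega)^d:\mathbf v\cdot\mathbf n|_\Gamma=0\}$ with $\|\mathbf v\|_{\mathbf V}^2=\|\nabla\mathbf v\|_{L^2}^2+\|\mathbf v_\tau\|_{L^2(\Gamma)}^2$, $H^1_\star(\Omega^\star)=\{v\in H^1(\Omega^\star):v|_{\partial^\star\Omega^\star}=0\}$, and $\mathbf S(\mathbf v)=\frac12(\nabla\mathbf v+\nabla\mathbf v^{\top})$. Let $\gamma,\delta,\alpha,\lambda,\varepsilon_D,L_s>0$ and $\theta_s\in\mathbb R$. Let $\rho,\eta,\beta,M,K,\varepsilon:\mathbb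 R\to\mathbb R$ be $C^1$ functions with bounded derivatives and with values in compact subintervals of $(0,\infty)$. Put $\varepsilon^\star(\varphi)=\varepsilon(\varphi)$ in $\Omega$ and $\varepsilon^\star(\varphi)=\varepsilon_D$ in $\Omega^\star\setminus\Omega$, and $$\mathcal W(\xi)=\begin{cases}(\xi+1)^2,&\xi<-1\\ \frac14(1-\xi^2)^2,&|\xi|\le1\\ (\xi-1)^2,&\xi>1,\end{cases}\quad \Theta_{fs}(\xi)=\frac{\cos\theta_s}{2}\sin\frac{\pi\xi}{2},\quad \psi(\xi)=\frac{1}{L_s\delta}e^{-\xi^2/(2\delta)},\quad \mathcal E(a,b)=\int_0^1\varepsilon'(sa+(1-s)b)\,ds .$$ Fix a measurable unit tangent field $\mathbf t$ on $\Gamma$ (for $d=2$ the unit tangent of the curve $\Gamma$). In expressions containing $\psi$, the product $\mathbf v_\tau\psi(\phi)$ denotes the scalar $(\mathbf v_\tau\cdot\mathbf t)\,\psi(\phi)$ on $\Gamma$. **The scheme.** Let $T>0$, $0<\Delta t\le T$, $N=\lceil T/\Delta t\rceil$, $\mathfrak d\varphi^{n}=\varphi^{n}-\varphi^{n-1}$,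 $\overline{\varphi^n}=\frac12(\varphi^n+\varphi^{n-1})$. Let $\mathbb W_h\subset H^1_\star(\Omega^\star)$, $\mathbb Q_h\subset H^1(\Omega)$, $\mathbb X_h\subset\mathbf V$ and $\mathbb M_h\subset\{p\in L^2(\Omega):\int_\Omega p=0\}$ be finite dimensional subspaces such that $W_h|_\Omega\in\mathbb Q_h$ for all $W_h\in\mathbb W_h$. Given $\bar V_0^n\in H^1(\Omega^\star)$, $0\le n\le N$, and $q_h^0,\phi_h^0\in\mathbb Q_h$, $\mathbf u_h^0\in\mathbb X_h$, a solution of the fully discrete scheme consists of $(V_h^{n+1},q_h^{n+1},\phi_h^{n+1},\mu_h^{n+1},\mathbf u_h^{n+1},p_h^{n+1})\in(\mathbb W_h+\bar V_0^{n+1})\times\mathbb Q_h^3\times\mathbb X_h\times\mathbb M_h$, $0\le n\le N-1$, with, for all $W_h\in\mathbb W_h$, $r_h,\bar\phi_h,\bar\mu_h\in\mathbb Q_h$, $\mathbf w_h\in\mathbb X_h$, $\bar p_h\in\mathbb M_h$ (in the fourth equation, for those $\bar\mu_h$ for which $\mathcal E(\phi_h^{n+1},\phi_h^n)|\nabla V_h^{n+1}|^2\bar\mu_h$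 is integrable, e.g. all bounded ones), $$\langle\varepsilon^\star(\phi_h^{n+1})\nabla V_h^{n+1},\nabla W_h\rangle_{\Omega^\star}=\langle q_h^{n+1},W_h\rangle,$$ $$\Big\langle\tfrac{\mathfrak d q_h^{n+1}}{\Delta t},r_h\Big\rangle-\langle q_h^n\mathbf u_h^{n+1},\nabla r_h\rangle+\langle K(\phi_h^n)\nabla(\lambda q_h^{n+1}+V_h^{n+1}),\nabla r_h\rangle=0,$$ $$\Big\langle\tfrac{\mathfrak d\phi_h^{n+1}}{\Delta t},\bar\phi_h\Big\rangle+\langle\mathbf u_h^{n+1}\cdot\nabla\phi_h^n,\bar\phi_h\rangle+\langle M(\phi_h^n)\nabla\mu_h^{n+1},\nabla\bar\phi_h\rangle=0,$$ $$\begin{aligned}\langle\mu_h^{n+1},\bar\mu_h\rangle={}&\tfrac\gamma\delta\langle\mathcal W'(\phi_h^n)+\mathcal A\,\mathfrak d\phi_h^{n+1},\bar\mu_h\rangle+\gamma\delta\langle\nabla\phi_h^{n+1},\nabla\bar\mu_h\rangle-\tfrac12\langle\mathcal E(\phi_h^{n+1},\phi_h^n)|\nabla V_h^{n+1}|^2,\bar\mu_h\rangle\\&+\tfrac12\langle\rho'(\phi_h^n)\mathbf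 u_h^n\cdot\mathbf u_h^{n+1},\bar\mu_h\rangle+\alpha\Big[\tfrac{\mathfrak d\phi_h^{n+1}}{\Delta t}+\mathbf u_{h\tau}^{n+1}\psi(\phi_h^n),\bar\mu_h\Big]+\gamma[\Theta_{fs}'(\phi_h^n)+\mathcal B\,\mathfrak d\phi_h^{n+1},\bar\mu_h],\end{aligned}$$ $$\begin{aligned}&\Big\langle\tfrac{\overline{\rho(\phi_h^{n+1})}\mathbf u_h^{n+1}-\rho(\phi_h^n)\mathbf u_h^n}{\Delta t},\mathbf w_h\Big\rangle+\langle\rho(\phi_h^n)\mathbf u_h^n\cdot\nabla\mathbf u_h^{n+1},\mathbf w_h\rangle+\tfrac12\langle\operatorname{div}(\rho(\phi_h^n)\mathbf u_h^n)\mathbf u_h^{n+1},\mathbf w_h\rangle+\langle\eta(\phi_h^n)\mathbf S(\mathbf u_h^{n+1}),\mathbf S(\mathbf w_h)\rangle\\&-\langle p_h^{n+1},\operatorname{div}\mathbf w_h\rangle+[\beta(\phi_h^n)\mathbf u_{h\tau}^{n+1},\mathbf w_{h\tau}]+\alpha[\mathbf u_{h\tau}^{n+1}\psi(\phi_h^n),\mathbf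 w_{h\tau}\psi(\phi_h^n)]=\langle\mu_h^{n+1}\nabla\phi_h^n,\mathbf w_h\rangle\\&-\langle q_h^n\nabla(\lambda q_h^{n+1}+V_h^{n+1}),\mathbf w_h\rangle+\tfrac12\Big\langle\rho'(\phi_h^n)\tfrac{\mathfrak d\phi_h^{n+1}}{\Delta t}\mathbf u_h^n,\mathbf w_h\Big\rangle-\alpha\Big[\tfrac{\mathfrak d\phi_h^{n+1}}{\Delta t},\mathbf w_{h\tau}\psi(\phi_h^n)\Big],\end{aligned}$$ $$\langle\bar p_h,\operatorname{div}\mathbf u_h^{n+1}\rangle=0.$$ Set $V_h^0=0$, $\mu_h^0=0$ and $\dot\phi_h^{n+1}=\mathfrak d\phi_h^{n+1}/\Delta t+\mathbf u_{h\tau}^{n+1}\psi(\phi_h^n)$ on $\Gamma$. **Proposition (Discrete stability).** For given $\Omega,\Omega^\star,\mathbf t$, parameters and material functions as above, $T>0$ and $R$, there is a constant $c$ such that the following holds for all $\mathcal A\ge\frac12\sup_{\xi\in\mathbb R}\mathcal W''(\xi)$, all $\mathcal B\ge\frac12\sup_{\xi\in\mathbb R}\Theta_{fs}''(\xi)$,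 all $\Delta t\in(0,T]$, all discrete spaces as above and all data with $$\|\mathbf u_h^0\|_{L^2}+\sqrt{\Delta t}\,\|\mathbf u_h^0\|_{\mathbf V}+\|\phi_h^0\|_{H^1}+\|q_h^0\|_{L^2}+\sqrt{\Delta t}\,\|\nabla q_h^0\|_{L^2}+\max_{0\le n\le N}\|\bar V_0^n\|_{H^1(\Omega^\star)}+\sum_{n=1}^N\|\mathfrak d\bar V_0^n\|_{H^1(\Omega^\star)}\le R:$$ every solution of the scheme satisfies $$\begin{aligned}&\max_n\|\mathbf u_h^n\|_{L^2}+\Big(\sum_{n=1}^N\|\mathfrak d\mathbf u_h^n\|_{L^2}^2\Big)^{1/2}+\Big(\Delta t\sum_{n=0}^N\|\mathbf u_h^n\|_{\mathbf V}^2\Big)^{1/2}+\max_n\|q_h^n\|_{L^2}+\Big(\sum_{n=1}^N\|\mathfrak d q_h^n\|_{L^2}^2\Big)^{1/2}\\&+\max_n\|\nabla\phi_h^n\|_{L^2}+\Big(\sum_{n=1}^N\|\nabla\mathfrak d\phi_h^n\|_{L^2}^2\Big)^{1/2}+\max_n\|\mathcal W(\phi_h^n)\|_{L^1}+\max_n\|\nabla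 V_h^n\|_{L^2(\Omega^\star)}+\Big(\sum_{n=1}^N\|\nabla\mathfrak d V_h^n\|_{L^2(\Omega^\star)}^2\Big)^{1/2}\\&+\Big(\Delta t\sum_{n=1}^N\|\dot\phi_h^n\|_{L^2(\Gamma)}^2\Big)^{1/2}+\max_n\|\Theta_{fs}(\phi_h^n)\|_{L^1(\Gamma)}+\Big(\Delta t\sum_{n=0}^N\|\nabla\mu_h^n\|_{L^2}^2\Big)^{1/2}+\Big(\Delta t\sum_{n=0}^N\|\nabla(\lambda q_h^n+V_h^n)\|_{L^2}^2\Big)^{1/2}\le c,\end{aligned}$$ where each maximum is over $0\le n\le N$. In particular $c$ depends neither on the discrete spaces (hence not on $h$) nor on $\Delta t$ nor on the solution. -/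

import Mathlib

open MeasureTheory Set
open scoped ContDiff

noncomputable section

namespace Electrowetting

/-! ### Function spaces -/

/-- Euclidean space `ℝ^d`. -/
abbrev E (d : ℕ) := EuclideanSpace ℝ (Fin d)

/-- Lebesgue measure on a subset of `ℝ^d`. -/
abbrev vol {d : ℕ} (Ω : Set (E d)) : Measure (E d) := volume.restrict Ω

/-- Surface measure on the boundary of `Ω`: the `(d-1)`-dimensional Hausdorff measure, normalised
as usual (it is Lebesgue measure on hyperplanes). -/
abbrev surf {d : ℕ} (Ω : Set (E d)) : Measure (E d) :=
  (Measure.euclideanHausdorffMeasure (d - 1)).restrict (frontier Ω)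

/-- Triples (function in `L²(Ω)`, field in `L²(Ω)^d`, boundary function in `L²(∂Ω)`). -/
abbrev Triple {d : ℕ} (Ω : Set (E d)) :=
  Lp ℝ 2 (vol Ω) × Lp (E d) 2 (vol Ω) × Lp ℝ 2 (surf Ω)

/-- A test function: infinitely differentiable with compact support in `ℝ^d`. -/
def IsTest {d : ℕ} (ζ : E d → ℝ) : Prop := ContDiff ℝ ∞ ζ ∧ HasCompactSupport ζ

theorem IsTest.memLp {d : ℕ} {ζ : E d → ℝ} (h : IsTest ζ) (Ω : Set (E d)) :
    MemLp ζ 2 (vol Ω) :=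
  (h.1.continuous.memLp_of_hasCompactSupport h.2 (μ := volume)).restrict Ω

theorem IsTest.memLp_gradient {d : ℕ} {ζ : E d → ℝ} (h : IsTest ζ) (Ω : Set (E d)) :
    MemLp (gradient ζ) 2 (vol Ω) := by
  have hc : Continuous (gradient ζ) :=
    (InnerProductSpace.toDual ℝ (E d)).symm.continuous.comp (h.1.continuous_fderiv (by simp))
  have hs : HasCompactSupport (gradient ζ) :=
    (h.2.fderiv (𝕜 := ℝ)).comp_left (g := (InnerProductSpace.toDual ℝ (E d)).symm) (by simp)
  exact (hc.memLp_of_hasCompactSupport hs (μ := volume)).restrict Ω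

theorem IsTest.integrable_left {d : ℕ} {ζ : E d → ℝ} (h : IsTest ζ) (Ω : Set (E d))
    (v : Lp ℝ 2 (vol Ω)) : Integrable (fun x => v x • gradient ζ x) (vol Ω) :=
  memLp_one_iff_integrable.1 ((h.memLp_gradient Ω).smul (Lp.memLp v))

theorem IsTest.integrable_right {d : ℕ} {ζ : E d → ℝ} (h : IsTest ζ) (Ω : Set (E d))
    (g : Lp (E d) 2 (vol Ω)) : Integrable (fun x => ζ x • g x) (vol Ω) :=
  memLp_one_iff_integrable.1 ((Lp.memLp g).smul (h.memLp Ω))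

/-- The triples `(v, g, t)` for which `g` is the weak gradient of `v` in `Ω`. -/
def weakGradient {d : ℕ} (Ω : Set (E d)) : Submodule ℝ (Triple Ω) where
  carrier := {x | ∀ ζ : E d → ℝ, IsTest ζ → tsupport ζ ⊆ Ω →
    ∫ y in Ω, x.1 y • gradient ζ y = -∫ y in Ω, ζ y • x.2.1 y}
  zero_mem' := by
    intro ζ _ _
    have h1 : ∫ y in Ω, (0 : Triple Ω).1 y • gradient ζ y = 0 :=
      integral_eq_zero_of_ae <| (Lp.coeFn_zero ℝ 2 (vol Ω)).mono fun y hy => by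
        simp only [Prod.fst_zero, hy, Pi.zero_apply, zero_smul]
    have h2 : ∫ y in Ω, ζ y • (0 : Triple Ω).2.1 y = 0 :=
      integral_eq_zero_of_ae <| (Lp.coeFn_zero (E d) 2 (vol Ω)).mono fun y hy => by
        simp only [Prod.fst_zero, Prod.snd_zero, hy, Pi.zero_apply, smul_zero]
    rw [h1, h2, neg_zero]
  add_mem' := by
    intro a b ha hb ζ hζ hs
    have h1 : ∫ y in Ω, (a + b).1 y • gradient ζ y
        = (∫ y in Ω, a.1 y • gradient ζ y) + ∫ y in Ω, b.1 y • gradient ζ y := by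
      rw [← integral_add (hζ.integrable_left Ω _) (hζ.integrable_left Ω _)]
      refine integral_congr_ae <| (Lp.coeFn_add a.1 b.1).mono fun y hy => ?_
      simp only [Prod.fst_add, hy, Pi.add_apply, add_smul]
    have h2 : ∫ y in Ω, ζ y • (a + b).2.1 y
        = (∫ y in Ω, ζ y • a.2.1 y) + ∫ y in Ω, ζ y • b.2.1 y := by
      rw [← integral_add (hζ.integrable_right Ω _) (hζ.integrable_right Ω _)]
      refine integral_congr_ae <| (Lp.coeFn_add a.2.1 b.2.1).mono fun y hy => ?_
      simp only [Prod.fst_add, Prod.snd_add, hy, Pi.add_apply, smul_add]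
    rw [h1, h2, ha ζ hζ hs, hb ζ hζ hs, neg_add]
  smul_mem' := by
    intro c a ha ζ hζ hs
    have h1 : ∫ y in Ω, (c • a).1 y • gradient ζ y = c • ∫ y in Ω, a.1 y • gradient ζ y := by
      rw [← integral_smul]
      refine integral_congr_ae <| (Lp.coeFn_smul c a.1).mono fun y hy => ?_
      simp only [Prod.smul_fst, hy, Pi.smul_apply, smul_assoc]
    have h2 : ∫ y in Ω, ζ y • (c • a).2.1 y = c • ∫ y in Ω, ζ y • a.2.1 y := by
      rw [← integral_smul]
      refine integral_congr_ae <| (Lp.coeFn_smul c a.2.1).mono fun y hy => ?_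
      simp only [Prod.smul_fst, Prod.smul_snd, hy, Pi.smul_apply]
      exact smul_comm (ζ y) c _
    rw [h1, h2, ha ζ hζ hs, smul_neg]

/-- The triples `(f|_Ω, ∇f|_Ω, f|_∂Ω)` of smooth functions `f` on `ℝ^d`. -/
def smoothTriples {d : ℕ} (Ω : Set (E d)) : Set (Triple Ω) :=
  {x | ∃ f : E d → ℝ, IsTest f ∧ x.1 =ᵐ[vol Ω] f ∧ x.2.1 =ᵐ[vol Ω] gradient f ∧
    x.2.2 =ᵐ[surf Ω] f}

/-- The Sobolev space `H¹(Ω)` of a bounded Lipschitz domain. An element is a function `v ∈ L²(Ω)`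
with its weak gradient `∇v ∈ L²(Ω)^d` and its trace `v|_∂Ω ∈ L²(∂Ω)`, the trace being the limit in
`L²(∂Ω)` of `f_k|_∂Ω` for smooth `f_k` with `f_k → v` in `H¹(Ω)`. By the density of smooth functions
and the trace theorem, every `v ∈ L²(Ω)` with weak gradient in `L²` gives exactly one element. -/
def H1 {d : ℕ} (Ω : Set (E d)) : Submodule ℝ (Triple Ω) :=
  weakGradient Ω ⊓ (Submodule.span ℝ (smoothTriples Ω)).topologicalClosure

/-- The underlying function of an element of `H¹(Ω)`. -/
def fn {d : ℕ} {Ω : Set (E d)} (v : H1 Ω) : E d → ℝ := v.1.1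

/-- The weak gradient of an element of `H¹(Ω)`. -/
def grad {d : ℕ} {Ω : Set (E d)} (v : H1 Ω) : E d → E d := v.1.2.1

/-- The boundary trace of an element of `H¹(Ω)`. -/
def tr {d : ℕ} {Ω : Set (E d)} (v : H1 Ω) : E d → ℝ := v.1.2.2

/-- The norm of `L²(Ω)`. -/
def normL2 {d : ℕ} {Ω : Set (E d)} (v : H1 Ω) : ℝ := ‖v.1.1‖

/-- The seminorm `‖∇v‖_{L²(Ω)}`. -/
def normGrad {d : ℕ} {Ω : Set (E d)} (v : H1 Ω) : ℝ := ‖v.1.2.1‖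

/-- The norm of `H¹(Ω)`. -/
def normH1 {d : ℕ} {Ω : Set (E d)} (v : H1 Ω) : ℝ := √(normL2 v ^ 2 + normGrad v ^ 2)

/-- Vector fields in `H¹(Ω)^d`, given by their components. -/
abbrev VecH1 {d : ℕ} (Ω : Set (E d)) := Fin d → H1 Ω

/-- The divergence of a vector field. -/
def dvg {d : ℕ} {Ω : Set (E d)} (u : VecH1 Ω) (x : E d) : ℝ := ∑ i, grad (u i) x i

/-- The entries of the symmetric gradient `S(u) = (∇u + ∇uᵀ) / 2`. -/
def symGrad {d : ℕ} {Ω : Set (E d)} (u : VecH1 Ω) (x : E d) (i j : Fin d) : ℝ :=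
  (grad (u i) x j + grad (u j) x i) / 2

/-- The boundary trace of a vector field. -/
def trVec {d : ℕ} {Ω : Set (E d)} (u : VecH1 Ω) (x : E d) : E d :=
  WithLp.toLp 2 fun i => tr (u i) x

/-- `n` is an outer unit normal at the boundary point `x` of the convex set `Ω`. (At almost every
boundary point there is exactly one.) -/
def IsOuterNormal {d : ℕ} (Ω : Set (E d)) (x n : E d) : Prop :=
  ‖n‖ = 1 ∧ ∀ y ∈ Ω, inner ℝ n (y - x) ≤ 0

open Classical in
/-- The outer unit normal of a convex domain. -/
def normal {d : ℕ} (Ω : Set (E d)) (x : E d) : E d :=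
  if h : ∃ n, IsOuterNormal Ω x n then h.choose else 0

/-- The tangential component `u_τ = u - (u · n) n` of a vector field on the boundary. -/
def tang {d : ℕ} {Ω : Set (E d)} (u : VecH1 Ω) (x : E d) : E d :=
  trVec u x - inner ℝ (trVec u x) (normal Ω x) • normal Ω x

/-- `u · n = 0` on `∂Ω`: the normal trace, which is given by the Green formula
`⟨u · n, ζ⟩_∂Ω = ∫_Ω (u · ∇ζ + ζ div u)`, vanishes. This is the condition that defines the velocity
space `V ⊆ H¹(Ω)^d`. -/
def NormalTraceZero {d : ℕ} {Ω : Set (E d)} (u : VecH1 Ω) : Prop :=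
  ∀ ζ : E d → ℝ, IsTest ζ →
    ∫ x in Ω, ((∑ i, fn (u i) x * gradient ζ x i) + ζ x * dvg u x) = 0

/-- The norm of `L²(Ω)^d`. -/
def vecNormL2 {d : ℕ} {Ω : Set (E d)} (u : VecH1 Ω) : ℝ := √(∑ i, normL2 (u i) ^ 2)

/-- The norm of `V`: `‖u‖_V² = ‖∇u‖²_{L²(Ω)} + ‖u_τ‖²_{L²(∂Ω)}`. -/
def normV {d : ℕ} {Ω : Set (E d)} (u : VecH1 Ω) : ℝ :=
  √((∑ i, normGrad (u i) ^ 2) + ∫ x, ‖tang u x‖ ^ 2 ∂(surf Ω))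

/-! ### Norms of finite sequences `φ^0, …, φ^N`, built on a (semi)norm `p` -/

/-- The norm of `ℓ^∞`. -/
def seqSup {X : Type*} (N : ℕ) (p : X → ℝ) (φ : ℕ → X) : ℝ := ⨆ n : Fin (N + 1), p (φ n)

/-- The norm of `ℓ²`. -/
def seqL2 {X : Type*} (dt : ℝ) (N : ℕ) (p : X → ℝ) (φ : ℕ → X) : ℝ :=
  √(dt * ∑ n ∈ Finset.range (N + 1), p (φ n) ^ 2)

/-- The norm of `𝔥^{1/2}`: the square root of the sum of `p(φ^n - φ^{n-1})²` over `1 ≤ n ≤ N`. -/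
def seqHalf {X : Type*} [Sub X] (N : ℕ) (p : X → ℝ) (φ : ℕ → X) : ℝ :=
  √(∑ n ∈ Finset.range N, p (φ (n + 1) - φ n) ^ 2)

/-! ### The model -/

/-- The Ginzburg-Landau double well potential with quadratic growth. -/
def W (ξ : ℝ) : ℝ :=
  if ξ < -1 then (ξ + 1) ^ 2 else if ξ ≤ 1 then (1 - ξ ^ 2) ^ 2 / 4 else (ξ - 1) ^ 2

/-- The interface energy density `Θ_fs` for the contact angle `θ`. -/
def Theta (θ ξ : ℝ) : ℝ := Real.cos θ / 2 * Real.sin (Real.pi * ξ / 2)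

/-- A phase dependent material property: continuously differentiable with bounded derivative, and
with values in a compact interval of positive numbers. -/
def IsMaterial (f : ℝ → ℝ) : Prop :=
  ContDiff ℝ 1 f ∧ ∃ m M : ℝ, 0 < m ∧ ∀ ξ, m ≤ f ξ ∧ f ξ ≤ M ∧ |deriv f ξ| ≤ M

/-- The physical parameters and the material functions. -/
structure Model where
  /-- surface tension -/
  γ : ℝ
  /-- interface thickness -/
  δ : ℝ
  /-- phase field parameter of the boundary condition -/
  α : ℝ
  /-- charge regularisation parameter -/
  lam : ℝ
  /-- length scale in the function `ψ` -/
  len : ℝ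
  /-- permittivity of the dielectric plates -/
  epsD : ℝ
  /-- equilibrium contact angle -/
  θ : ℝ
  /-- density -/
  ρ : ℝ → ℝ
  /-- viscosity -/
  η : ℝ → ℝ
  /-- slip coefficient -/
  β : ℝ → ℝ
  /-- mobility -/
  M : ℝ → ℝ
  /-- conductivity -/
  K : ℝ → ℝ
  /-- permittivity of the fluids -/
  eps : ℝ → ℝ
  γ_pos : 0 < γ
  δ_pos : 0 < δ
  α_pos : 0 < α
  lam_pos : 0 < lam
  len_pos : 0 < len
  epsD_pos : 0 < epsD
  ρ_mat : IsMaterial ρ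
  η_mat : IsMaterial η
  β_mat : IsMaterial β
  M_mat : IsMaterial M
  K_mat : IsMaterial K
  eps_mat : IsMaterial eps

/-- `ψ(φ) = exp(-φ² / (2δ)) / (len δ)`, which replaces the tangential derivative of the phase field
on the boundary. -/
def Model.ψ (P : Model) (ξ : ℝ) : ℝ := 1 / P.len * (1 / P.δ) * Real.exp (-ξ ^ 2 / (2 * P.δ))

/-- The averaged derivative `∫_0^1 ε'(s a + (1 - s) b) ds` of the permittivity. -/
def Model.calE (P : Model) (a b : ℝ) : ℝ := ∫ s in (0 : ℝ)..1, deriv P.eps (s * a + (1 - s) * b)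

/-- The fluid domain `Ω` and the domain `Ωs` of the fluid and the plates. A bounded convex open
nonempty set is connected and has a Lipschitz boundary. -/
structure Geometry (d : ℕ) where
  Ω : Set (E d)
  Ωs : Set (E d)
  open_Ω : IsOpen Ω
  open_Ωs : IsOpen Ωs
  convex_Ω : Convex ℝ Ω
  convex_Ωs : Convex ℝ Ωs
  nonempty_Ω : Ω.Nonempty
  bounded_Ωs : Bornology.IsBounded Ωs
  subset : Ω ⊆ Ωs
  /-- the part `∂Ωs \ ∂Ω` of the boundary, where the voltage is prescribed, has positive surface
  measure (equivalently, `Ω ≠ Ωs`) -/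
  dirichlet : surf Ωs (frontier Ωs \ frontier Ω) ≠ 0
  /-- a unit tangent field on `Γ = ∂Ω`: the direction in which the tangential derivative is
  replaced by `ψ`; in dimension two, the unit tangent of the curve `Γ` -/
  tau : E d → E d
  tau_meas : AEStronglyMeasurable tau (surf Ω)
  tau_unit : ∀ᵐ x ∂(surf Ω), ‖tau x‖ = 1 ∧ inner ℝ (tau x) (normal Ω x) = 0

open Classical in
/-- The permittivity `ε^⋆(φ)`: `ε(φ)` in `Ω` and constant in the plates. -/
def epsStar {d : ℕ} (G : Geometry d) (P : Model) (φ : H1 G.Ω) (x : E d) : ℝ :=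
  if x ∈ G.Ω then P.eps (fn φ x) else P.epsD

/-- The scalar `u_τ ψ(φ)` on `Γ`: the component of `u_τ` in the direction `tau`, times `ψ(φ)`.
(The component of `u_τ` in a tangential direction is that of `u`.) -/
def slip {d : ℕ} (G : Geometry d) (P : Model) (u : VecH1 G.Ω) (φ : H1 G.Ω) (x : E d) : ℝ :=
  inner ℝ (trVec u x) (G.tau x) * P.ψ (tr φ x)

/-- `div (ρ(φ) u) = ρ'(φ) ∇φ · u + ρ(φ) div u`. -/
def divFlux {d : ℕ} (G : Geometry d) (P : Model) (φ : H1 G.Ω) (u : VecH1 G.Ω) (x : E d) : ℝ :=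
  deriv P.ρ (fn φ x) * (∑ i, grad φ x i * fn (u i) x) + P.ρ (fn φ x) * dvg u x

/-! ### The fully discrete scheme -/

/-- Discrete spaces: `Wh ⊆ H¹_⋆(Ωs)` for the voltage, `Qh ⊆ H¹(Ω)` for the charge, the phase field
and the chemical potential, `Xh ⊆ V` for the velocity and `Mh ⊆ L²(Ω)`, of functions with mean value
zero, for the pressure. -/
structure Spaces {d : ℕ} (G : Geometry d) where
  Wh : Submodule ℝ (H1 G.Ωs)
  Qh : Submodule ℝ (H1 G.Ω)
  Xh : Submodule ℝ (VecH1 G.Ω)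
  Mh : Submodule ℝ (Lp ℝ 2 (vol G.Ω))
  finite_Wh : FiniteDimensional ℝ Wh
  finite_Qh : FiniteDimensional ℝ Qh
  finite_Xh : FiniteDimensional ℝ Xh
  finite_Mh : FiniteDimensional ℝ Mh
  Wh_trace : ∀ w ∈ Wh, ∀ᵐ x ∂((surf G.Ωs).restrict (frontier G.Ωs \ frontier G.Ω)), tr w x = 0
  Xh_normal : ∀ u ∈ Xh, NormalTraceZero u
  Mh_mean : ∀ p ∈ Mh, ∫ x in G.Ω, p x = 0
  /-- compatibility: the restriction to `Ω` of any element of `Wh` belongs to `Qh` -/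
  compat : ∀ w ∈ Wh, ∃ r ∈ Qh, fn r =ᵐ[vol G.Ω] fn w

/-- Sequences of voltages, charges, phase fields, chemical potentials, velocities and pressures. -/
structure Approx {d : ℕ} (G : Geometry d) where
  V : ℕ → H1 G.Ωs
  q : ℕ → H1 G.Ω
  φ : ℕ → H1 G.Ω
  μ : ℕ → H1 G.Ω
  u : ℕ → VecH1 G.Ω
  p : ℕ → Lp ℝ 2 (vol G.Ω)

/-- `s` solves the fully discrete scheme with stabilisation parameters `A`, `B`, time step `dt`,
`N` steps, discrete spaces `S` and extended boundary voltages `Vbar`. -/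
structure IsSolution {d : ℕ} (G : Geometry d) (P : Model) (A B dt : ℝ) (N : ℕ) (S : Spaces G)
    (Vbar : ℕ → H1 G.Ωs) (s : Approx G) : Prop where
  -- initial values, with the conventions `V^0 = 0` and `μ^0 = 0`
  V_zero : s.V 0 = 0
  μ_zero : s.μ 0 = 0
  q_mem : ∀ n ≤ N, s.q n ∈ S.Qh
  φ_mem : ∀ n ≤ N, s.φ n ∈ S.Qh
  u_mem : ∀ n ≤ N, s.u n ∈ S.Xh
  μ_mem : ∀ n < N, s.μ (n + 1) ∈ S.Qh
  V_mem : ∀ n < N, s.V (n + 1) - Vbar (n + 1) ∈ S.Wh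
  p_mem : ∀ n < N, s.p (n + 1) ∈ S.Mh
  /-- voltage -/
  potential : ∀ n < N, ∀ w ∈ S.Wh,
    ∫ x in G.Ωs, epsStar G P (s.φ (n + 1)) x * inner ℝ (grad (s.V (n + 1)) x) (grad w x)
      = ∫ x in G.Ω, fn (s.q (n + 1)) x * fn w x
  /-- charge -/
  charge : ∀ n < N, ∀ r ∈ S.Qh,
    (∫ x in G.Ω, (fn (s.q (n + 1)) x - fn (s.q n) x) / dt * fn r x)
      - (∫ x in G.Ω, fn (s.q n) x * ∑ i, fn (s.u (n + 1) i) x * grad r x i)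
      + (∫ x in G.Ω, P.K (fn (s.φ n) x) *
          inner ℝ (P.lam • grad (s.q (n + 1)) x + grad (s.V (n + 1)) x) (grad r x)) = 0
  /-- phase field -/
  phase : ∀ n < N, ∀ χ ∈ S.Qh,
    (∫ x in G.Ω, (fn (s.φ (n + 1)) x - fn (s.φ n) x) / dt * fn χ x)
      + (∫ x in G.Ω, (∑ i, fn (s.u (n + 1) i) x * grad (s.φ n) x i) * fn χ x)
      + (∫ x in G.Ω, P.M (fn (s.φ n) x) * inner ℝ (grad (s.μ (n + 1)) x) (grad χ x)) = 0
  /-- chemical potential, tested with the functions `χ` for which the term with `|∇V|²` exists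
  (for instance all bounded ones) -/
  chemical : ∀ n < N, ∀ χ ∈ S.Qh,
    IntegrableOn (fun x => P.calE (fn (s.φ (n + 1)) x) (fn (s.φ n) x) *
      ‖grad (s.V (n + 1)) x‖ ^ 2 * fn χ x) G.Ω →
    ∫ x in G.Ω, fn (s.μ (n + 1)) x * fn χ x
      = P.γ / P.δ * (∫ x in G.Ω, (deriv W (fn (s.φ n) x)
            + A * (fn (s.φ (n + 1)) x - fn (s.φ n) x)) * fn χ x)
        + P.γ * P.δ * (∫ x in G.Ω, inner ℝ (grad (s.φ (n + 1)) x) (grad χ x))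
        - 1 / 2 * (∫ x in G.Ω, P.calE (fn (s.φ (n + 1)) x) (fn (s.φ n) x) *
            ‖grad (s.V (n + 1)) x‖ ^ 2 * fn χ x)
        + 1 / 2 * (∫ x in G.Ω, deriv P.ρ (fn (s.φ n) x) *
            (∑ i, fn (s.u n i) x * fn (s.u (n + 1) i) x) * fn χ x)
        + P.α * (∫ x, ((tr (s.φ (n + 1)) x - tr (s.φ n) x) / dt
            + slip G P (s.u (n + 1)) (s.φ n) x) * tr χ x ∂(surf G.Ω))
        + P.γ * (∫ x, (deriv (Theta P.θ) (tr (s.φ n) x)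
            + B * (tr (s.φ (n + 1)) x - tr (s.φ n) x)) * tr χ x ∂(surf G.Ω))
  /-- velocity -/
  velocity : ∀ n < N, ∀ w ∈ S.Xh,
    (∫ x in G.Ω, ∑ i, ((P.ρ (fn (s.φ (n + 1)) x) + P.ρ (fn (s.φ n) x)) / 2 * fn (s.u (n + 1) i) x
          - P.ρ (fn (s.φ n) x) * fn (s.u n i) x) / dt * fn (w i) x)
      + (∫ x in G.Ω, P.ρ (fn (s.φ n) x) *
          ∑ i, (∑ j, fn (s.u n j) x * grad (s.u (n + 1) i) x j) * fn (w i) x)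
      + 1 / 2 * (∫ x in G.Ω, divFlux G P (s.φ n) (s.u n) x *
          ∑ i, fn (s.u (n + 1) i) x * fn (w i) x)
      + (∫ x in G.Ω, P.η (fn (s.φ n) x) *
          ∑ i, ∑ j, symGrad (s.u (n + 1)) x i j * symGrad w x i j)
      - (∫ x in G.Ω, s.p (n + 1) x * dvg w x)
      + (∫ x, P.β (tr (s.φ n) x) * inner ℝ (tang (s.u (n + 1)) x) (tang w x) ∂(surf G.Ω))
      + P.α * (∫ x, slip G P (s.u (n + 1)) (s.φ n) x * slip G P w (s.φ n) x ∂(surf G.Ω))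
    = (∫ x in G.Ω, fn (s.μ (n + 1)) x * ∑ i, grad (s.φ n) x i * fn (w i) x)
      - (∫ x in G.Ω, fn (s.q n) x *
          ∑ i, (P.lam * grad (s.q (n + 1)) x i + grad (s.V (n + 1)) x i) * fn (w i) x)
      + 1 / 2 * (∫ x in G.Ω, deriv P.ρ (fn (s.φ n) x) *
          ((fn (s.φ (n + 1)) x - fn (s.φ n) x) / dt) * ∑ i, fn (s.u n i) x * fn (w i) x)
      - P.α * (∫ x, (tr (s.φ (n + 1)) x - tr (s.φ n) x) / dt * slip G P w (s.φ n) x ∂(surf G.Ω))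
  /-- incompressibility -/
  pressure : ∀ n < N, ∀ p ∈ S.Mh, ∫ x in G.Ω, p x * dvg (s.u (n + 1)) x = 0

/-! ### The estimate -/

/-- Size of the data `u^0`, `φ^0`, `q^0`, `Vbar`. The terms with `√dt` are the terms `n = 0` of the
`ℓ²`-norms of `u` in `V` and of `∇q`; the last two are the norm of `Vbar` in `ℓ^∞(H¹(Ωs))` and its
total variation in time. -/
def dataSize {d : ℕ} (G : Geometry d) (dt : ℝ) (N : ℕ) (Vbar : ℕ → H1 G.Ωs)
    (u₀ : VecH1 G.Ω) (φ₀ q₀ : H1 G.Ω) : ℝ :=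
  vecNormL2 u₀ + √dt * normV u₀ + normH1 φ₀ + normL2 q₀ + √dt * normGrad q₀
    + seqSup N normH1 Vbar + ∑ n ∈ Finset.range N, normH1 (Vbar (n + 1) - Vbar n)

/-- `‖φ̇^{n+1}‖_{L²(Γ)}` for the discrete material derivative
`φ̇^{n+1} = (φ^{n+1} - φ^n) / dt + u_τ^{n+1} ψ(φ^n)` on the boundary. -/
def materialNorm {d : ℕ} (G : Geometry d) (P : Model) (dt : ℝ) (s : Approx G) (n : ℕ) : ℝ :=
  √(∫ x, ((tr (s.φ (n + 1)) x - tr (s.φ n) x) / dt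
      + slip G P (s.u (n + 1)) (s.φ n) x) ^ 2 ∂(surf G.Ω))

/-- The sum of the norms that the stability estimate controls. -/
def stabilityNorm {d : ℕ} (G : Geometry d) (P : Model) (dt : ℝ) (N : ℕ) (s : Approx G) : ℝ :=
  seqSup N vecNormL2 s.u + seqHalf N vecNormL2 s.u + seqL2 dt N normV s.u
    + seqSup N normL2 s.q + seqHalf N normL2 s.q
    + seqSup N normGrad s.φ + seqHalf N normGrad s.φ
    + seqSup N (fun f => ∫ x in G.Ω, |W (fn f x)|) s.φ
    + seqSup N normGrad s.V + seqHalf N normGrad s.V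
    + √(dt * ∑ n ∈ Finset.range N, materialNorm G P dt s n ^ 2)
    + seqSup N (fun f => ∫ x, |Theta P.θ (tr f x)| ∂(surf G.Ω)) s.φ
    + seqL2 dt N normGrad s.μ
    + seqL2 dt N (fun n => √(∫ x in G.Ω, ‖P.lam • grad (s.q n) x + grad (s.V n) x‖ ^ 2)) id

end Electrowetting

end

open Electrowetting

open MeasureTheory Set
open scoped ContDiff FourierTransform SchwartzMap ENNReal LineDeriv

/-! ### Fourier representation of averages along segments -/

namespace Electrowetting

/-! The scheme obeys a discrete energy law. The energy is the sum of the kinetic energy, `λ/2 ‖q‖²`,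
the electric energy `½⟨ε⋆(φ)∇V, ∇V⟩`, the Ginzburg-Landau energy of `φ` and the boundary energy `Θ`.
The velocity equation is tested with `u^{n+1}`, the phase equation with `μ^{n+1}`, the equation of
`μ` with `(φ^{n+1} - φ^n)/dt`, and the charge equation with `λ q^{n+1} + V^{n+1} - Vbar^{n+1}`,
which is admissible by the compatibility of the spaces. The potential equations at the levels `n+1`
and `n` turn the increment of charge into an increment of electric energy. On adding up, the
couplings `μ∇φ·u`, `q∇(λq+V)·u` and `ρ'(φ)` cancel, and the boundary terms with `α` complete the
square `‖φ̇‖²`. The details of the discretisation serve this purpose: the averaged density makes the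
kinetic increment exact, convection vanishes by Green's formula because `u·n = 0`
(`convective_identity`), `calE` is an exact difference quotient of `ε`, and `A`, `B` dominate the
second order Taylor terms of `W` and `Θ`. The outcome is `IsSolution.energy_step`.

Only the boundary voltage spoils monotonicity. Its electric term is absorbed into a modified energy,
up to the increments of `Vbar`, whose sum is bounded. At `n = 0` no potential equation is available,
and a term `⟨q⁰, V¹ - Vbar¹⟩` remains, which Friedrichs' inequality controls. The conduction term is
handled by Young's inequality. The delicate term is `⟨q^n u^{n+1}, ∇Vbar^{n+1}⟩`, because `∇Vbar` is
only in `L²`. Here `‖q u‖₂² ≤ ‖q‖₂ ‖q‖₆ ‖u‖₆²`; the Sobolev embedding replaces `L⁶` norms by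
gradients, `λ∇q = ∇(λq+V) - ∇V` expresses `∇q` by the flux, and Korn's inequality expresses `∇u` by
the symmetric gradient and `‖u‖₂`. Since `q` enters this bound with half a power of its gradient,
two applications of Young's inequality leave arbitrarily small multiples of the dissipation plus a
multiple of `‖q‖²`. The flux occurs at the old time level; adding `κ dt ‖∇(λq+V)‖²` to the energy
moves it to the new one. A discrete Gronwall inequality concludes, and its constant involves neither
the discrete spaces nor the time step.

Korn's inequality rests on a bound of `‖f‖₂` when each `∂_k f` is a sum of derivatives of `L²`
functions (`exists_eLpNorm_le_of_fderiv_eq_sum`), applied to `f = ∂_j u_i`, whose derivatives are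
combinations of derivatives of the symmetric gradient. That bound compares `f` with a weighted mean
along the segments of the convex domain; small segment parameters are treated by Fourier transform,
the others by integration by parts. The Sobolev embedding is the Gagliardo-Nirenberg argument along
segments that stay in the domain, and the trace and Friedrichs inequalities use that a convex domain
lies on one side of its boundary, with a cone at each point. -/

theorem integral_mul_comp_affine_mul_eq_fourier {d : ℕ} (g s θ : 𝓢(E d, ℂ)) (t : ℝ) :
    ∫ p : E d × E d, g p.1 * s ((1 - t) • p.1 + t • p.2) * θ p.2
      = ∫ ζ, 𝓕 s ζ * 𝓕 g (-((1 - t) • ζ)) * 𝓕 θ (-(t • ζ)) := by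
  have hs : ∀ z, s z = ∫ ζ, Real.fourierChar (inner ℝ ζ z) • 𝓕 s ζ := by
    intro z
    have h : 𝓕⁻ (𝓕 s) = s := FourierTransform.fourierInv_fourier_eq s
    have := congrArg (fun f : 𝓢(E d, ℂ) => f z) h
    simp only [SchwartzMap.fourierInv_coe] at this
    rw [← this, Real.fourierInv_eq]
  have hg : ∀ (g : 𝓢(E d, ℂ)) (a : ℝ) (ζ : E d),
      𝓕 g (-(a • ζ)) = ∫ x, Real.fourierChar (inner ℝ ζ (a • x)) • g x := by
    intro g a ζ
    rw [SchwartzMap.fourier_coe, Real.fourier_eq]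
    congr 1; ext x
    congr 2
    simp [inner_smul_right, real_inner_comm]
  have hi : Integrable (fun q : (E d × E d) × E d =>
      Real.fourierChar (inner ℝ q.2 ((1 - t) • q.1.1 + t • q.1.2)) •
        ((g q.1.1 * θ q.1.2) * 𝓕 s q.2)) ((volume.prod volume).prod volume) := by
    have h0 : Integrable (fun q : (E d × E d) × E d => (g q.1.1 * θ q.1.2) * 𝓕 s q.2)
        ((volume.prod volume).prod volume) :=
      (g.integrable.mul_prod θ.integrable).mul_prod (𝓕 s).integrable
    refine h0.mono ?_ ?_
    · apply Continuous.aestronglyMeasurable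
      have : Continuous (fun q : (E d × E d) × E d => 𝓕 s q.2) :=
        (𝓕 s).continuous.comp continuous_snd
      have h1 : Continuous (fun q : (E d × E d) × E d => g q.1.1) :=
        g.continuous.comp (continuous_fst.comp continuous_fst)
      have h2 : Continuous (fun q : (E d × E d) × E d => θ q.1.2) :=
        θ.continuous.comp (continuous_snd.comp continuous_fst)
      have h3 : Continuous (fun q : (E d × E d) × E d =>
          Real.fourierChar (inner ℝ q.2 ((1 - t) • q.1.1 + t • q.1.2))) := by
        refine Real.continuous_fourierChar.comp ?_
        fun_prop
      simp_rw [Circle.smul_def, smul_eq_mul]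
      exact (continuous_subtype_val.comp h3).mul ((h1.mul h2).mul this)
    · exact Filter.Eventually.of_forall fun q => by rw [Circle.norm_smul]
  calc ∫ p : E d × E d, g p.1 * s ((1 - t) • p.1 + t • p.2) * θ p.2
      = ∫ p : E d × E d, ∫ ζ, Real.fourierChar (inner ℝ ζ ((1 - t) • p.1 + t • p.2)) •
        ((g p.1 * θ p.2) * 𝓕 s ζ) := by
        congr 1; ext p
        rw [hs, mul_right_comm, ← integral_const_mul]
        congr 1; ext ζ
        rw [mul_smul_comm]
    _ = ∫ ζ, ∫ p : E d × E d, Real.fourierChar (inner ℝ ζ ((1 - t) • p.1 + t • p.2)) •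
        ((g p.1 * θ p.2) * 𝓕 s ζ) := integral_integral_swap hi
    _ = _ := by
        congr 1; ext ζ
        rw [hg g, hg θ, mul_assoc, mul_comm (𝓕 s ζ), ← integral_prod_mul, ← integral_mul_const]
        congr 1; ext p
        simp only [inner_add_right, AddChar.map_add_eq_mul, Circle.smul_def, Circle.coe_mul,
          smul_eq_mul]
        ring

/-- The Fourier transform of the derivative is evaluated at `-tζ` and therefore contributes a factor
`t`. This factor later compensates the `t⁻¹` that comes from integrating by parts. -/
theorem integral_mul_comp_affine_mul_lineDeriv {d : ℕ} (g s η : 𝓢(E d, ℂ)) (m : E d) (t : ℝ) :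
    ∫ p : E d × E d, g p.1 * s ((1 - t) • p.1 + t • p.2) * (∂_{m} η) p.2
      = -(t * (2 * Real.pi * Complex.I) *
        ∫ ζ, 𝓕 s ζ * 𝓕 g (-((1 - t) • ζ)) * ((inner ℝ ζ m : ℝ) * 𝓕 η (-(t • ζ)))) := by
  rw [integral_mul_comp_affine_mul_eq_fourier, ← integral_const_mul, ← integral_neg]
  congr 1; ext ζ
  rw [SchwartzMap.fourier_lineDerivOp_eq]
  rw [smul_apply, SchwartzMap.smulLeftCLM_apply_apply (by fun_prop)]
  simp [inner_smul_left]
  ring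

end Electrowetting

/-! ### A weight integrable in the segment parameter, and a bilinear bound -/

namespace Electrowetting

/-- The weight `|ζ| / (1 + t² |ζ|²)`. -/
noncomputable def cauchyWeight {d : ℕ} (t : ℝ) (ζ : E d) : ℝ≥0∞ :=
  ENNReal.ofReal (‖ζ‖ / (1 + (t * ‖ζ‖) ^ 2))

theorem measurable_cauchyWeight {d : ℕ} :
    Measurable (fun q : ℝ × E d => cauchyWeight q.1 q.2) := by
  unfold cauchyWeight
  fun_prop

/-- A primitive in `t` is `arctan (t ‖ζ‖)`, which is bounded by `π/2` uniformly in `ζ`. Integration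
over `t` thus pays for one derivative. -/
theorem lintegral_cauchyWeight_le {d : ℕ} (ζ : E d) :
    ∫⁻ t in Ioo (0 : ℝ) (1 / 2), cauchyWeight t ζ ≤ 2 := by
  have hd : ∀ t : ℝ, HasDerivAt (fun t => Real.arctan (t * ‖ζ‖)) (‖ζ‖ / (1 + (t * ‖ζ‖) ^ 2)) t := by
    intro t
    have := ((hasDerivAt_id' t).mul_const ‖ζ‖).arctan
    convert this using 1
    ring
  have hc : Continuous fun t : ℝ => ‖ζ‖ / (1 + (t * ‖ζ‖) ^ 2) := by
    refine Continuous.div (by fun_prop) (by fun_prop) fun t => by positivity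
  have h1 : ∫ t in (0:ℝ)..(1 / 2), ‖ζ‖ / (1 + (t * ‖ζ‖) ^ 2) = Real.arctan (1 / 2 * ‖ζ‖) := by
    rw [intervalIntegral.integral_eq_sub_of_hasDerivAt (fun t _ => hd t)
      (hc.intervalIntegrable _ _)]
    simp
  unfold cauchyWeight
  rw [← ofReal_integral_eq_lintegral_ofReal, ← integral_Ioc_eq_integral_Ioo,
    ← intervalIntegral.integral_of_le (by norm_num), h1]
  · refine (ENNReal.ofReal_le_ofReal (Real.arctan_lt_pi_div_two _).le).trans ?_
    refine (ENNReal.ofReal_le_ofReal (by linarith [Real.pi_lt_four] :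
      Real.pi / 2 ≤ 2)).trans (by simp)
  · exact (hc.integrableOn_Icc (a := 0) (b := 1 / 2)).mono_set Ioo_subset_Icc_self
  · exact Filter.Eventually.of_forall fun t => by positivity

theorem lintegral_comp_smul_eq {d : ℕ} {f : E d → ℝ≥0∞} (hf : Measurable f) {r : ℝ} (hr : r ≠ 0) :
    ∫⁻ x, f (r • x) = ENNReal.ofReal |(r ^ d)⁻¹| * ∫⁻ x, f x := by
  rw [← lintegral_map hf (measurable_const_smul r), Measure.map_addHaar_smul _ hr,
    lintegral_smul_measure]
  simp

/-- Since `1/2 ≤ 1 - t ≤ 1`, the dilation at most halves the numerator and does not increase the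
denominator. This permits the substitution `ζ ↦ (1 - t) ζ` in the weighted integral of `b`. -/
theorem cauchyWeight_le {d : ℕ} {t : ℝ} (ht : t ∈ Ioo (0 : ℝ) (1 / 2)) (ζ : E d) :
    cauchyWeight t ζ ≤ 2 * cauchyWeight t ((1 - t) • ζ) := by
  unfold cauchyWeight
  have h0 : ∀ y : ℝ, 2 * ENNReal.ofReal y = ENNReal.ofReal (2 * y) := fun y => by
    rw [ENNReal.ofReal_mul (by norm_num)]; simp
  rw [h0]
  apply ENNReal.ofReal_le_ofReal
  have h1 : (1:ℝ) / 2 ≤ 1 - t := by linarith [ht.2]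
  have h2 : 1 - t ≤ 1 := by linarith [ht.1]
  rw [norm_smul, Real.norm_of_nonneg (by linarith), ← mul_div_assoc]
  have : (t * ((1 - t) * ‖ζ‖)) ^ 2 ≤ (t * ‖ζ‖) ^ 2 := by
    have h0 := ht.1
    have : (1 - t) * ‖ζ‖ ≤ 1 * ‖ζ‖ := by gcongr
    have h3 : 0 ≤ (1 - t) * ‖ζ‖ := mul_nonneg (by linarith) (norm_nonneg _)
    have : t * ((1 - t) * ‖ζ‖) ≤ t * ‖ζ‖ := by nlinarith
    exact pow_le_pow_left₀ (by positivity) this 2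
  gcongr
  nlinarith [norm_nonneg ζ]

attribute [irreducible] cauchyWeight

theorem lintegral_comp_smul_mul_cauchyWeight_le {d : ℕ} {b : E d → ℝ≥0∞} (hb : Measurable b)
    {t : ℝ} (ht : t ∈ Ioo (0 : ℝ) (1 / 2)) :
    ∫⁻ ζ, b ((1 - t) • ζ) * cauchyWeight t ζ ≤ 2 ^ (d + 1) * ∫⁻ ζ, b ζ * cauchyWeight t ζ := by
  have hm : Measurable fun ζ : E d => cauchyWeight t ζ :=
    measurable_cauchyWeight.comp (measurable_const.prodMk measurable_id)
  calc ∫⁻ ζ, b ((1 - t) • ζ) * cauchyWeight t ζ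
      ≤ ∫⁻ ζ, 2 * (b ((1 - t) • ζ) * cauchyWeight t ((1 - t) • ζ)) := by
        refine lintegral_mono fun ζ => ?_
        rw [mul_left_comm]
        exact mul_le_mul' le_rfl (cauchyWeight_le ht ζ)
    _ = 2 * (ENNReal.ofReal |((1 - t) ^ d)⁻¹| * ∫⁻ ζ, b ζ * cauchyWeight t ζ) := by
        have h2 : (1 - t) ≠ 0 := by linarith [ht.2]
        rw [lintegral_const_mul _ (by fun_prop)]
        rw [lintegral_comp_smul_eq (f := fun ζ => b ζ * cauchyWeight t ζ) (hb.mul hm) h2]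
    _ ≤ _ := by
        rw [← mul_assoc]
        gcongr
        rw [pow_succ, mul_comm]
        gcongr
        rw [show (2 : ℝ≥0∞) = ENNReal.ofReal 2 by simp, ← ENNReal.ofReal_pow (by norm_num)]
        apply ENNReal.ofReal_le_ofReal
        have h2 : (0:ℝ) < 1 - t := by linarith [ht.2]
        rw [abs_of_pos (by positivity), ← inv_pow]
        gcongr
        rw [inv_le_comm₀ h2 (by norm_num)]
        linarith [ht.2]

/-- Cauchy-Schwarz in `(t, ζ)` with the square root of the weight given to each factor. In the
factor with `a` the weight is integrated in `t` at once; in the factor with `b` the dilation is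
removed first, for fixed `t`. -/
theorem lintegral_mul_comp_smul_mul_cauchyWeight_le {d : ℕ} {a b : E d → ℝ≥0∞}
    (ha : Measurable a) (hb : Measurable b) :
    ∫⁻ t in Ioo (0 : ℝ) (1 / 2), ∫⁻ ζ, a ζ * b ((1 - t) • ζ) * cauchyWeight t ζ
      ≤ 2 ^ (d + 2) * ((∫⁻ ζ, a ζ ^ (2 : ℝ)) ^ (1 / (2 : ℝ)) *
        (∫⁻ ζ, b ζ ^ (2 : ℝ)) ^ (1 / (2 : ℝ))) := by
  set ν := (volume.restrict (Ioo (0 : ℝ) (1 / 2))).prod (volume : Measure (E d))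
  have hk := measurable_cauchyWeight (d := d)
  have hb1 : Measurable (fun q : ℝ × E d => b ((1 - q.1) • q.2)) := hb.comp (by fun_prop)
  have ha1 : Measurable (fun q : ℝ × E d => a q.2) := ha.comp (by fun_prop)
  have hsq : ∀ x : ℝ≥0∞, x ^ (1 / (2 : ℝ)) * x ^ (1 / (2 : ℝ)) = x := by
    intro x
    rw [← ENNReal.rpow_add_of_nonneg _ _ (by norm_num) (by norm_num)]
    norm_num
  have hsq' : ∀ x : ℝ≥0∞, (x ^ (1 / (2 : ℝ))) ^ (2 : ℝ) = x := by
    intro x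
    rw [← ENNReal.rpow_mul]; norm_num
  have hA : ∫⁻ q, (a q.2 * cauchyWeight q.1 q.2 ^ (1 / (2 : ℝ))) ^ (2 : ℝ) ∂ν
      ≤ 2 * ∫⁻ ζ, a ζ ^ (2 : ℝ) := by
    rw [lintegral_prod_symm _ (by fun_prop), ← lintegral_const_mul _ (by fun_prop)]
    refine lintegral_mono fun ζ => ?_
    simp_rw [ENNReal.mul_rpow_of_nonneg _ _ (by norm_num : (0:ℝ) ≤ 2), hsq']
    have h3 : Measurable fun t : ℝ => cauchyWeight t ζ :=
      hk.comp (measurable_id.prodMk measurable_const)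
    rw [lintegral_const_mul _ h3, mul_comm 2]
    exact mul_le_mul' le_rfl (lintegral_cauchyWeight_le ζ)
  have hB : ∫⁻ q, (b ((1 - q.1) • q.2) * cauchyWeight q.1 q.2 ^ (1 / (2 : ℝ))) ^ (2 : ℝ) ∂ν
      ≤ 2 ^ (d + 1) * (2 * ∫⁻ ζ, b ζ ^ (2 : ℝ)) := by
    have hb2 : Measurable (fun q : ℝ × E d => b q.2 ^ (2 : ℝ) * cauchyWeight q.1 q.2) :=
      ((hb.comp measurable_snd).pow_const _).mul hk
    rw [lintegral_prod _ (by fun_prop)]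
    simp_rw [ENNReal.mul_rpow_of_nonneg _ _ (by norm_num : (0:ℝ) ≤ 2), hsq']
    calc _ ≤ ∫⁻ t in Ioo (0 : ℝ) (1 / 2), 2 ^ (d + 1) * ∫⁻ ζ, b ζ ^ (2 : ℝ) * cauchyWeight t ζ := by
          refine setLIntegral_mono' measurableSet_Ioo fun t ht => ?_
          exact lintegral_comp_smul_mul_cauchyWeight_le (b := fun ζ => b ζ ^ (2 : ℝ))
            (by fun_prop) ht
      _ = 2 ^ (d + 1) * ∫⁻ ζ, ∫⁻ t in Ioo (0 : ℝ) (1 / 2), b ζ ^ (2 : ℝ) * cauchyWeight t ζ := by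
          rw [lintegral_const_mul _ hb2.lintegral_prod_right', lintegral_lintegral_swap]
          exact hb2.aemeasurable
      _ ≤ _ := by
          rw [← lintegral_const_mul 2 (by fun_prop)]
          refine mul_le_mul' le_rfl (lintegral_mono fun ζ => ?_)
          have h3 : Measurable fun t : ℝ => cauchyWeight t ζ :=
            hk.comp (measurable_id.prodMk measurable_const)
          rw [lintegral_const_mul _ h3, mul_comm 2]
          exact mul_le_mul' le_rfl (lintegral_cauchyWeight_le ζ)
  calc _ = ∫⁻ q, ((fun q : ℝ × E d => a q.2 * cauchyWeight q.1 q.2 ^ (1 / (2 : ℝ))) *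
        fun q : ℝ × E d => b ((1 - q.1) • q.2) * cauchyWeight q.1 q.2 ^ (1 / (2 : ℝ))) q ∂ν := by
        rw [lintegral_prod _ (by fun_prop)]
        refine lintegral_congr fun t => lintegral_congr fun ζ => ?_
        simp only [Pi.mul_apply]
        rw [mul_mul_mul_comm, hsq]
    _ ≤ _ := ENNReal.lintegral_mul_le_Lp_mul_Lq ν Real.HolderConjugate.two_two
        (by fun_prop) (by fun_prop)
    -- Both factors receive the larger constant, so that the two square roots recombine to `2 ^ (d +
    -- 2)`.
    _ ≤ (2 ^ (d + 2) * ∫⁻ ζ, a ζ ^ (2 : ℝ)) ^ (1 / (2 : ℝ)) *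
        (2 ^ (d + 2) * ∫⁻ ζ, b ζ ^ (2 : ℝ)) ^ (1 / (2 : ℝ)) := by
        gcongr
        · refine hA.trans ?_
          gcongr
          exact le_self_pow (by norm_num) (by omega)
        · refine hB.trans (le_of_eq ?_)
          ring
    _ = _ := by
        rw [ENNReal.mul_rpow_of_nonneg _ _ (by norm_num),
          ENNReal.mul_rpow_of_nonneg _ _ (by norm_num), mul_mul_mul_comm, hsq]

end Electrowetting

open scoped ContDiff FourierTransform SchwartzMap ENNReal LineDeriv NNReal

/-! ### Averages of derivatives along segments -/

namespace Electrowetting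

theorem IsTest.continuous {d : ℕ} {f : E d → ℝ} (h : IsTest f) : Continuous f := h.1.continuous

theorem IsTest.differentiable {d : ℕ} {f : E d → ℝ} (h : IsTest f) : Differentiable ℝ f :=
  h.1.differentiable (by simp)

theorem IsTest.fderiv_apply {d : ℕ} {f : E d → ℝ} (h : IsTest f) (m : E d) :
    IsTest fun x => fderiv ℝ f x m :=
  ⟨(h.1.fderiv_right (m := ∞) (by simp)).clm_apply contDiff_const,
    (h.2.fderiv (𝕜 := ℝ)).comp_left (g := fun L : E d →L[ℝ] ℝ => L m) (by simp)⟩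

theorem IsTest.mul_left {d : ℕ} {f g : E d → ℝ} (h : IsTest f) (hg : ContDiff ℝ ∞ g) :
    IsTest fun x => g x * f x := ⟨hg.mul h.1, h.2.mul_left⟩

/-- A test function as a complex valued Schwartz function. -/
noncomputable def IsTest.toSchwartz {d : ℕ} {f : E d → ℝ} (h : IsTest f) : 𝓢(E d, ℂ) :=
  (h.2.comp_left (g := fun r : ℝ => (r : ℂ)) (by simp)).toSchwartzMap
    (Complex.ofRealCLM.contDiff.comp h.1)

theorem IsTest.toSchwartz_apply {d : ℕ} {f : E d → ℝ} (h : IsTest f) (x : E d) :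
    h.toSchwartz x = (f x : ℂ) := rfl

theorem IsTest.lineDeriv_toSchwartz {d : ℕ} {f : E d → ℝ} (h : IsTest f) (m x : E d) :
    (∂_{m} h.toSchwartz) x = (fderiv ℝ f x m : ℂ) := by
  rw [SchwartzMap.lineDerivOp_apply_eq_fderiv]
  have h1 : HasFDerivAt (fun y => (f y : ℂ)) (Complex.ofRealCLM ∘L fderiv ℝ f x) x :=
    Complex.ofRealCLM.hasFDerivAt.comp x (h.differentiable x).hasFDerivAt
  have : fderiv ℝ (h.toSchwartz : E d → ℂ) x = Complex.ofRealCLM ∘L fderiv ℝ f x := h1.fderiv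
  rw [this]; rfl

theorem eLpNorm_two_eq {α F : Type*} [MeasurableSpace α] [NormedAddCommGroup F] {f : α → F}
    {μ : Measure α} : eLpNorm f 2 μ = (∫⁻ x, ‖f x‖ₑ ^ (2 : ℝ) ∂μ) ^ (1 / (2 : ℝ)) := by
  rw [eLpNorm_eq_lintegral_rpow_enorm_toReal (by norm_num) (by norm_num)]
  simp

theorem IsTest.lintegral_fourier {d : ℕ} {f : E d → ℝ} (h : IsTest f) :
    (∫⁻ ζ, ‖𝓕 h.toSchwartz ζ‖ₑ ^ (2 : ℝ)) ^ (1 / (2 : ℝ)) = eLpNorm f 2 volume := by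
  rw [← eLpNorm_two_eq]
  have h1 := SchwartzMap.norm_fourier_toL2_eq h.toSchwartz
  rw [SchwartzMap.norm_toLp, SchwartzMap.norm_toLp, ENNReal.toReal_eq_toReal_iff' 
    ((𝓕 h.toSchwartz).memLp 2 volume).eLpNorm_ne_top (h.toSchwartz.memLp 2 volume).eLpNorm_ne_top]
    at h1
  rw [h1]
  refine eLpNorm_congr_norm_ae (Filter.Eventually.of_forall fun x => ?_)
  rw [h.toSchwartz_apply, Complex.norm_real]

theorem IsTest.hasCompactSupport_prod {d : ℕ} {f g : E d → ℝ} (hf : IsTest f) (hg : IsTest g) :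
    HasCompactSupport fun p : E d × E d => f p.1 * g p.2 := by
  refine HasCompactSupport.intro (hf.2.prod hg.2) fun p hp => ?_
  rw [mem_prod, not_and_or] at hp
  rcases hp with hp | hp
  · simp [image_eq_zero_of_notMem_tsupport hp]
  · simp [image_eq_zero_of_notMem_tsupport hp]

theorem IsTest.integrable_prod {d : ℕ} {f g : E d → ℝ} (hf : IsTest f) (hg : IsTest g)
    {s : E d × E d → ℝ} (hs : Continuous s) :
    Integrable (fun p : E d × E d => f p.1 * s p * g p.2) := by
  have hc : Continuous fun p : E d × E d => f p.1 * s p * g p.2 :=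
    ((hf.continuous.comp continuous_fst).mul hs).mul (hg.continuous.comp continuous_snd)
  refine hc.integrable_of_hasCompactSupport ?_
  have : (fun p : E d × E d => f p.1 * s p * g p.2) = fun p => s p * (f p.1 * g p.2) := by
    ext; ring
  rw [this]
  exact (hf.hasCompactSupport_prod hg).mul_left

/-- Integration by parts in `y` for fixed `x`: differentiating `s ((1 - t) x + t y)` in `y` produces
`t` times the derivative of `s`, and the compact support of `η` removes boundary terms. -/
theorem integral_mul_fderiv_comp_affine_mul {d : ℕ} {G s η : E d → ℝ} (hG : IsTest G)
    (hs : IsTest s) (hη : IsTest η) (m : E d) {t : ℝ} (ht : t ≠ 0) :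
    ∫ p : E d × E d, G p.1 * fderiv ℝ s ((1 - t) • p.1 + t • p.2) m * η p.2
      = -(t⁻¹ * ∫ p : E d × E d, G p.1 * s ((1 - t) • p.1 + t • p.2) * fderiv ℝ η p.2 m) := by
  have hc : Continuous fun p : E d × E d => (1 - t) • p.1 + t • p.2 := by fun_prop
  have i1 := hG.integrable_prod hη ((hs.fderiv_apply m).continuous.comp hc)
  have i2 := hG.integrable_prod (hη.fderiv_apply m) (hs.continuous.comp hc)
  simp only [Function.comp_def] at i1 i2
  rw [Measure.volume_eq_prod] at *
  rw [integral_prod _ i1, integral_prod _ i2, ← integral_const_mul, ← integral_neg]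
  congr 1; ext x
  have hd : ∀ y, HasFDerivAt (fun y => s ((1 - t) • x + t • y))
      (t • fderiv ℝ s ((1 - t) • x + t • y)) y := by
    intro y
    have h1 : HasFDerivAt (fun y : E d => (1 - t) • x + t • y) (t • ContinuousLinearMap.id ℝ (E d)) y :=
      ((hasFDerivAt_id y).const_smul t).const_add _
    exact ((hs.differentiable ((1 - t) • x + t • y)).hasFDerivAt.comp y h1).congr_fderiv
      (by ext; simp)
  have key := integral_mul_fderiv_eq_neg_fderiv_mul_of_integrable (μ := (volume : Measure (E d)))
    (f := fun y => s ((1 - t) • x + t • y)) (g := η) (v := m) ?_ ?_ ?_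
    (fun y _ => (hd y).differentiableAt) (fun y _ => hη.differentiable y)
  · simp only [(hd _).fderiv, mul_assoc] at key ⊢
    rw [integral_const_mul, integral_const_mul, key]
    simp only [FunLike.coe_smul, Pi.smul_apply, smul_eq_mul, mul_assoc, integral_const_mul]
    field_simp
  all_goals
    have hcx : Continuous fun y : E d => (1 - t) • x + t • y := by fun_prop
  · simp only [(hd _).fderiv]
    refine (Continuous.integrable_of_hasCompactSupport ?_ hη.2.mul_left)
    exact (continuous_const.mul ((hs.fderiv_apply m).continuous.comp hcx)).mul hη.continuous
  · exact ((hs.continuous.comp hcx).mul (hη.fderiv_apply m).continuous).integrable_of_hasCompactSupport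
      (hη.fderiv_apply m).2.mul_left
  · exact ((hs.continuous.comp hcx).mul hη.continuous).integrable_of_hasCompactSupport hη.2.mul_left

theorem SchwartzMap_exists_cauchy_decay {d : ℕ} (f : 𝓢(E d, ℂ)) :
    ∃ C : ℝ, 0 ≤ C ∧ ∀ x, ‖f x‖ ≤ C / (1 + ‖x‖ ^ 2) := by
  obtain ⟨C0, h0, hC0⟩ := f.decay 0 0
  obtain ⟨C2, h2, hC2⟩ := f.decay 2 0
  refine ⟨C0 + C2, by positivity, fun x => ?_⟩
  rw [le_div_iff₀ (by positivity)]
  have := hC0 x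
  have := hC2 x
  simp only [norm_iteratedFDeriv_zero, pow_zero, one_mul] at *
  nlinarith

theorem enorm_ofReal_complex (r : ℝ) : ‖(r : ℂ)‖ₑ = ‖r‖ₑ := by
  rw [← ofReal_norm, Complex.norm_real, ofReal_norm]

/-- Integration by parts alone would leave a factor `t⁻¹`, not integrable at `0`. On the Fourier
side it is cancelled, and what is left is `|ζ| |η̂(tζ)|`, bounded by the weight `|ζ| / (1 + t²|ζ|²)`
because `η̂` decays; the weight is integrable in `t` uniformly in `ζ`. -/
theorem exists_lintegral_fderiv_average_small_le {d : ℕ} {η : E d → ℝ} (hη : IsTest η) (m : E d) :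
    ∃ C : ℝ≥0, ∀ G s : E d → ℝ, IsTest G → IsTest s →
      ∫⁻ t in Ioo (0 : ℝ) (1 / 2),
          ‖∫ p : E d × E d, G p.1 * fderiv ℝ s ((1 - t) • p.1 + t • p.2) m * η p.2‖ₑ
        ≤ C * (eLpNorm G 2 volume * eLpNorm s 2 volume) := by
  obtain ⟨C0, hC0, hdec⟩ := SchwartzMap_exists_cauchy_decay (𝓕 hη.toSchwartz)
  -- `2π ‖m‖` comes from the symbol of the derivative in direction `m`, `C0` from the decay of `η̂`.
  set K : ℝ≥0∞ := ENNReal.ofReal (2 * Real.pi * (‖m‖ * C0)) with hK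
  refine ⟨(K * 2 ^ (d + 2)).toNNReal, fun G s hG hs => ?_⟩
  rw [ENNReal.coe_toNNReal (by finiteness)]
  set a : E d → ℝ≥0∞ := fun ζ => ‖𝓕 hs.toSchwartz ζ‖ₑ
  set b : E d → ℝ≥0∞ := fun ζ => ‖𝓕 hG.toSchwartz (-ζ)‖ₑ
  have ha : Measurable a := (𝓕 hs.toSchwartz).continuous.measurable.enorm
  have hb : Measurable b := ((𝓕 hG.toSchwartz).continuous.comp continuous_neg).measurable.enorm
  have hpt : ∀ t ∈ Ioo (0 : ℝ) (1 / 2),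
      ‖∫ p : E d × E d, G p.1 * fderiv ℝ s ((1 - t) • p.1 + t • p.2) m * η p.2‖ₑ
        ≤ K * ∫⁻ ζ, a ζ * b ((1 - t) • ζ) * cauchyWeight t ζ := by
    intro t ht
    have hK' : K = ENNReal.ofReal (2 * Real.pi) * ENNReal.ofReal (‖m‖ * C0) :=
      ENNReal.ofReal_mul (by positivity)
    have h1 := integral_mul_comp_affine_mul_lineDeriv hG.toSchwartz hs.toSchwartz hη.toSchwartz m t
    simp only [IsTest.toSchwartz_apply, IsTest.lineDeriv_toSchwartz, ← Complex.ofReal_mul] at h1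
    rw [integral_complex_ofReal] at h1
    rw [integral_mul_fderiv_comp_affine_mul hG hs hη m ht.1.ne', enorm_neg, ← enorm_ofReal_complex,
      Complex.ofReal_mul, h1]
    -- The `t⁻¹` from integrating by parts meets the `t` of the transformed derivative.
    have h2 : ((t⁻¹ : ℝ) : ℂ) * -(((t * (2 * Real.pi) : ℝ) : ℂ) * Complex.I *
        ∫ ζ, 𝓕 hs.toSchwartz ζ * 𝓕 hG.toSchwartz (-((1 - t) • ζ)) *
          ((inner ℝ ζ m : ℝ) * 𝓕 hη.toSchwartz (-(t • ζ))))
        = ((2 * Real.pi : ℝ) : ℂ) * ((-Complex.I) * 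
          ∫ ζ, 𝓕 hs.toSchwartz ζ * 𝓕 hG.toSchwartz (-((1 - t) • ζ)) *
          ((inner ℝ ζ m : ℝ) * 𝓕 hη.toSchwartz (-(t • ζ)))) := by
      have : (t : ℂ) ≠ 0 := by exact_mod_cast ht.1.ne'
      push_cast
      field_simp
    have h3 : (t * (2 * Real.pi * Complex.I) : ℂ) = ((t * (2 * Real.pi) : ℝ) : ℂ) * Complex.I := by
      push_cast; ring
    rw [h3, h2, enorm_mul, enorm_mul, enorm_neg]
    have hI : ‖Complex.I‖ₑ = 1 := by rw [← ofReal_norm]; simp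
    rw [hI, one_mul, enorm_ofReal_complex, Real.enorm_eq_ofReal (by positivity), hK',
      mul_assoc]
    refine mul_le_mul' le_rfl ((enorm_integral_le_lintegral_enorm _).trans ?_)
    rw [← lintegral_const_mul']
    · refine lintegral_mono fun ζ => ?_
      simp only [enorm_mul]
      have h4 : ‖((inner ℝ ζ m : ℝ) : ℂ)‖ₑ * ‖𝓕 hη.toSchwartz (-(t • ζ))‖ₑ
          ≤ ENNReal.ofReal (‖m‖ * C0) * cauchyWeight t ζ := by
        unfold cauchyWeight
        rw [← enorm_mul, ← ofReal_norm (E := ℂ), ← ENNReal.ofReal_mul (by positivity)]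
        apply ENNReal.ofReal_le_ofReal
        rw [norm_mul, Complex.norm_real]
        have h5 := hdec (-(t • ζ))
        rw [norm_neg (E := E d), norm_smul, Real.norm_of_nonneg ht.1.le] at h5
        calc _ ≤ (‖ζ‖ * ‖m‖) * (C0 / (1 + (t * ‖ζ‖) ^ 2)) := by
              gcongr; exact norm_inner_le_norm (𝕜 := ℝ) ζ m
          _ = _ := by ring
      calc _ ≤ a ζ * b ((1 - t) • ζ) * (ENNReal.ofReal (‖m‖ * C0) * cauchyWeight t ζ) :=
            mul_le_mul' le_rfl h4
        _ = _ := by ring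
    · finiteness
  calc _ ≤ ∫⁻ t in Ioo (0 : ℝ) (1 / 2), K * ∫⁻ ζ, a ζ * b ((1 - t) • ζ) * cauchyWeight t ζ :=
        setLIntegral_mono' measurableSet_Ioo hpt
    _ = K * ∫⁻ t in Ioo (0 : ℝ) (1 / 2), ∫⁻ ζ, a ζ * b ((1 - t) • ζ) * cauchyWeight t ζ :=
        lintegral_const_mul' _ _ (by finiteness)
    _ ≤ K * (2 ^ (d + 2) * ((∫⁻ ζ, a ζ ^ (2 : ℝ)) ^ (1 / (2 : ℝ)) *
        (∫⁻ ζ, b ζ ^ (2 : ℝ)) ^ (1 / (2 : ℝ)))) := by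
        gcongr
        exact lintegral_mul_comp_smul_mul_cauchyWeight_le ha hb
    _ = _ := by
        have hbn : ∫⁻ ζ, b ζ ^ (2 : ℝ) = ∫⁻ ζ, ‖𝓕 hG.toSchwartz ζ‖ₑ ^ (2 : ℝ) :=
          lintegral_neg_eq_self (fun ζ => ‖𝓕 hG.toSchwartz ζ‖ₑ ^ (2 : ℝ))
        rw [hbn, hs.lintegral_fourier, hG.lintegral_fourier]
        ring

theorem lintegral_comp_affine_eq {d : ℕ} {f : E d → ℝ≥0∞} (hf : Measurable f) {r : ℝ} (hr : r ≠ 0)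
    (a : E d) :
    ∫⁻ x, f (a + r • x) = ENNReal.ofReal |(r ^ d)⁻¹| * ∫⁻ x, f x := by
  rw [lintegral_comp_smul_eq (f := fun x => f (a + x)) (by fun_prop) hr,
    lintegral_add_left_eq_self]

/-- For `t ≥ 1/2` integration by parts costs at most a factor `2`, and the substitution `z = (1 - t)
x + t y` in `y` at most `2 ^ d`. Cauchy-Schwarz in `y` for each fixed `x` then leaves the `L¹` norm
of `G`. -/
theorem exists_lintegral_fderiv_average_large_le {d : ℕ} {η : E d → ℝ} (hη : IsTest η) (m : E d) :
    ∃ C : ℝ≥0, ∀ G s : E d → ℝ, IsTest G → IsTest s → ∀ t ∈ Ico (1 / 2 : ℝ) 1,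
      ‖∫ p : E d × E d, G p.1 * fderiv ℝ s ((1 - t) • p.1 + t • p.2) m * η p.2‖ₑ
        ≤ C * (eLpNorm G 1 volume * eLpNorm s 2 volume) := by
  have hη' := (hη.fderiv_apply m)
  set θ : E d → ℝ := fun x => fderiv ℝ η x m
  have hθ : eLpNorm θ 2 volume ≠ ⊤ :=
    (hη'.continuous.memLp_of_hasCompactSupport hη'.2).eLpNorm_ne_top
  refine ⟨(2 * ((2 ^ d) ^ (1 / (2 : ℝ)) * eLpNorm θ 2 volume)).toNNReal, fun G s hG hs t ht => ?_⟩
  rw [ENNReal.coe_toNNReal (by finiteness)]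
  have ht0 : 0 < t := by linarith [ht.1]
  have hc : Continuous fun p : E d × E d => (1 - t) • p.1 + t • p.2 := by fun_prop
  rw [integral_mul_fderiv_comp_affine_mul hG hs hη m ht0.ne', enorm_neg, enorm_mul]
  have h2 : ‖t⁻¹‖ₑ ≤ 2 := by
    rw [Real.enorm_eq_ofReal (by positivity)]
    refine (ENNReal.ofReal_le_ofReal (?_ : t⁻¹ ≤ 2)).trans (by simp)
    rw [inv_le_comm₀ ht0 (by norm_num)]; linarith [ht.1]
  have hsm := hs.continuous.measurable
  have hθm := hη'.continuous.measurable
  have hGm := hG.continuous.measurable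
  have h3 : ‖∫ p : E d × E d, G p.1 * s ((1 - t) • p.1 + t • p.2) * θ p.2‖ₑ
      ≤ eLpNorm G 1 volume * ((2 ^ d) ^ (1 / (2 : ℝ)) * eLpNorm s 2 volume * eLpNorm θ 2 volume) := by
    refine (enorm_integral_le_lintegral_enorm _).trans ?_
    rw [Measure.volume_eq_prod, lintegral_prod _ (by fun_prop), eLpNorm_one_eq_lintegral_enorm,
      ← lintegral_mul_const _ (by fun_prop)]
    refine lintegral_mono fun x => ?_
    simp only [enorm_mul, mul_assoc]
    rw [lintegral_const_mul _ (by fun_prop)]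
    refine mul_le_mul' le_rfl ?_
    have h4 := ENNReal.lintegral_mul_le_Lp_mul_Lq (volume : Measure (E d))
      Real.HolderConjugate.two_two (f := fun y => ‖s ((1 - t) • x + t • y)‖ₑ)
      (g := fun y => ‖θ y‖ₑ) (by fun_prop) (by fun_prop)
    simp only [Pi.mul_apply] at h4
    refine h4.trans ?_
    rw [← eLpNorm_two_eq (f := θ), ← mul_assoc]
    refine mul_le_mul' ?_ le_rfl
    rw [lintegral_comp_affine_eq (f := fun z => ‖s z‖ₑ ^ (2 : ℝ)) (by fun_prop) ht0.ne',
      ENNReal.mul_rpow_of_nonneg _ _ (by norm_num), ← eLpNorm_two_eq]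
    gcongr
    rw [show (2 : ℝ≥0∞) = ENNReal.ofReal 2 by simp, ← ENNReal.ofReal_pow (by norm_num)]
    apply ENNReal.ofReal_le_ofReal
    rw [abs_of_pos (by positivity), ← inv_pow]
    gcongr
    rw [inv_le_comm₀ ht0 (by norm_num)]; linarith [ht.1]
  calc _ ≤ 2 * (eLpNorm G 1 volume *
        ((2 ^ d) ^ (1 / (2 : ℝ)) * eLpNorm s 2 volume * eLpNorm θ 2 volume)) := mul_le_mul' h2 h3
    _ = _ := by ring

end Electrowetting

open scoped ContDiff ENNReal NNReal Topology

/-! ### Cut-off functions and the full range of segment parameters -/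

namespace Electrowetting

theorem exists_isTest_cutoff {d : ℕ} {K U : Set (E d)} (hK : IsCompact K) (hU : IsOpen U)
    (h : K ⊆ U) : ∃ χ : E d → ℝ, IsTest χ ∧ tsupport χ ⊆ U ∧ (∀ᶠ x in 𝓝ˢ K, χ x = 1) ∧
      ∀ x, χ x ∈ Icc (0 : ℝ) 1 := by
  obtain ⟨K', hK', h1, h2⟩ := exists_compact_between hK hU h
  obtain ⟨f, hf1, hf0, hf⟩ := exists_contMDiffMap_one_nhds_of_subset_interior
    (n := (⊤ : ℕ∞)) (modelWithCornersSelf ℝ (E d)) hK.isClosed h1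
  have hs : tsupport f ⊆ K' := closure_minimal (fun x hx => by
    by_contra hx'; exact hx (hf0 x hx')) hK'.isClosed
  exact ⟨f, ⟨f.contMDiff.contDiff, hK'.of_isClosed_subset (isClosed_tsupport _) hs⟩,
    hs.trans h2, hf1, hf⟩

theorem IsTest.memLp_volume {d : ℕ} {f : E d → ℝ} (h : IsTest f) (p : ℝ≥0∞) :
    MemLp f p volume := h.continuous.memLp_of_hasCompactSupport h.2

theorem IsTest.eLpNorm_one_le {d : ℕ} {Ω : Set (E d)} (hΩ : MeasurableSet Ω) {f : E d → ℝ}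
    (h : IsTest f) (hs : tsupport f ⊆ Ω) :
    eLpNorm f 1 volume ≤ volume Ω ^ (1 / (2 : ℝ)) * eLpNorm f 2 volume := by
  have h0 : ∀ p : ℝ≥0∞, eLpNorm f p volume = eLpNorm f p (volume.restrict Ω) := fun p => by
    rw [← eLpNorm_indicator_eq_eLpNorm_restrict hΩ, indicator_eq_self.2]
    exact (subset_tsupport f).trans hs
  have h1 := eLpNorm_le_eLpNorm_mul_rpow_measure_univ (μ := volume.restrict Ω) (p := 1) (q := 2)
    (by norm_num) h.continuous.aestronglyMeasurable
  rw [h0, h0, mul_comm]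
  refine h1.trans (le_of_eq ?_)
  simp
  norm_num

/-- The two ranges of `t` are joined at `1/2`. The support of `G` in a bounded set is needed to
replace its `L¹` norm by its `L²` norm. -/
theorem exists_lintegral_fderiv_average_le {d : ℕ} {Ω : Set (E d)} (hΩ : IsOpen Ω)
    (hb : Bornology.IsBounded Ω) {η : E d → ℝ} (hη : IsTest η) (m : E d) :
    ∃ C : ℝ≥0, ∀ G s : E d → ℝ, IsTest G → tsupport G ⊆ Ω → IsTest s →
      ∫⁻ t in Ioo (0 : ℝ) 1,
          ‖∫ p : E d × E d, G p.1 * fderiv ℝ s ((1 - t) • p.1 + t • p.2) m * η p.2‖ₑ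
        ≤ C * (eLpNorm G 2 volume * eLpNorm s 2 volume) := by
  obtain ⟨C1, h1⟩ := exists_lintegral_fderiv_average_small_le hη m
  obtain ⟨C2, h2⟩ := exists_lintegral_fderiv_average_large_le hη m
  have hv : volume Ω ≠ ⊤ := hb.measure_lt_top.ne
  refine ⟨C1 + C2 * (volume Ω ^ (1 / (2 : ℝ))).toNNReal, fun G s hG hGs hs => ?_⟩
  rw [← Ioo_union_Ico_eq_Ioo (a := (0 : ℝ)) (b := 1 / 2) (c := 1) (by norm_num) (by norm_num)]
  refine (lintegral_union_le _ _ _).trans ?_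
  push_cast
  rw [ENNReal.coe_toNNReal (by finiteness), add_mul]
  refine add_le_add (h1 G s hG hs) ?_
  calc _ ≤ ∫⁻ t in Ico (1 / 2 : ℝ) 1, C2 * (eLpNorm G 1 volume * eLpNorm s 2 volume) :=
        setLIntegral_mono' measurableSet_Ico fun t ht => h2 G s hG hs t ht
    _ ≤ C2 * (eLpNorm G 1 volume * eLpNorm s 2 volume) * 1 := by
        rw [setLIntegral_const]
        gcongr
        rw [Real.volume_Ico]
        refine ENNReal.ofReal_le_one.2 (by norm_num)
    _ ≤ C2 * ((volume Ω ^ (1 / (2 : ℝ)) * eLpNorm G 2 volume) * eLpNorm s 2 volume) := by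
        rw [mul_one]
        gcongr
        exact hG.eLpNorm_one_le hΩ.measurableSet hGs
    _ = _ := by ring

theorem hasDerivAt_affine_average {d : ℕ} {G κ f : E d → ℝ} (hG : IsTest G) (hκ : IsTest κ)
    (hf : IsTest f) (t : ℝ) :
    HasDerivAt (fun t => ∫ p : E d × E d, G p.1 * f ((1 - t) • p.1 + t • p.2) * κ p.2)
      (∫ p : E d × E d, G p.1 * fderiv ℝ f ((1 - t) • p.1 + t • p.2) (p.2 - p.1) * κ p.2) t := by
  have hcd : Continuous (fderiv ℝ f) := hf.1.continuous_fderiv (by simp)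
  obtain ⟨C, hC⟩ := (hf.2.fderiv (𝕜 := ℝ)).exists_bound_of_continuous hcd
  have hi : Integrable fun p : E d × E d => C * (|G p.1 * ‖p.2 - p.1‖ * κ p.2|) :=
    (hG.integrable_prod hκ (s := fun p => ‖p.2 - p.1‖) (by fun_prop)).abs.const_mul C
  have hc : ∀ t : ℝ, Continuous fun p : E d × E d => (1 - t) • p.1 + t • p.2 := fun t => by fun_prop
  refine (hasDerivAt_integral_of_dominated_loc_of_deriv_le (μ := volume)
    (F := fun (t : ℝ) p => G p.1 * f ((1 - t) • p.1 + t • p.2) * κ p.2)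
    (F' := fun (t : ℝ) p => G p.1 * fderiv ℝ f ((1 - t) • p.1 + t • p.2) (p.2 - p.1) * κ p.2)
    (x₀ := t) (s := univ) Filter.univ_mem ?_ ?_ ?_ ?_ hi ?_).2
  · exact Filter.Eventually.of_forall fun t =>
      (hG.integrable_prod hκ (hf.continuous.comp (hc t))).aestronglyMeasurable
  · exact hG.integrable_prod hκ (hf.continuous.comp (hc t))
  · exact (hG.integrable_prod hκ (s := fun p => fderiv ℝ f ((1 - t) • p.1 + t • p.2) (p.2 - p.1))
      ((hcd.comp (hc t)).clm_apply (by fun_prop))).aestronglyMeasurable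
  · refine Filter.Eventually.of_forall fun p t _ => ?_
    rw [norm_mul, norm_mul, abs_mul, abs_mul, abs_norm, ← Real.norm_eq_abs, ← Real.norm_eq_abs]
    have := (fderiv ℝ f ((1 - t) • p.1 + t • p.2)).le_of_opNorm_le (hC _) (p.2 - p.1)
    calc _ ≤ ‖G p.1‖ * (C * ‖p.2 - p.1‖) * ‖κ p.2‖ := by gcongr
      _ = _ := by ring
  · refine Filter.Eventually.of_forall fun p t _ => ?_
    have h1 : HasDerivAt (fun t : ℝ => (1 - t) • p.1 + t • p.2) (p.2 - p.1) t := by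
      have := (((hasDerivAt_id' t).const_sub 1).smul_const p.1).add
        ((hasDerivAt_id' t).smul_const p.2)
      refine this.congr_deriv ?_
      simp [neg_add_eq_sub]
    have h2 := (hf.differentiable ((1 - t) • p.1 + t • p.2)).hasFDerivAt.comp_hasDerivAt t h1
    exact (h2.const_mul (G p.1)).mul_const (κ p.2)

end Electrowetting

/-! ### Pairing estimate for functions whose gradient is a divergence -/

namespace Electrowetting

/-- The `k`-th standard unit vector. -/
noncomputable abbrev unitVec {d : ℕ} (k : Fin d) : E d := EuclideanSpace.single k (1 : ℝ)

theorem apply_eq_sum_unitVec {d : ℕ} (L : E d →L[ℝ] ℝ) (v : E d) :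
    L v = ∑ k, v k * L (unitVec k) := by
  conv_lhs => rw [← (EuclideanSpace.basisFun (Fin d) ℝ).sum_repr v]
  simp [map_sum]

theorem IsTest.coord_mul {d : ℕ} {f : E d → ℝ} (h : IsTest f) (k : Fin d) :
    IsTest fun x => x k * f x :=
  h.mul_left (EuclideanSpace.proj (𝕜 := ℝ) k).contDiff

theorem IsTest.eLpNorm_two_eq_restrict {d : ℕ} {Ω : Set (E d)} (hΩ : MeasurableSet Ω)
    {f : E d → ℝ} (hs : tsupport f ⊆ Ω) : eLpNorm f 2 volume = eLpNorm f 2 (vol Ω) := by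
  rw [← eLpNorm_indicator_eq_eLpNorm_restrict hΩ, indicator_eq_self.2]
  exact (subset_tsupport f).trans hs

/-- Integrability of the derivative is not required: when its integral is infinite there is nothing
to prove, and otherwise it is measurable as a derivative. -/
theorem enorm_sub_le_lintegral_deriv {H H' : ℝ → ℝ} (h : ∀ t, HasDerivAt H (H' t) t) :
    ‖H 1 - H 0‖ₑ ≤ ∫⁻ t in Ioo (0 : ℝ) 1, ‖H' t‖ₑ := by
  by_cases hi : ∫⁻ t in Ioo (0 : ℝ) 1, ‖H' t‖ₑ = ⊤
  · rw [hi]; exact le_top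
  have hd : H' = deriv H := funext fun t => (h t).deriv.symm
  have hm : Measurable H' := hd ▸ measurable_deriv H
  have hint : IntegrableOn H' (Ioo 0 1) := ⟨hm.aestronglyMeasurable, lt_top_iff_ne_top.2 hi⟩
  have := intervalIntegral.integral_eq_sub_of_hasDerivAt (a := 0) (b := 1) (fun t _ => h t)
    ((intervalIntegrable_iff_integrableOn_Ioo_of_le zero_le_one).2 hint)
  rw [← this, intervalIntegral.integral_of_le zero_le_one, integral_Ioc_eq_integral_Ioo]
  exact enorm_integral_le_lintegral_enorm _

/-- Let `H t = ∫∫ G(x) f((1 - t) x + t y) κ(y)`. The quantity to be bounded is `H 1 - H 0`. In `H'`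
the factor `∇f · (y - x)` is written through derivatives of `g`, and the components of `y - x` are
attached to `κ` and to `G`. The estimate of averages of derivatives then needs only `L²` norms of
`g`. -/
theorem exists_enorm_pairing_le {d : ℕ} {Ω : Set (E d)} (hΩ : IsOpen Ω) (hc : Convex ℝ Ω)
    (hb : Bornology.IsBounded Ω) {κ : E d → ℝ} (hκ : IsTest κ) (hκs : tsupport κ ⊆ Ω) :
    ∃ C : ℝ≥0, ∀ (G f : E d → ℝ) (g : Fin d → Fin d → E d → ℝ), IsTest G → tsupport G ⊆ Ω →
      IsTest f → (∀ k l, IsTest (g k l)) →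
      (∀ k x, fderiv ℝ f x (unitVec k) = ∑ l, fderiv ℝ (g k l) x (unitVec l)) →
      ‖(∫ x, G x) * (∫ x, f x * κ x) - (∫ x, G x * f x) * ∫ x, κ x‖ₑ
        ≤ C * (eLpNorm G 2 volume * ∑ k, ∑ l, eLpNorm (g k l) 2 (vol Ω)) := by
  obtain ⟨R, hR0, hR⟩ := hb.exists_pos_norm_le
  choose C1 hC1 using fun l : Fin d => exists_lintegral_fderiv_average_le hΩ hb hκ (unitVec l)
  choose C2 hC2 using fun k l : Fin d =>
    exists_lintegral_fderiv_average_le hΩ hb (hκ.coord_mul k) (unitVec l)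
  set C : Fin d → Fin d → ℝ≥0 := fun k l => C2 k l + C1 l * R.toNNReal
  refine ⟨∑ k, ∑ l, C k l, fun G f g hG hGs hf hg hfg => ?_⟩
  -- All segments joining the supports of `G` and `κ`: a compact set, inside `Ω` by convexity.
  -- Cutting `g` off outside a neighbourhood of it makes only the norm of `g` on `Ω` appear.
  set K := (fun q : ℝ × E d × E d => (1 - q.1) • q.2.1 + q.1 • q.2.2) ''
    (Icc (0 : ℝ) 1 ×ˢ tsupport G ×ˢ tsupport κ)
  have hK : IsCompact K :=
    (isCompact_Icc.prod (hG.2.isCompact.prod hκ.2.isCompact)).image (by fun_prop)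
  have hKΩ : K ⊆ Ω := by
    rintro _ ⟨q, ⟨hq1, hq2, hq3⟩, rfl⟩
    exact hc (hGs hq2) (hκs hq3) (by linarith [hq1.2]) hq1.1 (by ring)
  obtain ⟨χ, hχ, hχs, hχ1, hχ01⟩ := exists_isTest_cutoff hK hΩ hKΩ
  set s : Fin d → Fin d → E d → ℝ := fun k l x => g k l x * χ x
  have hs : ∀ k l, IsTest (s k l) := fun k l => hχ.mul_left (hg k l).1
  have hss : ∀ k l, eLpNorm (s k l) 2 volume ≤ eLpNorm (g k l) 2 (vol Ω) := by
    intro k l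
    rw [IsTest.eLpNorm_two_eq_restrict hΩ.measurableSet ((tsupport_mul_subset_right).trans hχs)]
    refine eLpNorm_mono fun x => ?_
    rw [norm_mul]
    refine mul_le_of_le_one_right (norm_nonneg _) ?_
    rw [Real.norm_of_nonneg (hχ01 x).1]; exact (hχ01 x).2
  have hGk : ∀ k, IsTest fun x => x k * G x := fun k => hG.coord_mul k
  have hGks : ∀ k, tsupport (fun x : E d => x k * G x) ⊆ Ω := fun k =>
    (tsupport_mul_subset_right).trans hGs
  have hGkn : ∀ k, eLpNorm (fun x : E d => x k * G x) 2 volume ≤ R.toNNReal * eLpNorm G 2 volume := by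
    intro k
    rw [IsTest.eLpNorm_two_eq_restrict hΩ.measurableSet (hGks k),
      IsTest.eLpNorm_two_eq_restrict hΩ.measurableSet hGs]
    refine eLpNorm_le_nnreal_smul_eLpNorm_of_ae_le_mul ?_ 2
    filter_upwards [ae_restrict_mem hΩ.measurableSet] with x hx
    rw [← NNReal.coe_le_coe]
    push_cast
    rw [Real.coe_toNNReal _ hR0.le, norm_mul]
    gcongr
    exact (PiLp.norm_apply_le x k).trans (hR x hx)
  set I : (E d → ℝ) → (E d → ℝ) → (E d → ℝ) → Fin d → ℝ → ℝ := fun G s η l t =>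
    ∫ p : E d × E d, G p.1 * fderiv ℝ s ((1 - t) • p.1 + t • p.2) (unitVec l) * η p.2 with hI
  set H' : ℝ → ℝ := fun t =>
    ∫ p : E d × E d, G p.1 * fderiv ℝ f ((1 - t) • p.1 + t • p.2) (p.2 - p.1) * κ p.2 with hH'
  have hpt : ∀ t ∈ Ioo (0 : ℝ) 1, H' t = ∑ k, ∑ l, (I G (s k l) (fun x => x k * κ x) l t
      - I (fun x => x k * G x) (s k l) κ l t) := by
    intro t ht
    have i1 : ∀ k l, Integrable fun p : E d × E d =>
        G p.1 * fderiv ℝ (s k l) ((1 - t) • p.1 + t • p.2) (unitVec l) * (p.2 k * κ p.2) :=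
      fun k l => hG.integrable_prod (hκ.coord_mul k)
        (s := fun p => fderiv ℝ (s k l) ((1 - t) • p.1 + t • p.2) (unitVec l))
        (((hs k l).fderiv_apply (unitVec l)).continuous.comp (by fun_prop))
    have i2 : ∀ k l, Integrable fun p : E d × E d =>
        (p.1 k * G p.1) * fderiv ℝ (s k l) ((1 - t) • p.1 + t • p.2) (unitVec l) * κ p.2 :=
      fun k l => (hGk k).integrable_prod hκ
        (s := fun p => fderiv ℝ (s k l) ((1 - t) • p.1 + t • p.2) (unitVec l))
        (((hs k l).fderiv_apply (unitVec l)).continuous.comp (by fun_prop))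
    simp only [hI, hH']
    rw [Finset.sum_congr rfl fun k _ => Finset.sum_congr rfl fun l _ =>
      (integral_sub (i1 k l) (i2 k l)).symm]
    have i3 : ∀ k l, Integrable fun p : E d × E d =>
        G p.1 * fderiv ℝ (s k l) ((1 - t) • p.1 + t • p.2) (unitVec l) * (p.2 k * κ p.2)
        - (p.1 k * G p.1) * fderiv ℝ (s k l) ((1 - t) • p.1 + t • p.2) (unitVec l) * κ p.2 :=
      fun k l => (i1 k l).sub (i2 k l)
    rw [Finset.sum_congr rfl fun k _ => (integral_finsetSum Finset.univ fun l _ => i3 k l).symm]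
    rw [← integral_finsetSum Finset.univ fun k _ =>
      integrable_finsetSum Finset.univ fun l _ => i3 k l]
    refine integral_congr_ae (Filter.Eventually.of_forall fun p => ?_)
    simp only []
    -- Off the supports both sides vanish. On them the point of the segment lies in `K`, where the
    -- cut-off is locally `1` and does not affect derivatives.
    by_cases h1 : G p.1 = 0
    · simp [h1]
    by_cases h2 : κ p.2 = 0
    · simp [h2]
    have hz : (1 - t) • p.1 + t • p.2 ∈ K :=
      ⟨(t, p), ⟨Ioo_subset_Icc_self ht, subset_tsupport _ h1, subset_tsupport _ h2⟩, rfl⟩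
    have hfd : ∀ k l, fderiv ℝ (s k l) ((1 - t) • p.1 + t • p.2)
        = fderiv ℝ (g k l) ((1 - t) • p.1 + t • p.2) := by
      intro k l
      refine Filter.EventuallyEq.fderiv_eq ?_
      filter_upwards [hχ1.filter_mono (nhds_le_nhdsSet hz)] with x hx
      simp [s, hx]
    simp_rw [hfd]
    rw [apply_eq_sum_unitVec, Finset.mul_sum, Finset.sum_mul]
    refine Finset.sum_congr rfl fun k _ => ?_
    rw [hfg, Finset.mul_sum, Finset.mul_sum, Finset.sum_mul]
    refine Finset.sum_congr rfl fun l _ => ?_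
    simp only [PiLp.sub_apply]
    ring
  have hle : ∫⁻ t in Ioo (0 : ℝ) 1, ‖H' t‖ₑ ≤ ∑ k, ∑ l,
      (C k l : ℝ≥0∞) * (eLpNorm G 2 volume * eLpNorm (g k l) 2 (vol Ω)) := by
    have hmeas : ∀ (G s η : E d → ℝ), IsTest G → IsTest s → IsTest η → ∀ l,
        Measurable fun t => ‖I G s η l t‖ₑ := by
      intro G s η hG hs hη l
      refine Measurable.enorm (StronglyMeasurable.measurable ?_)
      refine StronglyMeasurable.integral_prod_right (f := fun t (p : E d × E d) =>
        G p.1 * fderiv ℝ s ((1 - t) • p.1 + t • p.2) (unitVec l) * η p.2) ?_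
      refine Continuous.stronglyMeasurable ?_
      have h1 : Continuous fun x : ℝ × E d × E d => G x.2.1 := hG.continuous.comp (by fun_prop)
      have h2 : Continuous fun x : ℝ × E d × E d => η x.2.2 := hη.continuous.comp (by fun_prop)
      exact (h1.mul ((hs.fderiv_apply (unitVec l)).continuous.comp (by fun_prop))).mul h2
    have m1 : ∀ k l, Measurable fun t => ‖I G (s k l) (fun x => x k * κ x) l t‖ₑ :=
      fun k l => hmeas _ _ _ hG (hs k l) (hκ.coord_mul k) l
    have m2 : ∀ k l, Measurable fun t => ‖I (fun x => x k * G x) (s k l) κ l t‖ₑ :=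
      fun k l => hmeas _ _ _ (hGk k) (hs k l) hκ l
    calc _ ≤ ∫⁻ t in Ioo (0 : ℝ) 1, ∑ k, ∑ l, (‖I G (s k l) (fun x => x k * κ x) l t‖ₑ
          + ‖I (fun x => x k * G x) (s k l) κ l t‖ₑ) := by
          refine setLIntegral_mono' measurableSet_Ioo fun t ht => ?_
          rw [hpt t ht]
          refine (enorm_sum_le _ _).trans (Finset.sum_le_sum fun k _ => ?_)
          exact (enorm_sum_le _ _).trans (Finset.sum_le_sum fun l _ => enorm_sub_le)
      _ = ∑ k, ∑ l, ((∫⁻ t in Ioo (0 : ℝ) 1, ‖I G (s k l) (fun x => x k * κ x) l t‖ₑ)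
          + ∫⁻ t in Ioo (0 : ℝ) 1, ‖I (fun x => x k * G x) (s k l) κ l t‖ₑ) := by
          have m3 : ∀ k l, Measurable fun t => ‖I G (s k l) (fun x => x k * κ x) l t‖ₑ
              + ‖I (fun x => x k * G x) (s k l) κ l t‖ₑ := fun k l => (m1 k l).add (m2 k l)
          rw [lintegral_finsetSum _ fun k _ => Finset.measurable_fun_sum _ fun l _ => m3 k l]
          refine Finset.sum_congr rfl fun k _ => ?_
          rw [lintegral_finsetSum _ fun l _ => m3 k l]
          refine Finset.sum_congr rfl fun l _ => ?_
          rw [lintegral_add_left (m1 k l)]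
      _ ≤ _ := by
          refine Finset.sum_le_sum fun k _ => Finset.sum_le_sum fun l _ => ?_
          have e1 := hC2 k l G (s k l) hG hGs (hs k l)
          have e2 := hC1 l (fun x => x k * G x) (s k l) (hGk k) (hGks k) (hs k l)
          calc _ ≤ C2 k l * (eLpNorm G 2 volume * eLpNorm (s k l) 2 volume) +
                C1 l * (eLpNorm (fun x : E d => x k * G x) 2 volume * eLpNorm (s k l) 2 volume) :=
                add_le_add e1 e2
            _ ≤ C2 k l * (eLpNorm G 2 volume * eLpNorm (g k l) 2 (vol Ω)) +
                C1 l * ((R.toNNReal * eLpNorm G 2 volume) * eLpNorm (g k l) 2 (vol Ω)) := by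
                have := hss k l
                have := hGkn k
                gcongr
            _ = _ := by simp only [C]; push_cast; ring
  have hfin := enorm_sub_le_lintegral_deriv (hasDerivAt_affine_average hG hκ hf)
  have hH0 : ∫ p : E d × E d, G p.1 * f ((1 - (0 : ℝ)) • p.1 + (0 : ℝ) • p.2) * κ p.2
      = (∫ x, G x * f x) * ∫ x, κ x := by
    rw [Measure.volume_eq_prod, ← integral_prod_mul]
    simp
  have hH1 : ∫ p : E d × E d, G p.1 * f ((1 - (1 : ℝ)) • p.1 + (1 : ℝ) • p.2) * κ p.2
      = (∫ x, G x) * ∫ x, f x * κ x := by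
    rw [Measure.volume_eq_prod, ← integral_prod_mul]
    simp [mul_assoc]
  rw [hH0, hH1] at hfin
  refine hfin.trans (hle.trans ?_)
  calc _ ≤ ∑ k, ∑ l, ((∑ k, ∑ l, C k l : ℝ≥0) : ℝ≥0∞) *
        (eLpNorm G 2 volume * eLpNorm (g k l) 2 (vol Ω)) := by
        refine Finset.sum_le_sum fun k _ => Finset.sum_le_sum fun l _ => ?_
        gcongr
        exact (Finset.single_le_sum (f := fun l => C k l) (fun _ _ => zero_le) (Finset.mem_univ l)).trans
          (Finset.single_le_sum (f := fun k => ∑ l, C k l) (fun _ _ => zero_le) (Finset.mem_univ k))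
    _ = _ := by simp_rw [← Finset.mul_sum]

end Electrowetting

/-! ### Korn's second inequality for test functions -/

namespace Electrowetting

theorem IsTest.add {d : ℕ} {f g : E d → ℝ} (hf : IsTest f) (hg : IsTest g) :
    IsTest fun x => f x + g x := ⟨hf.1.add hg.1, hf.2.add hg.2⟩

theorem IsTest.const_mul {d : ℕ} {f : E d → ℝ} (hf : IsTest f) (c : ℝ) :
    IsTest fun x => c * f x := hf.mul_left contDiff_const

theorem IsTest.neg {d : ℕ} {f : E d → ℝ} (hf : IsTest f) : IsTest fun x => -f x := by
  simpa using hf.const_mul (-1)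

theorem IsTest.sub {d : ℕ} {f g : E d → ℝ} (hf : IsTest f) (hg : IsTest g) :
    IsTest fun x => f x - g x := by
  simpa [sub_eq_add_neg] using hf.add hg.neg

theorem exists_isTest_integral_eq_one {d : ℕ} {Ω : Set (E d)} (hΩ : IsOpen Ω) (hne : Ω.Nonempty) :
    ∃ κ : E d → ℝ, IsTest κ ∧ tsupport κ ⊆ Ω ∧ ∫ x, κ x = 1 := by
  obtain ⟨a, ha⟩ := hne
  obtain ⟨χ, hχ, hs, h1, h01⟩ := exists_isTest_cutoff (isCompact_singleton (x := a)) hΩ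
    (singleton_subset_iff.2 ha)
  have hpos : 0 < ∫ x, χ x := by
    refine hχ.continuous.integral_pos_of_hasCompactSupport_nonneg_nonzero hχ.2
      (fun x => (h01 x).1) (x := a) ?_
    rw [(h1.self_of_nhdsSet a rfl : χ a = 1)]; norm_num
  refine ⟨fun x => (∫ x, χ x)⁻¹ * χ x, hχ.const_mul _, (tsupport_mul_subset_right).trans hs, ?_⟩
  rw [integral_const_mul, inv_mul_cancel₀ hpos.ne']

theorem eLpNorm_restrict_le_of_isCompact {d : ℕ} {Ω : Set (E d)} (hΩ : IsOpen Ω)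
    (hb : Bornology.IsBounded Ω) {f : E d → ℝ} {M : ℝ≥0∞}
    (h : ∀ K, IsCompact K → K ⊆ Ω → eLpNorm f 2 (volume.restrict K) ≤ M) :
    eLpNorm f 2 (vol Ω) ≤ M := by
  obtain ⟨F, hFc, hFs, hFU, hFm⟩ := hΩ.exists_iUnion_isClosed
  have h2 : ∀ ν : Measure (E d), eLpNorm f 2 ν ≤ M ↔
      ∫⁻ x, ‖f x‖ₑ ^ (2 : ℝ) ∂ν ≤ M ^ (2 : ℝ) := by
    intro ν
    rw [eLpNorm_two_eq, one_div, ENNReal.rpow_inv_le_iff (by norm_num)]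
  rw [h2, ← hFU, setLIntegral_iUnion_of_directed _ hFm.directed_le]
  refine iSup_le fun n => (h2 _).1 (h _ ?_ (hFs n))
  exact Metric.isCompact_of_isClosed_isBounded (hFc n) (hb.subset (hFs n))

/-- A form of Nečas' inequality, by duality with `f` itself: the pairing estimate is used with `G =
χ f`, where `χ` is a cut-off for a compact `K ⊆ Ω`. The left side dominates `‖G‖²` up to the term
with the mean, the right side is linear in `‖G‖`, and one factor is divided out. The constant does
not depend on `K`, so `K` may exhaust `Ω`. -/
theorem exists_eLpNorm_le_of_fderiv_eq_sum {d : ℕ} {Ω : Set (E d)} (hΩ : IsOpen Ω)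
    (hc : Convex ℝ Ω) (hb : Bornology.IsBounded Ω) {κ : E d → ℝ} (hκ : IsTest κ)
    (hκs : tsupport κ ⊆ Ω) (hκ1 : ∫ x, κ x = 1) :
    ∃ C : ℝ≥0, ∀ (f : E d → ℝ) (g : Fin d → Fin d → E d → ℝ), IsTest f → (∀ k l, IsTest (g k l)) →
      (∀ k x, fderiv ℝ f x (unitVec k) = ∑ l, fderiv ℝ (g k l) x (unitVec l)) →
      eLpNorm f 2 (vol Ω) ≤ C * (∑ k, ∑ l, eLpNorm (g k l) 2 (vol Ω) + ‖∫ x, f x * κ x‖ₑ) := by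
  obtain ⟨C, hC⟩ := exists_enorm_pairing_le hΩ hc hb hκ hκs
  set D : ℝ≥0 := (volume Ω ^ (1 / (2 : ℝ))).toNNReal
  have hD : (D : ℝ≥0∞) = volume Ω ^ (1 / (2 : ℝ)) := by
    have : volume Ω ≠ ⊤ := hb.measure_lt_top.ne
    exact ENNReal.coe_toNNReal (by finiteness)
  refine ⟨C + D, fun f g hf hg hfg => ?_⟩
  refine eLpNorm_restrict_le_of_isCompact hΩ hb fun K hK hKΩ => ?_
  obtain ⟨χ, hχ, hχs, hχ1, hχ01⟩ := exists_isTest_cutoff hK hΩ hKΩ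
  set G : E d → ℝ := fun x => f x * χ x
  have hG : IsTest G := hχ.mul_left hf.1
  have hGs : tsupport G ⊆ Ω := (tsupport_mul_subset_right).trans hχs
  have hGfin := (hG.memLp_volume 2).eLpNorm_ne_top
  have h1 := hC G f g hG hGs hf hg hfg
  rw [hκ1, mul_one] at h1
  set a := ∑ k, ∑ l, eLpNorm (g k l) 2 (vol Ω)
  set b := ‖∫ x, f x * κ x‖ₑ
  have hKG : eLpNorm f 2 (volume.restrict K) ≤ eLpNorm G 2 volume := by
    refine le_trans (le_of_eq ?_) (eLpNorm_restrict_le G 2 volume K)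
    refine eLpNorm_congr_ae ?_
    filter_upwards [ae_restrict_mem hK.measurableSet] with x hx
    simp [G, hχ1.self_of_nhdsSet x hx]
  refine hKG.trans ?_
  -- Because `0 ≤ χ ≤ 1`, `(χ f)² ≤ χ f²`.
  have hGG : eLpNorm G 2 volume * eLpNorm G 2 volume ≤ ‖∫ x, G x * f x‖ₑ := by
    have e1 : eLpNorm G 2 volume * eLpNorm G 2 volume = ∫⁻ x, ‖G x‖ₑ ^ (2 : ℝ) := by
      rw [eLpNorm_two_eq, ← ENNReal.rpow_add_of_nonneg _ _ (by norm_num) (by norm_num)]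
      norm_num
    have hnn : ∀ x, 0 ≤ G x * f x := fun x => by
      simp only [G]
      have := (hχ01 x).1
      nlinarith [mul_nonneg this (mul_self_nonneg (f x))]
    have hi : Integrable fun x => G x * f x :=
      (hG.continuous.mul hf.continuous).integrable_of_hasCompactSupport hG.2.mul_right
    rw [Real.enorm_of_nonneg (integral_nonneg hnn), ofReal_integral_eq_lintegral_ofReal hi
      (Filter.Eventually.of_forall hnn), e1]
    refine lintegral_mono fun x => ?_
    rw [Real.enorm_eq_ofReal_abs, ENNReal.ofReal_rpow_of_nonneg (abs_nonneg _) (by norm_num)]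
    apply ENNReal.ofReal_le_ofReal
    rw [Real.rpow_two, sq_abs]
    simp only [G]
    have h3 := hχ01 x
    have h4 : χ x * (f x * f x) * χ x ≤ χ x * (f x * f x) * 1 :=
      mul_le_mul_of_nonneg_left h3.2 (mul_nonneg h3.1 (mul_self_nonneg _))
    nlinarith
  have hI : ‖∫ x, G x * f x‖ₑ ≤ (C + D : ℝ≥0) * (a + b) * eLpNorm G 2 volume := by
    have e1 : ∫ x, G x * f x = (∫ x, G x) * (∫ x, f x * κ x)
        - ((∫ x, G x) * (∫ x, f x * κ x) - ∫ x, G x * f x) := by ring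
    rw [e1]
    refine enorm_sub_le.trans ((add_le_add le_rfl h1).trans ?_)
    rw [enorm_mul]
    have e2 : ‖∫ x, G x‖ₑ ≤ D * eLpNorm G 2 volume := by
      rw [hD]
      refine le_trans ?_ (hG.eLpNorm_one_le hΩ.measurableSet hGs)
      rw [eLpNorm_one_eq_lintegral_enorm]
      exact enorm_integral_le_lintegral_enorm _
    calc _ ≤ (D * eLpNorm G 2 volume) * b + C * (eLpNorm G 2 volume * a) := by gcongr
      _ ≤ (D * eLpNorm G 2 volume) * (a + b) + C * (eLpNorm G 2 volume * (a + b)) := by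
          gcongr
          · exact le_add_self
          · exact le_self_add
      _ = _ := by push_cast; ring
  -- Division by `‖G‖` needs it to be nonzero and finite; finiteness holds because `G` is a test
  -- function.
  by_cases h0 : eLpNorm G 2 volume = 0
  · rw [h0]; exact zero_le
  exact (ENNReal.mul_le_mul_iff_left h0 hGfin).1 (hGG.trans hI)

theorem two_le_infty : (2 : WithTop ℕ∞) ≤ ((⊤ : ℕ∞) : WithTop ℕ∞) := by
  have : (((2 : ℕ∞)) : WithTop ℕ∞) ≤ ((⊤ : ℕ∞) : WithTop ℕ∞) := WithTop.coe_le_coe.2 le_top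
  exact this

theorem IsTest.fderiv_fderiv_comm {d : ℕ} {f : E d → ℝ} (hf : IsTest f) (v w x : E d) :
    fderiv ℝ (fun y => fderiv ℝ f y v) x w = fderiv ℝ (fun y => fderiv ℝ f y w) x v := by
  have hd : DifferentiableAt ℝ (fderiv ℝ f) x :=
    (hf.1.fderiv_right (m := 1) two_le_infty).differentiable (by simp) x
  have h1 : ∀ v : E d, fderiv ℝ (fun y => fderiv ℝ f y v) x = (fderiv ℝ (fderiv ℝ f) x).flip v := by
    intro v
    have := hd.hasFDerivAt.clm_apply (hasFDerivAt_const v x)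
    rw [this.fderiv]
    ext; simp
  have hs : IsSymmSndFDerivAt ℝ f x :=
    hf.1.contDiffAt.isSymmSndFDerivAt (by simpa using two_le_infty)
  rw [h1, h1]
  exact hs w v

/-- The entries of the symmetric gradient of a smooth vector field. -/
noncomputable def symDeriv {d : ℕ} (u : Fin d → E d → ℝ) (i j : Fin d) (x : E d) : ℝ :=
  (fderiv ℝ (u i) x (unitVec j) + fderiv ℝ (u j) x (unitVec i)) / 2

theorem isTest_symDeriv {d : ℕ} {u : Fin d → E d → ℝ} (hu : ∀ i, IsTest (u i)) (i j : Fin d) :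
    IsTest (symDeriv u i j) := by
  have := (((hu i).fderiv_apply (unitVec j)).add ((hu j).fderiv_apply (unitVec i))).const_mul (1 / 2)
  convert this using 2
  unfold symDeriv; ring

theorem fderiv_symDeriv {d : ℕ} {u : Fin d → E d → ℝ} (hu : ∀ i, IsTest (u i)) (i j : Fin d)
    (x v : E d) : fderiv ℝ (symDeriv u i j) x v =
      (fderiv ℝ (fun y => fderiv ℝ (u i) y (unitVec j)) x v
        + fderiv ℝ (fun y => fderiv ℝ (u j) y (unitVec i)) x v) / 2 := by
  have h := (((hu i).fderiv_apply (unitVec j)).differentiable x).hasFDerivAt.add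
    (((hu j).fderiv_apply (unitVec i)).differentiable x).hasFDerivAt
  have h2 : HasFDerivAt (symDeriv u i j) ((1 / 2 : ℝ) • _) x :=
    (h.const_mul (1 / 2)).congr_of_eventuallyEq
      (Filter.Eventually.of_forall fun y => by simp [symDeriv]; ring)
  rw [h2.fderiv]
  simp; ring

/-- Korn's second inequality for smooth vector fields on a bounded convex domain. -/
theorem exists_korn_of_isTest {d : ℕ} {Ω : Set (E d)} (hΩ : IsOpen Ω) (hne : Ω.Nonempty)
    (hc : Convex ℝ Ω) (hb : Bornology.IsBounded Ω) :
    ∃ C : ℝ≥0, ∀ u : Fin d → E d → ℝ, (∀ i, IsTest (u i)) → ∀ i j,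
      eLpNorm (fun x => fderiv ℝ (u i) x (unitVec j)) 2 (vol Ω) ≤
        C * (∑ k, ∑ l, eLpNorm (symDeriv u k l) 2 (vol Ω) + ∑ k, eLpNorm (u k) 2 (vol Ω)) := by
  obtain ⟨κ, hκ, hκs, hκ1⟩ := exists_isTest_integral_eq_one hΩ hne
  obtain ⟨C, hC⟩ := exists_eLpNorm_le_of_fderiv_eq_sum hΩ hc hb hκ hκs hκ1
  have hκd := fun j => hκ.fderiv_apply (unitVec j)
  have hfin : ∀ j, eLpNorm (fun x => fderiv ℝ κ x (unitVec j)) 2 (vol Ω) ≠ ⊤ :=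
    fun j => ((hκd j).memLp Ω).eLpNorm_ne_top
  set D : ℝ≥0 := ∑ j, (eLpNorm (fun x => fderiv ℝ κ x (unitVec j)) 2 (vol Ω)).toNNReal
  have hD : ∀ j, eLpNorm (fun x => fderiv ℝ κ x (unitVec j)) 2 (vol Ω) ≤ D := by
    intro j
    rw [← ENNReal.coe_toNNReal (hfin j), ENNReal.coe_le_coe]
    exact Finset.single_le_sum (f := fun j =>
      (eLpNorm (fun x => fderiv ℝ κ x (unitVec j)) 2 (vol Ω)).toNNReal) (fun _ _ => zero_le)
      (Finset.mem_univ j)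
  refine ⟨C * (d * d * 3 + D), fun u hu i j => ?_⟩
  have hS := fun i j => isTest_symDeriv hu i j
  set T := ∑ k, ∑ l, eLpNorm (symDeriv u k l) 2 (vol Ω)
  have hT : ∀ k l, eLpNorm (symDeriv u k l) 2 (vol Ω) ≤ T := fun k l =>
    (Finset.single_le_sum (f := fun l => eLpNorm (symDeriv u k l) 2 (vol Ω))
      (fun _ _ => zero_le) (Finset.mem_univ l)).trans
    (Finset.single_le_sum (f := fun k => ∑ l, eLpNorm (symDeriv u k l) 2 (vol Ω))
      (fun _ _ => zero_le) (Finset.mem_univ k))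
  have hU : eLpNorm (u i) 2 (vol Ω) ≤ ∑ k, eLpNorm (u k) 2 (vol Ω) :=
    Finset.single_le_sum (f := fun k => eLpNorm (u k) 2 (vol Ω)) (fun _ _ => zero_le)
      (Finset.mem_univ i)
  set b : Fin d → Fin d → ℝ := fun l k => if l = k then 1 else 0
  have hb : ∀ l k, ‖b l k‖ₑ ≤ 1 := fun l k => by by_cases h : l = k <;> simp [b, h]
  -- With the Kronecker symbol `b`, the divergence of `g k` is `∂_k S_ij + ∂_j S_ik - ∂_i S_jk`,
  -- which equals `∂_k ∂_j u_i` by symmetry of second derivatives.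
  set g : Fin d → Fin d → E d → ℝ := fun k l x =>
    b l k * symDeriv u i j x + b l j * symDeriv u i k x - b l i * symDeriv u j k x
  have hg : ∀ k l, IsTest (g k l) := fun k l =>
    (((hS i j).const_mul _).add ((hS i k).const_mul _)).sub ((hS j k).const_mul _)
  have hgd : ∀ k l x v, fderiv ℝ (g k l) x v = b l k * fderiv ℝ (symDeriv u i j) x v
      + b l j * fderiv ℝ (symDeriv u i k) x v - b l i * fderiv ℝ (symDeriv u j k) x v := by
    intro k l x v
    have h := ((((hS i j).differentiable x).hasFDerivAt.const_mul (b l k)).add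
      (((hS i k).differentiable x).hasFDerivAt.const_mul (b l j))).sub
      (((hS j k).differentiable x).hasFDerivAt.const_mul (b l i))
    have h2 : fderiv ℝ (g k l) x = _ := h.fderiv
    rw [h2]; simp
  have key := hC (fun x => fderiv ℝ (u i) x (unitVec j)) g ((hu i).fderiv_apply _) hg ?_
  · refine key.trans ?_
    have e1 : ∑ k, ∑ l, eLpNorm (g k l) 2 (vol Ω) ≤ (d * d * 3 : ℝ≥0) * T := by
      have : ∀ k l, eLpNorm (g k l) 2 (vol Ω) ≤ 3 * T := by
        intro k l
        have hm : ∀ k l, AEStronglyMeasurable (symDeriv u k l) (vol Ω) :=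
          fun k l => (hS k l).continuous.aestronglyMeasurable
        have hn : ∀ (r : ℝ) k l, ‖r‖ₑ ≤ 1 →
            eLpNorm (fun x => r * symDeriv u k l x) 2 (vol Ω) ≤ T := by
          intro r k l hr
          refine le_trans (eLpNorm_const_smul_le (c := r) (f := symDeriv u k l)) ?_
          exact (mul_le_of_le_one_left zero_le hr).trans (hT k l)
        refine (eLpNorm_sub_le (((hm i j).const_mul _).add ((hm i k).const_mul _))
          ((hm j k).const_mul _) (by norm_num)).trans ?_
        calc _ ≤ (T + T) + T := by
              refine add_le_add ((eLpNorm_add_le ((hm i j).const_mul _) ((hm i k).const_mul _)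
                (by norm_num)).trans (add_le_add ?_ ?_)) ?_
              · exact hn _ i j (hb l k)
              · exact hn _ i k (hb l j)
              · exact hn _ j k (hb l i)
          _ = _ := by ring
      refine (Finset.sum_le_sum fun k _ => Finset.sum_le_sum fun l _ => this k l).trans ?_
      simp only [Finset.sum_const, Finset.card_univ, Fintype.card_fin, nsmul_eq_mul]
      push_cast
      exact le_of_eq (by ring)
    -- The mean of `∂_j u_i` against `κ` contains no derivative of `u` after integration by parts;
    -- this is the origin of the lower order term in Korn's inequality.
    have e2 : ‖∫ x, fderiv ℝ (u i) x (unitVec j) * κ x‖ₑ ≤ D * eLpNorm (u i) 2 (vol Ω) := by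
      have ibp := integral_mul_fderiv_eq_neg_fderiv_mul_of_integrable (μ := (volume : Measure (E d)))
        (f := κ) (g := u i) (v := unitVec j)
        (((hκd j).continuous.mul (hu i).continuous).integrable_of_hasCompactSupport
          (hu i).2.mul_left)
        ((hκ.continuous.mul ((hu i).fderiv_apply _).continuous).integrable_of_hasCompactSupport
          hκ.2.mul_right)
        ((hκ.continuous.mul (hu i).continuous).integrable_of_hasCompactSupport hκ.2.mul_right)
        (fun x _ => hκ.differentiable x) (fun x _ => (hu i).differentiable x)
      simp_rw [mul_comm (fderiv ℝ (u i) _ _)]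
      rw [ibp, enorm_neg, ← setIntegral_eq_integral_of_forall_compl_eq_zero (s := Ω)]
      · refine (enorm_integral_le_lintegral_enorm _).trans ?_
        simp only [enorm_mul]
        have h4 := ENNReal.lintegral_mul_le_Lp_mul_Lq (vol Ω)
          Real.HolderConjugate.two_two (f := fun y => ‖fderiv ℝ κ y (unitVec j)‖ₑ)
          (g := fun y => ‖u i y‖ₑ) (hκd j).continuous.measurable.enorm.aemeasurable
          (hu i).continuous.measurable.enorm.aemeasurable
        rw [← eLpNorm_two_eq (f := fun y => fderiv ℝ κ y (unitVec j)), ← eLpNorm_two_eq] at h4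
        exact h4.trans (mul_le_mul' (hD j) le_rfl)
      · intro x hx
        have : fderiv ℝ κ x = 0 := image_eq_zero_of_notMem_tsupport fun h =>
          hx (hκs (tsupport_fderiv_subset ℝ h))
        simp [this]
    calc _ ≤ C * ((d * d * 3 : ℝ≥0) * T + D * ∑ k, eLpNorm (u k) 2 (vol Ω)) := by
          refine mul_le_mul' le_rfl (add_le_add e1 (e2.trans ?_))
          gcongr
      _ ≤ C * ((d * d * 3 + D : ℝ≥0) * T + (d * d * 3 + D : ℝ≥0) * ∑ k, eLpNorm (u k) 2 (vol Ω)) := by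
          gcongr
          · exact le_self_add
          · exact le_add_self
      _ = _ := by push_cast; ring
  · intro k x
    simp_rw [hgd, Finset.sum_sub_distrib, Finset.sum_add_distrib]
    simp only [b, ite_mul, one_mul, zero_mul, Finset.sum_ite_eq', Finset.mem_univ, if_true]
    rw [fderiv_symDeriv hu, fderiv_symDeriv hu, fderiv_symDeriv hu,
      (hu j).fderiv_fderiv_comm (unitVec i) (unitVec k), (hu k).fderiv_fderiv_comm (unitVec i),
      (hu i).fderiv_fderiv_comm (unitVec k) (unitVec j)]
    ring

end Electrowetting

open MeasureTheory Set Filter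

/-! ### Density of test functions in H¹, and Korn's inequality there -/

namespace Electrowetting

theorem gradient_apply {d : ℕ} (f : E d → ℝ) (x : E d) (i : Fin d) :
    gradient f x i = fderiv ℝ f x (unitVec i) := by
  have h : inner ℝ (gradient f x) (unitVec i) = fderiv ℝ f x (unitVec i) :=
    InnerProductSpace.toDual_symm_apply
  rw [EuclideanSpace.inner_single_right] at h
  simpa using h

theorem norm_gradient {d : ℕ} (f : E d → ℝ) (x : E d) : ‖gradient f x‖ = ‖fderiv ℝ f x‖ :=
  (InnerProductSpace.toDual ℝ (E d)).symm.norm_map _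

/-- The smooth triples already form a linear space, so the span in the definition of `H1` adds
nothing, and elements of `H1` are limits of single test functions. -/
theorem mem_smoothTriples_of_mem_span {d : ℕ} {Ω : Set (E d)} {x : Triple Ω}
    (hx : x ∈ Submodule.span ℝ (smoothTriples Ω)) : x ∈ smoothTriples Ω := by
  induction hx using Submodule.span_induction with
  | mem x h => exact h
  | zero =>
    have hg : gradient (fun _ : E d => (0 : ℝ)) = 0 := by
      funext x; simp [gradient]
    refine ⟨fun _ => 0, ⟨contDiff_const, HasCompactSupport.zero⟩, ?_, ?_, ?_⟩
    · exact Lp.coeFn_zero ℝ 2 (vol Ω)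
    · rw [hg]; exact Lp.coeFn_zero (E d) 2 (vol Ω)
    · exact Lp.coeFn_zero ℝ 2 (surf Ω)
  | add x y _ _ hx hy =>
    obtain ⟨f, hf, f1, f2, f3⟩ := hx
    obtain ⟨g, hg, g1, g2, g3⟩ := hy
    refine ⟨fun x => f x + g x, hf.add hg, ?_, ?_, ?_⟩
    · filter_upwards [Lp.coeFn_add x.1 y.1, f1, g1] with z h1 h2 h3
      simp only [Prod.fst_add]
      rw [h1, Pi.add_apply, h2, h3]
    · filter_upwards [Lp.coeFn_add x.2.1 y.2.1, f2, g2] with z h1 h2 h3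
      simp only [Prod.fst_add, Prod.snd_add]
      rw [h1, Pi.add_apply, h2, h3]
      ext i
      simp only [PiLp.add_apply, gradient_apply]
      rw [fderiv_fun_add (hf.differentiable z) (hg.differentiable z)]
      simp
    · filter_upwards [Lp.coeFn_add x.2.2 y.2.2, f3, g3] with z h1 h2 h3
      simp only [Prod.snd_add]
      rw [h1, Pi.add_apply, h2, h3]
  | smul c x _ hx =>
    obtain ⟨f, hf, f1, f2, f3⟩ := hx
    refine ⟨fun x => c * f x, hf.const_mul c, ?_, ?_, ?_⟩
    · filter_upwards [Lp.coeFn_smul c x.1, f1] with z h1 h2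
      simp only [Prod.smul_fst]
      rw [h1, Pi.smul_apply, h2, smul_eq_mul]
    · filter_upwards [Lp.coeFn_smul c x.2.1, f2] with z h1 h2
      simp only [Prod.smul_fst, Prod.smul_snd]
      rw [h1, Pi.smul_apply, h2]
      ext i
      simp only [PiLp.smul_apply, gradient_apply]
      rw [fderiv_const_mul (hf.differentiable z)]
      simp
    · filter_upwards [Lp.coeFn_smul c x.2.2, f3] with z h1 h2
      simp only [Prod.smul_snd]
      rw [h1, Pi.smul_apply, h2, smul_eq_mul]

/-- Elements of `H¹(Ω)` are limits of test functions. -/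
theorem exists_isTest_seq {d : ℕ} {Ω : Set (E d)} (v : H1 Ω) :
    ∃ f : ℕ → E d → ℝ, (∀ k, IsTest (f k)) ∧
      Tendsto (fun k => eLpNorm (fun x => f k x - fn v x) 2 (vol Ω)) atTop (𝓝 0) ∧
      Tendsto (fun k => eLpNorm (fun x => gradient (f k) x - grad v x) 2 (vol Ω)) atTop (𝓝 0) ∧
      Tendsto (fun k => eLpNorm (fun x => f k x - tr v x) 2 (surf Ω)) atTop (𝓝 0) := by
  have hv : v.1 ∈ closure (Submodule.span ℝ (smoothTriples Ω) : Set (Triple Ω)) := v.2.2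
  obtain ⟨x, hx, hlim⟩ := mem_closure_iff_seq_limit.1 hv
  choose f hf f1 f2 f3 using fun k => mem_smoothTriples_of_mem_span (hx k)
  have l1 := (Prod.tendsto_iff _ _).1 hlim
  have l2 := (Prod.tendsto_iff _ _).1 l1.2
  refine ⟨f, hf, ?_, ?_, ?_⟩
  · refine ((Lp.tendsto_Lp_iff_tendsto_eLpNorm' _ _).1 l1.1).congr fun k => ?_
    exact eLpNorm_congr_ae ((f1 k).mono fun y hy => by simp only [Pi.sub_apply, hy]; rfl)
  · refine ((Lp.tendsto_Lp_iff_tendsto_eLpNorm' _ _).1 l2.1).congr fun k => ?_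
    exact eLpNorm_congr_ae ((f2 k).mono fun y hy => by simp only [Pi.sub_apply, hy]; rfl)
  · refine ((Lp.tendsto_Lp_iff_tendsto_eLpNorm' _ _).1 l2.2).congr fun k => ?_
    exact eLpNorm_congr_ae ((f3 k).mono fun y hy => by simp only [Pi.sub_apply, hy]; rfl)

theorem memLp_fn {d : ℕ} {Ω : Set (E d)} (v : H1 Ω) : MemLp (fn v) 2 (vol Ω) := Lp.memLp v.1.1

theorem memLp_grad {d : ℕ} {Ω : Set (E d)} (v : H1 Ω) : MemLp (grad v) 2 (vol Ω) :=
  Lp.memLp v.1.2.1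

theorem memLp_tr {d : ℕ} {Ω : Set (E d)} (v : H1 Ω) : MemLp (tr v) 2 (surf Ω) :=
  Lp.memLp v.1.2.2

theorem memLp_grad_apply {d : ℕ} {Ω : Set (E d)} (v : H1 Ω) (i : Fin d) :
    MemLp (fun x => grad v x i) 2 (vol Ω) :=
  (memLp_grad v).continuousLinearMap_comp (EuclideanSpace.proj (𝕜 := ℝ) i)

theorem eLpNorm_fn {d : ℕ} {Ω : Set (E d)} (v : H1 Ω) :
    eLpNorm (fn v) 2 (vol Ω) = ENNReal.ofReal (normL2 v) := by
  unfold normL2 fn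
  rw [Lp.norm_def, ENNReal.ofReal_toReal (Lp.eLpNorm_ne_top _)]

theorem eLpNorm_grad {d : ℕ} {Ω : Set (E d)} (v : H1 Ω) :
    eLpNorm (grad v) 2 (vol Ω) = ENNReal.ofReal (normGrad v) := by
  unfold normGrad grad
  rw [Lp.norm_def, ENNReal.ofReal_toReal (Lp.eLpNorm_ne_top _)]

theorem tendsto_eLpNorm_of_tendsto_sub {α F : Type*} [MeasurableSpace α] [NormedAddCommGroup F]
    {μ : Measure α} {p : ℝ≥0∞} (hp : 1 ≤ p) {f : ℕ → α → F} {g : α → F}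
    (hf : ∀ k, AEStronglyMeasurable (f k) μ) (hg : MemLp g p μ)
    (h : Tendsto (fun k => eLpNorm (fun x => f k x - g x) p μ) atTop (𝓝 0)) :
    Tendsto (fun k => eLpNorm (f k) p μ) atTop (𝓝 (eLpNorm g p μ)) := by
  have h1 : Tendsto (fun k => eLpNorm g p μ - eLpNorm (fun x => f k x - g x) p μ) atTop
      (𝓝 (eLpNorm g p μ)) := by
    simpa using ENNReal.Tendsto.sub (tendsto_const_nhds (x := eLpNorm g p μ)) h
      (Or.inl hg.eLpNorm_ne_top)
  have h2 : Tendsto (fun k => eLpNorm g p μ + eLpNorm (fun x => f k x - g x) p μ) atTop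
      (𝓝 (eLpNorm g p μ)) := by
    simpa using (tendsto_const_nhds (x := eLpNorm g p μ)).add h
  refine tendsto_of_tendsto_of_tendsto_of_le_of_le h1 h2 (fun k => ?_) (fun k => ?_)
  · rw [tsub_le_iff_right]
    calc eLpNorm g p μ = eLpNorm (f k - (f k - g)) p μ := by simp
      _ ≤ _ := eLpNorm_sub_le (hf k) ((hf k).sub hg.1) hp
  · calc eLpNorm (f k) p μ = eLpNorm (g + (f k - g)) p μ := by simp
      _ ≤ _ := eLpNorm_add_le hg.1 ((hf k).sub hg.1) hp

theorem tendsto_eLpNorm_apply {d : ℕ} {Ω : Set (E d)} {f : ℕ → E d → ℝ} {v : H1 Ω} (i : Fin d)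
    (h : Tendsto (fun k => eLpNorm (fun x => gradient (f k) x - grad v x) 2 (vol Ω)) atTop (𝓝 0)) :
    Tendsto (fun k => eLpNorm (fun x => gradient (f k) x i - grad v x i) 2 (vol Ω)) atTop
      (𝓝 0) := by
  refine tendsto_of_tendsto_of_tendsto_of_le_of_le tendsto_const_nhds h (fun _ => zero_le)
    fun k => eLpNorm_mono fun x => ?_
  simpa using PiLp.norm_apply_le (gradient (f k) x - grad v x) i

theorem memLp_symGrad {d : ℕ} {Ω : Set (E d)} (u : VecH1 Ω) (i j : Fin d) :
    MemLp (fun x => symGrad u x i j) 2 (vol Ω) := by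
  have := ((memLp_grad_apply (u i) j).add (memLp_grad_apply (u j) i)).const_mul (1 / 2)
  refine this.ae_eq (Eventually.of_forall fun x => ?_)
  simp [symGrad]; ring

/-- Korn's second inequality. -/
theorem exists_korn {d : ℕ} {Ω : Set (E d)} (hΩ : IsOpen Ω) (hne : Ω.Nonempty)
    (hc : Convex ℝ Ω) (hb : Bornology.IsBounded Ω) :
    ∃ C : ℝ≥0, ∀ u : VecH1 Ω, ∀ i j, eLpNorm (fun x => grad (u i) x j) 2 (vol Ω) ≤
        C * (∑ k, ∑ l, eLpNorm (fun x => symGrad u x k l) 2 (vol Ω)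
          + ∑ k, eLpNorm (fn (u k)) 2 (vol Ω)) := by
  obtain ⟨C, hC⟩ := exists_korn_of_isTest hΩ hne hc hb
  refine ⟨C, fun u i j => ?_⟩
  choose f hf f1 f2 _ using fun i => exists_isTest_seq (u i)
  have hfm : ∀ i k, AEStronglyMeasurable (f i k) (vol Ω) :=
    fun i k => (hf i k).continuous.aestronglyMeasurable
  have hgm : ∀ i k j, AEStronglyMeasurable (fun x => gradient (f i k) x j) (vol Ω) :=
    fun i k j => by
      simp only [gradient_apply]
      exact ((hf i k).fderiv_apply _).continuous.aestronglyMeasurable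
  have hl := tendsto_eLpNorm_of_tendsto_sub (by norm_num) (fun k => hgm i k j)
    (memLp_grad_apply (u i) j) (tendsto_eLpNorm_apply j (f2 i))
  have hr1 := fun i => tendsto_eLpNorm_of_tendsto_sub (by norm_num) (fun k => hfm i k)
    (memLp_fn (u i)) (f1 i)
  have hr2 : ∀ i j, Tendsto (fun k => eLpNorm (symDeriv (fun i => f i k) i j) 2 (vol Ω)) atTop
      (𝓝 (eLpNorm (fun x => symGrad u x i j) 2 (vol Ω))) := by
    intro i j
    refine tendsto_eLpNorm_of_tendsto_sub (by norm_num)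
      (fun k => (isTest_symDeriv (fun i => hf i k) i j).continuous.aestronglyMeasurable)
      (memLp_symGrad u i j) ?_
    have h0 := (tendsto_eLpNorm_apply j (f2 i)).add (tendsto_eLpNorm_apply i (f2 j))
    rw [add_zero] at h0
    refine tendsto_of_tendsto_of_tendsto_of_le_of_le tendsto_const_nhds h0 (fun _ => zero_le)
      fun k => ?_
    have m1 := (hgm i k j).sub (memLp_grad_apply (u i) j).1
    have m2 := (hgm j k i).sub (memLp_grad_apply (u j) i).1
    refine le_trans ?_ (eLpNorm_add_le m1 m2 (by norm_num))
    refine eLpNorm_mono fun x => ?_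
    simp only [symDeriv, symGrad, Pi.add_apply, gradient_apply, Real.norm_eq_abs]
    rw [← sub_div, abs_div]
    refine (div_le_self (abs_nonneg _) (by norm_num)).trans (le_of_eq ?_)
    congr 1; ring
  refine le_of_tendsto_of_tendsto' hl (ENNReal.Tendsto.const_mul
    ((tendsto_finsetSum _ fun k _ => tendsto_finsetSum _ fun l _ => hr2 k l).add
      (tendsto_finsetSum _ fun k _ => hr1 k)) (Or.inr ENNReal.coe_ne_top)) fun k => ?_
  simp only [gradient_apply]
  exact hC (fun i => f i k) (fun i => hf i k) i j

end Electrowetting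

/-! ### Gagliardo-Nirenberg inequality near a point of the closure -/

namespace Electrowetting

/-- For the standard basis this is the grid-lines inequality of Loomis-Whitney type. A linear change
of coordinates carries the standard basis to `e` and multiplies the volume by a constant `c`. -/
theorem exists_lintegral_rpow_le_of_le_lintegral_lines {d : ℕ} {p : ℝ}
    (hp : Real.HolderConjugate d p) (e : Module.Basis (Fin d) ℝ (E d)) :
    ∃ C : ℝ≥0, ∀ u h : E d → ℝ≥0∞, Measurable u → Measurable h →
      (∀ x i, u x ≤ ∫⁻ t : ℝ, h (x + t • e i)) → ∫⁻ x, u x ^ p ≤ C * (∫⁻ x, h x) ^ p := by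
  set L : (Fin d → ℝ) ≃L[ℝ] E d := e.equivFun.symm.toContinuousLinearEquiv
  have hL : ∀ y, L y = ∑ i, y i • e i := fun y => by
    simp [L, Module.Basis.equivFun_symm_apply]
  have hupd : ∀ y i t, L (Function.update y i t) = L y + (t - y i) • e i := by
    intro y i t
    have : Function.update y i t = y + (t - y i) • Pi.single i (1 : ℝ) := by
      ext j
      by_cases h : j = i
      · subst h; simp
      · simp [h]
    rw [this, map_add, map_smul]
    congr 2
    rw [hL]
    simp [Pi.single_apply]
  have hLm : Measurable L := L.continuous.measurable
  set c := Measure.addHaarScalarFactor (volume : Measure (E d))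
    ((volume : Measure (Fin d → ℝ)).map L)
  have hc : 0 < c := Measure.addHaarScalarFactor_pos_of_isAddHaarMeasure ..
  have hv : (volume : Measure (E d)) = c • ((volume : Measure (Fin d → ℝ)).map L) :=
    Measure.isAddLeftInvariant_eq_smul ..
  have hI : ∀ f : E d → ℝ≥0∞, Measurable f → ∫⁻ x, f x = c * ∫⁻ y, f (L y) := by
    intro f hf
    rw [hv, ENNReal.smul_def, lintegral_smul_measure, lintegral_map hf hLm, smul_eq_mul]
  have hp0 : 0 ≤ p := hp.symm.nonneg
  have h1d : (1 : ℝ) < d := hp.lt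
  refine ⟨c * (c ^ p)⁻¹, fun u h hu hh hle => ?_⟩
  have hhm : Measurable fun y => h (L y) := hh.comp hLm
  have hpc : Real.HolderConjugate (Fintype.card (Fin d)) p := by simpa using hp
  have key : ∫⁻ y, u (L y) ^ p ≤ (∫⁻ y, h (L y)) ^ p := by
    -- Conjugacy means `p = d / (d - 1)`, so `u ^ p` is a product of `d` factors `u ^ (1 / (d -
    -- 1))`, one for each direction.
    calc ∫⁻ y, u (L y) ^ p
        = ∫⁻ y, (u (L y) ^ (1 / (d - 1 : ℝ))) ^ (d : ℝ) := by
          congr! 2 with y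
          rw [← ENNReal.rpow_mul, hp.conjugate_eq]
          field_simp
      _ = ∫⁻ y, ∏ _i : Fin d, u (L y) ^ (1 / (d - 1 : ℝ)) := by
          congr! 2 with y
          simp_rw [Finset.prod_const]
          simp
      _ ≤ ∫⁻ y, ∏ i, (∫⁻ t, h (L (Function.update y i t))) ^ ((1 : ℝ) / (d - 1 : ℝ)) := by
          refine lintegral_mono fun y => Finset.prod_le_prod' fun i _ => ?_
          refine ENNReal.rpow_le_rpow ?_ (by rw [one_div]; exact inv_nonneg.2 (by linarith))
          refine (hle (L y) i).trans (le_of_eq ?_)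
          simp_rw [hupd]
          exact (lintegral_sub_right_eq_self (fun t => h (L y + t • e i)) (y i)).symm
      _ ≤ _ := by
          have := lintegral_prod_lintegral_pow_le (fun _ : Fin d => (volume : Measure ℝ)) hpc hhm
          simpa [volume_pi] using this
  rw [hI _ (by fun_prop), hI _ hh, ENNReal.mul_rpow_of_nonneg _ _ hp0, ← mul_assoc,
    ENNReal.coe_mul, ENNReal.coe_inv (NNReal.rpow_pos hc).ne', ENNReal.coe_rpow_of_nonneg _ hp0,
    mul_assoc (c : ℝ≥0∞) _ _, ENNReal.inv_mul_cancel, mul_one]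
  · gcongr
  · simpa using fun h => absurd h hc.ne'
  · finiteness

/-- Near any point, a convex open set is stable under small displacements in the directions of
some basis. -/
theorem exists_basis_segment_subset {d : ℕ} {Ω : Set (E d)} (hΩ : IsOpen Ω) (hc : Convex ℝ Ω)
    (hne : Ω.Nonempty) (x₀ : E d) :
    ∃ (e : Module.Basis (Fin d) ℝ (E d)) (r : ℝ), 0 < r ∧ (∀ i, 2 * r < ‖e i‖) ∧
      ∀ x ∈ Ω, x ∈ Metric.ball x₀ r → ∀ i, ∀ t ∈ Icc (0 : ℝ) 1, x + t • e i ∈ Ω := by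
  obtain ⟨a, ha⟩ := hne
  obtain ⟨r, hr, hball⟩ := Metric.isOpen_iff.1 hΩ a ha
  set v := a - x₀
  set S := ∑ k, v k
  -- The vectors `v + s • unitVec i` are independent as soon as `s ≠ 0` and `s + S ≠ 0`. The second
  -- condition excludes one value, so one of `r/4` and `r/3` is suitable.
  obtain ⟨s, hs0, hsr, hsS⟩ : ∃ s : ℝ, 0 < s ∧ s < r / 2 ∧ s + S ≠ 0 := by
    by_cases h : r / 4 + S = 0
    · exact ⟨r / 3, by linarith, by linarith, by intro h'; linarith⟩
    · exact ⟨r / 4, by linarith, by linarith, h⟩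
  set f : Fin d → E d := fun i => v + s • unitVec i
  have hli : LinearIndependent ℝ f := by
    rw [Fintype.linearIndependent_iff]
    intro c hc0
    have hk : ∀ k, (∑ i, c i) * v k + s * c k = 0 := by
      intro k
      have := congrArg (fun z : E d => z k) hc0
      simpa [f, smul_add, Finset.sum_add_distrib, Finset.sum_mul, Pi.single_apply,
        mul_comm] using this
    have hsum : (∑ i, c i) * (s + S) = 0 := by
      have := Finset.sum_congr rfl fun k (_ : k ∈ Finset.univ) => hk k
      rw [Finset.sum_add_distrib, ← Finset.mul_sum, ← Finset.mul_sum, Finset.sum_const_zero] at this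
      linear_combination this
    have h0 : ∑ i, c i = 0 := (mul_eq_zero.1 hsum).resolve_right hsS
    intro k
    have := hk k
    rw [h0, zero_mul, zero_add] at this
    exact (mul_eq_zero.1 this).resolve_left hs0.ne'
  set e : Module.Basis (Fin d) ℝ (E d) :=
    basisOfLinearIndependentOfCardEqFinrank' f hli (by simp)
  have he : ∀ i, e i = v + s • unitVec i := fun i => by simp [e, f]
  obtain ⟨ρ, hρ0, hρ⟩ : ∃ ρ : ℝ, 0 < ρ ∧ ∀ i, ρ ≤ ‖e i‖ := by
    rcases isEmpty_or_nonempty (Fin d) with h | h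
    · exact ⟨1, one_pos, fun i => (h.false i).elim⟩
    · obtain ⟨i, hi⟩ := Finite.exists_min fun i => ‖e i‖
      exact ⟨‖e i‖, norm_pos_iff.2 (e.ne_zero i), hi⟩
  -- `ρ / 3` makes every `e i` longer than the diameter of the ball; `r / 2` together with `s < r /
  -- 2` keeps `x + e i` in the ball around `a`.
  refine ⟨e, min (ρ / 3) (r / 2), by positivity, fun i => ?_, fun x hx hxb i t ht => ?_⟩
  · have := hρ i
    have := min_le_left (ρ / 3) (r / 2)
    linarith
  · have hmem : x + e i ∈ Ω := by
      apply hball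
      rw [mem_ball_iff_norm, he]
      have h1 : x + (v + s • unitVec i) - a = (x - x₀) + s • unitVec i := by simp [v]; abel
      rw [h1]
      refine (norm_add_le _ _).trans_lt ?_
      rw [mem_ball_iff_norm] at hxb
      have := min_le_right (ρ / 3) (r / 2)
      rw [norm_smul, Real.norm_of_nonneg hs0.le]
      simp
      linarith
    have h2 : x + t • e i = (1 - t) • x + t • (x + e i) := by
      rw [smul_add, sub_smul, one_smul]; abel
    rw [h2]
    exact hc hx hmem (by linarith [ht.2]) ht.1 (by ring)

/-- The vector `e` is too long for both `x` and `x + e` to lie in the ball, so `F` vanishes at the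
far end of a segment that stays in `Ω`. Hence `F` need not vanish on the boundary of `Ω`, and no
extension across it is required. -/
theorem enorm_le_lintegral_fderiv_line {d : ℕ} {Ω : Set (E d)} {x₀ : E d} {r : ℝ} {e : E d}
    (he : 2 * r < ‖e‖)
    (h : ∀ x ∈ Ω, x ∈ Metric.ball x₀ r → ∀ t ∈ Icc (0 : ℝ) 1, x + t • e ∈ Ω)
    {F : E d → ℝ} (hF : ContDiff ℝ 1 F) (hs : Function.support F ⊆ Metric.ball x₀ r) (x : E d) :
    Ω.indicator (fun x => ‖F x‖ₑ) x
      ≤ ∫⁻ t : ℝ, ‖e‖ₑ * Ω.indicator (fun x => ‖fderiv ℝ F x‖ₑ) (x + t • e) := by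
  by_cases hx : x ∈ Ω
  swap
  · simp [hx]
  rw [indicator_of_mem hx]
  by_cases hF0 : F x = 0
  · simp [hF0]
  have hxb : x ∈ Metric.ball x₀ r := hs hF0
  have hF1 : F (x + e) = 0 := by
    by_contra h1
    have h2 : x + e ∈ Metric.ball x₀ r := hs h1
    rw [mem_ball_iff_norm] at hxb h2
    have : ‖e‖ ≤ ‖x + e - x₀‖ + ‖x - x₀‖ := by
      calc ‖e‖ = ‖(x + e - x₀) - (x - x₀)‖ := by congr 1; abel
        _ ≤ _ := norm_sub_le _ _
    linarith
  have hd : ∀ t : ℝ, HasDerivAt (fun t : ℝ => F (x + t • e)) (fderiv ℝ F (x + t • e) e) t := by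
    intro t
    have h1 : HasDerivAt (fun t : ℝ => x + t • e) e t := by
      simpa using ((hasDerivAt_id' t).smul_const e).const_add x
    exact ((hF.differentiable (by simp)) _).hasFDerivAt.comp_hasDerivAt t h1
  have hk := enorm_sub_le_lintegral_deriv hd
  simp only [one_smul, zero_smul, add_zero, hF1, zero_sub, enorm_neg] at hk
  calc _ ≤ _ := hk
    _ ≤ ∫⁻ t in Ioo (0 : ℝ) 1, ‖e‖ₑ * Ω.indicator (fun x => ‖fderiv ℝ F x‖ₑ) (x + t • e) := by
        refine setLIntegral_mono' measurableSet_Ioo fun t ht => ?_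
        rw [indicator_of_mem (h x hx hxb t (Ioo_subset_Icc_self ht)), mul_comm]
        exact ContinuousLinearMap.le_opENorm _ _
    _ ≤ _ := setLIntegral_le_lintegral _ _

theorem exists_lintegral_rpow_le_lintegral_fderiv {d : ℕ} {p : ℝ} (hp : Real.HolderConjugate d p)
    {Ω : Set (E d)} (hΩ : IsOpen Ω) (hc : Convex ℝ Ω) (hne : Ω.Nonempty) (x₀ : E d) :
    ∃ r : ℝ, 0 < r ∧ ∃ C : ℝ≥0, ∀ F : E d → ℝ, ContDiff ℝ 1 F →
      Function.support F ⊆ Metric.ball x₀ r →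
      ∫⁻ x in Ω, ‖F x‖ₑ ^ p ≤ C * (∫⁻ x in Ω, ‖fderiv ℝ F x‖ₑ) ^ p := by
  obtain ⟨e, r, hr, her, hseg⟩ := exists_basis_segment_subset hΩ hc hne x₀
  obtain ⟨C, hC⟩ := exists_lintegral_rpow_le_of_le_lintegral_lines hp e
  set M : ℝ≥0 := ∑ i, ‖e i‖₊
  have hM : ∀ i, ‖e i‖ₑ ≤ M := fun i => by
    rw [enorm_eq_nnnorm, ENNReal.coe_le_coe]
    exact Finset.single_le_sum (f := fun i => ‖e i‖₊) (fun _ _ => zero_le) (Finset.mem_univ i)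
  have hp0 : 0 ≤ p := hp.symm.nonneg
  refine ⟨r, hr, C * M ^ p, fun F hF hs => ?_⟩
  have hFm : Measurable fun x => ‖F x‖ₑ := hF.continuous.measurable.enorm
  have hdm : Measurable fun x => ‖fderiv ℝ F x‖ₑ := (hF.continuous_fderiv (by simp)).measurable.enorm
  have := hC (Ω.indicator fun x => ‖F x‖ₑ)
    (fun x => M * Ω.indicator (fun x => ‖fderiv ℝ F x‖ₑ) x) (hFm.indicator hΩ.measurableSet)
    ((hdm.indicator hΩ.measurableSet).const_mul _) fun x i => by
      refine (enorm_le_lintegral_fderiv_line (her i) (fun x hx hxb => hseg x hx hxb i) hF hs x).trans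
        (lintegral_mono fun t => ?_)
      exact mul_le_mul' (hM i) le_rfl
  rw [lintegral_const_mul _ (hdm.indicator hΩ.measurableSet), lintegral_indicator hΩ.measurableSet,
    ENNReal.mul_rpow_of_nonneg _ _ hp0, ← ENNReal.coe_rpow_of_nonneg _ hp0, ← mul_assoc,
    ← ENNReal.coe_mul] at this
  refine le_trans (le_of_eq ?_) this
  rw [← lintegral_indicator hΩ.measurableSet]
  congr 1; ext x
  by_cases hx : x ∈ Ω
  · simp [hx]
  · simp [hx, hp.symm.pos]

end Electrowetting

/-! ### The Sobolev embedding into L⁶ -/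

namespace Electrowetting

theorem eLpNorm_six_eq {α F : Type*} [MeasurableSpace α] [NormedAddCommGroup F] {f : α → F}
    {μ : Measure α} : eLpNorm f 6 μ = (∫⁻ x, ‖f x‖ₑ ^ (6 : ℝ) ∂μ) ^ (1 / (6 : ℝ)) := by
  rw [eLpNorm_eq_lintegral_rpow_enorm_toReal (by norm_num) (by norm_num)]
  simp

/-- The exponent `3/2` is the critical one for `d = 3`. For `d = 2` the critical exponent is `2`,
and Hölder's inequality on the bounded set lowers it, so that both dimensions share the subsequent
argument. -/
theorem exists_lintegral_rpow_three_halves_le {d : ℕ} (hd : d = 2 ∨ d = 3)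
    {Ω : Set (E d)} (hΩ : IsOpen Ω) (hc : Convex ℝ Ω) (hb : Bornology.IsBounded Ω)
    (hne : Ω.Nonempty) (x₀ : E d) :
    ∃ r : ℝ, 0 < r ∧ ∃ C : ℝ≥0, ∀ F : E d → ℝ, ContDiff ℝ 1 F →
      Function.support F ⊆ Metric.ball x₀ r →
      ∫⁻ x in Ω, ‖F x‖ₑ ^ (3 / 2 : ℝ) ≤ C * (∫⁻ x in Ω, ‖fderiv ℝ F x‖ₑ) ^ (3 / 2 : ℝ) := by
  rcases hd with rfl | rfl
  · obtain ⟨r, hr, C, hC⟩ := exists_lintegral_rpow_le_lintegral_fderiv (d := 2) (p := 2)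
      (by exact_mod_cast Real.HolderConjugate.two_two) hΩ hc hne x₀
    have hv : volume Ω ≠ ⊤ := hb.measure_lt_top.ne
    refine ⟨r, hr, (C ^ (3 / 4 : ℝ) * (volume Ω ^ (1 / 4 : ℝ)).toNNReal), fun F hF hs => ?_⟩
    have h1 := hC F hF hs
    have hF' : AEMeasurable (fun x => ‖F x‖ₑ ^ (3 / 2 : ℝ)) (vol Ω) :=
      (hF.continuous.measurable.enorm.pow_const _).aemeasurable
    have h2 := ENNReal.lintegral_mul_le_Lp_mul_Lq (vol Ω)
      (Real.holderConjugate_iff.2 ⟨by norm_num, by norm_num⟩ : Real.HolderConjugate (4 / 3) 4)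
      hF' (aemeasurable_const (b := (1 : ℝ≥0∞)))
    simp only [Pi.mul_apply, mul_one, ENNReal.one_rpow, lintegral_const, one_mul,
      Measure.restrict_apply_univ, ← ENNReal.rpow_mul] at h2
    norm_num at h2
    rw [show (3 / 2 : ℝ) = 2 * (3 / 4) by norm_num] at h2 ⊢
    push_cast
    rw [ENNReal.coe_toNNReal (by finiteness)]
    calc _ ≤ _ := h2
      _ ≤ (C * (∫⁻ x in Ω, ‖fderiv ℝ F x‖ₑ) ^ (2 : ℝ)) ^ (3 / 4 : ℝ) * volume Ω ^ (1 / 4 : ℝ) := by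
          gcongr
          simpa using h1
      _ = _ := by
          rw [ENNReal.mul_rpow_of_nonneg _ _ (by norm_num), ← ENNReal.rpow_mul,
            ENNReal.coe_rpow_of_nonneg _ (by norm_num)]
          ring
  · exact exists_lintegral_rpow_le_lintegral_fderiv (d := 3) (p := 3 / 2)
      (Real.holderConjugate_iff.2 ⟨by norm_num, by norm_num⟩) hΩ hc hne x₀

/-- The previous inequality is applied to `g⁴`, whose gradient is `4 g³ ∇g`. With `A = ∫ g⁶` and `B
= ∫ |∇g|²`, Cauchy-Schwarz gives `A ≤ C A^{3/4} B^{3/4}`. As `A` is finite, `A^{3/4}` can be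
cancelled, and the power `2/3` of the result is the claim. -/
theorem exists_sobolev_of_support_subset_ball {d : ℕ} (hd : d = 2 ∨ d = 3)
    {Ω : Set (E d)} (hΩ : IsOpen Ω) (hc : Convex ℝ Ω) (hb : Bornology.IsBounded Ω)
    (hne : Ω.Nonempty) (x₀ : E d) :
    ∃ r : ℝ, 0 < r ∧ ∃ C : ℝ≥0, ∀ g : E d → ℝ, IsTest g →
      Function.support g ⊆ Metric.ball x₀ r →
      eLpNorm g 6 (vol Ω) ≤ C * eLpNorm (fderiv ℝ g) 2 (vol Ω) := by
  obtain ⟨r, hr, C, hC⟩ := exists_lintegral_rpow_three_halves_le hd hΩ hc hb hne x₀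
  refine ⟨r, hr, (C * 4 ^ (3 / 2 : ℝ)) ^ (2 / 3 : ℝ), fun g hg hs => ?_⟩
  have hF : ContDiff ℝ 1 fun x => g x ^ 4 := (hg.1.of_le (by simp)).pow 4
  have hgm : Measurable fun x => ‖g x‖ₑ := hg.continuous.measurable.enorm
  have hdm : Measurable fun x => ‖fderiv ℝ g x‖ₑ :=
    (hg.1.continuous_fderiv (by simp)).measurable.enorm
  have h1 := hC (fun x => g x ^ 4) hF
    ((Function.support_pow g (by norm_num : 4 ≠ 0)).subset.trans hs)
  set A := ∫⁻ x in Ω, ‖g x‖ₑ ^ (6 : ℝ) with hA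
  set B := ∫⁻ x in Ω, ‖fderiv ℝ g x‖ₑ ^ (2 : ℝ) with hB
  have hAfin : A ≠ ⊤ := by
    have := ((hg.memLp_volume 6).restrict Ω).eLpNorm_ne_top
    rw [eLpNorm_six_eq] at this
    intro h
    rw [← hA, h] at this
    simp at this
  have e1 : ∀ x, ‖g x ^ 4‖ₑ ^ (3 / 2 : ℝ) = ‖g x‖ₑ ^ (6 : ℝ) := by
    intro x
    rw [enorm_pow, ← ENNReal.rpow_natCast, ← ENNReal.rpow_mul]
    norm_num
  have e2 : ∀ x, ‖fderiv ℝ (fun x => g x ^ 4) x‖ₑ = 4 * (‖g x‖ₑ ^ (3 : ℝ) * ‖fderiv ℝ g x‖ₑ) := by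
    intro x
    have : fderiv ℝ (fun x => g x ^ 4) x = (4 * g x ^ 3) • fderiv ℝ g x := by
      rw [((hg.differentiable x).hasFDerivAt.pow 4).fderiv]
      simp
    rw [this, enorm_smul, enorm_mul, enorm_pow, mul_assoc, ← ENNReal.rpow_natCast]
    have h4 : ‖(4 : ℝ)‖ₑ = 4 := by
      rw [Real.enorm_eq_ofReal (by norm_num)]; simp
    rw [h4]
    norm_num
  simp_rw [e1, e2] at h1
  have hm : Measurable fun x => ‖g x‖ₑ ^ (3 : ℝ) * ‖fderiv ℝ g x‖ₑ := (hgm.pow_const _).mul hdm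
  rw [lintegral_const_mul _ hm] at h1
  have h2 := ENNReal.lintegral_mul_le_Lp_mul_Lq (vol Ω) Real.HolderConjugate.two_two
    (f := fun x => ‖g x‖ₑ ^ (3 : ℝ)) (g := fun x => ‖fderiv ℝ g x‖ₑ)
    (hgm.pow_const _).aemeasurable hdm.aemeasurable
  simp only [Pi.mul_apply, ← ENNReal.rpow_mul] at h2
  rw [show (3 : ℝ) * 2 = 6 by norm_num, ← hA, ← hB] at h2
  have h3 : A ≤ (C * 4 ^ (3 / 2 : ℝ) : ℝ≥0) * (A ^ (3 / 4 : ℝ) * B ^ (3 / 4 : ℝ)) := by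
    refine h1.trans ((mul_le_mul' le_rfl
      (ENNReal.rpow_le_rpow (mul_le_mul' le_rfl h2) (by norm_num))).trans (le_of_eq ?_))
    rw [ENNReal.mul_rpow_of_nonneg _ _ (by norm_num), ENNReal.mul_rpow_of_nonneg _ _ (by norm_num),
      ← ENNReal.rpow_mul, ← ENNReal.rpow_mul]
    push_cast
    rw [ENNReal.coe_rpow_of_nonneg _ (by norm_num)]
    norm_num
    ring
  rw [eLpNorm_six_eq, ← hA, eLpNorm_two_eq, ← hB]
  by_cases hA0 : A = 0
  · simp [hA0]
  have h4 : A ^ (1 / 4 : ℝ) ≤ (C * 4 ^ (3 / 2 : ℝ) : ℝ≥0) * B ^ (3 / 4 : ℝ) := by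
    have hA34 : A ^ (3 / 4 : ℝ) ≠ 0 := by simp [hA0, hAfin]
    have hA34' : A ^ (3 / 4 : ℝ) ≠ ⊤ := by finiteness
    refine (ENNReal.mul_le_mul_iff_left hA34 hA34').1 ?_
    rw [← ENNReal.rpow_add_of_nonneg _ _ (by norm_num) (by norm_num)]
    norm_num at h3 ⊢
    refine h3.trans (le_of_eq ?_)
    ring
  have h5 := ENNReal.rpow_le_rpow h4 (by norm_num : (0 : ℝ) ≤ 2 / 3)
  rw [ENNReal.mul_rpow_of_nonneg _ _ (by norm_num), ← ENNReal.rpow_mul, ← ENNReal.rpow_mul,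
    ← ENNReal.coe_rpow_of_nonneg _ (by norm_num)] at h5
  norm_num at h5 ⊢
  exact h5

/-- The Sobolev inequality for test functions on a bounded convex domain. -/
theorem exists_sobolev_of_isTest {d : ℕ} (hd : d = 2 ∨ d = 3)
    {Ω : Set (E d)} (hΩ : IsOpen Ω) (hc : Convex ℝ Ω) (hb : Bornology.IsBounded Ω)
    (hne : Ω.Nonempty) :
    ∃ C : ℝ≥0, ∀ f : E d → ℝ, IsTest f →
      eLpNorm f 6 (vol Ω) ≤ C * (eLpNorm f 2 (vol Ω) + eLpNorm (gradient f) 2 (vol Ω)) := by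
  suffices h : ∃ C : ℝ≥0, ∀ f : E d → ℝ, IsTest f → eLpNorm f 6 (vol (Ω ∩ closure Ω))
      ≤ C * (eLpNorm f 2 (vol Ω) + eLpNorm (gradient f) 2 (vol Ω)) by
    rwa [inter_eq_left.2 subset_closure] at h
  have hK : IsCompact (closure Ω) := hb.isCompact_closure
  -- The local inequalities are glued by compactness of the closure: the property passes to subsets
  -- and finite unions, so it suffices to have it near each point.
  refine hK.induction_on (p := fun s => ∃ C : ℝ≥0, ∀ f : E d → ℝ, IsTest f →
    eLpNorm f 6 (vol (Ω ∩ s)) ≤ C * (eLpNorm f 2 (vol Ω) + eLpNorm (gradient f) 2 (vol Ω)))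
    ⟨0, fun f _ => by simp⟩ ?_ ?_ ?_
  · rintro s t hst ⟨C, hC⟩
    exact ⟨C, fun f hf => (eLpNorm_mono_measure f
      (Measure.restrict_mono (inter_subset_inter_right Ω hst) le_rfl)).trans (hC f hf)⟩
  · rintro s t ⟨C, hC⟩ ⟨D, hD⟩
    refine ⟨C + D, fun f hf => ?_⟩
    rw [inter_union_distrib_left, ENNReal.coe_add, add_mul]
    refine le_trans ?_ (add_le_add (hC f hf) (hD f hf))
    rw [eLpNorm_six_eq, eLpNorm_six_eq, eLpNorm_six_eq]
    refine (ENNReal.rpow_le_rpow (lintegral_union_le _ _ _) (by norm_num)).trans ?_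
    exact ENNReal.rpow_add_le_add_rpow _ _ (by norm_num) (by norm_num)
  · intro x _
    obtain ⟨r, hr, C, hC⟩ := exists_sobolev_of_support_subset_ball hd hΩ hc hb hne x
    obtain ⟨χ, hχ, hχs, hχ1, hχ01⟩ := exists_isTest_cutoff (isCompact_closedBall x (r / 2))
      Metric.isOpen_ball (Metric.closedBall_subset_ball (half_lt_self hr))
    have hdc : Continuous (fderiv ℝ χ) := hχ.1.continuous_fderiv (by simp)
    obtain ⟨M, hM⟩ := (hχ.2.fderiv (𝕜 := ℝ)).exists_bound_of_continuous hdc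
    have hM0 : 0 ≤ M := (norm_nonneg _).trans (hM 0)
    refine ⟨Metric.closedBall x (r / 2), mem_nhdsWithin_of_mem_nhds
      (Metric.closedBall_mem_nhds x (half_pos hr)), C * (M.toNNReal + 1), fun f hf => ?_⟩
    have hg : IsTest fun x => f x * χ x := hχ.mul_left hf.1
    have h1 := hC _ hg ((Function.support_mul_subset_right f χ).trans
      ((subset_tsupport χ).trans hχs))
    have h2 : eLpNorm f 6 (vol (Ω ∩ Metric.closedBall x (r / 2)))
        ≤ eLpNorm (fun x => f x * χ x) 6 (vol Ω) := by
      refine le_trans (le_of_eq ?_) (eLpNorm_mono_measure _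
        (Measure.restrict_mono (inter_subset_left : Ω ∩ Metric.closedBall x (r / 2) ⊆ Ω) le_rfl))
      refine eLpNorm_congr_ae ?_
      filter_upwards [ae_restrict_mem (hΩ.measurableSet.inter Metric.isClosed_closedBall.measurableSet)]
        with y hy
      simp [hχ1.self_of_nhdsSet y hy.2]
    refine h2.trans (h1.trans ?_)
    rw [ENNReal.coe_mul, mul_assoc]
    refine mul_le_mul' le_rfl ?_
    have m1 : AEStronglyMeasurable (fun x => ‖fderiv ℝ f x‖) (vol Ω) :=
      (hf.1.continuous_fderiv (by simp)).norm.aestronglyMeasurable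
    have m2 : AEStronglyMeasurable (fun x => M * ‖f x‖) (vol Ω) :=
      (hf.continuous.norm.const_smul M).aestronglyMeasurable
    have h3 : eLpNorm (fderiv ℝ fun x => f x * χ x) 2 (vol Ω)
        ≤ eLpNorm ((fun x => ‖fderiv ℝ f x‖) + fun x => M * ‖f x‖) 2 (vol Ω) := by
      refine eLpNorm_mono fun y => ?_
      have := ((hf.differentiable y).hasFDerivAt.mul (hχ.differentiable y).hasFDerivAt).fderiv
      have e : fderiv ℝ (fun x => f x * χ x) y = f y • fderiv ℝ χ y + χ y • fderiv ℝ f y := this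
      rw [e, Pi.add_apply, Real.norm_of_nonneg (by positivity), add_comm]
      refine (norm_add_le _ _).trans (add_le_add ?_ ?_)
      · rw [norm_smul, Real.norm_of_nonneg (hχ01 y).1]
        exact mul_le_of_le_one_left (norm_nonneg _) (hχ01 y).2
      · rw [norm_smul, mul_comm]
        gcongr
        exact hM y
    refine h3.trans ((eLpNorm_add_le m1 m2 (by norm_num)).trans ?_)
    have e3 : eLpNorm (fun x => ‖fderiv ℝ f x‖) 2 (vol Ω) = eLpNorm (gradient f) 2 (vol Ω) :=
      eLpNorm_congr_norm_ae (Eventually.of_forall fun y => by simp [norm_gradient])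
    have e4 : eLpNorm (fun x => M * ‖f x‖) 2 (vol Ω) ≤ M.toNNReal * eLpNorm f 2 (vol Ω) := by
      refine eLpNorm_le_nnreal_smul_eLpNorm_of_ae_le_mul (Eventually.of_forall fun y => ?_) 2
      rw [← NNReal.coe_le_coe]
      push_cast
      rw [Real.coe_toNNReal _ hM0, norm_mul, Real.norm_of_nonneg hM0, norm_norm]
    rw [e3]
    refine (add_le_add le_rfl e4).trans ?_
    push_cast
    rw [add_mul, one_mul, mul_add]
    calc _ ≤ (eLpNorm f 2 (vol Ω) + eLpNorm (gradient f) 2 (vol Ω)) +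
          (M.toNNReal * eLpNorm f 2 (vol Ω) + M.toNNReal * eLpNorm (gradient f) 2 (vol Ω)) :=
          add_le_add le_add_self le_self_add
      _ = _ := by ring

/-- The Sobolev inequality on a bounded convex domain, for differences with test functions. -/
theorem exists_sobolev {d : ℕ} (hd : d = 2 ∨ d = 3)
    {Ω : Set (E d)} (hΩ : IsOpen Ω) (hc : Convex ℝ Ω) (hb : Bornology.IsBounded Ω)
    (hne : Ω.Nonempty) :
    ∃ C : ℝ≥0, ∀ (v : H1 Ω) (g : E d → ℝ), IsTest g →
      eLpNorm (fun x => g x - fn v x) 6 (vol Ω) ≤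
        C * (eLpNorm (fun x => g x - fn v x) 2 (vol Ω)
          + eLpNorm (fun x => gradient g x - grad v x) 2 (vol Ω)) := by
  obtain ⟨C, hC⟩ := exists_sobolev_of_isTest hd hΩ hc hb hne
  refine ⟨C, fun v g hg => ?_⟩
  obtain ⟨f, hf, f1, f2, _⟩ := exists_isTest_seq v
  have hfm : ∀ k, AEStronglyMeasurable (f k) (vol Ω) :=
    fun k => (hf k).continuous.aestronglyMeasurable
  have hgc : ∀ {g : E d → ℝ}, IsTest g → AEStronglyMeasurable (gradient g) (vol Ω) := fun hg =>
    (hg.memLp_gradient Ω).1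
  obtain ⟨ns, hns, hae⟩ := (tendstoInMeasure_of_tendsto_eLpNorm (by norm_num) hfm (memLp_fn v).1
    f1).exists_seq_tendsto_ae
  have hsub := hns.tendsto_atTop
  have t1 : Tendsto (fun k => eLpNorm (fun x => g x - f (ns k) x) 2 (vol Ω)) atTop
      (𝓝 (eLpNorm (fun x => g x - fn v x) 2 (vol Ω))) := by
    refine tendsto_eLpNorm_of_tendsto_sub (by norm_num)
      (fun k => hg.continuous.aestronglyMeasurable.sub (hfm _)) ((hg.memLp Ω).sub (memLp_fn v)) ?_
    refine (f1.comp hsub).congr fun k => eLpNorm_congr_norm_ae (Eventually.of_forall fun x => ?_)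
    simp only [Real.norm_eq_abs]
    rw [sub_sub_sub_cancel_left, abs_sub_comm]
  have t2 : Tendsto (fun k => eLpNorm (fun x => gradient g x - gradient (f (ns k)) x) 2 (vol Ω)) atTop
      (𝓝 (eLpNorm (fun x => gradient g x - grad v x) 2 (vol Ω))) := by
    refine tendsto_eLpNorm_of_tendsto_sub (by norm_num)
      (fun k => (hgc hg).sub (hgc (hf _))) ((hg.memLp_gradient Ω).sub (memLp_grad v)) ?_
    refine (f2.comp hsub).congr fun k => eLpNorm_congr_norm_ae (Eventually.of_forall fun x => ?_)
    rw [sub_sub_sub_cancel_left, norm_sub_rev]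
  -- Membership of `v` in `L⁶` is not known in advance; Fatou's lemma along an almost everywhere
  -- convergent subsequence provides the bound.
  have hlim := Lp.eLpNorm_lim_le_liminf_eLpNorm (p := 6) (μ := vol Ω)
    (f := fun k x => g x - f (ns k) x) (fun k => hg.continuous.aestronglyMeasurable.sub (hfm _))
    (fun x => g x - fn v x) (by
      filter_upwards [hae] with x hx
      exact tendsto_const_nhds.sub hx)
  refine hlim.trans ?_
  have t3 := ENNReal.Tendsto.const_mul (t1.add t2) (Or.inr (ENNReal.coe_ne_top (r := C)))
  rw [← t3.liminf_eq]
  refine liminf_le_liminf (Eventually.of_forall fun k => ?_)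
  have h := hC (fun x => g x - f (ns k) x) (hg.sub (hf _))
  have e : gradient (fun x => g x - f (ns k) x) = fun x => gradient g x - gradient (f (ns k)) x := by
    funext x
    ext i
    simp only [PiLp.sub_apply, gradient_apply]
    rw [fderiv_fun_sub (hg.differentiable x) ((hf _).differentiable x)]
    simp
  rw [e] at h
  exact h

end Electrowetting

/-! ### Boundary charts of convex sets and the local trace estimate -/

namespace Electrowetting

/-- A coordinate in which `e` does not vanish is normalised to serve as the last variable, and a
multiple of it is subtracted from the others. -/
theorem exists_equiv_prod {m : ℕ} {e : E (m + 1)} (he : e ≠ 0) :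
    ∃ T : E (m + 1) ≃L[ℝ] E m × ℝ, T e = (0, 1) := by
  obtain ⟨i, hi⟩ : ∃ i, e i ≠ 0 := by
    by_contra! h
    exact he (by ext i; simpa using h i)
  let p : E (m + 1) →ₗ[ℝ] E m × ℝ :=
    { toFun := fun x => (WithLp.toLp 2 fun j => x (i.succAbove j) - x i / e i * e (i.succAbove j),
        x i / e i)
      map_add' := fun x y => by
        ext j
        · simp; ring
        · simp; ring
      map_smul' := fun c x => by
        ext j
        · simp; ring
        · simp; ring }
  have hp : Function.Injective p := by
    rw [injective_iff_map_eq_zero]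
    intro x hx
    have h2 : x i / e i = 0 := congrArg Prod.snd hx
    have h1 : ∀ j, x (i.succAbove j) - x i / e i * e (i.succAbove j) = 0 := fun j =>
      congrArg (fun z : E m × ℝ => z.1 j) hx
    ext k
    rcases Fin.eq_self_or_eq_succAbove i k with rfl | ⟨j, rfl⟩
    · simpa [hi] using h2
    · simpa [h2] using h1 j
  refine ⟨(LinearMap.linearEquivOfInjective p hp (by simp)).toContinuousLinearEquiv, ?_⟩
  change p e = _
  ext j
  · simp [p, hi]
  · simp [p, hi]

theorem exists_lintegral_comp_symm_eq {m : ℕ} (T : E (m + 1) ≃L[ℝ] E m × ℝ) :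
    ∃ c : ℝ≥0, ∀ f : E (m + 1) → ℝ≥0∞, Measurable f →
      ∫⁻ z, ∫⁻ t, f (T.symm (z, t)) = c * ∫⁻ x, f x := by
  have hm : Measurable T.symm := T.symm.continuous.measurable
  have : (volume : Measure (E m × ℝ)).IsAddHaarMeasure := by
    rw [Measure.volume_eq_prod]; infer_instance
  have : ((volume : Measure (E m × ℝ)).map T.symm).IsAddHaarMeasure :=
    T.symm.isAddHaarMeasure_map _
  refine ⟨Measure.addHaarScalarFactor ((volume : Measure (E m × ℝ)).map T.symm) volume,
    fun f hf => ?_⟩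
  rw [← smul_eq_mul, ← ENNReal.smul_def, ← lintegral_smul_measure,
    ← Measure.isAddLeftInvariant_eq_smul, lintegral_map hf hm, Measure.volume_eq_prod]
  exact (lintegral_prod (fun p => f (T.symm p)) (hf.comp hm).aemeasurable).symm

/-- The inverse of the projection is `K`-Lipschitz, so it enlarges `m`-dimensional Hausdorff measure
by at most `K ^ m`. In `E m` the normalised Hausdorff measure is Lebesgue measure. -/
theorem antilipschitz_measure_le {m n : ℕ} {s : Set (E n)} {p : E n → E m} {K : ℝ≥0}
    (hp : ∀ x ∈ s, ∀ y ∈ s, edist x y ≤ K * edist (p x) (p y)) (Z : Set (E m)) :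
    Measure.euclideanHausdorffMeasure m (p ⁻¹' Z ∩ s) ≤ K ^ m * volume Z := by
  have h1 : AntilipschitzWith K fun x : s => p x := fun x y => hp x x.2 y y.2
  rw [← EuclideanSpace.euclideanHausdorffMeasure_eq_volume,
    Measure.euclideanHausdorffMeasure_def, Measure.euclideanHausdorffMeasure_def,
    Measure.smul_apply, Measure.smul_apply, ENNReal.smul_def, ENNReal.smul_def, smul_eq_mul,
    smul_eq_mul, mul_left_comm]
  refine mul_le_mul' le_rfl ?_
  have h2 := h1.le_hausdorffMeasure_image (Nat.cast_nonneg m) ((fun x : s => p x) ⁻¹' Z)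
  rw [← isometry_subtype_coe.hausdorffMeasure_image (Or.inl (Nat.cast_nonneg m))] at h2
  rw [ENNReal.rpow_natCast] at h2
  refine le_trans (measure_mono ?_) (h2.trans (mul_le_mul' le_rfl
    (measure_mono (image_preimage_subset _ _))))
  rintro x ⟨hx, hxs⟩
  exact ⟨⟨x, hxs⟩, hx, rfl⟩

/-- Near a boundary point, a convex open set lies above its boundary in some direction `e`, and the
projection of the boundary along `e` is bi-Lipschitz. -/
theorem exists_boundary_chart {m : ℕ} {Ω : Set (E (m + 1))} (hΩ : IsOpen Ω) (hc : Convex ℝ Ω)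
    (hne : Ω.Nonempty) {x₀ : E (m + 1)} (hx₀ : x₀ ∈ frontier Ω) :
    ∃ (e : E (m + 1)) (T : E (m + 1) ≃L[ℝ] E m × ℝ) (r : ℝ) (K : ℝ≥0), 0 < r ∧ T e = (0, 1) ∧
      (∀ x ∈ closure Ω, x ∈ Metric.ball x₀ r → ∀ t ∈ Ioc (0 : ℝ) 1, x + t • e ∈ Ω) ∧
      ∀ x ∈ frontier Ω ∩ Metric.ball x₀ r, ∀ y ∈ frontier Ω ∩ Metric.ball x₀ r,
        edist x y ≤ K * edist (T x).1 (T y).1 := by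
  obtain ⟨a, ha⟩ := hne
  obtain ⟨R, hR, hball⟩ := Metric.isOpen_iff.1 hΩ a ha
  set e := a - x₀
  have he : e ≠ 0 := by
    intro h
    rw [hΩ.frontier_eq] at hx₀
    exact hx₀.2 ((sub_eq_zero.1 h) ▸ ha)
  obtain ⟨T, hT⟩ := exists_equiv_prod he
  set B := ‖(T.symm : E m × ℝ →L[ℝ] E (m + 1))‖
  set D := ‖(T : E (m + 1) →L[ℝ] E m × ℝ)‖
  have hB : 0 ≤ B := norm_nonneg _
  have hD : 0 ≤ D := norm_nonneg _
  set r := min (R / 2) (1 / (2 * (D + 1)))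
  have hr : 0 < r := by positivity
  have hrR : r ≤ R / 2 := min_le_left _ _
  have hrD : r ≤ 1 / (2 * (D + 1)) := min_le_right _ _
  -- `Ω` contains a ball around `a`, hence by convexity an open cone with vertex `x` around the
  -- direction `e`, for each `x` of the closure near `x₀`.
  have hcone : ∀ x ∈ closure Ω, x ∈ Metric.ball x₀ r → ∀ t ∈ Ioc (0 : ℝ) 1, ∀ w : E (m + 1),
      ‖w‖ < t * (R / 2) → x + t • e + w ∈ Ω := by
    intro x hx hxr t ht w hw
    have h1 : x + (e + t⁻¹ • w) ∈ interior Ω := by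
      rw [hΩ.interior_eq]
      apply hball
      rw [mem_ball_iff_norm] at hxr ⊢
      have : x + (e + t⁻¹ • w) - a = (x - x₀) + t⁻¹ • w := by simp only [e]; abel
      rw [this]
      refine (norm_add_le _ _).trans_lt ?_
      rw [norm_smul, norm_inv, Real.norm_of_nonneg ht.1.le]
      have : t⁻¹ * ‖w‖ < R / 2 := by
        rw [inv_mul_lt_iff₀ ht.1]; exact hw
      linarith
    have h2 := hc.add_smul_mem_interior' hx h1 ht
    rw [hΩ.interior_eq, smul_add, smul_inv_smul₀ ht.1.ne', ← add_assoc] at h2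
    exact h2
  -- A boundary point cannot belong to the open cone with vertex at another boundary point. Used in
  -- both directions, this bounds the component along `e` by the transversal one.
  have hhalf : ∀ x ∈ frontier Ω ∩ Metric.ball x₀ r, ∀ y ∈ frontier Ω ∩ Metric.ball x₀ r,
      ∀ t : ℝ, 0 ≤ t → t ≤ 1 → t * (R / 2) ≤ ‖y - x - t • e‖ := by
    intro x hx y hy t ht0 ht1
    rcases ht0.eq_or_lt with rfl | ht0
    · simp
    by_contra! h
    have := hcone x hx.1.1 hx.2 t ⟨ht0, ht1⟩ _ h
    rw [show x + t • e + (y - x - t • e) = y by abel] at this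
    have hy1 := hy.1
    rw [hΩ.frontier_eq] at hy1
    exact hy1.2 this
  refine ⟨e, T, r, (2 * ‖e‖ / R * B + B).toNNReal, hr, hT, fun x hx hxr t ht => ?_,
    fun x hx y hy => ?_⟩
  · simpa using hcone x hx hxr t ht 0 (by simpa using mul_pos ht.1 (half_pos hR))
  · set s := (T (y - x)).2
    set z := (T (y - x)).1
    have hz : z = (T y).1 - (T x).1 := by simp [z]
    have hw : y - x - s • e = T.symm (z, 0) := by
      apply T.injective
      rw [T.apply_symm_apply, map_sub, map_smul, hT]
      ext <;> simp [z, s]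
    have hwn : ‖y - x - s • e‖ ≤ B * ‖z‖ := by
      rw [hw]
      refine ((T.symm : E m × ℝ →L[ℝ] E (m + 1)).le_opNorm _).trans ?_
      simp [B]
    -- The cones have height one; the bound `1 / (2 (D + 1))` for the radius keeps the component
    -- along `e` within this range.
    have hs : |s| ≤ 1 := by
      have h1 : ‖T (y - x)‖ ≤ D * ‖y - x‖ := (T : E (m + 1) →L[ℝ] E m × ℝ).le_opNorm _
      have h2 : |s| ≤ ‖T (y - x)‖ := norm_snd_le (T (y - x))
      have h3 : ‖y - x‖ ≤ 2 * r := by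
        have a1 := mem_ball_iff_norm.1 hy.2
        have a2 := mem_ball_iff_norm.1 hx.2
        have : y - x = (y - x₀) - (x - x₀) := by abel
        rw [this]
        linarith [norm_sub_le (y - x₀) (x - x₀)]
      have h4 : r * (2 * (D + 1)) ≤ 1 := by
        rwa [le_div_iff₀ (by positivity)] at hrD
      nlinarith
    have hsw : |s| * (R / 2) ≤ ‖y - x - s • e‖ := by
      rcases le_total 0 s with h | h
      · rw [abs_of_nonneg h] at hs ⊢
        exact hhalf x hx y hy s h hs
      · rw [abs_of_nonpos h] at hs ⊢
        have := hhalf y hy x hx (-s) (by linarith) hs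
        rwa [← norm_neg, show -(x - y - -s • e) = y - x - s • e by rw [neg_smul]; abel] at this
    have hfin : ‖x - y‖ ≤ (2 * ‖e‖ / R * B + B) * ‖(T x).1 - (T y).1‖ := by
      rw [norm_sub_rev x y, norm_sub_rev (T x).1, ← hz]
      have h1 : ‖y - x‖ ≤ ‖y - x - s • e‖ + |s| * ‖e‖ := by
        have := norm_add_le (y - x - s • e) (s • e)
        rwa [sub_add_cancel, norm_smul, Real.norm_eq_abs] at this
      have h2 : |s| ≤ 2 / R * (B * ‖z‖) := by
        have := hsw.trans hwn
        rw [div_mul_eq_mul_div, le_div_iff₀ hR]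
        linarith
      calc ‖y - x‖ ≤ B * ‖z‖ + (2 / R * (B * ‖z‖)) * ‖e‖ :=
            h1.trans (add_le_add hwn (mul_le_mul_of_nonneg_right h2 (norm_nonneg _)))
        _ = _ := by ring
    rw [edist_dist, edist_dist, dist_eq_norm, dist_eq_norm]
    refine (ENNReal.ofReal_le_ofReal hfin).trans (le_of_eq ?_)
    rw [ENNReal.ofReal_mul (by positivity)]
    rfl

/-- From a boundary point one moves into `Ω` along `e`; the fundamental theorem of calculus bounds
`f(x)²` by an integral over that line, and integrating over the boundary becomes integrating over
its projection, at the cost `K ^ m`. The remaining constants are the Jacobian `c` of `T` and the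
Young constant `2 (1 + ‖e‖²)`. -/
theorem exists_lintegral_surf_ball_le {d : ℕ} (hd : 0 < d) {Ω : Set (E d)} (hΩ : IsOpen Ω)
    (hc : Convex ℝ Ω) (hne : Ω.Nonempty) {x₀ : E d} (hx₀ : x₀ ∈ frontier Ω) :
    ∃ r : ℝ, 0 < r ∧ ∃ C : ℝ≥0, ∀ f : E d → ℝ, ContDiff ℝ 1 f →
      ∫⁻ x in Metric.ball x₀ r, ‖f x‖ₑ ^ 2 ∂(surf Ω) ≤
        C * ∫⁻ x in Ω, (‖f x‖ₑ ^ 2 + ‖fderiv ℝ f x‖ₑ ^ 2) := by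
  obtain ⟨m, rfl⟩ := Nat.exists_eq_succ_of_ne_zero hd.ne'
  obtain ⟨e, T, r, K, hr, hT, hin, hK⟩ := exists_boundary_chart hΩ hc hne hx₀
  obtain ⟨c, hcT⟩ := exists_lintegral_comp_symm_eq T
  refine ⟨r, hr, K ^ m * (c * (2 * (1 + ‖e‖₊ ^ 2))), fun f hf => ?_⟩
  have hdc : Continuous (fderiv ℝ f) := hf.continuous_fderiv (by simp)
  set g : E (m + 1) → ℝ≥0∞ := Ω.indicator fun x =>
    (2 * (1 + ‖e‖₊ ^ 2) : ℝ≥0) * (‖f x‖ₑ ^ 2 + ‖fderiv ℝ f x‖ₑ ^ 2) with hg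
  have hFm : Measurable fun x => ‖f x‖ₑ ^ 2 + ‖fderiv ℝ f x‖ₑ ^ 2 :=
    (hf.continuous.measurable.enorm.pow_const _).add (hdc.measurable.enorm.pow_const _)
  have hgm : Measurable g := (hFm.const_mul _).indicator hΩ.measurableSet
  set h : E m → ℝ≥0∞ := fun z => ∫⁻ t, g (T.symm (z, t)) with hh
  have hhm : Measurable h :=
    Measurable.lintegral_prod_right' (f := fun p : E m × ℝ => g (T.symm p))
      (hgm.comp T.symm.continuous.measurable)
  have hpt : ∀ x ∈ frontier Ω ∩ Metric.ball x₀ r, ‖f x‖ₑ ^ 2 ≤ h (T x).1 := by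
    intro x hx
    have hline : ∀ s, T.symm ((T x).1, s) = x + (s - (T x).2) • e := by
      intro s
      rw [ContinuousLinearEquiv.symm_apply_eq, map_add, map_smul, hT]
      ext <;> simp
    -- The weight `1 - t` removes the value at the far end of the segment.
    have hD : ∀ t : ℝ, HasDerivAt (fun t => (1 - t) * f (x + t • e) ^ 2)
        (-(f (x + t • e) ^ 2) + (1 - t) * (2 * f (x + t • e) * fderiv ℝ f (x + t • e) e)) t := by
      intro t
      have h1 : HasDerivAt (fun t : ℝ => x + t • e) e t := by
        simpa using ((hasDerivAt_id t).smul_const e).const_add x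
      have h2 := ((hf.differentiable (by simp)) (x + t • e)).hasFDerivAt.comp_hasDerivAt t h1
      have h3 := ((hasDerivAt_id t).const_sub 1).mul (h2.pow 2)
      refine h3.congr_deriv ?_
      simp
    have h1 := enorm_sub_le_lintegral_deriv hD
    simp only [sub_self, zero_mul, zero_smul, add_zero, sub_zero, one_mul, zero_sub, enorm_neg,
      enorm_pow] at h1
    refine h1.trans ?_
    calc _ ≤ ∫⁻ t in Ioo (0 : ℝ) 1, g (x + t • e) := by
          refine setLIntegral_mono (hgm.comp (by fun_prop)) fun t ht => ?_
          have hmem : x + t • e ∈ Ω := hin x hx.1.1 hx.2 t ⟨ht.1, ht.2.le⟩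
          simp only [hg, indicator_of_mem hmem]
          set a := f (x + t • e)
          set b := fderiv ℝ f (x + t • e)
          have hreal : ‖-a ^ 2 + (1 - t) * (2 * a * b e)‖
              ≤ 2 * (1 + ‖e‖ ^ 2) * (‖a‖ ^ 2 + ‖b‖ ^ 2) := by
            have hb : ‖b e‖ ≤ ‖b‖ * ‖e‖ := b.le_opNorm e
            have h4 : ‖-a ^ 2 + (1 - t) * (2 * a * b e)‖ ≤ ‖a‖ ^ 2 + 2 * ‖a‖ * (‖b‖ * ‖e‖) := by
              refine (norm_add_le _ _).trans (add_le_add (by simp) ?_)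
              rw [norm_mul, norm_mul, norm_mul, Real.norm_of_nonneg (by linarith [ht.2] : 0 ≤ 1 - t)]
              have h5 : ‖(2 : ℝ)‖ * ‖a‖ * ‖b e‖ ≤ 2 * ‖a‖ * (‖b‖ * ‖e‖) := by
                rw [Real.norm_ofNat]
                gcongr
              refine (mul_le_of_le_one_left (by positivity) (by linarith [ht.1])).trans h5
            nlinarith [sq_nonneg (‖a‖ - ‖b‖ * ‖e‖), sq_nonneg (‖a‖ * ‖e‖), sq_nonneg ‖b‖,
              sq_nonneg ‖a‖]
          rw [← ofReal_norm, ← ofReal_norm a, ← ofReal_norm b]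
          refine (ENNReal.ofReal_le_ofReal hreal).trans (le_of_eq ?_)
          rw [ENNReal.ofReal_mul (by positivity), ENNReal.ofReal_add (by positivity)
            (by positivity), ENNReal.ofReal_pow (norm_nonneg _), ENNReal.ofReal_pow (norm_nonneg _)]
          congr 1
          rw [ENNReal.ofReal, ← norm_toNNReal]
          congr 1
          rw [← NNReal.coe_inj]
          simp
          positivity
      _ ≤ ∫⁻ t, g (x + t • e) := setLIntegral_le_lintegral _ _
      _ = h (T x).1 := by
          simp only [hh, hline]
          exact (lintegral_sub_right_eq_self (fun t => g (x + t • e)) _).symm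
  set ν := (surf Ω).restrict (Metric.ball x₀ r)
  have hTm : Measurable fun x => (T x).1 := (continuous_fst.comp T.continuous).measurable
  have hν : ν.map (fun x => (T x).1) ≤ (K ^ m : ℝ≥0∞) • volume := by
    refine Measure.le_iff.2 fun Z hZ => ?_
    rw [Measure.map_apply hTm hZ, Measure.restrict_apply (hTm hZ),
      Measure.restrict_apply ((hTm hZ).inter Metric.isOpen_ball.measurableSet), inter_assoc,
      inter_comm (Metric.ball x₀ r)]
    exact antilipschitz_measure_le hK Z
  calc ∫⁻ x, ‖f x‖ₑ ^ 2 ∂ν ≤ ∫⁻ x, h (T x).1 ∂ν := by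
        refine lintegral_mono_ae ?_
        have h1 : ∀ᵐ x ∂ν, x ∈ frontier Ω :=
          ae_restrict_of_ae (ae_restrict_mem isClosed_frontier.measurableSet)
        filter_upwards [h1, ae_restrict_mem Metric.isOpen_ball.measurableSet] with x hx1 hx2
        exact hpt x ⟨hx1, hx2⟩
    _ = ∫⁻ z, h z ∂(ν.map fun x => (T x).1) := (lintegral_map hhm hTm).symm
    _ ≤ ∫⁻ z, h z ∂((K ^ m : ℝ≥0∞) • volume) := lintegral_mono' hν le_rfl
    _ = K ^ m * (c * ∫⁻ x, g x) := by
        rw [lintegral_smul_measure, smul_eq_mul, ← hcT g hgm]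
    _ = _ := by
        rw [hg, lintegral_indicator hΩ.measurableSet, lintegral_const_mul _ hFm]
        push_cast
        ring

end Electrowetting

/-! ### Trace, Poincaré and Friedrichs inequalities -/

namespace Electrowetting

theorem exists_lintegral_surf_le {d : ℕ} (hd : 0 < d) {Ω : Set (E d)} (hΩ : IsOpen Ω)
    (hc : Convex ℝ Ω) (hb : Bornology.IsBounded Ω) (hne : Ω.Nonempty) :
    ∃ C : ℝ≥0, ∀ f : E d → ℝ, ContDiff ℝ 1 f →
      ∫⁻ x, ‖f x‖ₑ ^ 2 ∂(surf Ω) ≤ C * ∫⁻ x in Ω, (‖f x‖ₑ ^ 2 + ‖fderiv ℝ f x‖ₑ ^ 2) := by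
  suffices h : ∃ C : ℝ≥0, ∀ f : E d → ℝ, ContDiff ℝ 1 f →
      ∫⁻ x in frontier Ω, ‖f x‖ₑ ^ 2 ∂(surf Ω) ≤
        C * ∫⁻ x in Ω, (‖f x‖ₑ ^ 2 + ‖fderiv ℝ f x‖ₑ ^ 2) by
    rwa [Measure.restrict_restrict isClosed_frontier.measurableSet, inter_self] at h
  have hK : IsCompact (frontier Ω) :=
    hb.isCompact_closure.of_isClosed_subset isClosed_frontier frontier_subset_closure
  refine hK.induction_on (p := fun s => ∃ C : ℝ≥0, ∀ f : E d → ℝ, ContDiff ℝ 1 f →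
    ∫⁻ x in s, ‖f x‖ₑ ^ 2 ∂(surf Ω) ≤ C * ∫⁻ x in Ω, (‖f x‖ₑ ^ 2 + ‖fderiv ℝ f x‖ₑ ^ 2))
    ⟨0, fun f _ => by simp⟩ ?_ ?_ ?_
  · rintro s t hst ⟨C, hC⟩
    exact ⟨C, fun f hf => (lintegral_mono_set hst).trans (hC f hf)⟩
  · rintro s t ⟨C, hC⟩ ⟨D, hD⟩
    refine ⟨C + D, fun f hf => ?_⟩
    rw [ENNReal.coe_add, add_mul]
    exact (lintegral_union_le _ _ _).trans (add_le_add (hC f hf) (hD f hf))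
  · intro x hx
    obtain ⟨r, hr, C, hC⟩ := exists_lintegral_surf_ball_le hd hΩ hc hne hx
    exact ⟨_, mem_nhdsWithin_of_mem_nhds (Metric.ball_mem_nhds x hr), C, hC⟩

/-- The trace inequality for the constant function `1`. -/
theorem surf_univ_lt_top {d : ℕ} (hd : 0 < d) {Ω : Set (E d)} (hΩ : IsOpen Ω)
    (hc : Convex ℝ Ω) (hb : Bornology.IsBounded Ω) (hne : Ω.Nonempty) :
    surf Ω univ < ⊤ := by
  obtain ⟨C, hC⟩ := exists_lintegral_surf_le hd hΩ hc hb hne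
  have h := hC (fun _ => 1) contDiff_const
  simp only [fderiv_fun_const, enorm_one, one_pow, lintegral_const, one_mul, Pi.zero_apply,
    Measure.restrict_apply_univ] at h
  have hv : volume Ω < ⊤ := hb.measure_lt_top
  rw [Measure.restrict_apply_univ]
  refine h.trans_lt (ENNReal.mul_lt_top ENNReal.coe_lt_top (ENNReal.mul_lt_top ?_ hv))
  simp

theorem sq_lintegral_Ioo_le {g : ℝ → ℝ≥0∞} (hg : Measurable g) :
    (∫⁻ t in Ioo (0 : ℝ) 1, g t) ^ 2 ≤ ∫⁻ t in Ioo (0 : ℝ) 1, g t ^ 2 := by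
  have h := ENNReal.lintegral_mul_le_Lp_mul_Lq (volume.restrict (Ioo (0 : ℝ) 1))
    Real.HolderConjugate.two_two hg.aemeasurable (aemeasurable_const (b := (1 : ℝ≥0∞)))
  simp only [Pi.mul_apply, mul_one, ENNReal.one_rpow, lintegral_const,
    Measure.restrict_apply_univ, Real.volume_Ioo, sub_zero, ENNReal.ofReal_one] at h
  refine (pow_le_pow_left' h 2).trans (le_of_eq ?_)
  rw [← ENNReal.rpow_natCast, ← ENNReal.rpow_mul]
  norm_num

theorem enorm_sub_sq_le_lintegral_segment {d : ℕ} {f : E d → ℝ} (hf : ContDiff ℝ 1 f) (x y : E d) :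
    ‖f x - f y‖ₑ ^ 2 ≤
      ‖x - y‖ₑ ^ 2 * ∫⁻ t in Ioo (0 : ℝ) 1, ‖fderiv ℝ f ((1 - t) • x + t • y)‖ₑ ^ 2 := by
  have hdc : Continuous (fderiv ℝ f) := hf.continuous_fderiv (by simp)
  have hD : ∀ t : ℝ, HasDerivAt (fun t => f ((1 - t) • x + t • y))
      (fderiv ℝ f ((1 - t) • x + t • y) (y - x)) t := by
    intro t
    have h1 : HasDerivAt (fun t : ℝ => (1 - t) • x + t • y) (y - x) t := by
      have := (((hasDerivAt_id t).const_sub 1).smul_const x).add ((hasDerivAt_id t).smul_const y)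
      refine this.congr_deriv ?_
      simp [sub_eq_neg_add]
    exact ((hf.differentiable (by simp)) _).hasFDerivAt.comp_hasDerivAt t h1
  have h1 := enorm_sub_le_lintegral_deriv hD
  simp only [sub_self, zero_smul, one_smul, zero_add, sub_zero, add_zero] at h1
  rw [← enorm_neg, neg_sub] at h1
  have hm : Measurable fun t : ℝ => ‖fderiv ℝ f ((1 - t) • x + t • y)‖ₑ :=
    (hdc.comp (by fun_prop)).measurable.enorm
  have h2 : ‖f x - f y‖ₑ ≤
      ‖x - y‖ₑ * ∫⁻ t in Ioo (0 : ℝ) 1, ‖fderiv ℝ f ((1 - t) • x + t • y)‖ₑ := by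
    rw [← lintegral_const_mul _ hm]
    refine h1.trans (lintegral_mono fun t => ?_)
    rw [mul_comm, ← enorm_neg (x - y), neg_sub]
    exact ContinuousLinearMap.le_opENorm _ _
  calc _ ≤ _ := pow_le_pow_left' h2 2
    _ ≤ _ := by
      rw [mul_pow]
      exact mul_le_mul' le_rfl (sq_lintegral_Ioo_le hm)

/-- One of `t` and `1 - t` is at least `1/2`; the inner integration is performed in the
corresponding variable, with a Jacobian of at most `2 ^ d`. -/
theorem lintegral_lintegral_affine_le {d : ℕ} (Ω : Set (E d)) {F : E d → ℝ≥0∞}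
    (hF : Measurable F) (t : ℝ) :
    ∫⁻ x in Ω, ∫⁻ y in Ω, F ((1 - t) • x + t • y) ≤ 2 ^ d * ∫⁻ x, F x * volume Ω := by
  have key : ∀ r : ℝ, 1 / 2 ≤ r → ∀ a : E d, ∫⁻ x in Ω, F (a + r • x) ≤ 2 ^ d * ∫⁻ x, F x := by
    intro r hr a
    have hr0 : 0 < r := by linarith
    refine (setLIntegral_le_lintegral _ _).trans ?_
    rw [lintegral_comp_affine_eq hF hr0.ne']
    refine mul_le_mul' ?_ le_rfl
    rw [abs_of_pos (by positivity), ← inv_pow, ENNReal.ofReal_pow (by positivity)]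
    refine pow_le_pow_left' ?_ d
    have : r⁻¹ ≤ 2 := by
      rw [inv_le_comm₀ hr0 two_pos]; linarith
    simpa using ENNReal.ofReal_le_ofReal this
  have fin : ∫⁻ _ in Ω, (2 ^ d * ∫⁻ x, F x) = 2 ^ d * ∫⁻ x, F x * volume Ω := by
    rw [lintegral_const, Measure.restrict_apply_univ, lintegral_mul_const _ hF, mul_assoc]
  rw [← fin]
  rcases le_total (1 / 2) t with h | h
  · exact lintegral_mono fun x => key t h _
  · rw [lintegral_lintegral_swap (by fun_prop)]
    refine lintegral_mono fun y => ?_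
    simp_rw [add_comm _ (t • y)]
    exact key (1 - t) (by linarith) _

/-- The Poincaré inequality on a bounded convex domain, in a form without mean values. -/
theorem exists_poincare {d : ℕ} {Ω : Set (E d)} (hΩ : IsOpen Ω)
    (hc : Convex ℝ Ω) (hb : Bornology.IsBounded Ω) :
    ∃ C : ℝ≥0, ∀ f : E d → ℝ, ContDiff ℝ 1 f →
      ∫⁻ y in Ω, ∫⁻ x in Ω, ‖f x - f y‖ₑ ^ 2 ≤ C * ∫⁻ x in Ω, ‖fderiv ℝ f x‖ₑ ^ 2 := by
  obtain ⟨D, hD⟩ := Metric.isBounded_iff.1 hb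
  have hv : volume Ω ≠ ⊤ := hb.measure_lt_top.ne
  refine ⟨D.toNNReal ^ 2 * (2 ^ d * (volume Ω).toNNReal), fun f hf => ?_⟩
  have hdc : Continuous (fderiv ℝ f) := hf.continuous_fderiv (by simp)
  set F : E d → ℝ≥0∞ := Ω.indicator fun x => ‖fderiv ℝ f x‖ₑ ^ 2 with hF
  have hFm : Measurable F := (hdc.measurable.enorm.pow_const _).indicator hΩ.measurableSet
  have hpt : ∀ x ∈ Ω, ∀ y ∈ Ω, ‖f x - f y‖ₑ ^ 2 ≤
      (D.toNNReal : ℝ≥0∞) ^ 2 * ∫⁻ t in Ioo (0 : ℝ) 1, F ((1 - t) • x + t • y) := by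
    intro x hx y hy
    refine (enorm_sub_sq_le_lintegral_segment hf x y).trans (mul_le_mul' ?_ ?_)
    · refine pow_le_pow_left' ?_ 2
      rw [← edist_eq_enorm_sub, edist_dist]
      exact ENNReal.ofReal_le_ofReal (hD hx hy)
    · refine setLIntegral_mono (hFm.comp (by fun_prop)) fun t ht => ?_
      have : (1 - t) • x + t • y ∈ Ω := hc hx hy (by linarith [ht.2]) ht.1.le (by ring)
      rw [hF, indicator_of_mem this]
  have hm3 : Measurable fun p : (E d × ℝ) × E d => F ((1 - p.1.2) • p.2 + p.1.2 • p.1.1) :=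
    hFm.comp (by fun_prop)
  have hm3' : Measurable fun p : E d × ℝ => ∫⁻ x in Ω, F ((1 - p.2) • x + p.2 • p.1) :=
    hm3.lintegral_prod_right'
  have hm2 : ∀ y : E d, Measurable fun p : E d × ℝ => F ((1 - p.2) • p.1 + p.2 • y) := fun y =>
    hFm.comp (by fun_prop)
  calc ∫⁻ y in Ω, ∫⁻ x in Ω, ‖f x - f y‖ₑ ^ 2
      ≤ ∫⁻ y in Ω, ∫⁻ x in Ω, (D.toNNReal : ℝ≥0∞) ^ 2 *
          ∫⁻ t in Ioo (0 : ℝ) 1, F ((1 - t) • x + t • y) := by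
        refine lintegral_mono_ae ?_
        filter_upwards [ae_restrict_mem hΩ.measurableSet] with y hy
        refine lintegral_mono_ae ?_
        filter_upwards [ae_restrict_mem hΩ.measurableSet] with x hx
        exact hpt x hx y hy
    _ = (D.toNNReal : ℝ≥0∞) ^ 2 * ∫⁻ y in Ω, ∫⁻ x in Ω,
          ∫⁻ t in Ioo (0 : ℝ) 1, F ((1 - t) • x + t • y) := by
        have hne : (D.toNNReal : ℝ≥0∞) ^ 2 ≠ ⊤ := by finiteness
        rw [← lintegral_const_mul' _ _ hne]
        congr! 2 with y
        exact lintegral_const_mul' _ _ hne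
    _ = (D.toNNReal : ℝ≥0∞) ^ 2 * ∫⁻ t in Ioo (0 : ℝ) 1, ∫⁻ x in Ω, ∫⁻ y in Ω,
          F ((1 - t) • x + t • y) := by
        congr 1
        calc _ = ∫⁻ y in Ω, ∫⁻ t in Ioo (0 : ℝ) 1, ∫⁻ x in Ω, F ((1 - t) • x + t • y) := by
              congr! 2 with y
              exact lintegral_lintegral_swap (hm2 y).aemeasurable
          _ = ∫⁻ t in Ioo (0 : ℝ) 1, ∫⁻ y in Ω, ∫⁻ x in Ω, F ((1 - t) • x + t • y) :=
              lintegral_lintegral_swap hm3'.aemeasurable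
          _ = _ := by
              congr! 2 with t
              exact lintegral_lintegral_swap (hFm.comp (by fun_prop)).aemeasurable
    _ ≤ (D.toNNReal : ℝ≥0∞) ^ 2 * ∫⁻ t in Ioo (0 : ℝ) 1, 2 ^ d * ∫⁻ x, F x * volume Ω := by
        refine mul_le_mul' le_rfl (lintegral_mono fun t => ?_)
        exact lintegral_lintegral_affine_le Ω hFm t
    _ = _ := by
        rw [lintegral_const, Measure.restrict_apply_univ, Real.volume_Ioo,
          lintegral_mul_const _ hFm, hF, lintegral_indicator hΩ.measurableSet]
        push_cast
        rw [ENNReal.coe_toNNReal hv]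
        simp
        ring

theorem eLpNorm_two_sq {α F : Type*} [MeasurableSpace α] [NormedAddCommGroup F] (f : α → F)
    (μ : Measure α) : eLpNorm f 2 μ ^ 2 = ∫⁻ x, ‖f x‖ₑ ^ 2 ∂μ := by
  rw [eLpNorm_two_eq, ← ENNReal.rpow_natCast, ← ENNReal.rpow_mul]
  norm_num

theorem le_sqrt_mul_add_of_sq_le {a b c : ℝ≥0∞} {K : ℝ≥0} (h : a ^ 2 ≤ K * (b ^ 2 + c ^ 2)) :
    a ≤ NNReal.sqrt K * (b + c) := by
  rw [← ENNReal.pow_le_pow_left_iff two_ne_zero, mul_pow, ← ENNReal.coe_pow, NNReal.sq_sqrt]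
  refine h.trans (mul_le_mul' le_rfl ?_)
  calc b ^ 2 + c ^ 2 ≤ b ^ 2 + c ^ 2 + 2 * b * c := le_self_add
    _ = _ := by ring

/-- For fixed `y`, averaging `f(y)² ≤ 2 (f(x) - f(y))² + 2 f(x)²` over `x ∈ D` and applying the
trace inequality to `f - f(y)` bounds `f(y)²` by a volume integral. Integration over `y` produces
exactly the double integral of `exists_poincare`. -/
theorem exists_friedrichs_of_contDiff {d : ℕ} (hd : 0 < d) {Ω : Set (E d)} (hΩ : IsOpen Ω)
    (hc : Convex ℝ Ω) (hb : Bornology.IsBounded Ω) (hne : Ω.Nonempty) {D : Set (E d)}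
    (hD : surf Ω D ≠ 0) :
    ∃ C : ℝ≥0, ∀ f : E d → ℝ, ContDiff ℝ 1 f →
      ∫⁻ x in Ω, ‖f x‖ₑ ^ 2 ≤
        C * ((∫⁻ x in Ω, ‖fderiv ℝ f x‖ₑ ^ 2) + ∫⁻ x in D, ‖f x‖ₑ ^ 2 ∂(surf Ω)) := by
  obtain ⟨C₁, hC₁⟩ := exists_lintegral_surf_le hd hΩ hc hb hne
  obtain ⟨C₂, hC₂⟩ := exists_poincare hΩ hc hb
  have hv : volume Ω ≠ ⊤ := hb.measure_lt_top.ne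
  have hDt : surf Ω D ≠ ⊤ :=
    ((measure_mono (subset_univ D)).trans_lt (surf_univ_lt_top hd hΩ hc hb hne)).ne
  set s := (surf Ω D).toNNReal
  set V := (volume Ω).toNNReal
  have hs : s ≠ 0 := by simp [s, ENNReal.toNNReal_eq_zero_iff, hD, hDt]
  refine ⟨s⁻¹ * (2 * C₁ * (C₂ + V) + 2 * V), fun f hf => ?_⟩
  have hdc : Continuous (fderiv ℝ f) := hf.continuous_fderiv (by simp)
  have hfm : Measurable f := hf.continuous.measurable
  set a := ∫⁻ x in Ω, ‖fderiv ℝ f x‖ₑ ^ 2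
  set b := ∫⁻ x in D, ‖f x‖ₑ ^ 2 ∂(surf Ω)
  have h1 : ∀ y, (s : ℝ≥0∞) * ‖f y‖ₑ ^ 2 ≤
      2 * (C₁ * ((∫⁻ x in Ω, ‖f x - f y‖ₑ ^ 2) + a)) + 2 * b := by
    intro y
    have e1 : (s : ℝ≥0∞) * ‖f y‖ₑ ^ 2 = ∫⁻ _ in D, ‖f y‖ₑ ^ 2 ∂(surf Ω) := by
      rw [lintegral_const, Measure.restrict_apply_univ, ENNReal.coe_toNNReal hDt, mul_comm]
    have e2 : ∫⁻ _ in D, ‖f y‖ₑ ^ 2 ∂(surf Ω) ≤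
        ∫⁻ x in D, (2 * ‖f x - f y‖ₑ ^ 2 + 2 * ‖f x‖ₑ ^ 2) ∂(surf Ω) := by
      refine lintegral_mono fun x => ?_
      have h3 : ‖f y‖ₑ ≤ ‖f x - f y‖ₑ + ‖f x‖ₑ := by
        have := enorm_sub_le (a := f x) (b := f x - f y)
        rwa [sub_sub_cancel, add_comm] at this
      refine (pow_le_pow_left' h3 2).trans ?_
      have := ENNReal.rpow_add_le_mul_rpow_add_rpow ‖f x - f y‖ₑ ‖f x‖ₑ
        (p := 2) (by norm_num)
      norm_num at this
      rwa [mul_add] at this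
    rw [e1]
    refine e2.trans ?_
    rw [lintegral_add_left (by fun_prop), lintegral_const_mul _ (by fun_prop),
      lintegral_const_mul _ (by fun_prop)]
    gcongr
    refine (setLIntegral_le_lintegral _ _).trans ((hC₁ (fun x => f x - f y)
      (hf.sub contDiff_const)).trans (le_of_eq ?_))
    simp only [fderiv_sub_const]
    rw [lintegral_add_left (by fun_prop)]
  have hpm : Measurable fun p : E d × E d => ‖f p.2 - f p.1‖ₑ ^ 2 := by fun_prop
  have h2 := lintegral_mono (μ := vol Ω) h1
  have hm1 : Measurable fun y => ∫⁻ x in Ω, ‖f x - f y‖ₑ ^ 2 := hpm.lintegral_prod_right'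
  rw [lintegral_const_mul _ (by fun_prop),
    lintegral_add_right _ measurable_const, lintegral_const_mul _ (by fun_prop),
    lintegral_const_mul _ (by fun_prop), lintegral_add_right _ measurable_const, lintegral_const,
    lintegral_const, Measure.restrict_apply_univ, ← ENNReal.coe_toNNReal hv] at h2
  have h3 : (s : ℝ≥0∞) * ∫⁻ x in Ω, ‖f x‖ₑ ^ 2 ≤
      (2 * C₁ * (C₂ + V) + 2 * V : ℝ≥0) * (a + b) := by
    calc _ ≤ _ := h2
      _ ≤ 2 * (C₁ * (C₂ * a + a * V)) + 2 * b * V := by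
          gcongr
          exact hC₂ f hf
      -- Nonnegative terms are added to make the expression symmetric, so that `a + b` factors out.
      _ ≤ 2 * (C₁ * (C₂ * a + a * V)) + 2 * b * V + (2 * (C₁ * (C₂ * b + b * V)) + 2 * a * V) :=
          le_self_add
      _ = _ := by push_cast; ring
  push_cast at h3 ⊢
  rw [ENNReal.coe_inv hs, mul_assoc, ← ENNReal.mul_le_iff_le_inv (by simpa using hs) (by simp)]
  exact h3

/-- Friedrichs' inequality for functions that vanish on a part of the boundary. -/
theorem exists_friedrichs {d : ℕ} (hd : 0 < d) {Ω : Set (E d)} (hΩ : IsOpen Ω)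
    (hc : Convex ℝ Ω) (hb : Bornology.IsBounded Ω) (hne : Ω.Nonempty) {D : Set (E d)}
    (hD : surf Ω D ≠ 0) :
    ∃ C : ℝ, 0 ≤ C ∧ ∀ w : H1 Ω, (∀ᵐ x ∂((surf Ω).restrict D), tr w x = 0) →
      normL2 w ≤ C * normGrad w := by
  obtain ⟨C, hC⟩ := exists_friedrichs_of_contDiff hd hΩ hc hb hne hD
  refine ⟨NNReal.sqrt C, by positivity, fun w hw => ?_⟩
  obtain ⟨f, hf, f1, f2, f3⟩ := exists_isTest_seq w
  have t1 := tendsto_eLpNorm_of_tendsto_sub (by norm_num)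
    (fun k => (hf k).continuous.aestronglyMeasurable) (memLp_fn w) f1
  have t2 := tendsto_eLpNorm_of_tendsto_sub (by norm_num)
    (fun k => ((hf k).memLp_gradient Ω).1) (memLp_grad w) f2
  have t3 : Tendsto (fun k => eLpNorm (f k) 2 ((surf Ω).restrict D)) atTop (𝓝 0) := by
    refine tendsto_of_tendsto_of_tendsto_of_le_of_le tendsto_const_nhds f3 (fun _ => zero_le)
      fun k => ?_
    refine le_trans (le_of_eq (eLpNorm_congr_ae ?_))
      (eLpNorm_mono_measure _ Measure.restrict_le_self)
    filter_upwards [hw] with x hx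
    rw [hx, sub_zero]
  have key : ∀ k, eLpNorm (f k) 2 (vol Ω) ≤ NNReal.sqrt C *
      (eLpNorm (gradient (f k)) 2 (vol Ω) + eLpNorm (f k) 2 ((surf Ω).restrict D)) := by
    intro k
    apply le_sqrt_mul_add_of_sq_le
    rw [eLpNorm_two_sq, eLpNorm_two_sq, eLpNorm_two_sq]
    have := hC (f k) ((hf k).1.of_le (by simp))
    have e : ∀ x, ‖gradient (f k) x‖ₑ = ‖fderiv ℝ (f k) x‖ₑ := fun x => by
      rw [← ofReal_norm, norm_gradient, ofReal_norm]
    simp_rw [e]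
    exact this
  have hlim := le_of_tendsto_of_tendsto' t1
    (ENNReal.Tendsto.const_mul (t2.add t3) (Or.inr (ENNReal.coe_ne_top (r := NNReal.sqrt C)))) key
  rw [add_zero, eLpNorm_fn, eLpNorm_grad, ← ENNReal.ofReal_coe_nnreal,
    ← ENNReal.ofReal_mul (by positivity)] at hlim
  exact (ENNReal.ofReal_le_ofReal_iff (mul_nonneg (by positivity) (norm_nonneg _))).1 hlim

end Electrowetting

/-! ### Convergence of products in Lebesgue spaces -/

namespace Electrowetting

/-- Convergence in `L^p`. -/
structure LpTendsto {α : Type*} [MeasurableSpace α] (p : ℝ≥0∞) (μ : Measure α) (F : ℕ → α → ℝ)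
    (G : α → ℝ) : Prop where
  memLp : ∀ k, MemLp (F k) p μ
  memLp_lim : MemLp G p μ
  tendsto : Tendsto (fun k => eLpNorm (F k - G) p μ) atTop (𝓝 0)

namespace LpTendsto

variable {α : Type*} [MeasurableSpace α] {p q r : ℝ≥0∞} {μ : Measure α} {F F' : ℕ → α → ℝ}
  {G G' : α → ℝ}

theorem const (h : MemLp G p μ) : LpTendsto p μ (fun _ => G) G :=
  ⟨fun _ => h, h, by simp⟩

theorem comp (h : LpTendsto p μ F G) {ns : ℕ → ℕ} (hns : StrictMono ns) :
    LpTendsto p μ (fun k => F (ns k)) G :=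
  ⟨fun _ => h.1 _, h.2, h.3.comp hns.tendsto_atTop⟩

theorem add (h : LpTendsto p μ F G) (h' : LpTendsto p μ F' G') (hp : 1 ≤ p) :
    LpTendsto p μ (fun k => F k + F' k) (G + G') := by
  refine ⟨fun k => (h.1 k).add (h'.1 k), h.2.add h'.2, ?_⟩
  refine tendsto_of_tendsto_of_tendsto_of_le_of_le tendsto_const_nhds
    (by simpa using h.3.add h'.3) (fun _ => zero_le) fun k => ?_
  rw [add_sub_add_comm]
  exact eLpNorm_add_le ((h.1 k).sub h.2).1 ((h'.1 k).sub h'.2).1 hp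

theorem sum {ι : Type*} {s : Finset ι} {F : ι → ℕ → α → ℝ} {G : ι → α → ℝ}
    (h : ∀ i ∈ s, LpTendsto p μ (F i) (G i)) (hp : 1 ≤ p) :
    LpTendsto p μ (fun k => ∑ i ∈ s, F i k) (∑ i ∈ s, G i) := by
  classical
  induction s using Finset.induction_on with
  | empty => exact const (G := 0) MemLp.zero
  | insert i s hi ih =>
    simp only [Finset.sum_insert hi]
    exact (h i (Finset.mem_insert_self i s)).add
      (ih fun j hj => h j (Finset.mem_insert_of_mem hj)) hp

theorem mono [IsFiniteMeasure μ] (h : LpTendsto p μ F G) (hq : q ≤ p) : LpTendsto q μ F G := by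
  refine ⟨fun k => (h.1 k).mono_exponent hq, h.2.mono_exponent hq, ?_⟩
  by_cases hμ : μ = 0
  · simp [hμ]
  refine tendsto_of_tendsto_of_tendsto_of_le_of_le tendsto_const_nhds ?_ (fun _ => zero_le)
    fun k => eLpNorm_le_eLpNorm_mul_rpow_measure_univ hq ((h.1 k).sub h.2).1
  have := ENNReal.Tendsto.mul_const (b := μ univ ^ (1 / q.toReal - 1 / p.toReal)) h.3
    (Or.inr (ENNReal.rpow_ne_top_of_ne_zero (by simpa using hμ) (measure_ne_top _ _)))
  simpa using this

theorem mul (h : LpTendsto p μ F G) (h' : LpTendsto q μ F' G') [ENNReal.HolderTriple p q r]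
    (h1 : 1 ≤ r) : LpTendsto r μ (fun k => F k * F' k) (G * G') := by
  have mm : ∀ {f g : α → ℝ}, MemLp f p μ → MemLp g q μ → MemLp (f * g) r μ := fun {f g} hf hg =>
    MemLp.mul (p := p) (q := q) (r := r) hg hf
  have nn : ∀ {f g : α → ℝ}, MemLp f p μ → MemLp g q μ →
      eLpNorm (f * g) r μ ≤ eLpNorm f p μ * eLpNorm g q μ := fun {f g} hf hg => by
    have h0 : eLpNorm (f • g) r μ ≤ eLpNorm f p μ * eLpNorm g q μ :=
      eLpNorm_smul_le_mul_eLpNorm hg.1 hf.1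
    have e : f • g = f * g := by
      funext x
      simp only [Pi.smul_apply', smul_eq_mul, Pi.mul_apply]
    rwa [e] at h0
  refine ⟨fun k => mm (h.1 k) (h'.1 k), mm h.2 h'.2, ?_⟩
  have t1 := ENNReal.Tendsto.mul h.3 (Or.inr ENNReal.zero_ne_top) h'.3
    (Or.inr ENNReal.zero_ne_top)
  have t2 := ENNReal.Tendsto.mul_const h.3 (Or.inr h'.2.eLpNorm_ne_top)
  have t3 := ENNReal.Tendsto.const_mul h'.3 (Or.inr h.2.eLpNorm_ne_top)
  have t := (t1.add t2).add t3
  rw [mul_zero, zero_mul, mul_zero, add_zero, add_zero] at t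
  refine tendsto_of_tendsto_of_tendsto_of_le_of_le tendsto_const_nhds t (fun _ => zero_le)
    fun k => ?_
  have e : F k * F' k - G * G'
      = (F k - G) * (F' k - G') + (F k - G) * G' + G * (F' k - G') := by
    funext x
    simp only [Pi.sub_apply, Pi.add_apply, Pi.mul_apply]
    ring
  have m1 := (h.1 k).sub h.2
  have m2 := (h'.1 k).sub h'.2
  rw [e]
  refine (eLpNorm_add_le ((mm m1 m2).add (mm m1 h'.2)).1 (mm h.2 m2).1 h1).trans ?_
  refine add_le_add ((eLpNorm_add_le (mm m1 m2).1 (mm m1 h'.2).1 h1).trans ?_) (nn h.2 m2)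
  exact add_le_add (nn m1 m2) (nn m1 h'.2)

/-- The difference is `a_k (F_k - G) + (a_k - b) G`: the first part is controlled by the uniform
bound, the second by dominated convergence. Pointwise convergence is all that is available for
`ρ(φ_k)` and `ρ'(φ_k)`, as `ρ'` is merely continuous and bounded. -/
theorem bdd_mul {a : ℕ → α → ℝ} {b : α → ℝ} {M : ℝ} (ha : ∀ k, AEStronglyMeasurable (a k) μ)
    (hM : ∀ k x, |a k x| ≤ M) (hb : ∀ᵐ x ∂μ, Tendsto (fun k => a k x) atTop (𝓝 (b x)))
    (h : LpTendsto 1 μ F G) : LpTendsto 1 μ (fun k => a k * F k) (b * G) := by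
  have hbm : AEStronglyMeasurable b μ := aestronglyMeasurable_of_tendsto_ae atTop ha hb
  have hbM : ∀ᵐ x ∂μ, |b x| ≤ M := hb.mono fun x hx =>
    le_of_tendsto hx.abs (Eventually.of_forall fun k => hM k x)
  have ml : ∀ {a f : α → ℝ}, AEStronglyMeasurable a μ → (∀ᵐ x ∂μ, |a x| ≤ M) → MemLp f 1 μ →
      MemLp (a * f) 1 μ := by
    intro a f ha haM hf
    exact memLp_one_iff_integrable.2 ((memLp_one_iff_integrable.1 hf).bdd_mul ha haM)
  refine ⟨fun k => ml (ha k) (Eventually.of_forall (hM k)) (h.1 k), ml hbm hbM h.2, ?_⟩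
  have t1 : Tendsto (fun k => eLpNorm ((a k - b) * G) 1 μ) atTop (𝓝 0) := by
    simp_rw [eLpNorm_one_eq_lintegral_enorm]
    have hG := memLp_one_iff_integrable.1 h.2
    have := tendsto_lintegral_of_dominated_convergence' (μ := μ)
      (F := fun k x => ‖((a k - b) * G) x‖ₑ) (f := fun _ => 0)
      (fun x => ENNReal.ofReal (2 * M) * ‖G x‖ₑ)
      (fun k => (((ha k).sub hbm).mul hG.1).enorm) (fun k => ?_) ?_ ?_
    · simpa using this
    · filter_upwards [hbM] with x hx
      rw [Pi.mul_apply, enorm_mul, ← ofReal_norm]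
      refine mul_le_mul' (ENNReal.ofReal_le_ofReal ?_) le_rfl
      have := hM k x
      rw [Pi.sub_apply, Real.norm_eq_abs]
      linarith [abs_sub (a k x) (b x)]
    · rw [lintegral_const_mul' _ _ ENNReal.ofReal_ne_top]
      exact ENNReal.mul_ne_top ENNReal.ofReal_ne_top hG.2.ne
    · filter_upwards [hb] with x hx
      have := ((hx.sub_const (b x)).mul_const (G x)).enorm
      simpa using this
  have t2 := (ENNReal.Tendsto.const_mul h.3 (Or.inr (ENNReal.ofReal_ne_top (r := M)))).add t1
  rw [mul_zero, zero_add] at t2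
  refine tendsto_of_tendsto_of_tendsto_of_le_of_le tendsto_const_nhds t2 (fun _ => zero_le)
    fun k => ?_
  have e : a k * F k - b * G = a k * (F k - G) + (a k - b) * G := by ring
  rw [e]
  refine (eLpNorm_add_le ((ha k).mul ((h.1 k).sub h.2).1) (((ha k).sub hbm).mul h.2.1)
    le_rfl).trans (add_le_add ?_ le_rfl)
  refine eLpNorm_le_mul_eLpNorm_of_ae_le_mul (Eventually.of_forall fun x => ?_) 1
  rw [Pi.mul_apply, norm_mul]
  exact mul_le_mul_of_nonneg_right (hM k x) (norm_nonneg _)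

theorem integral (h : LpTendsto 1 μ F G) :
    Tendsto (fun k => ∫ x, F k x ∂μ) atTop (𝓝 (∫ x, G x ∂μ)) :=
  tendsto_integral_of_L1' G h.2.1
    (Eventually.of_forall fun k => memLp_one_iff_integrable.1 (h.1 k)) h.3

end LpTendsto

/-- By the Sobolev inequality for differences, some test function is at finite `L⁶` distance from
`v`. -/
theorem memLp_fn_six {d : ℕ} (hd : d = 2 ∨ d = 3) {Ω : Set (E d)} (hΩ : IsOpen Ω)
    (hc : Convex ℝ Ω) (hb : Bornology.IsBounded Ω) (hne : Ω.Nonempty) (v : H1 Ω) :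
    MemLp (fn v) 6 (vol Ω) := by
  obtain ⟨C, hC⟩ := exists_sobolev hd hΩ hc hb hne
  obtain ⟨f, hf, f1, f2, _⟩ := exists_isTest_seq v
  have h := ENNReal.Tendsto.const_mul (f1.add f2) (Or.inr (ENNReal.coe_ne_top (r := C)))
  rw [add_zero, mul_zero] at h
  obtain ⟨k, hk⟩ := (h.eventually_lt_const one_pos).exists
  have hm : MemLp (fun x => f k x - fn v x) 6 (vol Ω) :=
    ⟨(hf k).continuous.aestronglyMeasurable.sub (memLp_fn v).1,
      ((hC v (f k) (hf k)).trans_lt hk).trans ENNReal.one_lt_top⟩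
  have := (((hf k).memLp_volume 6).restrict Ω).sub hm
  refine this.ae_eq (Eventually.of_forall fun x => ?_)
  simp

theorem exists_isTest_lpTendsto {d : ℕ} (hd : d = 2 ∨ d = 3) {Ω : Set (E d)} (hΩ : IsOpen Ω)
    (hc : Convex ℝ Ω) (hb : Bornology.IsBounded Ω) (hne : Ω.Nonempty) (v : H1 Ω) :
    ∃ f : ℕ → E d → ℝ, (∀ k, IsTest (f k)) ∧ LpTendsto 6 (vol Ω) f (fn v) ∧
      (∀ i, LpTendsto 2 (vol Ω) (fun k x => gradient (f k) x i) (fun x => grad v x i)) ∧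
      ∀ᵐ x ∂(vol Ω), Tendsto (fun k => f k x) atTop (𝓝 (fn v x)) := by
  obtain ⟨C, hC⟩ := exists_sobolev hd hΩ hc hb hne
  obtain ⟨f, hf, f1, f2, _⟩ := exists_isTest_seq v
  obtain ⟨ns, hns, hae⟩ := (tendstoInMeasure_of_tendsto_eLpNorm (by norm_num)
    (fun k => (hf k).continuous.aestronglyMeasurable) (memLp_fn v).1 f1).exists_seq_tendsto_ae
  have h := ENNReal.Tendsto.const_mul (f1.add f2) (Or.inr (ENNReal.coe_ne_top (r := C)))
  rw [add_zero, mul_zero] at h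
  have h6 : LpTendsto 6 (vol Ω) f (fn v) :=
    ⟨fun k => ((hf k).memLp_volume 6).restrict Ω, memLp_fn_six hd hΩ hc hb hne v,
      tendsto_of_tendsto_of_tendsto_of_le_of_le tendsto_const_nhds h (fun _ => zero_le)
        fun k => hC v (f k) (hf k)⟩
  have h2 : ∀ i, LpTendsto 2 (vol Ω) (fun k x => gradient (f k) x i) (fun x => grad v x i) :=
    fun i => ⟨fun k => ((hf k).memLp_gradient Ω).continuousLinearMap_comp
      (EuclideanSpace.proj (𝕜 := ℝ) i), memLp_grad_apply v i, tendsto_eLpNorm_apply i f2⟩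
  exact ⟨fun k => f (ns k), fun k => hf _, h6.comp hns, fun i => (h2 i).comp hns, hae⟩

/-- If two elements of `H¹` agree on the smaller of two domains, so do their gradients. -/
theorem grad_ae_eq_of_fn_ae_eq {d : ℕ} {Ω Ω' : Set (E d)} (hΩ : IsOpen Ω) (hΩ' : MeasurableSet Ω')
    (hsub : Ω ⊆ Ω') {r : H1 Ω} {w : H1 Ω'} (h : fn r =ᵐ[vol Ω] fn w) :
    grad r =ᵐ[vol Ω] grad w := by
  have hle : vol Ω ≤ vol Ω' := Measure.restrict_mono hsub le_rfl
  have hr : LocallyIntegrable (grad r) (vol Ω) := (memLp_grad r).locallyIntegrable (by norm_num)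
  have hw : LocallyIntegrable (grad w) (vol Ω) :=
    ((memLp_grad w).mono_measure hle).locallyIntegrable (by norm_num)
  -- A test function supported in the smaller domain is admissible in both definitions of the weak
  -- gradient, so the difference of the gradients is orthogonal to all of them.
  have key := hΩ.ae_eq_zero_of_integral_contDiff_smul_eq_zero (μ := vol Ω)
    (f := fun x => grad r x - grad w x) (((hr.sub hw)).locallyIntegrableOn _) fun ζ h1 h2 h3 => by
      have hζ : IsTest ζ := ⟨h1, h2⟩
      have i1 : Integrable (fun x => ζ x • grad r x) (vol Ω) := hζ.integrable_right Ω r.1.2.1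
      have i2 : Integrable (fun x => ζ x • grad w x) (vol Ω) :=
        (hζ.integrable_right Ω' w.1.2.1).mono_measure hle
      simp_rw [smul_sub]
      rw [integral_sub i1 i2]
      have e1 : ∫ y in Ω, fn r y • gradient ζ y = -∫ y in Ω, ζ y • grad r y := r.2.1 ζ hζ h3
      have e2 : ∫ y in Ω', fn w y • gradient ζ y = -∫ y in Ω', ζ y • grad w y :=
        w.2.1 ζ hζ (h3.trans hsub)
      have z : ∀ x ∉ Ω, ζ x = 0 ∧ gradient ζ x = 0 := fun x hx => by
        have hx' : x ∉ tsupport ζ := fun h => hx (h3 h)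
        refine ⟨image_eq_zero_of_notMem_tsupport hx', ?_⟩
        have : fderiv ℝ ζ x = 0 := by
          by_contra h0
          exact hx' (support_fderiv_subset ℝ h0)
        simp [gradient, this]
      rw [setIntegral_eq_of_subset_of_forall_sdiff_eq_zero hΩ' hsub
          fun x hx => by simp [(z x hx.2).2],
        setIntegral_eq_of_subset_of_forall_sdiff_eq_zero hΩ' hsub
          fun x hx => by simp [(z x hx.2).1]] at e2
      have e3 : ∫ y in Ω, fn r y • gradient ζ y = ∫ y in Ω, fn w y • gradient ζ y :=
        integral_congr_ae (h.mono fun x hx => by simp only [hx])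
      rw [e1, e2] at e3
      rw [sub_eq_zero]
      exact neg_injective e3
  filter_upwards [key, ae_restrict_mem hΩ.measurableSet] with x hx hxΩ
  exact sub_eq_zero.1 (hx hxΩ)

end Electrowetting

/-! ### Green's formula and the cancellation of convection -/

namespace Electrowetting

theorem holderTriple_four_four_two : ENNReal.HolderTriple 4 4 2 := ⟨by
  rw [← ENNReal.toReal_eq_toReal_iff' (by finiteness) (by finiteness),
    ENNReal.toReal_add (by finiteness) (by finiteness)]
  norm_num⟩

theorem holderTriple_six_six_three : ENNReal.HolderTriple 6 6 3 := ⟨by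
  rw [← ENNReal.toReal_eq_toReal_iff' (by finiteness) (by finiteness),
    ENNReal.toReal_add (by finiteness) (by finiteness)]
  norm_num⟩

theorem holderTriple_six_three_two : ENNReal.HolderTriple 6 3 2 := ⟨by
  rw [← ENNReal.toReal_eq_toReal_iff' (by finiteness) (by finiteness),
    ENNReal.toReal_add (by finiteness) (by finiteness)]
  norm_num⟩

/-- A `C¹` function is a limit of smooth functions, locally uniformly with its derivative. -/
theorem exists_contDiff_near {σ : ℝ → ℝ} (hσ : ContDiff ℝ 1 σ) (R : ℝ) {ε : ℝ} (hε : 0 < ε) :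
    ∃ q : ℝ → ℝ, ContDiff ℝ ∞ q ∧
      ∀ ξ, |ξ| ≤ R → |q ξ - σ ξ| ≤ ε * R ∧ |deriv q ξ - deriv σ ξ| ≤ ε := by
  -- Weierstrass approximation is applied to the derivative; the primitive with the right value at
  -- `0` is then close to `σ` as well.
  obtain ⟨p, hp⟩ := exists_polynomial_near_of_continuousOn (-R) R (deriv σ)
    (hσ.continuous_deriv (by simp)).continuousOn ε hε
  set q : ℝ → ℝ := fun ξ => σ 0 + ∫ s in (0 : ℝ)..ξ, p.eval s
  have hq : ∀ ξ, HasDerivAt q (p.eval ξ) ξ := fun ξ =>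
    (intervalIntegral.integral_hasDerivAt_right (p.continuous.intervalIntegrable _ _)
      (p.continuous.stronglyMeasurableAtFilter _ _) p.continuous.continuousAt).const_add _
  have hd : deriv q = fun ξ => p.eval ξ := funext fun ξ => (hq ξ).deriv
  refine ⟨q, ?_, fun ξ hξ => ?_⟩
  · rw [contDiff_infty_iff_deriv, hd]
    exact ⟨fun ξ => (hq ξ).differentiableAt, by
      simpa only [Polynomial.coe_aeval_eq_eval] using p.contDiff_aeval (R := ℝ) (𝕜 := ℝ) ∞⟩
  · have hb : ∀ s ∈ Icc (-R) R, |deriv q s - deriv σ s| ≤ ε := fun s hs => by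
      rw [hd]; exact (hp s hs).le
    have hmem : ξ ∈ Icc (-R) R := abs_le.1 hξ
    refine ⟨?_, hb ξ hmem⟩
    have hdσ := hσ.differentiable one_ne_zero
    have h0 : (0 : ℝ) ∈ Icc (-R) R := by
      have := abs_nonneg ξ
      constructor <;> linarith
    have := (convex_Icc (-R) R).norm_image_sub_le_of_norm_deriv_le (f := fun s => q s - σ s)
      (C := ε) (fun s _ => (hq s).differentiableAt.sub (hdσ s)) (fun s hs => by
        rw [deriv_fun_sub (hq s).differentiableAt (hdσ s)]
        exact hb s hs) h0 hmem
    simp only [q, intervalIntegral.integral_same, add_zero, sub_self, sub_zero,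
      Real.norm_eq_abs] at this
    exact this.trans (mul_le_mul_of_nonneg_left hξ hε.le)

section

variable {d : ℕ} {Ω : Set (E d)}

theorem memLp_dvg (u : VecH1 Ω) : MemLp (dvg u) 2 (vol Ω) := by
  have := memLp_finsetSum (μ := vol Ω) (p := 2) Finset.univ
    (fun i _ => memLp_grad_apply (u i) i)
  exact this

/-- The Green formula with the weight `σ(f) g²`, for test functions `f` and `g`. -/
theorem integral_flux_eq_zero_of_isTest {u : VecH1 Ω} (hu : NormalTraceZero u)
    {σ : ℝ → ℝ} (hσ : ContDiff ℝ 1 σ) {f g : E d → ℝ} (hf : IsTest f) (hg : IsTest g) :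
    ∫ x in Ω, (σ (f x) * (2 * ∑ j, fn (u j) x * g x * gradient g x j)
      + (deriv σ (f x) * (∑ i, gradient f x i * (fn (u i) x * (g x * g x)))
        + σ (f x) * (dvg u x * (g x * g x)))) = 0 := by
  obtain ⟨R, hR⟩ := hf.2.exists_bound_of_continuous hf.continuous
  -- The condition `u · n = 0` is formulated with smooth test functions, while `σ` is only `C¹`.
  -- Hence `σ` is first approximated, with its derivative, on an interval containing the range of
  -- `f`.
  have hε : ∀ m : ℕ, (0 : ℝ) < 1 / ((m : ℝ) + 1) := fun m => by positivity
  choose q hq hqσ using fun m : ℕ => exists_contDiff_near hσ R (hε m)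
  set Φ : (ℝ → ℝ) → E d → ℝ := fun σ x => σ (f x) * (2 * ∑ j, fn (u j) x * g x * gradient g x j)
      + (deriv σ (f x) * (∑ i, gradient f x i * (fn (u i) x * (g x * g x)))
        + σ (f x) * (dvg u x * (g x * g x))) with hΦ
  have hz : ∀ m, ∫ x in Ω, Φ (q m) x = 0 := by
    intro m
    have hζ : IsTest fun x => q m (f x) * g x ^ 2 := by
      have h1 : IsTest fun x => g x * g x := hg.mul_left hg.1
      have h2 := h1.mul_left ((hq m).comp hf.1)
      simpa [pow_two] using h2
    have := hu _ hζ
    rw [← this]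
    refine integral_congr_ae (Eventually.of_forall fun x => ?_)
    have hd : ∀ i, gradient (fun x => q m (f x) * g x ^ 2) x i
        = deriv (q m) (f x) * gradient f x i * g x ^ 2
          + q m (f x) * (2 * g x * gradient g x i) := by
      intro i
      simp only [gradient_apply]
      have hq' := ((hq m).differentiable (by simp) (f x)).hasDerivAt.comp_hasFDerivAt x
        (hf.differentiable x).hasFDerivAt
      have h3 := (hq'.mul ((hg.differentiable x).hasFDerivAt.pow 2)).fderiv
      have h4 : fderiv ℝ (fun x => q m (f x) * g x ^ 2) x = _ := h3
      rw [h4]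
      simp
      ring
    simp only [hΦ, hd, mul_add, Finset.sum_add_distrib, Finset.mul_sum]
    rw [add_comm (∑ i, _) (∑ i, _), add_assoc]
    congr 1
    · exact Finset.sum_congr rfl fun i _ => by ring
    · congr 1
      · exact Finset.sum_congr rfl fun i _ => by ring
      · ring
  have tq : ∀ x, Tendsto (fun m => q m (f x)) atTop (𝓝 (σ (f x))) ∧
      Tendsto (fun m => deriv (q m) (f x)) atTop (𝓝 (deriv σ (f x))) := by
    intro x
    have e := tendsto_one_div_add_atTop_nhds_zero_nat (𝕜 := ℝ)
    have e' := e.mul_const R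
    rw [zero_mul] at e'
    constructor
    · rw [tendsto_iff_norm_sub_tendsto_zero]
      exact squeeze_zero (fun _ => norm_nonneg _) (fun m => (hqσ m (f x) (hR x)).1) e'
    · rw [tendsto_iff_norm_sub_tendsto_zero]
      exact squeeze_zero (fun _ => norm_nonneg _) (fun m => (hqσ m (f x) (hR x)).2) e
  obtain ⟨K, hK⟩ : ∃ K, ∀ ξ ∈ Icc (-R) R, |σ ξ| ≤ K ∧ |deriv σ ξ| ≤ K := by
    obtain ⟨K₁, h₁⟩ := isCompact_Icc.exists_bound_of_continuousOn (s := Icc (-R) R)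
      hσ.continuous.continuousOn
    obtain ⟨K₂, h₂⟩ := isCompact_Icc.exists_bound_of_continuousOn (s := Icc (-R) R)
      (hσ.continuous_deriv (by simp)).continuousOn
    exact ⟨max K₁ K₂, fun ξ hξ => ⟨(h₁ ξ hξ).trans (le_max_left _ _),
      (h₂ ξ hξ).trans (le_max_right _ _)⟩⟩
  have hR0 : 0 ≤ R := (norm_nonneg _).trans (hR 0)
  have hbd : ∀ m x, |q m (f x)| ≤ K + R + 1 ∧ |deriv (q m) (f x)| ≤ K + R + 1 := by
    intro m x
    obtain ⟨a, b⟩ := hqσ m (f x) (hR x)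
    obtain ⟨a', b'⟩ := hK (f x) (abs_le.1 (hR x))
    have hle : (1 : ℝ) / ((m : ℝ) + 1) ≤ 1 := by
      rw [div_le_one (by positivity)]; linarith [(Nat.cast_nonneg m : (0 : ℝ) ≤ m)]
    have hRm : 1 / ((m : ℝ) + 1) * R ≤ R := mul_le_of_le_one_left hR0 hle
    constructor
    · linarith [abs_sub_abs_le_abs_sub (q m (f x)) (σ (f x))]
    · linarith [abs_sub_abs_le_abs_sub (deriv (q m) (f x)) (deriv σ (f x))]
  have i1 : Integrable (fun x => 2 * ∑ j, fn (u j) x * g x * gradient g x j) (vol Ω) := by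
    refine (integrable_finsetSum _ fun j _ => ?_).const_mul 2
    have h1 : MemLp (fun x => gradient g x j * g x) 2 (vol Ω) :=
      ((hg.memLp_volume ⊤).restrict Ω).mul (((hg.memLp_gradient Ω).continuousLinearMap_comp
        (EuclideanSpace.proj (𝕜 := ℝ) j)))
    have := (memLp_fn (u j)).integrable_mul h1
    refine this.congr (Eventually.of_forall fun x => ?_)
    simp only [Pi.mul_apply]
    ring
  have hgg : MemLp (fun x => g x * g x) ⊤ (vol Ω) := by
    have : IsTest fun x => g x * g x := hg.mul_left hg.1
    exact (this.memLp_volume ⊤).restrict Ω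
  have i2 : Integrable (fun x => ∑ i, gradient f x i * (fn (u i) x * (g x * g x))) (vol Ω) := by
    refine integrable_finsetSum _ fun i _ => ?_
    have h1 : MemLp (fun x => fn (u i) x * (g x * g x)) 2 (vol Ω) := hgg.mul (memLp_fn (u i))
    exact MemLp.integrable_mul ((hf.memLp_gradient Ω).continuousLinearMap_comp
      (EuclideanSpace.proj (𝕜 := ℝ) i)) h1
  have i3 : Integrable (fun x => dvg u x * (g x * g x)) (vol Ω) := by
    have : MemLp (fun x => g x * g x) 2 (vol Ω) :=
      IsTest.memLp (ζ := fun x => g x * g x) (hg.mul_left hg.1) Ω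
    exact (memLp_dvg u).integrable_mul this
  have hlim : Tendsto (fun m => ∫ x in Ω, Φ (q m) x) atTop (𝓝 (∫ x in Ω, Φ σ x)) := by
    refine tendsto_integral_of_dominated_convergence (fun x => (K + R + 1) *
      (‖2 * ∑ j, fn (u j) x * g x * gradient g x j‖
        + (‖∑ i, gradient f x i * (fn (u i) x * (g x * g x))‖ + ‖dvg u x * (g x * g x)‖)))
      (fun m => ?_) ((i1.norm.add (i2.norm.add i3.norm)).const_mul _) (fun m => ?_) ?_
    · have c1 : Continuous fun x => q m (f x) := (hq m).continuous.comp hf.continuous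
      have c2 : Continuous fun x => deriv (q m) (f x) :=
        ((hq m).continuous_deriv (by simp)).comp hf.continuous
      exact (c1.aestronglyMeasurable.mul i1.1).add ((c2.aestronglyMeasurable.mul i2.1).add
        (c1.aestronglyMeasurable.mul i3.1))
    · refine Eventually.of_forall fun x => ?_
      obtain ⟨a, b⟩ := hbd m x
      simp only [hΦ]
      rw [mul_add, mul_add]
      refine (norm_add_le _ _).trans (add_le_add ?_ ((norm_add_le _ _).trans (add_le_add ?_ ?_)))
      all_goals
        rw [norm_mul]
        exact mul_le_mul_of_nonneg_right (by assumption) (norm_nonneg _)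
    · refine Eventually.of_forall fun x => ?_
      exact ((tq x).1.mul_const _).add (((tq x).2.mul_const _).add ((tq x).1.mul_const _))
  simp_rw [hz] at hlim
  exact (tendsto_nhds_unique hlim tendsto_const_nhds)

/-- The convective terms, tested with the velocity itself, cancel. -/
theorem convective_identity (hd : d = 2 ∨ d = 3) (hΩ : IsOpen Ω) (hc : Convex ℝ Ω)
    (hb : Bornology.IsBounded Ω) (hne : Ω.Nonempty) {σ : ℝ → ℝ} (hσ : IsMaterial σ)
    {u : VecH1 Ω} (hu : NormalTraceZero u) (φ b : H1 Ω) :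
    Integrable (fun x => σ (fn φ x) * ((∑ j, fn (u j) x * grad b x j) * fn b x)) (vol Ω) ∧
    Integrable (fun x => (deriv σ (fn φ x) * (∑ i, grad φ x i * fn (u i) x)
      + σ (fn φ x) * dvg u x) * (fn b x * fn b x)) (vol Ω) ∧
    (∫ x in Ω, σ (fn φ x) * ((∑ j, fn (u j) x * grad b x j) * fn b x))
      + 1 / 2 * (∫ x in Ω, (deriv σ (fn φ x) * (∑ i, grad φ x i * fn (u i) x)
        + σ (fn φ x) * dvg u x) * (fn b x * fn b x)) = 0 := by
  have : IsFiniteMeasure (vol Ω) := ⟨by simpa using hb.measure_lt_top⟩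
  have := holderTriple_four_four_two
  have := holderTriple_six_six_three
  have := holderTriple_six_three_two
  obtain ⟨hσ1, m, M, hm, hM⟩ := hσ
  obtain ⟨f, hf, f6, f2, fae⟩ := exists_isTest_lpTendsto hd hΩ hc hb hne φ
  obtain ⟨g, hg, g6, g2, -⟩ := exists_isTest_lpTendsto hd hΩ hc hb hne b
  have u6 : ∀ j, LpTendsto 6 (vol Ω) (fun _ => fn (u j)) (fn (u j)) := fun j =>
    LpTendsto.const (memLp_fn_six hd hΩ hc hb hne (u j))
  have h46 : (4 : ℝ≥0∞) ≤ 6 := by norm_num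
  have L1 : LpTendsto 1 (vol Ω)
      (fun k => ∑ j, (fn (u j) * g k) * fun x => gradient (g k) x j)
      (∑ j, (fn (u j) * fn b) * fun x => grad b x j) :=
    LpTendsto.sum (fun j _ => ((((u6 j).mono h46).mul (g6.mono h46) (r := 2)
      (by norm_num)).mul (g2 j) le_rfl)) le_rfl
  -- The critical term: `∇φ` is only in `L²`, so the product of `u` and two factors `b` must
  -- converge in `L²`, which uses the three exponents `6` exactly.
  have L2 : LpTendsto 1 (vol Ω)
      (fun k => ∑ i, (fun x => gradient (f k) x i) * (fn (u i) * (g k * g k)))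
      (∑ i, (fun x => grad φ x i) * (fn (u i) * (fn b * fn b))) :=
    LpTendsto.sum (fun i _ => (f2 i).mul ((u6 i).mul (g6.mul g6 (r := 3) (by norm_num)) (r := 2)
      (by norm_num)) le_rfl) le_rfl
  have L3 : LpTendsto 1 (vol Ω) (fun k => dvg u * (g k * g k)) (dvg u * (fn b * fn b)) :=
    (LpTendsto.const (memLp_dvg u)).mul ((g6.mono h46).mul (g6.mono h46) (r := 2)
      (by norm_num)) le_rfl
  have aσ : ∀ k, AEStronglyMeasurable (fun x => σ (f k x)) (vol Ω) := fun k =>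
    (hσ1.continuous.comp (hf k).continuous).aestronglyMeasurable
  have aσ' : ∀ k, AEStronglyMeasurable (fun x => deriv σ (f k x)) (vol Ω) := fun k =>
    ((hσ1.continuous_deriv (by simp)).comp (hf k).continuous).aestronglyMeasurable
  have bσ : ∀ k x, |σ (f k x)| ≤ M := fun k x => by
    rw [abs_of_pos (hm.trans_le (hM _).1)]; exact (hM _).2.1
  have tσ : ∀ᵐ x ∂(vol Ω), Tendsto (fun k => σ (f k x)) atTop (𝓝 (σ (fn φ x))) :=
    fae.mono fun x hx => (hσ1.continuous.tendsto _).comp hx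
  have tσ' : ∀ᵐ x ∂(vol Ω), Tendsto (fun k => deriv σ (f k x)) atTop (𝓝 (deriv σ (fn φ x))) :=
    fae.mono fun x hx => ((hσ1.continuous_deriv (by simp)).tendsto _).comp hx
  have M1 := L1.bdd_mul aσ bσ tσ
  have M2 := L2.bdd_mul aσ' (fun k x => (hM _).2.2) tσ'
  have M3 := L3.bdd_mul aσ bσ tσ
  have M23 := M2.add M3 le_rfl
  -- The `2` comes from differentiating `g²`; it matches the factor `1/2` of the divergence term in
  -- the scheme.
  have hz : ∀ k, 2 * (∫ x in Ω, ((fun x => σ (f k x)) *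
      ∑ j, (fn (u j) * g k) * fun x => gradient (g k) x j) x)
      + ∫ x in Ω, (((fun x => deriv σ (f k x)) *
        ∑ i, (fun x => gradient (f k) x i) * (fn (u i) * (g k * g k)))
        + (fun x => σ (f k x)) * (dvg u * (g k * g k))) x = 0 := by
    intro k
    rw [← integral_const_mul, ← integral_add
      ((memLp_one_iff_integrable.1 (M1.1 k)).const_mul 2) (memLp_one_iff_integrable.1 (M23.1 k)),
      ← integral_flux_eq_zero_of_isTest hu hσ1 (hf k) (hg k)]
    refine integral_congr_ae (Eventually.of_forall fun x => ?_)
    simp only [Pi.add_apply, Pi.mul_apply, Finset.sum_apply]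
    ring
  have lim := (M1.integral.const_mul 2).add M23.integral
  simp_rw [hz] at lim
  have hfin := tendsto_nhds_unique lim tendsto_const_nhds
  have e1 : ((fun x => σ (fn φ x)) * ∑ j, (fn (u j) * fn b) * fun x => grad b x j)
      = fun x => σ (fn φ x) * ((∑ j, fn (u j) x * grad b x j) * fn b x) := by
    funext x
    simp only [Pi.mul_apply, Finset.sum_apply, Finset.sum_mul]
    congr 1
    exact Finset.sum_congr rfl fun j _ => by ring
  have e2 : (((fun x => deriv σ (fn φ x)) *
        ∑ i, (fun x => grad φ x i) * (fn (u i) * (fn b * fn b)))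
        + (fun x => σ (fn φ x)) * (dvg u * (fn b * fn b)))
      = fun x => (deriv σ (fn φ x) * (∑ i, grad φ x i * fn (u i) x)
      + σ (fn φ x) * dvg u x) * (fn b x * fn b x) := by
    funext x
    simp only [Pi.mul_apply, Pi.add_apply, Finset.sum_apply, add_mul, Finset.sum_mul,
      Finset.mul_sum]
    congr 1
    · exact Finset.sum_congr rfl fun j _ => by ring
    · ring
  have i1 := memLp_one_iff_integrable.1 M1.2
  have i2 := memLp_one_iff_integrable.1 M23.2
  rw [e1] at i1 hfin
  rw [e2] at i2 hfin
  exact ⟨i1, i2, by linarith⟩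

end

end Electrowetting

namespace Electrowetting

/-! ### The potentials -/

/-- Only a one-sided bound of the second derivative enters: `k` is increasing and vanishes at `a`,
and it is the derivative of `h`, so `h` has its minimum at `a`. -/
theorem le_of_deriv_deriv_le {f : ℝ → ℝ} (hf : Differentiable ℝ f) (hf' : Differentiable ℝ (deriv f))
    {L : ℝ} (hL : ∀ ξ, deriv (deriv f) ξ ≤ L) (a b : ℝ) :
    f b - f a ≤ deriv f a * (b - a) + L / 2 * (b - a) ^ 2 := by
  set k : ℝ → ℝ := fun ξ => L * (ξ - a) - (deriv f ξ - deriv f a) with hk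
  have hkd : ∀ ξ, HasDerivAt k (L - deriv (deriv f) ξ) ξ := fun ξ => by
    have h1 := (((hasDerivAt_id ξ).sub_const a).const_mul L).sub
      ((hf' ξ).hasDerivAt.sub_const (deriv f a))
    exact h1.congr_deriv (by simp)
  have hmono : Monotone k := monotone_of_deriv_nonneg (fun ξ => (hkd ξ).differentiableAt)
    fun ξ => by rw [(hkd ξ).deriv]; linarith [hL ξ]
  have hka : k a = 0 := by simp [hk]
  set h : ℝ → ℝ := fun ξ => L / 2 * (ξ - a) ^ 2 - (f ξ - deriv f a * (ξ - a)) with hh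
  have hhd : ∀ ξ, HasDerivAt h (k ξ) ξ := fun ξ => by
    have h1 := ((((hasDerivAt_id ξ).sub_const a).pow 2).const_mul (L / 2)).sub
      ((hf ξ).hasDerivAt.sub (((hasDerivAt_id ξ).sub_const a).const_mul (deriv f a)))
    refine h1.congr_deriv ?_
    simp [hk]
    ring
  have hcont : Continuous h := (Differentiable.continuous fun ξ => (hhd ξ).differentiableAt)
  have hle : h a ≤ h b := by
    rcases le_total a b with hab | hab
    · refine monotoneOn_of_deriv_nonneg (convex_Ici a) hcont.continuousOn
        (fun ξ _ => (hhd ξ).differentiableAt.differentiableWithinAt) (fun ξ hξ => ?_)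
        (self_mem_Ici (a := a)) hab hab
      rw [interior_Ici] at hξ
      rw [(hhd ξ).deriv, ← hka]
      exact hmono (le_of_lt hξ)
    · refine antitoneOn_of_deriv_nonpos (convex_Iic a) hcont.continuousOn
        (fun ξ _ => (hhd ξ).differentiableAt.differentiableWithinAt) (fun ξ hξ => ?_)
        hab (self_mem_Iic (a := a)) hab
      rw [interior_Iic] at hξ
      rw [(hhd ξ).deriv, ← hka]
      exact hmono (le_of_lt hξ)
  simp only [hh, sub_self] at hle
  linarith

theorem hasDerivAt_max_pow (n : ℕ) (x : ℝ) :
    HasDerivAt (fun x : ℝ => max x 0 ^ (n + 2)) ((n + 2 : ℝ) * max x 0 ^ (n + 1)) x := by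
  rcases lt_trichotomy x 0 with h | rfl | h
  · have e : (fun x : ℝ => max x 0 ^ (n + 2)) =ᶠ[𝓝 x] fun _ => 0 := by
      filter_upwards [gt_mem_nhds h] with y hy
      simp [max_eq_right hy.le]
    rw [max_eq_right h.le]
    simpa using (hasDerivAt_const x (0 : ℝ)).congr_of_eventuallyEq e
  · have h0 : HasDerivAt (fun x : ℝ => max x 0 ^ (n + 2)) 0 0 := by
      rw [hasDerivAt_iff_isLittleO_nhds_zero]
      simp only [zero_add, max_self, ne_eq, Nat.add_eq_zero_iff, OfNat.ofNat_ne_zero, and_false,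
        not_false_eq_true, zero_pow, sub_zero, smul_zero]
      have h1 : (fun h : ℝ => max h 0 ^ (n + 2)) =O[𝓝 0] fun h : ℝ => h ^ (n + 2) := by
        refine Asymptotics.IsBigO.of_bound 1 (Eventually.of_forall fun h => ?_)
        rw [one_mul, norm_pow, norm_pow]
        refine pow_le_pow_left₀ (norm_nonneg _) ?_ _
        rw [Real.norm_eq_abs, Real.norm_eq_abs, abs_of_nonneg (le_max_right _ _)]
        exact max_le (le_abs_self h) (abs_nonneg h)
      exact h1.trans_isLittleO (by simpa using Asymptotics.isLittleO_pow_id (𝕜 := ℝ) (by omega))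
    simpa using h0
  · have e : (fun x : ℝ => max x 0 ^ (n + 2)) =ᶠ[𝓝 x] fun x => x ^ (n + 2) := by
      filter_upwards [lt_mem_nhds h] with y hy
      simp [max_eq_left hy.le]
    rw [max_eq_left h.le]
    have := (hasDerivAt_pow (n + 2) x).congr_of_eventuallyEq e
    simpa using this

/-- At `±1` the quartic and the quadratic branches agree to third order. Writing their difference
with cubes of positive parts makes it visible that `W` is twice differentiable and lets it be
differentiated without cases. -/
theorem W_eq (ξ : ℝ) : W ξ = (1 - ξ ^ 2) ^ 2 / 4 - max (ξ - 1) 0 ^ 3 * (ξ + 3) / 4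
    - max (-ξ - 1) 0 ^ 3 * (3 - ξ) / 4 := by
  unfold W
  split_ifs with h1 h2
  · rw [max_eq_right (by linarith), max_eq_left (by linarith)]; ring
  · rw [max_eq_right (by linarith), max_eq_right (by linarith)]; ring
  · rw [max_eq_left (by linarith), max_eq_right (by linarith)]; ring

theorem hasDerivAt_W (ξ : ℝ) : HasDerivAt W (ξ ^ 3 - ξ
    - (max (ξ - 1) 0 ^ 2 * (3 * (ξ + 3)) + max (ξ - 1) 0 ^ 3) / 4
    + (max (-ξ - 1) 0 ^ 2 * (3 * (3 - ξ)) + max (-ξ - 1) 0 ^ 3) / 4) ξ := by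
  have a1 := (hasDerivAt_max_pow 1 (ξ - 1)).comp ξ ((hasDerivAt_id ξ).sub_const 1)
  have a2 := (hasDerivAt_max_pow 1 (-ξ - 1)).comp ξ ((hasDerivAt_id ξ).neg.sub_const 1)
  have a3 := (((hasDerivAt_id ξ).pow 2).const_sub 1).pow 2
  have a4 := ((a3.div_const 4).sub ((a1.mul ((hasDerivAt_id ξ).add_const 3)).div_const 4)).sub
    ((a2.mul ((hasDerivAt_id ξ).const_sub 3)).div_const 4)
  have e : W = fun ξ => (1 - ξ ^ 2) ^ 2 / 4 - max (ξ - 1) 0 ^ 3 * (ξ + 3) / 4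
    - max (-ξ - 1) 0 ^ 3 * (3 - ξ) / 4 := funext W_eq
  rw [e]
  refine a4.congr_deriv ?_
  simp
  ring

theorem hasDerivAt_deriv_W (ξ : ℝ) : HasDerivAt (deriv W) (3 * ξ ^ 2 - 1
    - (max (ξ - 1) 0 * (6 * (ξ + 3)) + 6 * max (ξ - 1) 0 ^ 2) / 4
    - (max (-ξ - 1) 0 * (6 * (3 - ξ)) + 6 * max (-ξ - 1) 0 ^ 2) / 4) ξ := by
  have a1 := (hasDerivAt_max_pow 1 (ξ - 1)).comp ξ ((hasDerivAt_id ξ).sub_const 1)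
  have a2 := (hasDerivAt_max_pow 1 (-ξ - 1)).comp ξ ((hasDerivAt_id ξ).neg.sub_const 1)
  have b1 := (hasDerivAt_max_pow 0 (ξ - 1)).comp ξ ((hasDerivAt_id ξ).sub_const 1)
  have b2 := (hasDerivAt_max_pow 0 (-ξ - 1)).comp ξ ((hasDerivAt_id ξ).neg.sub_const 1)
  have a4 := ((((hasDerivAt_id ξ).pow 3).sub (hasDerivAt_id ξ)).sub
    (((b1.mul (((hasDerivAt_id ξ).add_const 3).const_mul 3)).add a1).div_const 4)).add
    (((b2.mul (((hasDerivAt_id ξ).const_sub 3).const_mul 3)).add a2).div_const 4)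
  have e : deriv W = fun ξ => ξ ^ 3 - ξ
    - (max (ξ - 1) 0 ^ 2 * (3 * (ξ + 3)) + max (ξ - 1) 0 ^ 3) / 4
    + (max (-ξ - 1) 0 ^ 2 * (3 * (3 - ξ)) + max (-ξ - 1) 0 ^ 3) / 4 :=
    funext fun ξ => (hasDerivAt_W ξ).deriv
  rw [e]
  refine a4.congr_deriv ?_
  simp
  ring

theorem deriv_deriv_W_le (ξ : ℝ) : deriv (deriv W) ξ ≤ 2 := by
  rw [(hasDerivAt_deriv_W ξ).deriv]
  rcases lt_or_ge ξ (-1) with h | h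
  · rw [max_eq_right (by linarith), max_eq_left (by linarith)]; nlinarith
  rcases le_or_gt ξ 1 with h' | h'
  · rw [max_eq_right (by linarith), max_eq_right (by linarith)]; nlinarith
  · rw [max_eq_left (by linarith), max_eq_right (by linarith)]; nlinarith

theorem abs_deriv_W_le (ξ : ℝ) : |deriv W ξ| ≤ 2 * |ξ| := by
  rw [(hasDerivAt_W ξ).deriv]
  rcases lt_or_ge ξ (-1) with h | h
  · rw [max_eq_right (by linarith), max_eq_left (by linarith), abs_of_nonpos (by linarith : ξ ≤ 0),
      abs_le]
    constructor <;> ring_nf <;> linarith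
  rcases le_or_gt ξ 1 with h' | h'
  · rw [max_eq_right (by linarith), max_eq_right (by linarith)]
    have e : ξ ^ 3 - ξ - ((0 : ℝ) ^ 2 * (3 * (ξ + 3)) + 0 ^ 3) / 4
        + (0 ^ 2 * (3 * (3 - ξ)) + 0 ^ 3) / 4 = ξ * (ξ ^ 2 - 1) := by ring
    rw [e, abs_mul, mul_comm]
    refine mul_le_mul_of_nonneg_right ?_ (abs_nonneg _)
    rw [abs_le]
    constructor <;> nlinarith
  · rw [max_eq_left (by linarith), max_eq_right (by linarith), abs_of_nonneg (by linarith : 0 ≤ ξ),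
      abs_le]
    constructor <;> ring_nf <;> linarith

theorem W_nonneg (ξ : ℝ) : 0 ≤ W ξ := by
  unfold W
  split_ifs <;> positivity

theorem W_le (ξ : ℝ) : W ξ ≤ 1 + ξ ^ 2 := by
  unfold W
  split_ifs with h1 h2
  · nlinarith
  · have : ξ ^ 2 ≤ 1 := by nlinarith
    nlinarith [sq_nonneg ξ]
  · nlinarith

theorem continuous_W : Continuous W :=
  Differentiable.continuous fun ξ => (hasDerivAt_W ξ).differentiableAt

theorem continuous_deriv_W : Continuous (deriv W) :=
  Differentiable.continuous fun ξ => (hasDerivAt_deriv_W ξ).differentiableAt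

/-- Second order Taylor expansion at the old value. The stabilisation `A (b - a)` absorbs the
remainder, so the explicit `W'(a)` can replace an implicit derivative without losing the energy
inequality. -/
theorem W_sub_le {A : ℝ} (hA : (1 / 2) * (⨆ ξ : ℝ, iteratedDeriv 2 W ξ) ≤ A) (a b : ℝ) :
    W b - W a ≤ (deriv W a + A * (b - a)) * (b - a) := by
  have e : iteratedDeriv 2 W = deriv (deriv W) := by
    rw [iteratedDeriv_succ, iteratedDeriv_one]
  rw [e] at hA
  -- The numerical bound `2` only certifies that the supremum is a genuine one; for an unbounded
  -- family `⨆` would take a default value.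
  have hb : BddAbove (range (deriv (deriv W))) := ⟨2, by rintro _ ⟨ξ, rfl⟩; exact deriv_deriv_W_le ξ⟩
  have := le_of_deriv_deriv_le (fun ξ => (hasDerivAt_W ξ).differentiableAt)
    (fun ξ => (hasDerivAt_deriv_W ξ).differentiableAt) (fun ξ => le_ciSup hb ξ) a b
  nlinarith [sq_nonneg (b - a)]

theorem hasDerivAt_Theta (θ ξ : ℝ) :
    HasDerivAt (Theta θ) (Real.cos θ / 2 * (Real.cos (Real.pi * ξ / 2) * (Real.pi / 2))) ξ := by
  have h : HasDerivAt (fun ξ : ℝ => Real.pi * ξ / 2) (Real.pi / 2) ξ := by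
    simpa using ((hasDerivAt_id ξ).const_mul Real.pi).div_const 2
  exact h.sin.const_mul _

theorem hasDerivAt_deriv_Theta (θ ξ : ℝ) : HasDerivAt (deriv (Theta θ))
    (Real.cos θ / 2 * (-Real.sin (Real.pi * ξ / 2) * (Real.pi / 2) * (Real.pi / 2))) ξ := by
  have h : HasDerivAt (fun ξ : ℝ => Real.pi * ξ / 2) (Real.pi / 2) ξ := by
    simpa using ((hasDerivAt_id ξ).const_mul Real.pi).div_const 2
  have e : deriv (Theta θ) =
      fun ξ => Real.cos θ / 2 * (Real.cos (Real.pi * ξ / 2) * (Real.pi / 2)) :=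
    funext fun ξ => (hasDerivAt_Theta θ ξ).deriv
  rw [e]
  exact (h.cos.mul_const _).const_mul _

theorem abs_Theta_le (θ ξ : ℝ) : |Theta θ ξ| ≤ 1 / 2 := by
  unfold Theta
  rw [abs_mul, abs_div]
  have h1 := Real.abs_cos_le_one θ
  have h2 := Real.abs_sin_le_one (Real.pi * ξ / 2)
  have h3 : |(2 : ℝ)| = 2 := abs_of_pos two_pos
  rw [h3]
  nlinarith [abs_nonneg (Real.cos θ), abs_nonneg (Real.sin (Real.pi * ξ / 2))]

theorem abs_deriv_Theta_le (θ ξ : ℝ) : |deriv (Theta θ) ξ| ≤ Real.pi / 4 := by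
  rw [(hasDerivAt_Theta θ ξ).deriv, abs_mul, abs_div, abs_mul, abs_of_pos (two_pos (α := ℝ)),
    abs_of_pos (half_pos Real.pi_pos)]
  have h1 := Real.abs_cos_le_one θ
  have h2 := Real.abs_cos_le_one (Real.pi * ξ / 2)
  have hpi := Real.pi_pos
  calc |Real.cos θ| / 2 * (|Real.cos (Real.pi * ξ / 2)| * (Real.pi / 2))
      ≤ 1 / 2 * (1 * (Real.pi / 2)) := by gcongr
    _ = Real.pi / 4 := by ring

theorem continuous_Theta (θ : ℝ) : Continuous (Theta θ) :=
  Differentiable.continuous fun ξ => (hasDerivAt_Theta θ ξ).differentiableAt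

theorem continuous_deriv_Theta (θ : ℝ) : Continuous (deriv (Theta θ)) :=
  Differentiable.continuous fun ξ => (hasDerivAt_deriv_Theta θ ξ).differentiableAt

theorem Theta_sub_le {θ B : ℝ} (hB : (1 / 2) * (⨆ ξ : ℝ, iteratedDeriv 2 (Theta θ) ξ) ≤ B)
    (a b : ℝ) : Theta θ b - Theta θ a ≤ (deriv (Theta θ) a + B * (b - a)) * (b - a) := by
  have e : iteratedDeriv 2 (Theta θ) = deriv (deriv (Theta θ)) := by
    rw [iteratedDeriv_succ, iteratedDeriv_one]
  rw [e] at hB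
  have hb : BddAbove (range (deriv (deriv (Theta θ)))) := by
    refine ⟨|Real.cos θ / 2| * (1 * (Real.pi / 2) * (Real.pi / 2)), ?_⟩
    rintro _ ⟨ξ, rfl⟩
    rw [(hasDerivAt_deriv_Theta θ ξ).deriv]
    refine (le_abs_self _).trans ?_
    rw [abs_mul, abs_mul, abs_mul, abs_neg, abs_of_pos (half_pos Real.pi_pos)]
    have hpi := Real.pi_pos
    gcongr
    exact Real.abs_sin_le_one _
  have := le_of_deriv_deriv_le (fun ξ => (hasDerivAt_Theta θ ξ).differentiableAt)
    (fun ξ => (hasDerivAt_deriv_Theta θ ξ).differentiableAt) (fun ξ => le_ciSup hb ξ) a b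
  nlinarith [sq_nonneg (b - a)]

/-- Fundamental theorem of calculus along the segment from `b` to `a`. This exact chain rule is what
lets the `|∇V|²` term in the chemical potential cancel the change of the permittivity in the
electric energy. -/
theorem Model.calE_mul_sub (P : Model) (a b : ℝ) : P.calE a b * (a - b) = P.eps a - P.eps b := by
  obtain ⟨h1, -⟩ := P.eps_mat
  have hd : ∀ s : ℝ, HasDerivAt (fun s => P.eps (s * a + (1 - s) * b))
      (deriv P.eps (s * a + (1 - s) * b) * (a - b)) s := by
    intro s
    have h2 : HasDerivAt (fun s : ℝ => s * a + (1 - s) * b) (a - b) s := by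
      have := ((hasDerivAt_id s).mul_const a).add (((hasDerivAt_id s).const_sub 1).mul_const b)
      refine this.congr_deriv ?_
      ring
    exact ((h1.differentiable one_ne_zero _).hasDerivAt).comp s h2
  have hc : Continuous fun s : ℝ => deriv P.eps (s * a + (1 - s) * b) :=
    (h1.continuous_deriv le_rfl).comp (by fun_prop)
  unfold Model.calE
  rw [← intervalIntegral.integral_mul_const, intervalIntegral.integral_eq_sub_of_hasDerivAt
    (fun s _ => hd s) ((hc.mul continuous_const).intervalIntegrable _ _)]
  simp

end Electrowetting

namespace Electrowetting

/-! ### Calculus in `H¹` -/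

section

variable {d : ℕ} {Ω : Set (E d)}

theorem measurable_fn (v : H1 Ω) : Measurable (fn v) := (Lp.stronglyMeasurable v.1.1).measurable

theorem measurable_tr (v : H1 Ω) : Measurable (tr v) := (Lp.stronglyMeasurable v.1.2.2).measurable

theorem fn_add (v w : H1 Ω) : fn (v + w) =ᵐ[vol Ω] fun x => fn v x + fn w x :=
  Lp.coeFn_add v.1.1 w.1.1

theorem fn_sub (v w : H1 Ω) : fn (v - w) =ᵐ[vol Ω] fun x => fn v x - fn w x :=
  Lp.coeFn_sub v.1.1 w.1.1

theorem fn_smul (c : ℝ) (v : H1 Ω) : fn (c • v) =ᵐ[vol Ω] fun x => c * fn v x :=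
  Lp.coeFn_smul c v.1.1

theorem grad_add (v w : H1 Ω) : grad (v + w) =ᵐ[vol Ω] fun x => grad v x + grad w x :=
  Lp.coeFn_add v.1.2.1 w.1.2.1

theorem grad_sub (v w : H1 Ω) : grad (v - w) =ᵐ[vol Ω] fun x => grad v x - grad w x :=
  Lp.coeFn_sub v.1.2.1 w.1.2.1

theorem grad_smul (c : ℝ) (v : H1 Ω) : grad (c • v) =ᵐ[vol Ω] fun x => c • grad v x :=
  Lp.coeFn_smul c v.1.2.1

theorem grad_zero : grad (0 : H1 Ω) =ᵐ[vol Ω] 0 := Lp.coeFn_zero (E d) 2 (vol Ω)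

theorem tr_sub (v w : H1 Ω) : tr (v - w) =ᵐ[surf Ω] fun x => tr v x - tr w x :=
  Lp.coeFn_sub v.1.2.2 w.1.2.2

theorem tr_smul (c : ℝ) (v : H1 Ω) : tr (c • v) =ᵐ[surf Ω] fun x => c * tr v x :=
  Lp.coeFn_smul c v.1.2.2

theorem normL2_nonneg (v : H1 Ω) : 0 ≤ normL2 v := norm_nonneg _

theorem normGrad_nonneg (v : H1 Ω) : 0 ≤ normGrad v := norm_nonneg _

theorem integral_inner_self_eq_norm_sq {α F : Type*} [MeasurableSpace α] [NormedAddCommGroup F]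
    [InnerProductSpace ℝ F] {μ : Measure α} (f : Lp F 2 μ) : ∫ x, ‖f x‖ ^ 2 ∂μ = ‖f‖ ^ 2 := by
  rw [← real_inner_self_eq_norm_sq, L2.inner_def]
  simp_rw [real_inner_self_eq_norm_sq]

theorem normL2_sq (v : H1 Ω) : normL2 v ^ 2 = ∫ x in Ω, fn v x ^ 2 := by
  rw [normL2, ← integral_inner_self_eq_norm_sq]
  simp_rw [Real.norm_eq_abs, sq_abs]
  rfl

theorem normGrad_sq (v : H1 Ω) : normGrad v ^ 2 = ∫ x in Ω, ‖grad v x‖ ^ 2 := by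
  rw [normGrad, ← integral_inner_self_eq_norm_sq]
  rfl

theorem normGrad_le_normH1 (v : H1 Ω) : normGrad v ≤ normH1 v :=
  Real.le_sqrt_of_sq_le (le_add_of_nonneg_left (sq_nonneg _))

theorem normH1_nonneg (v : H1 Ω) : 0 ≤ normH1 v := Real.sqrt_nonneg _

theorem vecNormL2_sq (u : VecH1 Ω) : vecNormL2 u ^ 2 = ∑ i, normL2 (u i) ^ 2 :=
  Real.sq_sqrt (Finset.sum_nonneg fun _ _ => sq_nonneg _)

theorem integrable_fn_sq (v : H1 Ω) : Integrable (fun x => fn v x ^ 2) (vol Ω) :=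
  (memLp_fn v).integrable_sq

theorem integrable_norm_grad_sq (v : H1 Ω) : Integrable (fun x => ‖grad v x‖ ^ 2) (vol Ω) :=
  (memLp_grad v).norm.integrable_sq

theorem integrable_inner_of_memLp {α F : Type*} [MeasurableSpace α] [NormedAddCommGroup F]
    [InnerProductSpace ℝ F] {μ : Measure α} {f g : α → F} (hf : MemLp f 2 μ) (hg : MemLp g 2 μ) :
    Integrable (fun x => inner ℝ (f x) (g x)) μ := by
  refine (hf.norm.integrable_mul hg.norm).mono (hf.1.inner hg.1) (Eventually.of_forall fun x => ?_)
  rw [Pi.mul_apply, norm_mul, norm_norm, norm_norm]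
  exact norm_inner_le_norm _ _

theorem integral_inner_le {α F : Type*} [MeasurableSpace α] [NormedAddCommGroup F]
    [InnerProductSpace ℝ F] {μ : Measure α} {f g : α → F} (hf : MemLp f 2 μ) (hg : MemLp g 2 μ)
    {a : α → ℝ} {M : ℝ} (hM : 0 ≤ M) (ha : ∀ x, |a x| ≤ M) :
    |∫ x, a x * inner ℝ (f x) (g x) ∂μ| ≤
      M * (√(∫ x, ‖f x‖ ^ 2 ∂μ) * √(∫ x, ‖g x‖ ^ 2 ∂μ)) := by
  have h1 : |∫ x, a x * inner ℝ (f x) (g x) ∂μ| ≤ ∫ x, M * (‖f x‖ * ‖g x‖) ∂μ := by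
    rw [← Real.norm_eq_abs]
    refine norm_integral_le_of_norm_le ((hf.norm.integrable_mul hg.norm).const_mul M)
      (Eventually.of_forall fun x => ?_)
    rw [norm_mul]
    exact mul_le_mul (ha x) (norm_inner_le_norm _ _) (norm_nonneg _) hM
  refine h1.trans ?_
  rw [integral_const_mul]
  refine mul_le_mul_of_nonneg_left ?_ hM
  have h2 := integral_mul_norm_le_Lp_mul_Lq (μ := μ) (f := f) (g := g)
    Real.HolderConjugate.two_two (by simpa using hf) (by simpa using hg)
  simpa [Real.sqrt_eq_rpow] using h2

theorem IsMaterial.continuous {σ : ℝ → ℝ} (h : IsMaterial σ) :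
    Continuous σ := h.1.continuous

theorem IsMaterial.pos {σ : ℝ → ℝ} (h : IsMaterial σ) (ξ : ℝ) : 0 < σ ξ := by
  obtain ⟨_, m, M, hm, hM⟩ := h
  exact hm.trans_le (hM ξ).1

theorem IsMaterial.integrable_mul {α : Type*} [MeasurableSpace α] {μ : Measure α} {σ : ℝ → ℝ}
    (h : IsMaterial σ) {φ g : α → ℝ} (hφ : Measurable φ) (hg : Integrable g μ) :
    Integrable (fun x => σ (φ x) * g x) μ := by
  obtain ⟨hc, m, M, hm, hM⟩ := h
  refine hg.bdd_mul (c := M) (hc.continuous.measurable.comp hφ).aestronglyMeasurable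
    (Eventually.of_forall fun x => ?_)
  rw [Real.norm_eq_abs, abs_of_pos (hm.trans_le (hM _).1)]
  exact (hM _).2.1

end

/-! ### Bounds and integrability for the coefficients of the model -/

section

variable {d : ℕ} (G : Geometry d) (P : Model)

theorem Geometry.bounded_Ω (G : Geometry d) : Bornology.IsBounded G.Ω :=
  G.bounded_Ωs.subset G.subset

theorem Geometry.nonempty_Ωs (G : Geometry d) : G.Ωs.Nonempty := G.nonempty_Ω.mono G.subset

theorem vol_mono_subset (G : Geometry d) : vol G.Ω ≤ vol G.Ωs :=
  Measure.restrict_mono G.subset le_rfl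

theorem memLp_grad_restrict (w : H1 G.Ωs) : MemLp (grad w) 2 (vol G.Ω) :=
  (memLp_grad w).mono_measure (vol_mono_subset G)

theorem measurable_epsStar (φ : H1 G.Ω) : Measurable (epsStar G P φ) :=
  Measurable.ite G.open_Ω.measurableSet (P.eps_mat.continuous.measurable.comp (measurable_fn φ))
    measurable_const

theorem exists_epsStar_bounds : ∃ m M : ℝ, 0 < m ∧ 0 < M ∧ ∀ (φ : H1 G.Ω) (x : E d),
    m ≤ epsStar G P φ x ∧ epsStar G P φ x ≤ M := by
  obtain ⟨_, m, M, hm, hM⟩ := P.eps_mat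
  refine ⟨min m P.epsD, max M P.epsD, lt_min hm P.epsD_pos, lt_max_of_lt_right P.epsD_pos,
    fun φ x => ?_⟩
  unfold epsStar
  split_ifs with h
  · exact ⟨(min_le_left _ _).trans (hM _).1, (hM _).2.1.trans (le_max_left _ _)⟩
  · exact ⟨min_le_right _ _, le_max_right _ _⟩

theorem integrable_epsStar_mul (φ : H1 G.Ω) {μ : Measure (E d)} {g : E d → ℝ}
    (hg : Integrable g μ) : Integrable (fun x => epsStar G P φ x * g x) μ := by
  obtain ⟨m, M, hm, hM0, hM⟩ := exists_epsStar_bounds G P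
  refine hg.bdd_mul (c := M) (measurable_epsStar G P φ).aestronglyMeasurable
    (Eventually.of_forall fun x => ?_)
  rw [Real.norm_eq_abs, abs_of_pos (hm.trans_le (hM φ x).1)]
  exact (hM φ x).2

theorem memLp_trVec {Ω : Set (E d)} (u : VecH1 Ω) : MemLp (trVec u) 2 (surf Ω) := by
  have h : ∀ i, MemLp (fun x => tr (u i) x • unitVec i) 2 (surf Ω) := fun i =>
    MemLp.of_le (memLp_tr (u i)) ((measurable_tr (u i)).smul_const _).aestronglyMeasurable
      (Eventually.of_forall fun x => by simp [norm_smul])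
  refine (memLp_finsetSum Finset.univ fun i _ => h i).ae_eq (Eventually.of_forall fun x => ?_)
  ext k
  simp [trVec, Pi.single_apply]

theorem Model.continuous_psi : Continuous P.ψ := by
  unfold Model.ψ
  fun_prop

theorem Model.abs_psi_le (ξ : ℝ) : |P.ψ ξ| ≤ 1 / P.len * (1 / P.δ) := by
  have h1 := P.len_pos
  have h2 := P.δ_pos
  unfold Model.ψ
  rw [abs_of_pos (by positivity)]
  refine mul_le_of_le_one_right (by positivity) (Real.exp_le_one_iff.2 ?_)
  rw [neg_div]
  exact neg_nonpos.2 (by positivity)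

theorem memLp_slip (u : VecH1 G.Ω) (φ : H1 G.Ω) : MemLp (slip G P u φ) 2 (surf G.Ω) := by
  have h1 : AEStronglyMeasurable (slip G P u φ) (surf G.Ω) :=
    ((memLp_trVec u).1.inner G.tau_meas).mul
      (P.continuous_psi.measurable.comp (measurable_tr φ)).aestronglyMeasurable
  refine MemLp.of_le_mul (memLp_trVec u) (c := 1 / P.len * (1 / P.δ)) h1 ?_
  filter_upwards [G.tau_unit] with x hx
  unfold slip
  rw [norm_mul, mul_comm]
  refine mul_le_mul (P.abs_psi_le _) ?_ (norm_nonneg _) ?_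
  · have := norm_inner_le_norm (𝕜 := ℝ) (trVec u x) (G.tau x)
    rwa [hx.1, mul_one] at this
  · have h1 := P.len_pos
    have h2 := P.δ_pos
    positivity

theorem integrable_W {Ω : Set (E d)} (hb : Bornology.IsBounded Ω) (φ : H1 Ω) :
    Integrable (fun x => W (fn φ x)) (vol Ω) := by
  have : IsFiniteMeasure (vol Ω) := ⟨by simpa using hb.measure_lt_top⟩
  refine ((integrable_const (1 : ℝ)).add (integrable_fn_sq φ)).mono'
    (continuous_W.measurable.comp (measurable_fn φ)).aestronglyMeasurable
    (Eventually.of_forall fun x => ?_)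
  rw [Real.norm_of_nonneg (W_nonneg _)]
  exact W_le _

theorem memLp_deriv_W {Ω : Set (E d)} (φ : H1 Ω) :
    MemLp (fun x => deriv W (fn φ x)) 2 (vol Ω) :=
  MemLp.of_le_mul (memLp_fn φ) (c := 2)
    (continuous_deriv_W.measurable.comp (measurable_fn φ)).aestronglyMeasurable
    (Eventually.of_forall fun _ => abs_deriv_W_le _)

theorem isFiniteMeasure_surf (hd : 0 < d) {Ω : Set (E d)} (hΩ : IsOpen Ω)
    (hc : Convex ℝ Ω) (hb : Bornology.IsBounded Ω) (hne : Ω.Nonempty) :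
    IsFiniteMeasure (surf Ω) := ⟨surf_univ_lt_top hd hΩ hc hb hne⟩

theorem integrable_Theta {Ω : Set (E d)} [IsFiniteMeasure (surf Ω)] (θ : ℝ) (φ : H1 Ω) :
    Integrable (fun x => Theta θ (tr φ x)) (surf Ω) :=
  (integrable_const (1 / 2 : ℝ)).mono'
    ((continuous_Theta θ).measurable.comp (measurable_tr φ)).aestronglyMeasurable
    (Eventually.of_forall fun _ => abs_Theta_le _ _)

theorem memLp_deriv_Theta {Ω : Set (E d)} [IsFiniteMeasure (surf Ω)] (θ : ℝ) (φ : H1 Ω) :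
    MemLp (fun x => deriv (Theta θ) (tr φ x)) 2 (surf Ω) :=
  MemLp.of_le (memLp_const (Real.pi / 4))
    ((continuous_deriv_Theta θ).measurable.comp (measurable_tr φ)).aestronglyMeasurable
    (Eventually.of_forall fun x => by
      rw [Real.norm_eq_abs, Real.norm_eq_abs]
      exact (abs_deriv_Theta_le _ _).trans (le_abs_self _))

end

end Electrowetting

namespace Electrowetting

/-! ### The energy balance of one time step -/

variable {d : ℕ} {G : Geometry d} {P : Model}

/-- The kinetic energy. -/
noncomputable def kinetic (G : Geometry d) (P : Model) (φ : H1 G.Ω) (u : VecH1 G.Ω) : ℝ :=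
  1 / 2 * ∫ x in G.Ω, P.ρ (fn φ x) * ∑ i, fn (u i) x ^ 2

/-- The bilinear form `⟨ε^⋆(φ) ∇V, ∇Z⟩`. -/
noncomputable def electric (G : Geometry d) (P : Model) (φ : H1 G.Ω) (V Z : H1 G.Ωs) : ℝ :=
  ∫ x in G.Ωs, epsStar G P φ x * inner ℝ (grad V x) (grad Z x)

theorem integral_sub_add {α : Type*} [MeasurableSpace α] {μ : Measure α} {f g h : α → ℝ}
    (hf : Integrable f μ) (hg : Integrable g μ) (hh : Integrable h μ) :
    ∫ x, f x ∂μ - ∫ x, g x ∂μ + ∫ x, h x ∂μ = ∫ x, f x - g x + h x ∂μ := by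
  rw [← integral_sub hf hg, ← integral_add (f := fun x => f x - g x) (hf.sub hg) hh]

theorem integrable_sum_fn_sq (u : VecH1 G.Ω) :
    Integrable (fun x => ∑ i, fn (u i) x ^ 2) (vol G.Ω) :=
  integrable_finsetSum _ fun i _ => integrable_fn_sq (u i)

/-- Pointwise, `((ρ' + ρ)/2 u' - ρ u) · u' = ½ρ'|u'|² - ½ρ|u|² + ½ρ|u' - u|²`, where `ρ'` is the
density at the new level. The averaged density makes this an identity. -/
theorem integral_momentum_eq (φ φ' : H1 G.Ω) (u u' : VecH1 G.Ω) (dt : ℝ) :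
    ∫ x in G.Ω, ∑ i, ((P.ρ (fn φ' x) + P.ρ (fn φ x)) / 2 * fn (u' i) x
      - P.ρ (fn φ x) * fn (u i) x) / dt * fn (u' i) x
    = 1 / dt * (kinetic G P φ' u' - kinetic G P φ u + kinetic G P φ (u' - u)) := by
  have i1 := (P.ρ_mat.integrable_mul (measurable_fn φ') (integrable_sum_fn_sq u')).const_mul (1 / 2)
  have i2 := (P.ρ_mat.integrable_mul (measurable_fn φ) (integrable_sum_fn_sq u)).const_mul (1 / 2)
  have i3 := (P.ρ_mat.integrable_mul (measurable_fn φ)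
    (integrable_sum_fn_sq (u' - u))).const_mul (1 / 2)
  unfold kinetic
  rw [← integral_const_mul, ← integral_const_mul, ← integral_const_mul, integral_sub_add i1 i2 i3,
    ← integral_const_mul]
  have hs : ∀ᵐ x ∂(vol G.Ω), ∀ i, fn ((u' - u) i) x = fn (u' i) x - fn (u i) x :=
    ae_all_iff.2 fun i => fn_sub (u' i) (u i)
  refine integral_congr_ae (hs.mono fun x hx => ?_)
  simp only [hx, Finset.mul_sum, ← Finset.sum_sub_distrib, ← Finset.sum_add_distrib]
  refine Finset.sum_congr rfl fun i _ => ?_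
  ring

theorem convective_eq_zero (hd : d = 2 ∨ d = 3) {u : VecH1 G.Ω} (hu : NormalTraceZero u)
    (φ : H1 G.Ω) (w : VecH1 G.Ω) :
    (∫ x in G.Ω, P.ρ (fn φ x) * ∑ i, (∑ j, fn (u j) x * grad (w i) x j) * fn (w i) x)
      + 1 / 2 * (∫ x in G.Ω, divFlux G P φ u x * ∑ i, fn (w i) x * fn (w i) x) = 0 := by
  have h := fun i => convective_identity hd G.open_Ω G.convex_Ω G.bounded_Ω G.nonempty_Ω P.ρ_mat hu φ
    (w i)
  have h2 : ∀ i, Integrable (fun x => divFlux G P φ u x * (fn (w i) x * fn (w i) x)) (vol G.Ω) :=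
    fun i => (h i).2.1
  simp_rw [Finset.mul_sum]
  rw [integral_finsetSum _ fun i _ => (h i).1, integral_finsetSum _ fun i _ => h2 i,
    Finset.mul_sum, ← Finset.sum_add_distrib]
  exact Finset.sum_eq_zero fun i _ => (h i).2.2

section

variable {A B dt : ℝ} {N : ℕ} {S : Spaces G} {Vbar : ℕ → H1 G.Ωs} {s : Approx G}

/-- The velocity equation is tested with the new velocity. The pressure term vanishes because the
new pressure is admissible in the incompressibility equation, and the convective terms vanish
because the old velocity is tangential on the boundary. -/
theorem IsSolution.velocity_energy (hd : d = 2 ∨ d = 3)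
    (H : IsSolution G P A B dt N S Vbar s) {n : ℕ} (hn : n < N) :
    1 / dt * (kinetic G P (s.φ (n + 1)) (s.u (n + 1)) - kinetic G P (s.φ n) (s.u n)
        + kinetic G P (s.φ n) (s.u (n + 1) - s.u n))
      + (∫ x in G.Ω, P.η (fn (s.φ n) x) * ∑ i, ∑ j, symGrad (s.u (n + 1)) x i j ^ 2)
      + (∫ x, P.β (tr (s.φ n) x) * ‖tang (s.u (n + 1)) x‖ ^ 2 ∂(surf G.Ω))
      + P.α * (∫ x, slip G P (s.u (n + 1)) (s.φ n) x ^ 2 ∂(surf G.Ω))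
    = (∫ x in G.Ω, fn (s.μ (n + 1)) x * ∑ i, grad (s.φ n) x i * fn (s.u (n + 1) i) x)
      - (∫ x in G.Ω, fn (s.q n) x *
          ∑ i, (P.lam * grad (s.q (n + 1)) x i + grad (s.V (n + 1)) x i) * fn (s.u (n + 1) i) x)
      + 1 / 2 * (∫ x in G.Ω, deriv P.ρ (fn (s.φ n) x) *
          ((fn (s.φ (n + 1)) x - fn (s.φ n) x) / dt) *
            ∑ i, fn (s.u n i) x * fn (s.u (n + 1) i) x)
      - P.α * (∫ x, (tr (s.φ (n + 1)) x - tr (s.φ n) x) / dt *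
          slip G P (s.u (n + 1)) (s.φ n) x ∂(surf G.Ω)) := by
  have h := H.velocity n hn _ (H.u_mem (n + 1) hn)
  have hp := H.pressure n hn _ (H.p_mem n hn)
  have hc := convective_eq_zero (P := P) hd (S.Xh_normal _ (H.u_mem n hn.le)) (s.φ n) (s.u (n + 1))
  rw [integral_momentum_eq, hp] at h
  simp only [real_inner_self_eq_norm_sq, ← pow_two] at h hc
  linarith

/-- Testing with the difference quotient of `φ` turns each potential term into an increment: exactly
for the gradient and for `ε`, as an inequality for `W` and `Θ`. -/
theorem IsSolution.chemical_energy [IsFiniteMeasure (surf G.Ω)]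
    (hA : (1 / 2) * (⨆ ξ : ℝ, iteratedDeriv 2 W ξ) ≤ A)
    (hB : (1 / 2) * (⨆ ξ : ℝ, iteratedDeriv 2 (Theta P.θ) ξ) ≤ B) (hdt : 0 < dt)
    (H : IsSolution G P A B dt N S Vbar s) {n : ℕ} (hn : n < N) :
    P.γ / P.δ * ((∫ x in G.Ω, W (fn (s.φ (n + 1)) x)) - ∫ x in G.Ω, W (fn (s.φ n) x))
      + P.γ * P.δ * (1 / 2 * normGrad (s.φ (n + 1)) ^ 2 - 1 / 2 * normGrad (s.φ n) ^ 2
        + 1 / 2 * normGrad (s.φ (n + 1) - s.φ n) ^ 2)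
      - 1 / 2 * (∫ x in G.Ω, (P.eps (fn (s.φ (n + 1)) x) - P.eps (fn (s.φ n) x)) *
          ‖grad (s.V (n + 1)) x‖ ^ 2)
      + dt * (1 / 2 * ∫ x in G.Ω, deriv P.ρ (fn (s.φ n) x) *
          ((fn (s.φ (n + 1)) x - fn (s.φ n) x) / dt) *
            ∑ i, fn (s.u n i) x * fn (s.u (n + 1) i) x)
      + dt * (P.α * ∫ x, ((tr (s.φ (n + 1)) x - tr (s.φ n) x) / dt
          + slip G P (s.u (n + 1)) (s.φ n) x) * ((tr (s.φ (n + 1)) x - tr (s.φ n) x) / dt)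
            ∂(surf G.Ω))
      + P.γ * ((∫ x, Theta P.θ (tr (s.φ (n + 1)) x) ∂(surf G.Ω))
          - ∫ x, Theta P.θ (tr (s.φ n) x) ∂(surf G.Ω))
    ≤ dt * ∫ x in G.Ω, fn (s.μ (n + 1)) x * ((fn (s.φ (n + 1)) x - fn (s.φ n) x) / dt) := by
  set φ := s.φ n
  set φ' := s.φ (n + 1)
  set V' := s.V (n + 1)
  set χ : H1 G.Ω := dt⁻¹ • (φ' - φ) with hχ
  have hχm : χ ∈ S.Qh := S.Qh.smul_mem _ (S.Qh.sub_mem (H.φ_mem _ hn) (H.φ_mem _ hn.le))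
  have cf : fn χ =ᵐ[vol G.Ω] fun x => (fn φ' x - fn φ x) / dt := by
    filter_upwards [fn_smul dt⁻¹ (φ' - φ), fn_sub φ' φ] with x h1 h2
    rw [h1, h2]; ring
  have cg : grad χ =ᵐ[vol G.Ω] fun x => dt⁻¹ • (grad φ' x - grad φ x) := by
    filter_upwards [grad_smul dt⁻¹ (φ' - φ), grad_sub φ' φ] with x h1 h2
    rw [h1, h2]
  have ct : tr χ =ᵐ[surf G.Ω] fun x => (tr φ' x - tr φ x) / dt := by
    filter_upwards [tr_smul dt⁻¹ (φ' - φ), tr_sub φ' φ] with x h1 h2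
    rw [h1, h2]; ring
  have iV : Integrable (fun x => ‖grad V' x‖ ^ 2) (vol G.Ω) :=
    (memLp_grad_restrict G V').norm.integrable_sq
  have e3 : (fun x => P.calE (fn φ' x) (fn φ x) * ‖grad V' x‖ ^ 2 * fn χ x) =ᵐ[vol G.Ω]
      fun x => dt⁻¹ * ((P.eps (fn φ' x) - P.eps (fn φ x)) * ‖grad V' x‖ ^ 2) := by
    filter_upwards [cf] with x hx
    rw [hx, ← P.calE_mul_sub]
    ring
  -- The test function may be unbounded, but after multiplication by `calE` the increment of `φ`
  -- becomes an increment of the bounded function `ε`; hence the integrability condition of the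
  -- equation is met.
  have i3 : Integrable (fun x => (P.eps (fn φ' x) - P.eps (fn φ x)) * ‖grad V' x‖ ^ 2)
      (vol G.Ω) := by
    refine ((P.eps_mat.integrable_mul (measurable_fn φ') iV).sub
      (P.eps_mat.integrable_mul (measurable_fn φ) iV)).congr (Eventually.of_forall fun x => ?_)
    simp only [Pi.sub_apply]
    ring
  have h := H.chemical n hn χ hχm ((i3.const_mul dt⁻¹).congr e3.symm)
  have t0 : ∫ x in G.Ω, fn (s.μ (n + 1)) x * fn χ x
      = ∫ x in G.Ω, fn (s.μ (n + 1)) x * ((fn φ' x - fn φ x) / dt) :=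
    integral_congr_ae (cf.mono fun x hx => by simp only [hx])
  have hdφ : MemLp (fun x => fn φ' x - fn φ x) 2 (vol G.Ω) := (memLp_fn φ').sub (memLp_fn φ)
  have hdt' : MemLp (fun x => tr φ' x - tr φ x) 2 (surf G.Ω) := (memLp_tr φ').sub (memLp_tr φ)
  have t1 : (∫ x in G.Ω, W (fn φ' x)) - (∫ x in G.Ω, W (fn φ x))
      ≤ dt * ∫ x in G.Ω, (deriv W (fn φ x) + A * (fn φ' x - fn φ x)) * fn χ x := by
    rw [← integral_sub (integrable_W G.bounded_Ω φ') (integrable_W G.bounded_Ω φ),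
      ← integral_const_mul]
    have e : (fun x => (deriv W (fn φ x) + A * (fn φ' x - fn φ x)) * (fn φ' x - fn φ x))
        =ᵐ[vol G.Ω] fun x => dt * ((deriv W (fn φ x) + A * (fn φ' x - fn φ x)) * fn χ x) := by
      filter_upwards [cf] with x hx
      rw [hx]; field_simp
    have i : Integrable (fun x => (deriv W (fn φ x) + A * (fn φ' x - fn φ x))
        * (fn φ' x - fn φ x)) (vol G.Ω) :=
      ((memLp_deriv_W φ).add (hdφ.const_mul A)).integrable_mul hdφ
    rw [← integral_congr_ae e]
    exact integral_mono ((integrable_W G.bounded_Ω φ').sub (integrable_W G.bounded_Ω φ)) i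
      fun x => W_sub_le hA _ _
  have t2 : 1 / 2 * normGrad φ' ^ 2 - 1 / 2 * normGrad φ ^ 2 + 1 / 2 * normGrad (φ' - φ) ^ 2
      = dt * ∫ x in G.Ω, inner ℝ (grad φ' x) (grad χ x) := by
    rw [normGrad_sq, normGrad_sq, normGrad_sq, ← integral_const_mul, ← integral_const_mul,
      ← integral_const_mul, ← integral_const_mul,
      integral_sub_add ((integrable_norm_grad_sq φ').const_mul _)
        ((integrable_norm_grad_sq φ).const_mul _) ((integrable_norm_grad_sq (φ' - φ)).const_mul _)]
    refine integral_congr_ae ?_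
    filter_upwards [cg, grad_sub φ' φ] with x h1 h2
    rw [h1, h2, inner_smul_right, mul_inv_cancel_left₀ hdt.ne', norm_sub_sq_real, inner_sub_right,
      real_inner_self_eq_norm_sq]
    ring
  have t3 : ∫ x in G.Ω, (P.eps (fn φ' x) - P.eps (fn φ x)) * ‖grad V' x‖ ^ 2
      = dt * ∫ x in G.Ω, P.calE (fn φ' x) (fn φ x) * ‖grad V' x‖ ^ 2 * fn χ x := by
    rw [integral_congr_ae e3, integral_const_mul, mul_inv_cancel_left₀ hdt.ne']
  have t4 : ∫ x in G.Ω, deriv P.ρ (fn φ x) * ((fn φ' x - fn φ x) / dt) *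
        ∑ i, fn (s.u n i) x * fn (s.u (n + 1) i) x
      = ∫ x in G.Ω, deriv P.ρ (fn φ x) *
        (∑ i, fn (s.u n i) x * fn (s.u (n + 1) i) x) * fn χ x :=
    integral_congr_ae (cf.mono fun x hx => by simp only [hx]; ring)
  have t5 : ∫ x, ((tr φ' x - tr φ x) / dt + slip G P (s.u (n + 1)) φ x) * ((tr φ' x - tr φ x) / dt)
        ∂(surf G.Ω)
      = ∫ x, ((tr φ' x - tr φ x) / dt + slip G P (s.u (n + 1)) φ x) * tr χ x ∂(surf G.Ω) :=
    integral_congr_ae (ct.mono fun x hx => by simp only [hx])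
  have t6 : (∫ x, Theta P.θ (tr φ' x) ∂(surf G.Ω)) - (∫ x, Theta P.θ (tr φ x) ∂(surf G.Ω))
      ≤ dt * ∫ x, (deriv (Theta P.θ) (tr φ x) + B * (tr φ' x - tr φ x)) * tr χ x
        ∂(surf G.Ω) := by
    rw [← integral_sub (integrable_Theta P.θ φ') (integrable_Theta P.θ φ),
      ← integral_const_mul]
    have e : (fun x => (deriv (Theta P.θ) (tr φ x) + B * (tr φ' x - tr φ x))
          * (tr φ' x - tr φ x)) =ᵐ[surf G.Ω]
        fun x => dt * ((deriv (Theta P.θ) (tr φ x) + B * (tr φ' x - tr φ x)) * tr χ x) := by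
      filter_upwards [ct] with x hx
      rw [hx]; field_simp
    have i : Integrable (fun x => (deriv (Theta P.θ) (tr φ x) + B * (tr φ' x - tr φ x))
          * (tr φ' x - tr φ x)) (surf G.Ω) :=
      ((memLp_deriv_Theta P.θ φ).add (hdt'.const_mul B)).integrable_mul hdt'
    rw [← integral_congr_ae e]
    exact integral_mono ((integrable_Theta P.θ φ').sub (integrable_Theta P.θ φ)) i
      fun x => Theta_sub_le hB _ _
  rw [← t0, h, t2, t3, t4, t5]
  have u1 := mul_le_mul_of_nonneg_left t1 (div_nonneg P.γ_pos.le P.δ_pos.le)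
  have u2 := mul_le_mul_of_nonneg_left t6 P.γ_pos.le
  linarith

theorem memLp_fn_mul_fn (hd : d = 2 ∨ d = 3) (v w : H1 G.Ω) :
    MemLp (fun x => fn v x * fn w x) 2 (vol G.Ω) := by
  have : IsFiniteMeasure (vol G.Ω) := ⟨by simpa using G.bounded_Ω.measure_lt_top⟩
  have := holderTriple_four_four_two
  have h6 := fun v : H1 G.Ω =>
    (memLp_fn_six hd G.open_Ω G.convex_Ω G.bounded_Ω G.nonempty_Ω v).mono_exponent
      (by norm_num : (4 : ℝ≥0∞) ≤ 6)
  exact MemLp.mul (p := 4) (q := 4) (r := 2) (h6 w) (h6 v)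

theorem integrable_transport (hd : d = 2 ∨ d = 3) (q : H1 G.Ω) (u : VecH1 G.Ω) {g : E d → E d}
    (hg : MemLp g 2 (vol G.Ω)) :
    Integrable (fun x => fn q x * ∑ i, fn (u i) x * g x i) (vol G.Ω) := by
  simp_rw [Finset.mul_sum]
  refine integrable_finsetSum _ fun i _ => ?_
  have := (memLp_fn_mul_fn hd q (u i)).integrable_mul
    (hg.continuousLinearMap_comp (EuclideanSpace.proj (𝕜 := ℝ) i))
  refine this.congr (Eventually.of_forall fun x => ?_)
  simp [mul_assoc]

/-- The natural test function is `λ q + V`, but only `V - Vbar` has a restriction in the charge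
space. The compatibility condition supplies that restriction as an element `r₀`, whose gradient is
the restricted one by `grad_ae_eq_of_fn_ae_eq`; the terms with `Vbar` are the price. -/
theorem IsSolution.charge_energy (hd : d = 2 ∨ d = 3)
    (H : IsSolution G P A B dt N S Vbar s) {n : ℕ} (hn : n < N) :
    1 / dt * (P.lam * (1 / 2 * normL2 (s.q (n + 1)) ^ 2 - 1 / 2 * normL2 (s.q n) ^ 2
        + 1 / 2 * normL2 (s.q (n + 1) - s.q n) ^ 2)
      + ((∫ x in G.Ω, fn (s.q (n + 1)) x * fn (s.V (n + 1) - Vbar (n + 1)) x)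
        - ∫ x in G.Ω, fn (s.q n) x * fn (s.V (n + 1) - Vbar (n + 1)) x))
      - ((∫ x in G.Ω, fn (s.q n) x *
          ∑ i, (P.lam * grad (s.q (n + 1)) x i + grad (s.V (n + 1)) x i) * fn (s.u (n + 1) i) x)
        - ∫ x in G.Ω, fn (s.q n) x * ∑ i, fn (s.u (n + 1) i) x * grad (Vbar (n + 1)) x i)
      + ((∫ x in G.Ω, P.K (fn (s.φ n) x) *
          ‖P.lam • grad (s.q (n + 1)) x + grad (s.V (n + 1)) x‖ ^ 2)
        - ∫ x in G.Ω, P.K (fn (s.φ n) x) *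
          inner ℝ (P.lam • grad (s.q (n + 1)) x + grad (s.V (n + 1)) x) (grad (Vbar (n + 1)) x))
    = 0 := by
  set q := s.q n
  set q' := s.q (n + 1)
  set V' := s.V (n + 1)
  set Z := Vbar (n + 1)
  set u' := s.u (n + 1)
  set φ := s.φ n
  obtain ⟨r₀, hr₀, hrw⟩ := S.compat _ (H.V_mem n hn)
  have hrg := grad_ae_eq_of_fn_ae_eq G.open_Ω G.open_Ωs.measurableSet G.subset hrw
  have hle := vol_mono_subset G
  have h := H.charge n hn (P.lam • q' + r₀)
    (S.Qh.add_mem (S.Qh.smul_mem _ (H.q_mem _ hn)) hr₀)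
  have cf : fn (P.lam • q' + r₀) =ᵐ[vol G.Ω] fun x => P.lam * fn q' x + fn (V' - Z) x := by
    filter_upwards [fn_add (P.lam • q') r₀, fn_smul P.lam q', hrw] with x h1 h2 h3
    rw [h1, h2, h3]
  have cg : grad (P.lam • q' + r₀) =ᵐ[vol G.Ω]
      fun x => (P.lam • grad q' x + grad V' x) - grad Z x := by
    filter_upwards [grad_add (P.lam • q') r₀, grad_smul P.lam q', hrg,
      ae_mono hle (grad_sub V' Z)] with x h1 h2 h3 h4
    rw [h1, h2, h3, h4]
    abel
  have mw : MemLp (fn (V' - Z)) 2 (vol G.Ω) := (memLp_fn _).mono_measure hle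
  have mX : MemLp (fun x => P.lam • grad q' x + grad V' x) 2 (vol G.Ω) :=
    ((memLp_grad q').const_smul P.lam).add (memLp_grad_restrict G V')
  have mZ : MemLp (grad Z) 2 (vol G.Ω) := memLp_grad_restrict G Z
  have t1 : ∫ x in G.Ω, (fn q' x - fn q x) / dt * fn (P.lam • q' + r₀) x
      = 1 / dt * (P.lam * (1 / 2 * normL2 q' ^ 2 - 1 / 2 * normL2 q ^ 2
        + 1 / 2 * normL2 (q' - q) ^ 2)
        + ((∫ x in G.Ω, fn q' x * fn (V' - Z) x) - ∫ x in G.Ω, fn q x * fn (V' - Z) x)) := by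
    have j1 := (integrable_fn_sq q').const_mul (1 / 2)
    have j2 := (integrable_fn_sq q).const_mul (1 / 2)
    have j3 := (integrable_fn_sq (q' - q)).const_mul (1 / 2)
    have j4 : Integrable (fun x => fn q' x * fn (V' - Z) x) (vol G.Ω) :=
      (memLp_fn q').integrable_mul mw
    have j5 : Integrable (fun x => fn q x * fn (V' - Z) x) (vol G.Ω) :=
      (memLp_fn q).integrable_mul mw
    have j6 : Integrable (fun x => P.lam * (1 / 2 * fn q' x ^ 2 - 1 / 2 * fn q x ^ 2
        + 1 / 2 * fn (q' - q) x ^ 2)) (vol G.Ω) := ((j1.sub j2).add j3).const_mul P.lam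
    rw [normL2_sq, normL2_sq, normL2_sq, ← integral_const_mul, ← integral_const_mul,
      ← integral_const_mul, integral_sub_add j1 j2 j3, ← integral_const_mul, ← add_sub_assoc,
      add_sub_right_comm, integral_sub_add j6 j5 j4,
      ← integral_const_mul]
    refine integral_congr_ae ?_
    filter_upwards [cf, fn_sub q' q] with x h1 h2
    rw [h1, h2]
    ring
  have t2 : ∫ x in G.Ω, fn q x * ∑ i, fn (u' i) x * grad (P.lam • q' + r₀) x i
      = (∫ x in G.Ω, fn q x * ∑ i, (P.lam * grad q' x i + grad V' x i) * fn (u' i) x)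
        - ∫ x in G.Ω, fn q x * ∑ i, fn (u' i) x * grad Z x i := by
    have j1 := integrable_transport hd q u' mX
    have j2 := integrable_transport hd q u' mZ
    have e : ∫ x in G.Ω, fn q x * ∑ i, (P.lam * grad q' x i + grad V' x i) * fn (u' i) x
        = ∫ x in G.Ω, fn q x * ∑ i, fn (u' i) x * (P.lam • grad q' x + grad V' x) i := by
      simp only [PiLp.add_apply, PiLp.smul_apply, smul_eq_mul, mul_comm]
    rw [e, ← integral_sub j1 j2]
    refine integral_congr_ae (cg.mono fun x hx => ?_)
    simp only [hx, PiLp.sub_apply, mul_sub, Finset.sum_sub_distrib]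
  have t3 : ∫ x in G.Ω, P.K (fn φ x) *
        inner ℝ (P.lam • grad q' x + grad V' x) (grad (P.lam • q' + r₀) x)
      = (∫ x in G.Ω, P.K (fn φ x) * ‖P.lam • grad q' x + grad V' x‖ ^ 2)
        - ∫ x in G.Ω, P.K (fn φ x) * inner ℝ (P.lam • grad q' x + grad V' x) (grad Z x) := by
    rw [← integral_sub (P.K_mat.integrable_mul (measurable_fn φ) mX.norm.integrable_sq)
      (P.K_mat.integrable_mul (measurable_fn φ) (integrable_inner_of_memLp mX mZ))]
    refine integral_congr_ae (cg.mono fun x hx => ?_)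
    simp only [hx, inner_sub_right, real_inner_self_eq_norm_sq, mul_sub]
  rw [t1, t2, t3] at h
  exact h

/-- Polarisation of the electric form at the old permittivity. The change of permittivity at fixed
`V'` lives in `Ω` only, since `ε⋆` is constant in the plates; that term cancels against the one in
`IsSolution.chemical_energy`. -/
theorem electric_sub_eq (φ φ' : H1 G.Ω) (V V' Z : H1 G.Ωs) :
    electric G P φ' V' (V' - Z) - electric G P φ V (V' - Z)
      = 1 / 2 * electric G P φ' V' V' - 1 / 2 * electric G P φ V V
        + 1 / 2 * electric G P φ (V' - V) (V' - V)
        + 1 / 2 * (∫ x in G.Ω, (P.eps (fn φ' x) - P.eps (fn φ x)) * ‖grad V' x‖ ^ 2)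
        - (electric G P φ' V' Z - electric G P φ V Z) := by
  have hi : ∀ (φ : H1 G.Ω) (V Z : H1 G.Ωs),
      Integrable (fun x => epsStar G P φ x * inner ℝ (grad V x) (grad Z x)) (vol G.Ωs) :=
    fun φ V Z => integrable_epsStar_mul G P φ
      (integrable_inner_of_memLp (memLp_grad V) (memLp_grad Z))
  have e : ∫ x in G.Ω, (P.eps (fn φ' x) - P.eps (fn φ x)) * ‖grad V' x‖ ^ 2
      = (∫ x in G.Ωs, epsStar G P φ' x * inner ℝ (grad V' x) (grad V' x))
        - ∫ x in G.Ωs, epsStar G P φ x * inner ℝ (grad V' x) (grad V' x) := by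
    rw [← integral_sub (hi φ' V' V') (hi φ V' V'),
      setIntegral_eq_of_subset_of_forall_sdiff_eq_zero G.open_Ωs.measurableSet G.subset
        (fun x hx => by simp [epsStar, hx.2])]
    refine setIntegral_congr_fun G.open_Ω.measurableSet fun x hx => ?_
    simp only [epsStar, if_pos hx, real_inner_self_eq_norm_sq, sub_mul]
  rw [e]
  unfold electric
  have c1 : ∀ (φ : H1 G.Ω) (V : H1 G.Ωs), ∫ x in G.Ωs, epsStar G P φ x * inner ℝ (grad V x) (grad (V' - Z) x)
      = (∫ x in G.Ωs, epsStar G P φ x * inner ℝ (grad V x) (grad V' x))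
        - ∫ x in G.Ωs, epsStar G P φ x * inner ℝ (grad V x) (grad Z x) := by
    intro φ V
    rw [← integral_sub (hi φ V V') (hi φ V Z)]
    refine integral_congr_ae ((grad_sub V' Z).mono fun x hx => ?_)
    simp only [hx, inner_sub_right, mul_sub]
  have c2 : ∫ x in G.Ωs, epsStar G P φ x * inner ℝ (grad (V' - V) x) (grad (V' - V) x)
      = (∫ x in G.Ωs, epsStar G P φ x * inner ℝ (grad V' x) (grad V' x))
        - 2 * (∫ x in G.Ωs, epsStar G P φ x * inner ℝ (grad V x) (grad V' x))
        + ∫ x in G.Ωs, epsStar G P φ x * inner ℝ (grad V x) (grad V x) := by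
    rw [← integral_const_mul, integral_sub_add (hi φ V' V') ((hi φ V V').const_mul 2) (hi φ V V)]
    refine integral_congr_ae ((grad_sub V' V).mono fun x hx => ?_)
    simp only [hx, inner_sub_right, inner_sub_left]
    rw [real_inner_comm (grad V x) (grad V' x)]
    ring
  rw [c1, c1, c2]
  ring

/-- The total energy. -/
noncomputable def energy (G : Geometry d) (P : Model) (s : Approx G) (n : ℕ) : ℝ :=
  kinetic G P (s.φ n) (s.u n) + P.lam * (1 / 2 * normL2 (s.q n) ^ 2)
    + 1 / 2 * electric G P (s.φ n) (s.V n) (s.V n)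
    + P.γ * P.δ * (1 / 2 * normGrad (s.φ n) ^ 2) + P.γ / P.δ * (∫ x in G.Ω, W (fn (s.φ n) x))
    + P.γ * (∫ x, Theta P.θ (tr (s.φ n) x) ∂(surf G.Ω))

/-- The numerical dissipation in one time step. -/
noncomputable def jump (G : Geometry d) (P : Model) (s : Approx G) (n : ℕ) : ℝ :=
  kinetic G P (s.φ n) (s.u (n + 1) - s.u n) + P.lam * (1 / 2 * normL2 (s.q (n + 1) - s.q n) ^ 2)
    + 1 / 2 * electric G P (s.φ n) (s.V (n + 1) - s.V n) (s.V (n + 1) - s.V n)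
    + P.γ * P.δ * (1 / 2 * normGrad (s.φ (n + 1) - s.φ n) ^ 2)

/-- The physical dissipation. -/
noncomputable def dissipation (G : Geometry d) (P : Model) (dt : ℝ) (s : Approx G) (n : ℕ) : ℝ :=
  (∫ x in G.Ω, P.η (fn (s.φ n) x) * ∑ i, ∑ j, symGrad (s.u (n + 1)) x i j ^ 2)
    + (∫ x, P.β (tr (s.φ n) x) * ‖tang (s.u (n + 1)) x‖ ^ 2 ∂(surf G.Ω))
    + P.α * materialNorm G P dt s n ^ 2
    + (∫ x in G.Ω, P.M (fn (s.φ n) x) * ‖grad (s.μ (n + 1)) x‖ ^ 2)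
    + (∫ x in G.Ω, P.K (fn (s.φ n) x) *
          ‖P.lam • grad (s.q (n + 1)) x + grad (s.V (n + 1)) x‖ ^ 2)

theorem IsSolution.potential_succ (H : IsSolution G P A B dt N S Vbar s) {n : ℕ} (hn : n < N)
    {w : H1 G.Ωs} (hw : w ∈ S.Wh) : ∫ x in G.Ω, fn (s.q (n + 1)) x * fn w x
      = electric G P (s.φ (n + 1)) (s.V (n + 1)) w := (H.potential n hn w hw).symm

theorem electric_zero_left (φ : H1 G.Ω) (Z : H1 G.Ωs) : electric G P φ 0 Z = 0 := by
  refine integral_eq_zero_of_ae ((grad_zero (Ω := G.Ωs)).mono fun x hx => ?_)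
  simp [hx]

/-- The tested equations, multiplied by the time step, are added; the couplings occur in pairs of
opposite sign. What remains on the right is due to the boundary voltage, apart from the first step,
where the initial charge is not matched by a potential. -/
theorem IsSolution.energy_step (hd : d = 2 ∨ d = 3) [IsFiniteMeasure (surf G.Ω)]
    (hA : (1 / 2) * (⨆ ξ : ℝ, iteratedDeriv 2 W ξ) ≤ A)
    (hB : (1 / 2) * (⨆ ξ : ℝ, iteratedDeriv 2 (Theta P.θ) ξ) ≤ B) (hdt : 0 < dt)
    (H : IsSolution G P A B dt N S Vbar s) {n : ℕ} (hn : n < N) :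
    energy G P s (n + 1) + jump G P s n + dt * dissipation G P dt s n ≤ energy G P s n
      + (electric G P (s.φ (n + 1)) (s.V (n + 1)) (Vbar (n + 1))
        - electric G P (s.φ n) (s.V n) (Vbar (n + 1)))
      + (if n = 0 then ∫ x in G.Ω, fn (s.q 0) x * fn (s.V 1 - Vbar 1) x else 0)
      + dt * (∫ x in G.Ω, P.K (fn (s.φ n) x) *
          inner ℝ (P.lam • grad (s.q (n + 1)) x + grad (s.V (n + 1)) x) (grad (Vbar (n + 1)) x))
      - dt * (∫ x in G.Ω, fn (s.q n) x * ∑ i, fn (s.u (n + 1) i) x * grad (Vbar (n + 1)) x i) := by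
  have hv := H.velocity_energy hd hn
  have hc := H.chemical_energy hA hB hdt hn
  have hq := H.charge_energy hd hn
  have hφ := H.phase n hn _ (H.μ_mem n hn)
  have hp1 := H.potential_succ hn (H.V_mem n hn)
  -- The potential equation of level `n` is used with a test function of level `n + 1`. For `n = 0`
  -- there is no such equation: by convention `V⁰ = 0`, and the full charge term survives.
  have hp0 : ∫ x in G.Ω, fn (s.q n) x * fn (s.V (n + 1) - Vbar (n + 1)) x
      = electric G P (s.φ n) (s.V n) (s.V (n + 1) - Vbar (n + 1))
        + (if n = 0 then ∫ x in G.Ω, fn (s.q 0) x * fn (s.V 1 - Vbar 1) x else 0) := by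
    rcases n with _ | n
    · rw [H.V_zero, electric_zero_left]
      simp
    · rw [H.potential_succ (by omega) (H.V_mem _ hn)]
      simp
  have hel := electric_sub_eq (P := P) (s.φ n) (s.φ (n + 1)) (s.V n) (s.V (n + 1)) (Vbar (n + 1))
  have hdt' : MemLp (fun x => (tr (s.φ (n + 1)) x - tr (s.φ n) x) / dt) 2 (surf G.Ω) := by
    simp_rw [div_eq_inv_mul]
    exact ((memLp_tr _).sub (memLp_tr _)).const_mul _
  have hsl := memLp_slip G P (s.u (n + 1)) (s.φ n)
  -- The `α` terms of the chemical potential and of the velocity equation are the parts of one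
  -- square.
  have hm : materialNorm G P dt s n ^ 2
      = (∫ x, ((tr (s.φ (n + 1)) x - tr (s.φ n) x) / dt
          + slip G P (s.u (n + 1)) (s.φ n) x) * ((tr (s.φ (n + 1)) x - tr (s.φ n) x) / dt)
            ∂(surf G.Ω))
        + (∫ x, slip G P (s.u (n + 1)) (s.φ n) x ^ 2 ∂(surf G.Ω))
        + ∫ x, (tr (s.φ (n + 1)) x - tr (s.φ n) x) / dt *
          slip G P (s.u (n + 1)) (s.φ n) x ∂(surf G.Ω) := by
    have j1 : Integrable (fun x => ((tr (s.φ (n + 1)) x - tr (s.φ n) x) / dt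
          + slip G P (s.u (n + 1)) (s.φ n) x) * ((tr (s.φ (n + 1)) x - tr (s.φ n) x) / dt))
        (surf G.Ω) := (hdt'.add hsl).integrable_mul hdt'
    have j2 := hsl.integrable_sq
    have j3 : Integrable (fun x => (tr (s.φ (n + 1)) x - tr (s.φ n) x) / dt *
          slip G P (s.u (n + 1)) (s.φ n) x) (surf G.Ω) := hdt'.integrable_mul hsl
    rw [materialNorm, Real.sq_sqrt (integral_nonneg fun _ => sq_nonneg _),
      ← integral_add j1 j2, ← integral_add (f := fun x => _ + _) (j1.add j2) j3]
    refine integral_congr_ae (Eventually.of_forall fun x => ?_)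
    ring
  have e1 : ∫ x in G.Ω, (∑ i, fn (s.u (n + 1) i) x * grad (s.φ n) x i) * fn (s.μ (n + 1)) x
      = ∫ x in G.Ω, fn (s.μ (n + 1)) x * ∑ i, grad (s.φ n) x i * fn (s.u (n + 1) i) x := by
    simp only [mul_comm]
  have e2 : ∫ x in G.Ω, (fn (s.φ (n + 1)) x - fn (s.φ n) x) / dt * fn (s.μ (n + 1)) x
      = ∫ x in G.Ω, fn (s.μ (n + 1)) x * ((fn (s.φ (n + 1)) x - fn (s.φ n) x) / dt) := by
    simp only [mul_comm]
  rw [e1, e2] at hφ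
  simp only [real_inner_self_eq_norm_sq] at hφ
  rw [hp1, hp0] at hq
  unfold energy jump dissipation
  rw [hm]
  have hv' := congrArg (dt * ·) hv
  have hq' := congrArg (dt * ·) hq
  have hφ' := congrArg (dt * ·) hφ
  simp only [mul_add, mul_sub, mul_zero, ← mul_assoc, mul_one_div_cancel hdt.ne', one_mul]
    at hv' hq' hφ' hc ⊢
  linarith

end

end Electrowetting

namespace Electrowetting

/-! ### Bounds for the terms of the energy balance -/

variable {d : ℕ} {G : Geometry d} {P : Model}

theorem sqrt_integral_norm_sq {α F : Type*} [MeasurableSpace α] [NormedAddCommGroup F]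
    [InnerProductSpace ℝ F] {μ : Measure α} {f : α → F} (hf : MemLp f 2 μ) :
    √(∫ x, ‖f x‖ ^ 2 ∂μ) = (eLpNorm f 2 μ).toReal := by
  have h := integral_inner_self_eq_norm_sq (hf.toLp f)
  have e : ∫ x, ‖hf.toLp f x‖ ^ 2 ∂μ = ∫ x, ‖f x‖ ^ 2 ∂μ :=
    integral_congr_ae (hf.coeFn_toLp.mono fun x hx => by simp only [hx])
  rw [← e, h, Real.sqrt_sq (norm_nonneg _), Lp.norm_toLp]

/-- The `L²` norm of the symmetric gradient. -/
noncomputable def symNorm (u : VecH1 G.Ω) : ℝ := √(∫ x in G.Ω, ∑ i, ∑ j, symGrad u x i j ^ 2)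

/-- The `L²` norm of `∇(λ q + V)`. -/
noncomputable def fluxNorm (P : Model) (q : H1 G.Ω) (V : H1 G.Ωs) : ℝ :=
  √(∫ x in G.Ω, ‖P.lam • grad q x + grad V x‖ ^ 2)

theorem integrable_symGrad_sq (u : VecH1 G.Ω) :
    Integrable (fun x => ∑ i, ∑ j, symGrad u x i j ^ 2) (vol G.Ω) :=
  integrable_finsetSum _ fun i _ => integrable_finsetSum _ fun j _ =>
    (memLp_symGrad u i j).integrable_sq

theorem memLp_flux (P : Model) (q : H1 G.Ω) (V : H1 G.Ωs) :
    MemLp (fun x => P.lam • grad q x + grad V x) 2 (vol G.Ω) :=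
  ((memLp_grad q).const_smul P.lam).add (memLp_grad_restrict G V)

theorem symNorm_sq (u : VecH1 G.Ω) :
    symNorm u ^ 2 = ∫ x in G.Ω, ∑ i, ∑ j, symGrad u x i j ^ 2 :=
  Real.sq_sqrt (integral_nonneg fun _ => Finset.sum_nonneg fun _ _ =>
    Finset.sum_nonneg fun _ _ => sq_nonneg _)

theorem fluxNorm_sq (q : H1 G.Ω) (V : H1 G.Ωs) :
    fluxNorm P q V ^ 2 = ∫ x in G.Ω, ‖P.lam • grad q x + grad V x‖ ^ 2 :=
  Real.sq_sqrt (integral_nonneg fun _ => sq_nonneg _)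

theorem symNorm_nonneg (u : VecH1 G.Ω) : 0 ≤ symNorm u := Real.sqrt_nonneg _

theorem fluxNorm_nonneg (q : H1 G.Ω) (V : H1 G.Ωs) : 0 ≤ fluxNorm P q V := Real.sqrt_nonneg _

theorem vecNormL2_nonneg (u : VecH1 G.Ω) : 0 ≤ vecNormL2 u := Real.sqrt_nonneg _

theorem normL2_le_vecNormL2 (u : VecH1 G.Ω) (i : Fin d) : normL2 (u i) ≤ vecNormL2 u :=
  Real.le_sqrt_of_sq_le (Finset.single_le_sum (f := fun i => normL2 (u i) ^ 2)
    (fun _ _ => sq_nonneg _) (Finset.mem_univ i))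

theorem toReal_eLpNorm_symGrad_le (u : VecH1 G.Ω) (i j : Fin d) :
    (eLpNorm (fun x => symGrad u x i j) 2 (vol G.Ω)).toReal ≤ symNorm u := by
  rw [← sqrt_integral_norm_sq (memLp_symGrad u i j)]
  refine Real.sqrt_le_sqrt (integral_mono (memLp_symGrad u i j).norm.integrable_sq
    (integrable_symGrad_sq u) fun x => ?_)
  simp only [Real.norm_eq_abs, sq_abs]
  refine (Finset.single_le_sum (f := fun j => symGrad u x i j ^ 2) (fun _ _ => sq_nonneg _)
    (Finset.mem_univ j)).trans ?_
  exact Finset.single_le_sum (f := fun i => ∑ j, symGrad u x i j ^ 2)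
    (fun _ _ => Finset.sum_nonneg fun _ _ => sq_nonneg _) (Finset.mem_univ i)

theorem toReal_eLpNorm_fn {Ω : Set (E d)} (v : H1 Ω) :
    (eLpNorm (fn v) 2 (vol Ω)).toReal = normL2 v := by
  rw [eLpNorm_fn, ENNReal.toReal_ofReal (normL2_nonneg v)]

theorem toReal_eLpNorm_grad {Ω : Set (E d)} (v : H1 Ω) :
    (eLpNorm (grad v) 2 (vol Ω)).toReal = normGrad v := by
  rw [eLpNorm_grad, ENNReal.toReal_ofReal (normGrad_nonneg v)]

/-- Korn's inequality in terms of `symNorm`. -/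
theorem exists_normGrad_le (G : Geometry d) : ∃ C : ℝ, 0 ≤ C ∧ ∀ (u : VecH1 G.Ω) (i : Fin d),
    normGrad (u i) ≤ C * (symNorm u + vecNormL2 u) := by
  obtain ⟨C, hC⟩ := exists_korn G.open_Ω G.nonempty_Ω G.convex_Ω G.bounded_Ω
  set D : ℝ := C * (d * d + d)
  have hD : 0 ≤ D := by positivity
  refine ⟨d * D, by positivity, fun u i => ?_⟩
  have hs := symNorm_nonneg u
  have ha := vecNormL2_nonneg u
  have h1 : ∀ j, (eLpNorm (fun x => grad (u i) x j) 2 (vol G.Ω)).toReal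
      ≤ D * (symNorm u + vecNormL2 u) := by
    intro j
    have hfin : ∀ k l, eLpNorm (fun x => symGrad u x k l) 2 (vol G.Ω) ≠ ⊤ := fun k l =>
      (memLp_symGrad u k l).eLpNorm_ne_top
    have hfin' : ∀ k, eLpNorm (fn (u k)) 2 (vol G.Ω) ≠ ⊤ := fun k =>
      (memLp_fn (u k)).eLpNorm_ne_top
    have hS : (∑ k, ∑ l, eLpNorm (fun x => symGrad u x k l) 2 (vol G.Ω)) ≠ ⊤ :=
      ENNReal.sum_ne_top.2 fun k _ => ENNReal.sum_ne_top.2 fun l _ => hfin k l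
    have hF : (∑ k, eLpNorm (fn (u k)) 2 (vol G.Ω)) ≠ ⊤ := ENNReal.sum_ne_top.2 fun k _ => hfin' k
    have h2 := ENNReal.toReal_mono (ENNReal.mul_ne_top ENNReal.coe_ne_top
      (ENNReal.add_ne_top.2 ⟨hS, hF⟩)) (hC u i j)
    rw [ENNReal.toReal_mul, ENNReal.toReal_add hS hF, ENNReal.toReal_sum fun k _ =>
      ENNReal.sum_ne_top.2 fun l _ => hfin k l, ENNReal.toReal_sum fun k _ => hfin' k] at h2
    refine h2.trans ?_
    have h3 : ∑ k, (∑ l, eLpNorm (fun x => symGrad u x k l) 2 (vol G.Ω)).toReal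
        ≤ d * d * symNorm u := by
      calc _ ≤ ∑ _k : Fin d, ∑ _l : Fin d, symNorm u := by
            refine Finset.sum_le_sum fun k _ => ?_
            rw [ENNReal.toReal_sum fun l _ => hfin k l]
            exact Finset.sum_le_sum fun l _ => toReal_eLpNorm_symGrad_le u k l
        _ = _ := by simp; ring
    have h4 : ∑ k, (eLpNorm (fn (u k)) 2 (vol G.Ω)).toReal ≤ d * vecNormL2 u := by
      calc _ ≤ ∑ _k : Fin d, vecNormL2 u := Finset.sum_le_sum fun k _ => by
            rw [toReal_eLpNorm_fn]; exact normL2_le_vecNormL2 u k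
        _ = _ := by simp
    calc _ ≤ (C : ℝ) * (d * d * symNorm u + d * vecNormL2 u) := by
          rw [ENNReal.coe_toReal]; gcongr
      _ ≤ (C : ℝ) * ((d * d + d) * symNorm u + (d * d + d) * vecNormL2 u) := by
          gcongr
          · exact le_add_of_nonneg_right (by positivity)
          · exact le_add_of_nonneg_left (by positivity)
      _ = _ := by ring
  have h5 : eLpNorm (grad (u i)) 2 (vol G.Ω) ≤
      ∑ j, eLpNorm (fun x => grad (u i) x j) 2 (vol G.Ω) := by
    calc eLpNorm (grad (u i)) 2 (vol G.Ω)
        ≤ eLpNorm (∑ j, fun x => ‖grad (u i) x j‖) 2 (vol G.Ω) := by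
          refine eLpNorm_mono fun x => ?_
          rw [Finset.sum_apply, Real.norm_of_nonneg (Finset.sum_nonneg fun _ _ => norm_nonneg _)]
          conv_lhs => rw [← (EuclideanSpace.basisFun (Fin d) ℝ).sum_repr (grad (u i) x)]
          refine (norm_sum_le _ _).trans (Finset.sum_le_sum fun j _ => ?_)
          simp [norm_smul]
      _ ≤ ∑ j, eLpNorm (fun x => ‖grad (u i) x j‖) 2 (vol G.Ω) :=
          eLpNorm_sum_le (fun j _ => (memLp_grad_apply (u i) j).norm.1) (by norm_num)
      _ = _ := by simp_rw [eLpNorm_norm]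
  rw [← toReal_eLpNorm_grad]
  have hfin : ∀ j, eLpNorm (fun x => grad (u i) x j) 2 (vol G.Ω) ≠ ⊤ := fun j =>
    (memLp_grad_apply (u i) j).eLpNorm_ne_top
  refine (ENNReal.toReal_mono (ENNReal.sum_ne_top.2 fun j _ => hfin j) h5).trans ?_
  rw [ENNReal.toReal_sum fun j _ => hfin j]
  refine (Finset.sum_le_sum fun j _ => h1 j).trans (le_of_eq ?_)
  simp
  ring

theorem exists_toReal_eLpNorm_six_le (hd : d = 2 ∨ d = 3) (G : Geometry d) :
    ∃ C : ℝ, 0 ≤ C ∧ ∀ v : H1 G.Ω,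
      (eLpNorm (fn v) 6 (vol G.Ω)).toReal ≤ C * (normL2 v + normGrad v) := by
  obtain ⟨C, hC⟩ := exists_sobolev hd G.open_Ω G.convex_Ω G.bounded_Ω G.nonempty_Ω
  refine ⟨C, C.2, fun v => ?_⟩
  have h := hC v (fun _ => 0) ⟨contDiff_const, HasCompactSupport.zero⟩
  have hg : ∀ x, gradient (fun _ : E d => (0 : ℝ)) x = 0 := fun x => by simp [gradient]
  simp only [hg, zero_sub] at h
  have e1 : eLpNorm (fun x => -fn v x) 6 (vol G.Ω) = eLpNorm (fn v) 6 (vol G.Ω) := eLpNorm_neg ..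
  have e2 : eLpNorm (fun x => -fn v x) 2 (vol G.Ω) = eLpNorm (fn v) 2 (vol G.Ω) := eLpNorm_neg ..
  have e3 : eLpNorm (fun x => -grad v x) 2 (vol G.Ω) = eLpNorm (grad v) 2 (vol G.Ω) :=
    eLpNorm_neg ..
  rw [e1, e2, e3] at h
  have h2 := ENNReal.toReal_mono (ENNReal.mul_ne_top ENNReal.coe_ne_top
      (ENNReal.add_ne_top.2 ⟨(memLp_fn v).eLpNorm_ne_top, (memLp_grad v).eLpNorm_ne_top⟩)) h
  rw [ENNReal.toReal_mul, ENNReal.toReal_add (memLp_fn v).eLpNorm_ne_top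
    (memLp_grad v).eLpNorm_ne_top, toReal_eLpNorm_fn, toReal_eLpNorm_grad] at h2
  exact h2

theorem eLpNorm_mul_le {α : Type*} [MeasurableSpace α] {μ : Measure α} {p q r : ℝ≥0∞}
    [ENNReal.HolderTriple p q r] {f g : α → ℝ} (hf : AEStronglyMeasurable f μ)
    (hg : AEStronglyMeasurable g μ) :
    eLpNorm (fun x => f x * g x) r μ ≤ eLpNorm f p μ * eLpNorm g q μ := by
  have h0 : eLpNorm (f • g) r μ ≤ eLpNorm f p μ * eLpNorm g q μ :=
    eLpNorm_smul_le_mul_eLpNorm hg hf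
  have e : f • g = fun x => f x * g x := by
    funext x
    simp only [Pi.smul_apply', smul_eq_mul]
  rwa [e] at h0

/-- Write `f²g²` as `f · (f g²)` and apply Hölder with exponents `2, 2` and then `6, 6, 6`. Only one
of the two powers of `f` is measured in `L⁶`, which leaves room for Young's inequality when `f` is
the charge. -/
theorem eLpNorm_two_mul_sq_le {α : Type*} [MeasurableSpace α] {μ : Measure α} {f g : α → ℝ}
    (hf : AEStronglyMeasurable f μ) (hg : AEStronglyMeasurable g μ) :
    eLpNorm (fun x => f x * g x) 2 μ ^ 2 ≤ eLpNorm f 2 μ * (eLpNorm f 6 μ * eLpNorm g 6 μ ^ 2) := by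
  have := holderTriple_six_six_three
  have := holderTriple_six_three_two
  have h1 := eLpNorm_mul_le (p := 6) (q := 6) (r := 3) hg hg
  have h2 := eLpNorm_mul_le (p := 6) (q := 3) (r := 2) (f := f) (g := fun x => g x * g x) hf
    (hg.mul hg)
  have h3 := eLpNorm_mul_le (p := 2) (q := 2) (r := 1) (f := f) (g := fun x => f x * (g x * g x)) hf
    (hf.mul (hg.mul hg))
  rw [eLpNorm_two_sq]
  have e : ∫⁻ x, ‖f x * g x‖ₑ ^ 2 ∂μ = eLpNorm (fun x => f x * (f x * (g x * g x))) 1 μ := by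
    rw [eLpNorm_one_eq_lintegral_enorm]
    refine lintegral_congr fun x => ?_
    rw [← enorm_pow]
    congr 1
    ring
  rw [e, pow_two (eLpNorm g 6 μ)]
  exact h3.trans (mul_le_mul' le_rfl (h2.trans (mul_le_mul' le_rfl h1)))

/-- The dissipation contains the gradient of `λ q + V` and not that of `q`; the latter is recovered
by subtracting `∇V`, which the energy controls. -/
theorem lam_mul_normGrad_le (q : H1 G.Ω) (V : H1 G.Ωs) :
    P.lam * normGrad q ≤ fluxNorm P q V + normGrad V := by
  have m1 := memLp_flux P q V
  have m2 := memLp_grad_restrict G V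
  have h := eLpNorm_sub_le (p := 2) m1.1 m2.1 (by norm_num)
  have e : (fun x => P.lam • grad q x + grad V x) - grad V = P.lam • grad q := by
    funext x
    simp
  rw [e, eLpNorm_const_smul] at h
  have h2 : eLpNorm (grad V) 2 (vol G.Ω) ≤ eLpNorm (grad V) 2 (vol G.Ωs) :=
    eLpNorm_mono_measure _ (vol_mono_subset G)
  have h3 := ENNReal.toReal_mono (ENNReal.add_ne_top.2
    ⟨m1.eLpNorm_ne_top, (memLp_grad V).eLpNorm_ne_top⟩) (h.trans (add_le_add le_rfl h2))
  rw [ENNReal.toReal_mul, ENNReal.toReal_add m1.eLpNorm_ne_top (memLp_grad V).eLpNorm_ne_top,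
    toReal_eLpNorm_grad, toReal_eLpNorm_grad, ← sqrt_integral_norm_sq m1] at h3
  simpa [fluxNorm, abs_of_pos P.lam_pos] using h3

theorem sqrt_integral_restrict_le (Z : H1 G.Ωs) :
    √(∫ x in G.Ω, ‖grad Z x‖ ^ 2) ≤ normGrad Z := by
  refine Real.sqrt_le_iff.2 ⟨normGrad_nonneg Z, ?_⟩
  rw [normGrad_sq]
  exact integral_mono_measure (vol_mono_subset G) (Eventually.of_forall fun x => sq_nonneg _)
    (integrable_norm_grad_sq Z)

/-- The estimate of the transport of charge by the velocity against a fixed field. -/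
theorem exists_transport_le (hd : d = 2 ∨ d = 3) (G : Geometry d) (P : Model) :
    ∃ C : ℝ, 0 ≤ C ∧ ∀ (q : H1 G.Ω) (u : VecH1 G.Ω) (V Z : H1 G.Ωs),
      |∫ x in G.Ω, fn q x * ∑ i, fn (u i) x * grad Z x i| ≤
        C * (√(normL2 q * (normL2 q + fluxNorm P q V + normGrad V))
          * (symNorm u + vecNormL2 u)) * normGrad Z := by
  obtain ⟨C₁, hC₁, h6⟩ := exists_toReal_eLpNorm_six_le hd G
  obtain ⟨C₂, hC₂, hK⟩ := exists_normGrad_le G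
  have hlam := P.lam_pos
  set D := C₁ * (1 + 1 / P.lam) with hD
  refine ⟨d * (√D * (C₁ * (1 + C₂))), by positivity, fun q u V Z => ?_⟩
  have hq := normL2_nonneg q
  have hX := fluxNorm_nonneg (P := P) q V
  have hV := normGrad_nonneg V
  have hs := symNorm_nonneg u
  have ha := vecNormL2_nonneg u
  have hZ := normGrad_nonneg Z
  have q6 : (eLpNorm (fn q) 6 (vol G.Ω)).toReal
      ≤ D * (normL2 q + fluxNorm P q V + normGrad V) := by
    refine (h6 q).trans ?_
    rw [hD, mul_assoc]
    refine mul_le_mul_of_nonneg_left ?_ hC₁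
    have h1 : normGrad q ≤ 1 / P.lam * (fluxNorm P q V + normGrad V) := by
      rw [one_div, le_inv_mul_iff₀ hlam]
      exact lam_mul_normGrad_le q V
    have h2 : 0 ≤ 1 / P.lam * normL2 q := by positivity
    nlinarith
  have u6 : ∀ i, (eLpNorm (fn (u i)) 6 (vol G.Ω)).toReal
      ≤ C₁ * (1 + C₂) * (symNorm u + vecNormL2 u) := by
    intro i
    refine (h6 (u i)).trans ?_
    rw [mul_assoc]
    refine mul_le_mul_of_nonneg_left ?_ hC₁
    have := hK u i
    have := normL2_le_vecNormL2 u i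
    linarith
  have hy : ∀ i, √(∫ x in G.Ω, ‖fn q x * fn (u i) x‖ ^ 2) ≤
      √D * (C₁ * (1 + C₂)) * (√(normL2 q * (normL2 q + fluxNorm P q V + normGrad V))
        * (symNorm u + vecNormL2 u)) := by
    intro i
    have m := memLp_fn_mul_fn hd q (u i)
    have m6 := memLp_fn_six hd G.open_Ω G.convex_Ω G.bounded_Ω G.nonempty_Ω
    rw [sqrt_integral_norm_sq m]
    have h1 := eLpNorm_two_mul_sq_le (memLp_fn q).1 (memLp_fn (u i)).1
    have h2 := ENNReal.toReal_mono (ENNReal.mul_ne_top (memLp_fn q).eLpNorm_ne_top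
      (ENNReal.mul_ne_top (m6 q).eLpNorm_ne_top
        (ENNReal.pow_ne_top (m6 (u i)).eLpNorm_ne_top))) h1
    rw [ENNReal.toReal_pow, ENNReal.toReal_mul, ENNReal.toReal_mul, ENNReal.toReal_pow,
      toReal_eLpNorm_fn] at h2
    refine abs_le_of_sq_le_sq' ?_ (by positivity) |>.2
    refine h2.trans ?_
    rw [mul_pow, mul_pow, mul_pow (√(_ * _)), Real.sq_sqrt (by positivity), Real.sq_sqrt
      (by positivity)]
    calc _ ≤ normL2 q * (D * (normL2 q + fluxNorm P q V + normGrad V) *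
          (C₁ * (1 + C₂) * (symNorm u + vecNormL2 u)) ^ 2) := by
          gcongr
          exact u6 i
      _ = _ := by ring
  have hi : ∀ i, Integrable (fun x => fn q x * fn (u i) x * grad Z x i) (vol G.Ω) := fun i =>
    (memLp_fn_mul_fn hd q (u i)).integrable_mul
      ((memLp_grad_restrict G Z).continuousLinearMap_comp (EuclideanSpace.proj (𝕜 := ℝ) i))
  have e : ∫ x in G.Ω, fn q x * ∑ i, fn (u i) x * grad Z x i
      = ∑ i, ∫ x in G.Ω, fn q x * fn (u i) x * grad Z x i := by
    rw [← integral_finsetSum _ fun i _ => hi i]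
    simp_rw [Finset.mul_sum, mul_assoc]
  rw [e]
  refine (Finset.abs_sum_le_sum_abs _ _).trans ?_
  calc _ ≤ ∑ _i : Fin d, √D * (C₁ * (1 + C₂)) *
        (√(normL2 q * (normL2 q + fluxNorm P q V + normGrad V))
        * (symNorm u + vecNormL2 u)) * normGrad Z := by
        refine Finset.sum_le_sum fun i _ => ?_
        have mz : MemLp (fun x => grad Z x i) 2 (vol G.Ω) :=
          (memLp_grad_restrict G Z).continuousLinearMap_comp (EuclideanSpace.proj (𝕜 := ℝ) i)
        have h := integral_inner_le (memLp_fn_mul_fn hd q (u i)) mz (a := fun _ => 1) zero_le_one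
          (fun _ => by simp)
        have e2 : ∫ x in G.Ω, (1 : ℝ) * inner ℝ (fn q x * fn (u i) x) (grad Z x i)
            = ∫ x in G.Ω, fn q x * fn (u i) x * grad Z x i := by
          refine integral_congr_ae (Eventually.of_forall fun x => ?_)
          simp [mul_comm]
        rw [e2, one_mul] at h
        refine h.trans (mul_le_mul (hy i) ?_ (Real.sqrt_nonneg _) (by positivity))
        refine le_trans (Real.sqrt_le_sqrt ?_) (sqrt_integral_restrict_le Z)
        refine integral_mono mz.norm.integrable_sq (memLp_grad_restrict G Z).norm.integrable_sq
          fun x => ?_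
        exact pow_le_pow_left₀ (norm_nonneg _) (PiLp.norm_apply_le _ i) 2
    _ = _ := by
        rw [Finset.sum_const, Finset.card_univ, Fintype.card_fin, nsmul_eq_mul]
        ring

/-- The same estimate after Young's inequality. -/
theorem exists_transport_young (hd : d = 2 ∨ d = 3) (G : Geometry d) (P : Model) {R κ : ℝ}
    (hκ : 0 < κ) :
    ∃ C : ℝ, 0 ≤ C ∧ ∀ (q : H1 G.Ω) (u : VecH1 G.Ω) (V Z : H1 G.Ωs), normGrad Z ≤ R →
      |∫ x in G.Ω, fn q x * ∑ i, fn (u i) x * grad Z x i| ≤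
        κ * (symNorm u ^ 2 + vecNormL2 u ^ 2 + fluxNorm P q V ^ 2 + normGrad V ^ 2)
          + C * normL2 q ^ 2 := by
  obtain ⟨C, hC, h⟩ := exists_transport_le hd G P
  -- Young's inequality is used twice: it first splits off the velocity norms, leaving `D Q (Q + X +
  -- v)`, and then splits `(X + v) · D Q`. The first use yields `D`, the second `D² / (2κ)`.
  set D := C ^ 2 * R ^ 2 / (2 * κ) with hD
  have hD0 : 0 ≤ D := by positivity
  refine ⟨D + D ^ 2 / (2 * κ), by positivity, fun q u V Z hZR => ?_⟩
  have hq := normL2_nonneg q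
  have hX := fluxNorm_nonneg (P := P) q V
  have hV := normGrad_nonneg V
  have hs := symNorm_nonneg u
  have ha := vecNormL2_nonneg u
  have hZ := normGrad_nonneg Z
  refine (h q u V Z).trans ?_
  set Q := normL2 q
  set X := fluxNorm P q V
  set v := normGrad V
  set σ := symNorm u
  set a := vecNormL2 u
  set r := √(Q * (Q + X + v))
  have hr : r ^ 2 = Q * (Q + X + v) := Real.sq_sqrt (by positivity)
  have hr0 : 0 ≤ r := Real.sqrt_nonneg _
  have h1 : C * (r * (σ + a)) * normGrad Z ≤ C * (r * (σ + a)) * R := by gcongr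
  have young : ∀ x y : ℝ, x * y ≤ κ / 2 * x ^ 2 + 1 / (2 * κ) * y ^ 2 := by
    intro x y
    have h2 : 0 ≤ (κ * x - y) ^ 2 / (2 * κ) := by positivity
    have h3 : (κ * x - y) ^ 2 / (2 * κ) = κ / 2 * x ^ 2 + 1 / (2 * κ) * y ^ 2 - x * y := by
      field_simp
      ring
    linarith
  have h2 := young (σ + a) (C * r * R)
  have h3 : 1 / (2 * κ) * (C * r * R) ^ 2 = D * (Q * (Q + X + v)) := by
    rw [← hr, hD]; ring
  have h4 := young (X + v) (D * Q)
  have h5 : 1 / (2 * κ) * (D * Q) ^ 2 = D ^ 2 / (2 * κ) * Q ^ 2 := by ring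
  have h6 : (σ + a) ^ 2 ≤ 2 * (σ ^ 2 + a ^ 2) := by nlinarith [sq_nonneg (σ - a)]
  have h7 : (X + v) ^ 2 ≤ 2 * (X ^ 2 + v ^ 2) := by nlinarith [sq_nonneg (X - v)]
  have h8 : κ / 2 * (σ + a) ^ 2 ≤ κ * (σ ^ 2 + a ^ 2) := by nlinarith
  have h9 : κ / 2 * (X + v) ^ 2 ≤ κ * (X ^ 2 + v ^ 2) := by nlinarith
  calc _ ≤ C * (r * (σ + a)) * R := h1
    _ = (σ + a) * (C * r * R) := by ring
    _ ≤ κ * (σ ^ 2 + a ^ 2) + D * (Q * (Q + X + v)) := by rw [← h3]; linarith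
    _ = κ * (σ ^ 2 + a ^ 2) + D * Q ^ 2 + (X + v) * (D * Q) := by ring
    _ ≤ κ * (σ ^ 2 + a ^ 2) + D * Q ^ 2 + (κ * (X ^ 2 + v ^ 2) + D ^ 2 / (2 * κ) * Q ^ 2) := by
        rw [← h5]; linarith
    _ = _ := by ring

end Electrowetting

namespace Electrowetting

/-! ### Coercivity of the energy and of the dissipation -/

variable {d : ℕ} {G : Geometry d} {P : Model}

/-- The lower bound is kept free of integrability because it is applied to `‖u_τ‖²`, which involves
a pointwise choice of the normal. If `g` is not integrable, its integral is `0` by convention and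
the bound is trivial. -/
theorem IsMaterial.exists_integral_bounds {σ : ℝ → ℝ} (h : IsMaterial σ) :
    ∃ m M : ℝ, 0 < m ∧ 0 < M ∧ ∀ {α : Type} [MeasurableSpace α] (μ : Measure α) (φ g : α → ℝ),
      Measurable φ → (∀ x, 0 ≤ g x) → m * ∫ x, g x ∂μ ≤ ∫ x, σ (φ x) * g x ∂μ ∧
        (Integrable g μ → ∫ x, σ (φ x) * g x ∂μ ≤ M * ∫ x, g x ∂μ) := by
  obtain ⟨m, M, hm, hM⟩ := h.2
  refine ⟨m, M, hm, hm.trans_le ((hM 0).1.trans (hM 0).2.1), fun {α} _ μ φ g hφ hg => ⟨?_, ?_⟩⟩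
  · by_cases hi : Integrable g μ
    · rw [← integral_const_mul]
      exact integral_mono (hi.const_mul m) (h.integrable_mul hφ hi)
        fun x => mul_le_mul_of_nonneg_right (hM _).1 (hg x)
    · rw [integral_undef hi, mul_zero]
      exact integral_nonneg fun x => mul_nonneg (h.pos _).le (hg x)
  · intro hi
    rw [← integral_const_mul]
    exact integral_mono (h.integrable_mul hφ hi) (hi.const_mul M)
      fun x => mul_le_mul_of_nonneg_right (hM _).2.1 (hg x)

theorem vecNormL2_sq_eq_integral (u : VecH1 G.Ω) :
    vecNormL2 u ^ 2 = ∫ x in G.Ω, ∑ i, fn (u i) x ^ 2 := by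
  rw [vecNormL2_sq, integral_finsetSum _ fun i _ => integrable_fn_sq (u i)]
  simp_rw [normL2_sq]

theorem exists_kinetic_bounds (G : Geometry d) (P : Model) : ∃ m M : ℝ, 0 < m ∧ 0 < M ∧
    ∀ (φ : H1 G.Ω) (u : VecH1 G.Ω), m * vecNormL2 u ^ 2 ≤ kinetic G P φ u ∧
      kinetic G P φ u ≤ M * vecNormL2 u ^ 2 := by
  obtain ⟨m, M, hm, hM, h⟩ := P.ρ_mat.exists_integral_bounds
  refine ⟨m / 2, M / 2, by positivity, by positivity, fun φ u => ?_⟩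
  obtain ⟨h1, h2⟩ := h (vol G.Ω) (fn φ) (fun x => ∑ i, fn (u i) x ^ 2) (measurable_fn φ)
    fun x => Finset.sum_nonneg fun i _ => sq_nonneg _
  have h3 := h2 (integrable_sum_fn_sq u)
  rw [← vecNormL2_sq_eq_integral] at h1 h3
  unfold kinetic
  constructor <;> linarith

theorem exists_electric_bounds (G : Geometry d) (P : Model) : ∃ m M : ℝ, 0 < m ∧ 0 < M ∧
    ∀ (φ : H1 G.Ω) (V Z : H1 G.Ωs), m * normGrad V ^ 2 ≤ electric G P φ V V ∧
      |electric G P φ V Z| ≤ M * (normGrad V * normGrad Z) := by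
  obtain ⟨m, M, hm, hM, h⟩ := exists_epsStar_bounds G P
  refine ⟨m, M, hm, hM, fun φ V Z => ⟨?_, ?_⟩⟩
  · rw [normGrad_sq, ← integral_const_mul]
    unfold electric
    simp only [real_inner_self_eq_norm_sq]
    exact integral_mono ((integrable_norm_grad_sq V).const_mul m)
      (integrable_epsStar_mul G P φ (integrable_norm_grad_sq V))
      fun x => mul_le_mul_of_nonneg_right (h φ x).1 (sq_nonneg _)
  · have h1 := integral_inner_le (memLp_grad V) (memLp_grad Z) hM.le (a := epsStar G P φ)
      fun x => by rw [abs_of_pos (hm.trans_le (h φ x).1)]; exact (h φ x).2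
    rwa [← normGrad_sq, ← normGrad_sq, Real.sqrt_sq (normGrad_nonneg V),
      Real.sqrt_sq (normGrad_nonneg Z)] at h1

theorem electric_sub_right (φ : H1 G.Ω) (V Z Z' : H1 G.Ωs) :
    electric G P φ V (Z' - Z) = electric G P φ V Z' - electric G P φ V Z := by
  unfold electric
  rw [← integral_sub
    (integrable_epsStar_mul G P φ (integrable_inner_of_memLp (memLp_grad V) (memLp_grad Z')))
    (integrable_epsStar_mul G P φ (integrable_inner_of_memLp (memLp_grad V) (memLp_grad Z)))]
  refine integral_congr_ae ((grad_sub Z' Z).mono fun x hx => ?_)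
  simp only [hx, inner_sub_right, mul_sub]

theorem exists_conduction_le (G : Geometry d) (P : Model) : ∃ M : ℝ, 0 < M ∧
    ∀ (φ q : H1 G.Ω) (V Z : H1 G.Ωs),
      ∫ x in G.Ω, P.K (fn φ x) * inner ℝ (P.lam • grad q x + grad V x) (grad Z x)
        ≤ M * (fluxNorm P q V * normGrad Z) := by
  obtain ⟨m, M, hm, hM⟩ := P.K_mat.2
  have hM0 : 0 < M := hm.trans_le ((hM 0).1.trans (hM 0).2.1)
  refine ⟨M, hM0, fun φ q V Z => ?_⟩
  have h1 := integral_inner_le (memLp_flux P q V) (memLp_grad_restrict G Z) hM0.le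
    (a := fun x => P.K (fn φ x))
    fun x => by rw [abs_of_pos (hm.trans_le (hM _).1)]; exact (hM _).2.1
  refine (le_abs_self _).trans (h1.trans ?_)
  exact mul_le_mul_of_nonneg_left (mul_le_mul_of_nonneg_left (sqrt_integral_restrict_le Z)
    (fluxNorm_nonneg q V)) hM0.le

/-- The square of the norms that are controlled by the energy. -/
noncomputable def energySize (G : Geometry d) (s : Approx G) (n : ℕ) : ℝ :=
  vecNormL2 (s.u n) ^ 2 + normL2 (s.q n) ^ 2 + normGrad (s.V n) ^ 2 + normGrad (s.φ n) ^ 2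
    + ∫ x in G.Ω, W (fn (s.φ n) x)

/-- The square of the norms that are controlled by the numerical dissipation. -/
noncomputable def jumpSize (G : Geometry d) (s : Approx G) (n : ℕ) : ℝ :=
  vecNormL2 (s.u (n + 1) - s.u n) ^ 2 + normL2 (s.q (n + 1) - s.q n) ^ 2
    + normGrad (s.V (n + 1) - s.V n) ^ 2 + normGrad (s.φ (n + 1) - s.φ n) ^ 2

/-- The square of the norms that are controlled by the physical dissipation. -/
noncomputable def dissipationSize (G : Geometry d) (P : Model) (dt : ℝ) (s : Approx G) (n : ℕ) :
    ℝ :=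
  symNorm (s.u (n + 1)) ^ 2 + (∫ x, ‖tang (s.u (n + 1)) x‖ ^ 2 ∂(surf G.Ω))
    + materialNorm G P dt s n ^ 2 + normGrad (s.μ (n + 1)) ^ 2
    + fluxNorm P (s.q (n + 1)) (s.V (n + 1)) ^ 2

theorem integral_W_nonneg (φ : H1 G.Ω) : 0 ≤ ∫ x in G.Ω, W (fn φ x) :=
  integral_nonneg fun _ => W_nonneg _

theorem abs_integral_Theta_le [IsFiniteMeasure (surf G.Ω)] (θ : ℝ) (φ : H1 G.Ω) :
    ∫ x, |Theta θ (tr φ x)| ∂(surf G.Ω) ≤ (surf G.Ω).real univ / 2 := by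
  calc _ ≤ ∫ _, (1 / 2 : ℝ) ∂(surf G.Ω) :=
        integral_mono (integrable_Theta θ φ).abs (integrable_const _) fun x => abs_Theta_le _ _
    _ = _ := by rw [integral_const, smul_eq_mul]; ring

theorem energy_lower_arith {m m₁ m₂ lam γδ γd c a q v g w k e θ : ℝ} (l1 : m ≤ m₁)
    (l2 : m ≤ m₂ / 2) (l3 : m ≤ lam / 2) (l4 : m ≤ γδ / 2) (l5 : m ≤ γd) (hw : 0 ≤ w)
    (hk : m₁ * a ^ 2 ≤ k) (he : m₂ * v ^ 2 ≤ e) (hθ : -c ≤ θ) :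
    m * (a ^ 2 + q ^ 2 + v ^ 2 + g ^ 2 + w) ≤ k + lam * (1 / 2 * q ^ 2) + 1 / 2 * e
      + γδ * (1 / 2 * g ^ 2) + γd * w + θ + c := by
  have n1 := mul_le_mul_of_nonneg_right l1 (sq_nonneg a)
  have n2 := mul_le_mul_of_nonneg_right l2 (sq_nonneg v)
  have n3 := mul_le_mul_of_nonneg_right l3 (sq_nonneg q)
  have n4 := mul_le_mul_of_nonneg_right l4 (sq_nonneg g)
  have n5 := mul_le_mul_of_nonneg_right l5 hw
  linarith

theorem energy_upper_arith {M₁ M₂ lam γδ γd c a q v g w k e θ : ℝ} (h1 : 0 ≤ M₁) (h2 : 0 ≤ M₂)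
    (h3 : 0 ≤ lam) (h4 : 0 ≤ γδ) (h5 : 0 ≤ γd) (hw : 0 ≤ w) (hk : k ≤ M₁ * a ^ 2)
    (he : e ≤ M₂ * (v * v)) (hθ : θ ≤ c) :
    k + lam * (1 / 2 * q ^ 2) + 1 / 2 * e + γδ * (1 / 2 * g ^ 2) + γd * w + θ
      ≤ (M₁ + M₂ + lam + γδ + γd) * (a ^ 2 + q ^ 2 + v ^ 2 + g ^ 2 + w) + c := by
  have e1 : 0 ≤ M₁ * (q ^ 2 + v ^ 2 + g ^ 2 + w) := by positivity
  have e2 : 0 ≤ M₂ * (a ^ 2 + q ^ 2 + 1 / 2 * v ^ 2 + g ^ 2 + w) := by positivity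
  have e3 : 0 ≤ lam * (a ^ 2 + 1 / 2 * q ^ 2 + v ^ 2 + g ^ 2 + w) := by positivity
  have e4 : 0 ≤ γδ * (a ^ 2 + q ^ 2 + v ^ 2 + 1 / 2 * g ^ 2 + w) := by positivity
  have e5 : 0 ≤ γd * (a ^ 2 + q ^ 2 + v ^ 2 + g ^ 2) := by positivity
  linarith

/-- Every part of the energy is nonnegative except the boundary energy, which is bounded because
`|Θ| ≤ 1/2` and the surface has finite measure; hence the additive constant `C`. -/
theorem exists_energy_bounds (G : Geometry d) (P : Model) [IsFiniteMeasure (surf G.Ω)] :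
    ∃ m M C : ℝ, 0 < m ∧ 0 < M ∧ 0 ≤ C ∧ ∀ (s : Approx G) (n : ℕ),
      m * energySize G s n ≤ energy G P s n + C ∧ energy G P s n ≤ M * energySize G s n + C ∧
      m * jumpSize G s n ≤ jump G P s n := by
  obtain ⟨m₁, M₁, hm₁, hM₁, h₁⟩ := exists_kinetic_bounds G P
  obtain ⟨m₂, M₂, hm₂, hM₂, h₂⟩ := exists_electric_bounds G P
  have g1 := P.lam_pos
  have g2 := P.γ_pos
  have g3 := P.δ_pos
  have g4 : 0 < P.γ * P.δ := by positivity
  have g5 : 0 < P.γ / P.δ := by positivity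
  set c := P.γ * ((surf G.Ω).real univ / 2)
  have hc : 0 ≤ c := by positivity
  set m := min (min m₁ (m₂ / 2)) (min (P.lam / 2) (min (P.γ * P.δ / 2) (P.γ / P.δ))) with hm
  have l1 : m ≤ m₁ := (min_le_left _ _).trans (min_le_left _ _)
  have l2 : m ≤ m₂ / 2 := (min_le_left _ _).trans (min_le_right _ _)
  have l3 : m ≤ P.lam / 2 := (min_le_right _ _).trans (min_le_left _ _)
  have l4 : m ≤ P.γ * P.δ / 2 :=
    (min_le_right _ _).trans ((min_le_right _ _).trans (min_le_left _ _))
  have l5 : m ≤ P.γ / P.δ := (min_le_right _ _).trans ((min_le_right _ _).trans (min_le_right _ _))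
  have hm0 : 0 < m := by simp only [hm, lt_min_iff]; refine ⟨⟨?_, ?_⟩, ?_, ?_, ?_⟩ <;> positivity
  have hΘ : ∀ φ : H1 G.Ω, |P.γ * ∫ x, Theta P.θ (tr φ x) ∂(surf G.Ω)| ≤ c := by
    intro φ
    rw [abs_mul, abs_of_pos g2]
    exact mul_le_mul_of_nonneg_left
      ((abs_integral_le_integral_abs).trans (abs_integral_Theta_le P.θ φ)) g2.le
  refine ⟨m, M₁ + M₂ + P.lam + P.γ * P.δ + P.γ / P.δ, c, hm0, by positivity, hc, fun s n => ?_⟩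
  have k1 := h₁ (s.φ n) (s.u n)
  have k2 := h₂ (s.φ n) (s.V n) (s.V n)
  have k2' := (le_abs_self _).trans k2.2
  have k3 := abs_le.1 (hΘ (s.φ n))
  have k4 := h₁ (s.φ n) (s.u (n + 1) - s.u n)
  have k5 := h₂ (s.φ n) (s.V (n + 1) - s.V n) (s.V (n + 1) - s.V n)
  have k6 := integral_W_nonneg (s.φ n)
  unfold energySize jumpSize energy jump
  refine ⟨?_, ?_, ?_⟩
  · exact energy_lower_arith l1 l2 l3 l4 l5 k6 k1.1 k2.1 k3.1
  · exact energy_upper_arith hM₁.le hM₂.le g1.le g4.le g5.le k6 k1.2 k2' k3.2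
  · have := energy_lower_arith (q := normL2 (s.q (n + 1) - s.q n))
      (g := normGrad (s.φ (n + 1) - s.φ n)) l1 l2 l3 l4 l5 le_rfl k4.1 k5.1
      (neg_nonpos.2 le_rfl : -(0 : ℝ) ≤ 0)
    simpa using this

theorem exists_dissipation_bound (G : Geometry d) (P : Model) :
    ∃ m : ℝ, 0 < m ∧ ∀ (dt : ℝ) (s : Approx G) (n : ℕ),
      m * dissipationSize G P dt s n ≤ dissipation G P dt s n := by
  obtain ⟨m₁, _, hm₁, _, h₁⟩ := P.η_mat.exists_integral_bounds
  obtain ⟨m₂, _, hm₂, _, h₂⟩ := P.β_mat.exists_integral_bounds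
  obtain ⟨m₃, _, hm₃, _, h₃⟩ := P.M_mat.exists_integral_bounds
  obtain ⟨m₄, _, hm₄, _, h₄⟩ := P.K_mat.exists_integral_bounds
  have g := P.α_pos
  set m := min (min m₁ m₂) (min (min m₃ m₄) P.α) with hm
  have l1 : m ≤ m₁ := (min_le_left _ _).trans (min_le_left _ _)
  have l2 : m ≤ m₂ := (min_le_left _ _).trans (min_le_right _ _)
  have l3 : m ≤ m₃ := (min_le_right _ _).trans ((min_le_left _ _).trans (min_le_left _ _))
  have l4 : m ≤ m₄ := (min_le_right _ _).trans ((min_le_left _ _).trans (min_le_right _ _))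
  have l5 : m ≤ P.α := (min_le_right _ _).trans (min_le_right _ _)
  refine ⟨m, by simp only [hm, lt_min_iff]; exact ⟨⟨hm₁, hm₂⟩, ⟨hm₃, hm₄⟩, g⟩, fun dt s n => ?_⟩
  have k1 := (h₁ (vol G.Ω) (fn (s.φ n)) (fun x => ∑ i, ∑ j, symGrad (s.u (n + 1)) x i j ^ 2)
    (measurable_fn _) fun x => Finset.sum_nonneg fun i _ => Finset.sum_nonneg fun j _ =>
      sq_nonneg _).1
  have k2 := (h₂ (surf G.Ω) (tr (s.φ n)) (fun x => ‖tang (s.u (n + 1)) x‖ ^ 2)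
    (measurable_tr _) fun x => sq_nonneg _).1
  have k3 := (h₃ (vol G.Ω) (fn (s.φ n)) (fun x => ‖grad (s.μ (n + 1)) x‖ ^ 2)
    (measurable_fn _) fun x => sq_nonneg _).1
  have k4 := (h₄ (vol G.Ω) (fn (s.φ n))
    (fun x => ‖P.lam • grad (s.q (n + 1)) x + grad (s.V (n + 1)) x‖ ^ 2)
    (measurable_fn _) fun x => sq_nonneg _).1
  rw [← symNorm_sq] at k1
  rw [← normGrad_sq] at k3
  rw [← fluxNorm_sq] at k4
  have t0 : 0 ≤ ∫ x, ‖tang (s.u (n + 1)) x‖ ^ 2 ∂(surf G.Ω) := integral_nonneg fun _ => sq_nonneg _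
  unfold dissipationSize dissipation
  have n1 := mul_le_mul_of_nonneg_right l1 (sq_nonneg (symNorm (s.u (n + 1))))
  have n2 := mul_le_mul_of_nonneg_right l2 t0
  have n3 := mul_le_mul_of_nonneg_right l3 (sq_nonneg (normGrad (s.μ (n + 1))))
  have n4 := mul_le_mul_of_nonneg_right l4
    (sq_nonneg (fluxNorm P (s.q (n + 1)) (s.V (n + 1))))
  have n5 := mul_le_mul_of_nonneg_right l5 (sq_nonneg (materialNorm G P dt s n))
  linarith

/-! ### A discrete Gronwall inequality -/

/-- The implicit factor is inverted through `1 ≤ (1 - a) exp (2a)`, valid for `0 ≤ a ≤ 1/2`, and `1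
+ b ≤ exp b`. The dissipation `J` is carried along on the left, so that its sum is bounded too. -/
theorem discrete_gronwall {N : ℕ} {Y J a b c : ℕ → ℝ} (hY : ∀ n, n ≤ N → 0 ≤ Y n)
    (hJ : ∀ n, n < N → 0 ≤ J n) (ha : ∀ n, n < N → 0 ≤ a n ∧ a n ≤ 1 / 2)
    (hb : ∀ n, n < N → 0 ≤ b n) (hc : ∀ n, n < N → 0 ≤ c n)
    (h : ∀ n, n < N → (1 - a n) * Y (n + 1) + J n ≤ (1 + b n) * Y n + c n) :
    ∀ m, m ≤ N → Y m + ∑ n ∈ Finset.range m, J n ≤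
      Real.exp (∑ n ∈ Finset.range m, (2 * a n + b n)) *
        (Y 0 + 2 * ∑ n ∈ Finset.range m, c n) := by
  intro m
  induction m with
  | zero => simp
  | succ m ih =>
    intro hm
    have hm' : m < N := hm
    have ih := ih hm'.le
    obtain ⟨ha0, ha1⟩ := ha m hm'
    have hb0 := hb m hm'
    have hc0 := hc m hm'
    have hJ0 := hJ m hm'
    have hY0 := hY m hm'.le
    have hY1 := hY (m + 1) hm
    have hs : 0 ≤ ∑ n ∈ Finset.range m, J n :=
      Finset.sum_nonneg fun n hn => hJ n (by have := Finset.mem_range.1 hn; omega)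
    rw [Finset.sum_range_succ, Finset.sum_range_succ _ m, Finset.sum_range_succ _ m, Real.exp_add]
    set S₁ := ∑ n ∈ Finset.range m, J n
    set S₂ := ∑ n ∈ Finset.range m, (2 * a n + b n)
    set S₃ := ∑ n ∈ Finset.range m, c n
    have hS₂ : 0 ≤ S₂ := Finset.sum_nonneg fun n hn => by
      have h1 := Finset.mem_range.1 hn
      have := (ha n (by omega)).1
      have := hb n (by omega)
      positivity
    have hpos : 0 < 1 - a m := by linarith
    set E := Real.exp (2 * a m + b m)
    -- `(1 - a)(1 + 2a) ≥ 1` is where `a ≤ 1/2` is needed.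
    have hE1 : 1 + b m ≤ (1 - a m) * E := by
      have e1 : 1 + b m ≤ Real.exp (b m) := by linarith [Real.add_one_le_exp (b m)]
      have e2 : 1 ≤ (1 - a m) * Real.exp (2 * a m) := by
        have := Real.add_one_le_exp (2 * a m)
        nlinarith
      have e3 : E = Real.exp (2 * a m) * Real.exp (b m) := Real.exp_add _ _
      rw [e3, ← mul_assoc]
      exact e1.trans (le_mul_of_one_le_left (Real.exp_pos _).le e2)
    have hE : 1 ≤ E := Real.one_le_exp (by positivity)
    have hS : 1 ≤ Real.exp S₂ := Real.one_le_exp hS₂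
    have step : Y (m + 1) + J m ≤ E * Y m + 2 * c m := by
      have h1 := h m hm'
      have h2 : (1 - a m) * (Y (m + 1) + J m) ≤ (1 - a m) * (E * Y m + 2 * c m) := by
        have h3 : (1 + b m) * Y m ≤ (1 - a m) * E * Y m := mul_le_mul_of_nonneg_right hE1 hY0
        have h4 : a m * J m ≥ 0 := by positivity
        have h5 : c m ≤ (1 - a m) * (2 * c m) := by nlinarith
        nlinarith
      exact le_of_mul_le_mul_left h2 hpos
    calc Y (m + 1) + (S₁ + J m) ≤ E * (Y m + S₁) + 2 * c m := by nlinarith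
      _ ≤ E * (Real.exp S₂ * (Y 0 + 2 * S₃)) + 2 * c m := by
          have := mul_le_mul_of_nonneg_left ih (zero_le_one.trans hE)
          linarith
      _ ≤ E * (Real.exp S₂ * (Y 0 + 2 * S₃)) + (Real.exp S₂ * E) * (2 * c m) := by
          have : 1 ≤ Real.exp S₂ * E := one_le_mul_of_one_le_of_one_le hS hE
          nlinarith
      _ = _ := by ring

end Electrowetting

namespace Electrowetting

/-! ### The energy estimate -/

variable {d : ℕ} {G : Geometry d} {P : Model}

theorem normV_nonneg (u : VecH1 G.Ω) : 0 ≤ normV u := Real.sqrt_nonneg _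

theorem normGrad_sub_le {Ω : Set (E d)} (v w : H1 Ω) : normGrad (v - w) ≤ normGrad v + normGrad w :=
  norm_sub_le v.1.2.1 w.1.2.1

theorem le_seqSup {X : Type*} {N : ℕ} (p : X → ℝ) (φ : ℕ → X) {n : ℕ} (hn : n ≤ N) :
    p (φ n) ≤ seqSup N p φ :=
  le_ciSup (f := fun n : Fin (N + 1) => p (φ n)) (Set.finite_range _).bddAbove
    ⟨n, Nat.lt_succ_of_le hn⟩

theorem data_bounds {dt R : ℝ} {N : ℕ} {Vbar : ℕ → H1 G.Ωs} {u : VecH1 G.Ω} {φ q : H1 G.Ω}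
    (h : dataSize G dt N Vbar u φ q ≤ R) :
    0 ≤ R ∧ vecNormL2 u ≤ R ∧ √dt * normV u ≤ R ∧ normH1 φ ≤ R ∧ normL2 q ≤ R ∧
      √dt * normGrad q ≤ R ∧ (∀ n ≤ N, normGrad (Vbar n) ≤ R) ∧
      ∑ n ∈ Finset.range N, normGrad (Vbar (n + 1) - Vbar n) ≤ R := by
  unfold dataSize at h
  have h1 := vecNormL2_nonneg u
  have h2 : 0 ≤ √dt * normV u := mul_nonneg (Real.sqrt_nonneg _) (normV_nonneg u)
  have h3 := normH1_nonneg φ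
  have h4 := normL2_nonneg q
  have h5 : 0 ≤ √dt * normGrad q := mul_nonneg (Real.sqrt_nonneg _) (normGrad_nonneg q)
  have h6 : 0 ≤ seqSup N normH1 Vbar := Real.iSup_nonneg fun _ => normH1_nonneg _
  have h7 : 0 ≤ ∑ n ∈ Finset.range N, normH1 (Vbar (n + 1) - Vbar n) :=
    Finset.sum_nonneg fun _ _ => normH1_nonneg _
  refine ⟨by linarith, by linarith, by linarith, by linarith, by linarith, by linarith,
    fun n hn => ?_, ?_⟩
  · have := le_seqSup normH1 Vbar hn
    exact (normGrad_le_normH1 _).trans (by linarith)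
  · exact (Finset.sum_le_sum fun n _ => normGrad_le_normH1 _).trans (by linarith)

theorem energySize_nonneg (s : Approx G) (n : ℕ) : 0 ≤ energySize G s n :=
  add_nonneg (by positivity) (integral_W_nonneg _)

theorem jumpSize_nonneg (s : Approx G) (n : ℕ) : 0 ≤ jumpSize G s n := by
  unfold jumpSize
  positivity

theorem dissipationSize_nonneg (dt : ℝ) (s : Approx G) (n : ℕ) :
    0 ≤ dissipationSize G P dt s n := by
  have : 0 ≤ ∫ x, ‖tang (s.u (n + 1)) x‖ ^ 2 ∂(surf G.Ω) := integral_nonneg fun _ => sq_nonneg _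
  unfold dissipationSize
  positivity

/-- Friedrichs' inequality in the large domain; here the positive measure of the Dirichlet part of
the boundary enters. -/
theorem exists_initial_le (hd : d = 2 ∨ d = 3) (G : Geometry d) :
    ∃ C : ℝ, 0 ≤ C ∧ ∀ (S : Spaces G) (q : H1 G.Ω) (w : H1 G.Ωs), w ∈ S.Wh →
      ∫ x in G.Ω, fn q x * fn w x ≤ C * (normL2 q * normGrad w) := by
  obtain ⟨C, hC, h⟩ := exists_friedrichs (by omega : 0 < d) G.open_Ωs G.convex_Ωs G.bounded_Ωs
    G.nonempty_Ωs G.dirichlet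
  refine ⟨C, hC, fun S q w hw => ?_⟩
  have mw : MemLp (fn w) 2 (vol G.Ω) := (memLp_fn w).mono_measure (vol_mono_subset G)
  have h1 := integral_inner_le (memLp_fn q) mw (a := fun _ => 1) zero_le_one (fun _ => by simp)
  have e : ∫ x in G.Ω, (1 : ℝ) * inner ℝ (fn q x) (fn w x) = ∫ x in G.Ω, fn q x * fn w x := by
    refine integral_congr_ae (Eventually.of_forall fun x => ?_)
    simp [mul_comm]
  have e1 : √(∫ x in G.Ω, ‖fn q x‖ ^ 2) = normL2 q := by
    rw [sqrt_integral_norm_sq (memLp_fn q), toReal_eLpNorm_fn]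
  have e2 : √(∫ x in G.Ω, ‖fn w x‖ ^ 2) ≤ normL2 w := by
    rw [sqrt_integral_norm_sq mw, ← toReal_eLpNorm_fn]
    exact ENNReal.toReal_mono (memLp_fn w).eLpNorm_ne_top
      (eLpNorm_mono_measure _ (vol_mono_subset G))
  rw [e, e1, one_mul] at h1
  calc _ ≤ normL2 q * √(∫ x in G.Ω, ‖fn w x‖ ^ 2) := (le_abs_self _).trans h1
    _ ≤ normL2 q * (C * normGrad w) :=
        mul_le_mul_of_nonneg_left (e2.trans (h w (S.Wh_trace w hw))) (normL2_nonneg q)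
    _ = _ := by ring

/-- The energy step in the form required by Gronwall: `l` is the effect of the increment of `Vbar`,
`i` marks the first step and `e` bounds its extra term, `k` is conduction and `t` transport. Half of
`D` absorbs the new `σ'²` and `X'²`, for which `κ ≤ m/4` suffices; the old `X²` cancels against the
term of the modified energy, and the remaining squares are bounded by `Y` or `Y'`. -/
theorem step_arith {m M C C₂ dt κ R b i Y Y' J D l e k t a a' q v v' X X' σ' : ℝ}
    (hm : 0 < m) (hM : 0 ≤ M) (hC : 0 ≤ C) (hdt : 0 < dt) (hκ : 0 < κ) (hκm : κ ≤ m / 4)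
    (hb : 0 ≤ b) (hi : 0 ≤ i)
    (hE : Y' + J + dt * D ≤ Y - l + i * e + dt * (k - t + κ * X' ^ 2 - κ * X ^ 2))
    (hl : |l| ≤ M * (v * b))
    (hY : m / 2 * (a ^ 2 + q ^ 2 + v ^ 2) ≤ Y) (hY' : m / 2 * (a' ^ 2 + v' ^ 2) ≤ Y')
    (hD : m * (σ' ^ 2 + X' ^ 2) ≤ D) (hk : k ≤ M * (X' * R))
    (ht : |t| ≤ κ * (σ' ^ 2 + a' ^ 2 + X ^ 2 + v ^ 2) + C * q ^ 2)
    (he : e ≤ m / 8 * v' ^ 2 + C₂) :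
    (1 - (κ * (2 / m) * dt + 1 / 4 * i)) * Y' + (J + dt * D / 2)
      ≤ (1 + ((κ + C) * (2 / m) * dt + M * (2 / m) * b)) * Y
        + (M ^ 2 * R ^ 2 / m * dt + M * b + C₂ * i) := by
  have cancel : ∀ x : ℝ, 2 / m * (m / 2 * x) = x := fun x => by field_simp
  have hm2 : 0 < 2 / m := by positivity
  have y1 : a ^ 2 + q ^ 2 + v ^ 2 ≤ 2 / m * Y := by
    rw [← cancel (a ^ 2 + q ^ 2 + v ^ 2)]; exact mul_le_mul_of_nonneg_left hY hm2.le
  have y2 : a' ^ 2 + v' ^ 2 ≤ 2 / m * Y' := by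
    rw [← cancel (a' ^ 2 + v' ^ 2)]; exact mul_le_mul_of_nonneg_left hY' hm2.le
  have y3 : v ^ 2 ≤ 2 / m * Y := by linarith [sq_nonneg a, sq_nonneg q]
  have y4 : q ^ 2 ≤ 2 / m * Y := by linarith [sq_nonneg a, sq_nonneg v]
  have y5 : a' ^ 2 ≤ 2 / m * Y' := by linarith [sq_nonneg v']
  have y6 : m / 8 * v' ^ 2 ≤ 1 / 4 * Y' := by
    have := mul_nonneg hm.le (sq_nonneg a')
    linarith
  have p0 : v * b ≤ b + b * v ^ 2 := by
    have h1 : v ≤ 1 + v ^ 2 := by linarith [sq_nonneg (v - 1), sq_nonneg v]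
    have := mul_le_mul_of_nonneg_right h1 hb
    linarith
  have p1 := mul_le_mul_of_nonneg_left p0 hM
  have p2 := mul_le_mul_of_nonneg_left y3 (mul_nonneg hM hb)
  have p3 : M * (X' * R) ≤ m / 4 * X' ^ 2 + M ^ 2 * R ^ 2 / m := by
    have h0 : 0 ≤ (m * X' / 2 - M * R) ^ 2 / m := by positivity
    have h1 : (m * X' / 2 - M * R) ^ 2 / m
        = m / 4 * X' ^ 2 + M ^ 2 * R ^ 2 / m - M * (X' * R) := by
      field_simp
      ring
    linarith
  have p4 := mul_le_mul_of_nonneg_left y5 hκ.le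
  have p5 := mul_le_mul_of_nonneg_left y3 hκ.le
  have p5' := mul_le_mul_of_nonneg_left y4 hC
  have p6 := mul_le_mul_of_nonneg_left (he.trans (add_le_add_left y6 C₂)) hi
  have p7 := mul_le_mul_of_nonneg_right hκm (sq_nonneg σ')
  have p8 := mul_le_mul_of_nonneg_right hκm (sq_nonneg X')
  have hl1 := (abs_le.1 hl).1
  have ht1 := (abs_le.1 ht).1
  have p9 : k - t + κ * X' ^ 2 - κ * X ^ 2 - D / 2 ≤
      M ^ 2 * R ^ 2 / m + κ * (2 / m * Y') + (κ + C) * (2 / m * Y) := by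
    have := mul_nonneg hm.le (sq_nonneg σ')
    linarith
  have p10 := mul_le_mul_of_nonneg_left p9 hdt.le
  generalize 2 / m = r at *
  generalize M ^ 2 * R ^ 2 / m = r' at *
  linarith

end Electrowetting

namespace Electrowetting

variable {d : ℕ} {G : Geometry d} {P : Model}

theorem normGrad_zero {Ω : Set (E d)} : normGrad (0 : H1 Ω) = 0 := norm_zero

theorem integral_W_le (φ : H1 G.Ω) :
    ∫ x in G.Ω, W (fn φ x) ≤ (vol G.Ω).real univ + normL2 φ ^ 2 := by
  have : IsFiniteMeasure (vol G.Ω) := ⟨by simpa using G.bounded_Ω.measure_lt_top⟩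
  rw [normL2_sq]
  calc _ ≤ ∫ x in G.Ω, 1 + fn φ x ^ 2 :=
        integral_mono (integrable_W G.bounded_Ω φ)
          ((integrable_const _).add (integrable_fn_sq φ)) fun x => W_le _
    _ = _ := by
        rw [integral_add (integrable_const _) (integrable_fn_sq φ), integral_const, smul_eq_mul,
          mul_one]

theorem fluxNorm_zero_right (q : H1 G.Ω) : fluxNorm P q (0 : H1 G.Ωs) = P.lam * normGrad q := by
  have e : ∫ x in G.Ω, ‖P.lam • grad q x + grad (0 : H1 G.Ωs) x‖ ^ 2
      = (P.lam * normGrad q) ^ 2 := by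
    rw [mul_pow, normGrad_sq, ← integral_const_mul]
    have h0 : grad (0 : H1 G.Ωs) =ᵐ[vol G.Ω] 0 := ae_mono (vol_mono_subset G) grad_zero
    refine integral_congr_ae (h0.mono fun x hx => ?_)
    simp [hx, norm_smul, mul_pow]
  rw [fluxNorm, e, Real.sqrt_sq (mul_nonneg P.lam_pos.le (normGrad_nonneg q))]

theorem ceil_mul_le {T dt : ℝ} (hdt : 0 < dt) (h : dt ≤ T) : (⌈T / dt⌉₊ : ℝ) * dt ≤ 2 * T := by
  have h1 := (Nat.ceil_lt_add_one (div_nonneg (hdt.le.trans h) hdt.le)).le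
  have h2 := mul_le_mul_of_nonneg_right h1 hdt.le
  rw [add_mul, div_mul_cancel₀ _ hdt.ne'] at h2
  linarith

theorem sum_coeff_le {N k : ℕ} (hk : k ≤ N) {T dt R p q r : ℝ} {b : ℕ → ℝ} (hdt : 0 < dt)
    (hN : (N : ℝ) * dt ≤ 2 * T) (hb : ∀ n, 0 ≤ b n) (hbR : ∑ n ∈ Finset.range N, b n ≤ R)
    (hp : 0 ≤ p) (hq : 0 ≤ q) (hr : 0 ≤ r) :
    ∑ n ∈ Finset.range k, (p * dt + q * b n + r * (if n = 0 then 1 else 0))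
      ≤ p * (2 * T) + q * R + r := by
  have hsub := Finset.range_mono hk
  refine (Finset.sum_le_sum_of_subset_of_nonneg hsub fun n _ _ => ?_).trans ?_
  · have := hb n
    split_ifs <;> positivity
  · rw [Finset.sum_add_distrib, Finset.sum_add_distrib, ← Finset.mul_sum _ b q, ← Finset.mul_sum _ _ r,
      Finset.sum_const, Finset.card_range, nsmul_eq_mul, Finset.sum_ite_eq']
    have h1 : (N : ℝ) * (p * dt) ≤ p * (2 * T) := by
      have := mul_le_mul_of_nonneg_left hN hp
      linarith
    have h2 := mul_le_mul_of_nonneg_left hbR hq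
    have h3 : r * (if 0 ∈ Finset.range N then (1 : ℝ) else 0) ≤ r := by split_ifs <;> simp [hr]
    linarith

/-- The Lyapunov functional of the scheme. -/
noncomputable def lyapunov (G : Geometry d) (P : Model) (κ dt : ℝ) (Vbar : ℕ → H1 G.Ωs)
    (s : Approx G) (n : ℕ) : ℝ :=
  energy G P s n - electric G P (s.φ n) (s.V n) (Vbar n)
    + κ * dt * fluxNorm P (s.q n) (s.V n) ^ 2

theorem energySize_zero_le {dt R : ℝ} {N : ℕ} {Vbar : ℕ → H1 G.Ωs} {s : Approx G}
    (hV : s.V 0 = 0) (hdata : dataSize G dt N Vbar (s.u 0) (s.φ 0) (s.q 0) ≤ R) :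
    energySize G s 0 ≤ 4 * R ^ 2 + (vol G.Ω).real univ := by
  obtain ⟨hR, h1, -, h3, h4, -, -, -⟩ := data_bounds hdata
  have k1 := pow_le_pow_left₀ (vecNormL2_nonneg _) h1 2
  have k2 := pow_le_pow_left₀ (normL2_nonneg _) h4 2
  have k3 := pow_le_pow_left₀ (normH1_nonneg _) h3 2
  have k4 : normH1 (s.φ 0) ^ 2 = normL2 (s.φ 0) ^ 2 + normGrad (s.φ 0) ^ 2 :=
    Real.sq_sqrt (by positivity)
  have k5 := integral_W_le (s.φ 0)
  unfold energySize
  rw [hV, normGrad_zero]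
  linarith [sq_nonneg R]

-- Gronwall's inequality is applied to the energy minus its coupling with `Vbar`, plus `κ dt` times
-- the squared flux. Subtracting the coupling makes the electric term on the right telescope up to
-- increments of `Vbar`; adding the flux makes up for the old time level in the transport estimate.
set_option maxHeartbeats 1600000 in
theorem exists_energy_estimate (hd : d = 2 ∨ d = 3) (G : Geometry d) (P : Model) {T : ℝ}
    (hT : 0 < T) (R : ℝ) :
    ∃ C : ℝ, ∀ (A B : ℝ), (1 / 2) * (⨆ ξ : ℝ, iteratedDeriv 2 W ξ) ≤ A →
      (1 / 2) * (⨆ ξ : ℝ, iteratedDeriv 2 (Theta P.θ) ξ) ≤ B →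
      ∀ (S : Spaces G) (dt : ℝ), 0 < dt → dt ≤ T → ∀ (Vbar : ℕ → H1 G.Ωs) (s : Approx G),
        IsSolution G P A B dt ⌈T / dt⌉₊ S Vbar s →
        dataSize G dt ⌈T / dt⌉₊ Vbar (s.u 0) (s.φ 0) (s.q 0) ≤ R →
        (∀ n ≤ ⌈T / dt⌉₊, energySize G s n ≤ C) ∧
        ∑ n ∈ Finset.range ⌈T / dt⌉₊, jumpSize G s n ≤ C ∧
        dt * ∑ n ∈ Finset.range ⌈T / dt⌉₊, dissipationSize G P dt s n ≤ C := by
  have : IsFiniteMeasure (surf G.Ω) :=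
    isFiniteMeasure_surf (by omega) G.open_Ω G.convex_Ω G.bounded_Ω G.nonempty_Ω
  obtain ⟨m₁, M₁, C₀, hm₁, hM₁, hC₀, hen⟩ := exists_energy_bounds G P
  obtain ⟨m₂, hm₂, hdi⟩ := exists_dissipation_bound G P
  obtain ⟨_, M₂, _, hM₂, hel⟩ := exists_electric_bounds G P
  obtain ⟨M₃, hM₃, hco⟩ := exists_conduction_le G P
  obtain ⟨C₁, hC₁, hin⟩ := exists_initial_le hd G
  set m := min m₁ m₂
  have hm : 0 < m := lt_min hm₁ hm₂
  set M := M₂ + M₃ with hMdef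
  have hM : 0 < M := by positivity
  -- `m / 4` serves the absorption into the dissipation; `m / (8 T)` keeps the implicit coefficient
  -- `κ (2/m) dt` below `1/4` for all admissible time steps.
  set κ := min (m / 4) (m / (8 * T))
  have hκ : 0 < κ := lt_min (by positivity) (by positivity)
  have hκm : κ ≤ m / 4 := min_le_left _ _
  have hκT : κ * (2 / m) * T ≤ 1 / 4 := by
    calc κ * (2 / m) * T ≤ m / (8 * T) * (2 / m) * T := by gcongr; exact min_le_right _ _
      _ = 1 / 4 := by field_simp; norm_num
  obtain ⟨C, hC, htr⟩ := exists_transport_young hd G P (R := R) hκ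
  -- `C₂` comes from Young's inequality for the first-step term, and `C₃` makes the shifted
  -- functional nonnegative. `Λ` bounds the sum of the exponents, `Γ` that of the sources, `Y₀` the
  -- initial value; `2 T` bounds the number of steps times `dt`.
  set C₂ := 2 / m * (C₁ * R) ^ 2 + C₁ * R ^ 2
  set C₃ := C₀ + M ^ 2 * R ^ 2 / (2 * m)
  set Λ := (2 * (κ * (2 / m)) + (κ + C) * (2 / m)) * (2 * T) + M * (2 / m) * R + 1 / 2
  set Γ := M ^ 2 * R ^ 2 / m * (2 * T) + M * R + C₂
  set Y₀ := M₁ * (4 * R ^ 2 + (vol G.Ω).real univ) + C₀ + C₃ + κ * (P.lam * R) ^ 2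
  set Z := Real.exp Λ * (Y₀ + 2 * Γ)
  refine ⟨2 / m * Z, fun A B hA hB S dt hdt hdT Vbar s H hdata => ?_⟩
  set N := ⌈T / dt⌉₊
  have hN : (N : ℝ) * dt ≤ 2 * T := ceil_mul_le hdt hdT
  obtain ⟨hR, -, -, -, hq0, hgq0, hVR, hbR⟩ := data_bounds hdata
  have hC₂ : 0 ≤ C₂ := by positivity
  set b : ℕ → ℝ := fun n => normGrad (Vbar (n + 1) - Vbar n)
  have hb : ∀ n, 0 ≤ b n := fun n => normGrad_nonneg _
  set ι : ℕ → ℝ := fun n => if n = 0 then 1 else 0 with hι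
  have hι0 : ∀ n, 0 ≤ ι n := fun n => by simp only [hι]; split_ifs <;> simp
  have hι1 : ∀ n, ι n ≤ 1 := fun n => by simp only [hι]; split_ifs <;> simp
  set Y : ℕ → ℝ := fun n => lyapunov G P κ dt Vbar s n + C₃ with hYdef
  set J : ℕ → ℝ := fun n => jump G P s n + dt * dissipation G P dt s n / 2 with hJdef
  have hJ : ∀ n, m * jumpSize G s n + dt * (m * dissipationSize G P dt s n) / 2 ≤ J n := by
    intro n
    have h1 := mul_le_mul_of_nonneg_right (min_le_left m₁ m₂) (jumpSize_nonneg s n)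
    have h2 := mul_le_mul_of_nonneg_right (min_le_right m₁ m₂)
      (dissipationSize_nonneg (P := P) dt s n)
    have h3 := mul_le_mul_of_nonneg_left (h2.trans (hdi dt s n)) hdt.le
    have h4 := (hen s n).2.2
    simp only [hJdef]
    linarith
  -- Half of the coercivity is spent on the coupling with `Vbar`.
  have hY : ∀ n, n ≤ N → m / 2 * energySize G s n ≤ Y n := by
    intro n hn
    have h1 := mul_le_mul_of_nonneg_right (min_le_left m₁ m₂) (energySize_nonneg s n)
    have h2 := (hen s n).1
    have h3 := (le_abs_self _).trans (hel (s.φ n) (s.V n) (Vbar n)).2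
    have v0 := normGrad_nonneg (s.V n)
    have h4 : M₂ * (normGrad (s.V n) * normGrad (Vbar n)) ≤ M * (normGrad (s.V n) * R) := by
      have := hVR n hn
      have := normGrad_nonneg (Vbar n)
      gcongr
      linarith
    have h5 : M * (normGrad (s.V n) * R)
        ≤ m / 2 * normGrad (s.V n) ^ 2 + M ^ 2 * R ^ 2 / (2 * m) := by
      have k0 : 0 ≤ (m * normGrad (s.V n) - M * R) ^ 2 / (2 * m) := by positivity
      have k1 : (m * normGrad (s.V n) - M * R) ^ 2 / (2 * m) = m / 2 * normGrad (s.V n) ^ 2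
          + M ^ 2 * R ^ 2 / (2 * m) - M * (normGrad (s.V n) * R) := by
        field_simp
        ring
      linarith
    have h6 : normGrad (s.V n) ^ 2 ≤ energySize G s n := by
      unfold energySize
      have := integral_W_nonneg (s.φ n)
      linarith [sq_nonneg (vecNormL2 (s.u n)), sq_nonneg (normL2 (s.q n)),
        sq_nonneg (normGrad (s.φ n))]
    have h7 := mul_le_mul_of_nonneg_left h6 (half_pos hm).le
    have h8 : 0 ≤ κ * dt * fluxNorm P (s.q n) (s.V n) ^ 2 := by positivity
    simp only [hYdef, lyapunov]
    linarith
  have hY3 : ∀ n, n ≤ N → m / 2 * (vecNormL2 (s.u n) ^ 2 + normL2 (s.q n) ^ 2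
      + normGrad (s.V n) ^ 2) ≤ Y n := by
    intro n hn
    refine (mul_le_mul_of_nonneg_left ?_ (half_pos hm).le).trans (hY n hn)
    unfold energySize
    have := integral_W_nonneg (s.φ n)
    linarith [sq_nonneg (normGrad (s.φ n))]
  have hstep : ∀ n, n < N → (1 - (κ * (2 / m) * dt + 1 / 4 * ι n)) * Y (n + 1) + J n
      ≤ (1 + ((κ + C) * (2 / m) * dt + M * (2 / m) * b n)) * Y n
        + (M ^ 2 * R ^ 2 / m * dt + M * b n + C₂ * ι n) := by
    intro n hn
    have hE := H.energy_step hd hA hB hdt hn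
    set k := ∫ x in G.Ω, P.K (fn (s.φ n) x) *
      inner ℝ (P.lam • grad (s.q (n + 1)) x + grad (s.V (n + 1)) x) (grad (Vbar (n + 1)) x)
    set t := ∫ x in G.Ω, fn (s.q n) x * ∑ i, fn (s.u (n + 1) i) x * grad (Vbar (n + 1)) x i
    have hZ := hVR (n + 1) hn
    have hl := (hel (s.φ n) (s.V n) (Vbar (n + 1) - Vbar n)).2
    rw [electric_sub_right] at hl
    set e := C₁ * (R * (normGrad (s.V (n + 1)) + R)) with he
    have hv' := normGrad_nonneg (s.V (n + 1))
    have hi : (if n = 0 then ∫ x in G.Ω, fn (s.q 0) x * fn (s.V 1 - Vbar 1) x else 0)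
        ≤ ι n * e := by
      rcases n with _ | n
      · simp only [hι, if_true, one_mul]
        refine (hin S (s.q 0) _ (H.V_mem 0 hn)).trans ?_
        have h1 := (normGrad_sub_le (s.V 1) (Vbar 1)).trans (add_le_add_right hZ _)
        exact mul_le_mul_of_nonneg_left (mul_le_mul hq0 h1 (normGrad_nonneg _) hR) hC₁
      · simp [hι]
    refine step_arith (e := e) (k := k) (t := t)
      (l := electric G P (s.φ n) (s.V n) (Vbar (n + 1)) - electric G P (s.φ n) (s.V n) (Vbar n))
      (a := vecNormL2 (s.u n)) (q := normL2 (s.q n)) (v := normGrad (s.V n))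
      (a' := vecNormL2 (s.u (n + 1))) (v' := normGrad (s.V (n + 1)))
      (X := fluxNorm P (s.q n) (s.V n)) (X' := fluxNorm P (s.q (n + 1)) (s.V (n + 1)))
      (σ' := symNorm (s.u (n + 1))) hm hM.le hC hdt hκ hκm (hb n) (hι0 n) ?_ ?_ (hY3 n hn.le) ?_
      ?_ ?_ (htr _ _ _ _ hZ) ?_
    · simp only [hYdef, lyapunov]
      linarith
    · refine hl.trans (mul_le_mul_of_nonneg_right (by linarith) ?_)
      exact mul_nonneg (normGrad_nonneg _) (normGrad_nonneg _)
    · refine le_trans (mul_le_mul_of_nonneg_left ?_ (half_pos hm).le) (hY3 (n + 1) hn)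
      linarith [sq_nonneg (normL2 (s.q (n + 1)))]
    · refine le_trans ?_ (hdi dt s n)
      refine (mul_le_mul_of_nonneg_left ?_ hm.le).trans
        (mul_le_mul_of_nonneg_right (min_le_right m₁ m₂) (dissipationSize_nonneg dt s n))
      have : 0 ≤ ∫ x, ‖tang (s.u (n + 1)) x‖ ^ 2 ∂(surf G.Ω) := integral_nonneg fun _ => sq_nonneg _
      unfold dissipationSize
      linarith [sq_nonneg (materialNorm G P dt s n), sq_nonneg (normGrad (s.μ (n + 1)))]
    · refine (hco (s.φ n) (s.q (n + 1)) (s.V (n + 1)) (Vbar (n + 1))).trans ?_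
      have := fluxNorm_nonneg (P := P) (s.q (n + 1)) (s.V (n + 1))
      have := normGrad_nonneg (Vbar (n + 1))
      gcongr
      linarith
    · have k0 : 0 ≤ (m * normGrad (s.V (n + 1)) - 4 * (C₁ * R)) ^ 2 / (8 * m) := by positivity
      have k1 : (m * normGrad (s.V (n + 1)) - 4 * (C₁ * R)) ^ 2 / (8 * m)
          = m / 8 * normGrad (s.V (n + 1)) ^ 2 + 2 / m * (C₁ * R) ^ 2
            - C₁ * R * normGrad (s.V (n + 1)) := by
        field_simp
        ring
      simp only [he]
      linarith
  have hY0 : Y 0 ≤ Y₀ := by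
    have h1 := (hen s 0).2.1
    have h2 := mul_le_mul_of_nonneg_left (energySize_zero_le H.V_zero hdata) hM₁.le
    have h3 : κ * dt * fluxNorm P (s.q 0) (s.V 0) ^ 2 ≤ κ * (P.lam * R) ^ 2 := by
      rw [H.V_zero, fluxNorm_zero_right]
      have h4 := pow_le_pow_left₀ (mul_nonneg (Real.sqrt_nonneg dt) (normGrad_nonneg _)) hgq0 2
      rw [mul_pow, Real.sq_sqrt hdt.le] at h4
      have h5 := mul_le_mul_of_nonneg_left h4 (mul_nonneg hκ.le (sq_nonneg P.lam))
      linarith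
    simp only [hYdef, lyapunov]
    have h6 : electric G P (s.φ 0) (s.V 0) (Vbar 0) = 0 := by rw [H.V_zero, electric_zero_left]
    linarith
  have hYpos : ∀ n, n ≤ N → 0 ≤ Y n := fun n hn =>
    (mul_nonneg (half_pos hm).le (energySize_nonneg s n)).trans (hY n hn)
  have hJpos : ∀ n, 0 ≤ J n := fun n => by
    have h1 := jumpSize_nonneg s n
    have h2 := dissipationSize_nonneg (P := P) dt s n
    exact le_trans (by positivity) (hJ n)
  -- The implicit coefficient is at most `1/4` from the transport term plus `1/4` in the first step,
  -- hence at most `1/2`.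
  have hgr := discrete_gronwall hYpos (fun n _ => hJpos n)
    (fun n _ => ⟨add_nonneg (by positivity) (mul_nonneg (by norm_num) (hι0 n)), by
      have h1 : κ * (2 / m) * dt ≤ κ * (2 / m) * T := by gcongr
      have h2 := hι1 n
      linarith⟩)
    (fun n _ => by have := hb n; positivity)
    (fun n _ => by have := hb n; have := hι0 n; positivity) hstep
  have hZ : ∀ k, k ≤ N → Y k + ∑ n ∈ Finset.range k, J n ≤ Z := by
    intro k hk
    refine (hgr k hk).trans ?_
    have s1 : ∑ n ∈ Finset.range k, (2 * (κ * (2 / m) * dt + 1 / 4 * ι n)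
        + ((κ + C) * (2 / m) * dt + M * (2 / m) * b n)) ≤ Λ := by
      refine le_trans (le_of_eq (Finset.sum_congr rfl fun n _ => ?_)) (sum_coeff_le hk
        (p := 2 * (κ * (2 / m)) + (κ + C) * (2 / m)) (q := M * (2 / m)) (r := 1 / 2) hdt hN hb hbR
        (by positivity) (by positivity) (by positivity))
      simp only [hι]
      ring
    have s2 : ∑ n ∈ Finset.range k, (M ^ 2 * R ^ 2 / m * dt + M * b n + C₂ * ι n) ≤ Γ :=
      sum_coeff_le hk hdt hN hb hbR (by positivity) hM.le hC₂
    have s3 : 0 ≤ ∑ n ∈ Finset.range k, (M ^ 2 * R ^ 2 / m * dt + M * b n + C₂ * ι n) :=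
      Finset.sum_nonneg fun n _ => by have := hb n; have := hι0 n; positivity
    have s4 := hYpos 0 (Nat.zero_le _)
    exact mul_le_mul (Real.exp_le_exp.2 s1) (by linarith) (by linarith) (Real.exp_pos _).le
  have scale : ∀ x : ℝ, m / 2 * x ≤ Z → x ≤ 2 / m * Z := by
    intro x hx
    have h1 := mul_le_mul_of_nonneg_left hx (by positivity : 0 ≤ 2 / m)
    have h2 : 2 / m * (m / 2 * x) = x := by field_simp
    rwa [h2] at h1
  have hsum : m * ∑ n ∈ Finset.range N, jumpSize G s n
      + m / 2 * (dt * ∑ n ∈ Finset.range N, dissipationSize G P dt s n) ≤ Z := by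
    have h1 := hZ N le_rfl
    have h2 := hYpos N le_rfl
    have h3 := Finset.sum_le_sum fun n (_ : n ∈ Finset.range N) => hJ n
    rw [Finset.sum_add_distrib, ← Finset.mul_sum, ← Finset.sum_div, ← Finset.mul_sum,
      ← Finset.mul_sum] at h3
    linarith
  have hj : 0 ≤ m * ∑ n ∈ Finset.range N, jumpSize G s n :=
    mul_nonneg hm.le (Finset.sum_nonneg fun n _ => jumpSize_nonneg s n)
  have hD : 0 ≤ m * (dt * ∑ n ∈ Finset.range N, dissipationSize G P dt s n) :=
    mul_nonneg hm.le (mul_nonneg hdt.le (Finset.sum_nonneg fun n _ => dissipationSize_nonneg dt s n))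
  refine ⟨fun n hn => scale _ ?_, scale _ ?_, scale _ ?_⟩
  · have h1 := hZ n hn
    have h2 := hY n hn
    have h3 : 0 ≤ ∑ n ∈ Finset.range n, J n := Finset.sum_nonneg fun n _ => hJpos n
    linarith
  · linarith
  · linarith

end Electrowetting

namespace Electrowetting

/-! ### The stability estimate -/

variable {d : ℕ} {G : Geometry d} {P : Model}

theorem seqSup_le {X : Type*} {N : ℕ} {p : X → ℝ} {φ : ℕ → X} {c : ℝ}
    (h : ∀ n ≤ N, p (φ n) ≤ c) : seqSup N p φ ≤ c :=
  ciSup_le fun n => h n (Nat.lt_succ_iff.1 n.2)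

theorem seqSup_le_sqrt {X : Type*} {N : ℕ} {p : X → ℝ} {φ : ℕ → X} {c : ℝ}
    (h : ∀ n ≤ N, p (φ n) ^ 2 ≤ c) : seqSup N p φ ≤ √c :=
  seqSup_le fun n hn => Real.le_sqrt_of_sq_le (h n hn)

theorem seqHalf_le_sqrt {X : Type*} [Sub X] {N : ℕ} {p : X → ℝ} {φ : ℕ → X} {f : ℕ → ℝ} {c : ℝ}
    (h : ∀ n, p (φ (n + 1) - φ n) ^ 2 ≤ f n) (hf : ∑ n ∈ Finset.range N, f n ≤ c) :
    seqHalf N p φ ≤ √c :=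
  Real.sqrt_le_sqrt ((Finset.sum_le_sum fun n _ => h n).trans hf)

/-- The sum starts at `n = 0`, while the dissipation controls the levels from `1` on; the first term
has to come from the data. -/
theorem seqL2_le_sqrt {X : Type*} {N : ℕ} {p : X → ℝ} {φ : ℕ → X} {f : ℕ → ℝ} {dt c₀ c : ℝ}
    (hdt : 0 ≤ dt) (h0 : dt * p (φ 0) ^ 2 ≤ c₀) (h : ∀ n < N, p (φ (n + 1)) ^ 2 ≤ f n)
    (hf : dt * ∑ n ∈ Finset.range N, f n ≤ c) : seqL2 dt N p φ ≤ √(c + c₀) := by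
  refine Real.sqrt_le_sqrt ?_
  rw [Finset.sum_range_succ', mul_add]
  refine add_le_add (le_trans (mul_le_mul_of_nonneg_left ?_ hdt) hf) h0
  exact Finset.sum_le_sum fun n hn => h n (Finset.mem_range.1 hn)

theorem exists_normV_sq_le (G : Geometry d) : ∃ C : ℝ, 0 ≤ C ∧ ∀ u : VecH1 G.Ω,
    normV u ^ 2 ≤ C * (symNorm u ^ 2 + vecNormL2 u ^ 2) + ∫ x, ‖tang u x‖ ^ 2 ∂(surf G.Ω) := by
  obtain ⟨C, hC, h⟩ := exists_normGrad_le G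
  refine ⟨d * (2 * C ^ 2), by positivity, fun u => ?_⟩
  have ht : 0 ≤ ∫ x, ‖tang u x‖ ^ 2 ∂(surf G.Ω) := integral_nonneg fun _ => sq_nonneg _
  rw [normV, Real.sq_sqrt (add_nonneg (Finset.sum_nonneg fun _ _ => sq_nonneg _) ht)]
  refine add_le_add_left ?_ _
  calc ∑ i, normGrad (u i) ^ 2 ≤ ∑ _i : Fin d, 2 * C ^ 2 * (symNorm u ^ 2 + vecNormL2 u ^ 2) := by
        refine Finset.sum_le_sum fun i _ => ?_
        refine (pow_le_pow_left₀ (normGrad_nonneg _) (h u i) 2).trans ?_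
        have h1 : (symNorm u + vecNormL2 u) ^ 2 ≤ 2 * (symNorm u ^ 2 + vecNormL2 u ^ 2) := by
          linarith [sq_nonneg (symNorm u - vecNormL2 u)]
        have := mul_le_mul_of_nonneg_left h1 (sq_nonneg C)
        linarith
    _ = _ := by
        rw [Finset.sum_const, Finset.card_univ, Fintype.card_fin, nsmul_eq_mul]
        ring

theorem vecNormL2_sq_le_energySize (s : Approx G) (n : ℕ) :
    vecNormL2 (s.u n) ^ 2 ≤ energySize G s n := by
  unfold energySize
  linarith [integral_W_nonneg (s.φ n), sq_nonneg (normL2 (s.q n)), sq_nonneg (normGrad (s.V n)),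
    sq_nonneg (normGrad (s.φ n))]

theorem normL2_sq_le_energySize (s : Approx G) (n : ℕ) :
    normL2 (s.q n) ^ 2 ≤ energySize G s n := by
  unfold energySize
  linarith [integral_W_nonneg (s.φ n), sq_nonneg (vecNormL2 (s.u n)), sq_nonneg (normGrad (s.V n)),
    sq_nonneg (normGrad (s.φ n))]

theorem normGrad_V_sq_le_energySize (s : Approx G) (n : ℕ) :
    normGrad (s.V n) ^ 2 ≤ energySize G s n := by
  unfold energySize
  linarith [integral_W_nonneg (s.φ n), sq_nonneg (vecNormL2 (s.u n)), sq_nonneg (normL2 (s.q n)),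
    sq_nonneg (normGrad (s.φ n))]

theorem normGrad_φ_sq_le_energySize (s : Approx G) (n : ℕ) :
    normGrad (s.φ n) ^ 2 ≤ energySize G s n := by
  unfold energySize
  linarith [integral_W_nonneg (s.φ n), sq_nonneg (vecNormL2 (s.u n)), sq_nonneg (normL2 (s.q n)),
    sq_nonneg (normGrad (s.V n))]

theorem integral_abs_W_le_energySize (s : Approx G) (n : ℕ) :
    ∫ x in G.Ω, |W (fn (s.φ n) x)| ≤ energySize G s n := by
  simp only [abs_of_nonneg (W_nonneg _)]
  unfold energySize
  linarith [sq_nonneg (vecNormL2 (s.u n)), sq_nonneg (normL2 (s.q n)), sq_nonneg (normGrad (s.V n)),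
    sq_nonneg (normGrad (s.φ n))]

theorem seqL2_normV_le {C K R T dt : ℝ} {N : ℕ} {s : Approx G} (hdt : 0 < dt) (hC : 0 ≤ C)
    (hN : (N : ℝ) * dt ≤ 2 * T)
    (hV : ∀ u : VecH1 G.Ω, normV u ^ 2 ≤
      C * (symNorm u ^ 2 + vecNormL2 u ^ 2) + ∫ x, ‖tang u x‖ ^ 2 ∂(surf G.Ω))
    (h0 : √dt * normV (s.u 0) ≤ R) (hE : ∀ n ≤ N, energySize G s n ≤ K)
    (hD : dt * ∑ n ∈ Finset.range N, dissipationSize G P dt s n ≤ K) :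
    seqL2 dt N normV s.u ≤ √((C + 1) * K + C * K * (2 * T) + R ^ 2) := by
  have hK : 0 ≤ K := (energySize_nonneg s 0).trans (hE 0 (Nat.zero_le _))
  refine seqL2_le_sqrt (f := fun n => (C + 1) * dissipationSize G P dt s n + C * K) hdt.le ?_ ?_ ?_
  · have h1 := pow_le_pow_left₀ (mul_nonneg (Real.sqrt_nonneg _) (normV_nonneg _)) h0 2
    rwa [mul_pow, Real.sq_sqrt hdt.le] at h1
  · intro n hn
    have h1 := hV (s.u (n + 1))
    have h2 := mul_le_mul_of_nonneg_left ((vecNormL2_sq_le_energySize s (n + 1)).trans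
      (hE (n + 1) hn)) hC
    have ht : 0 ≤ ∫ x, ‖tang (s.u (n + 1)) x‖ ^ 2 ∂(surf G.Ω) := integral_nonneg fun _ => sq_nonneg _
    have h3 : symNorm (s.u (n + 1)) ^ 2 + ∫ x, ‖tang (s.u (n + 1)) x‖ ^ 2 ∂(surf G.Ω)
        ≤ dissipationSize G P dt s n := by
      unfold dissipationSize
      linarith [sq_nonneg (materialNorm G P dt s n), sq_nonneg (normGrad (s.μ (n + 1))),
        sq_nonneg (fluxNorm P (s.q (n + 1)) (s.V (n + 1)))]
    have h4 := mul_le_mul_of_nonneg_left h3 hC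
    have h5 := mul_nonneg hC ht
    linarith [sq_nonneg (symNorm (s.u (n + 1)))]
  · rw [Finset.sum_add_distrib, ← Finset.mul_sum, Finset.sum_const, Finset.card_range,
      nsmul_eq_mul]
    have h1 := mul_le_mul_of_nonneg_left hD (by positivity : 0 ≤ C + 1)
    have h2 := mul_le_mul_of_nonneg_left hN (mul_nonneg hC hK)
    linarith

end Electrowetting

theorem mainTheorem2 (d : ℕ) (hd : d = 2 ∨ d = 3) (G : Geometry d) (P : Model)
    (T : ℝ) (hT : 0 < T) (R : ℝ) :
    ∃ c : ℝ, ∀ (A B : ℝ), (1 / 2) * (⨆ ξ : ℝ, iteratedDeriv 2 W ξ) ≤ A →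
      (1 / 2) * (⨆ ξ : ℝ, iteratedDeriv 2 (Theta P.θ) ξ) ≤ B →
      ∀ (S : Spaces G) (dt : ℝ), 0 < dt → dt ≤ T →
      ∀ (Vbar : ℕ → H1 G.Ωs) (s : Approx G),
        IsSolution G P A B dt ⌈T / dt⌉₊ S Vbar s →
        dataSize G dt ⌈T / dt⌉₊ Vbar (s.u 0) (s.φ 0) (s.q 0) ≤ R →
        stabilityNorm G P dt ⌈T / dt⌉₊ s ≤ c := by
  have : MeasureTheory.IsFiniteMeasure (surf G.Ω) :=
    isFiniteMeasure_surf (by omega) G.open_Ω G.convex_Ω G.bounded_Ω G.nonempty_Ω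
  obtain ⟨K, hK⟩ := exists_energy_estimate hd G P hT R
  obtain ⟨C, hC, hV⟩ := exists_normV_sq_le G
  -- The summands follow the order of `stabilityNorm`. The potential `W` is bounded by the energy
  -- itself, so no root is taken; the bound for `Θ` uses only `|Θ| ≤ 1/2`.
  refine ⟨√K + √K + √((C + 1) * K + C * K * (2 * T) + R ^ 2) + √K + √K + √K + √K + K + √K + √K
    + √K + (surf G.Ω).real Set.univ / 2 + √(K + 0) + √(K + (P.lam * R) ^ 2),
    fun A B hA hB S dt hdt hdT Vbar s H hdata => ?_⟩
  obtain ⟨hE, hJ, hD⟩ := hK A B hA hB S dt hdt hdT Vbar s H hdata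
  obtain ⟨-, -, hu0, -, -, hq0, -, -⟩ := data_bounds hdata
  have hN := ceil_mul_le hdt hdT
  generalize ⌈T / dt⌉₊ = N at *
  have hjump : ∀ n, jumpSize G s n = vecNormL2 (s.u (n + 1) - s.u n) ^ 2
      + normL2 (s.q (n + 1) - s.q n) ^ 2 + normGrad (s.V (n + 1) - s.V n) ^ 2
      + normGrad (s.φ (n + 1) - s.φ n) ^ 2 := fun _ => rfl
  have htang : ∀ n, 0 ≤ ∫ x, ‖tang (s.u (n + 1)) x‖ ^ 2 ∂(surf G.Ω) := fun n =>
    MeasureTheory.integral_nonneg fun _ => sq_nonneg _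
  have hdiss : ∀ n, materialNorm G P dt s n ^ 2 ≤ dissipationSize G P dt s n ∧
      normGrad (s.μ (n + 1)) ^ 2 ≤ dissipationSize G P dt s n ∧
      fluxNorm P (s.q (n + 1)) (s.V (n + 1)) ^ 2 ≤ dissipationSize G P dt s n := by
    intro n
    have h1 := htang n
    have h2 := sq_nonneg (symNorm (s.u (n + 1)))
    have h3 := sq_nonneg (materialNorm G P dt s n)
    have h4 := sq_nonneg (normGrad (s.μ (n + 1)))
    have h5 := sq_nonneg (fluxNorm P (s.q (n + 1)) (s.V (n + 1)))
    unfold dissipationSize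
    refine ⟨?_, ?_, ?_⟩ <;> linarith
  unfold stabilityNorm
  refine add_le_add (add_le_add (add_le_add (add_le_add (add_le_add (add_le_add (add_le_add
    (add_le_add (add_le_add (add_le_add (add_le_add (add_le_add (add_le_add ?_ ?_) ?_) ?_) ?_) ?_)
    ?_) ?_) ?_) ?_) ?_) ?_) ?_) ?_
  · exact seqSup_le_sqrt fun n hn => (vecNormL2_sq_le_energySize s n).trans (hE n hn)
  · refine seqHalf_le_sqrt (fun n => ?_) hJ
    rw [hjump]
    linarith [sq_nonneg (normL2 (s.q (n + 1) - s.q n)),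
      sq_nonneg (normGrad (s.V (n + 1) - s.V n)), sq_nonneg (normGrad (s.φ (n + 1) - s.φ n))]
  · exact seqL2_normV_le hdt hC hN hV hu0 hE hD
  · exact seqSup_le_sqrt fun n hn => (normL2_sq_le_energySize s n).trans (hE n hn)
  · refine seqHalf_le_sqrt (fun n => ?_) hJ
    rw [hjump]
    linarith [sq_nonneg (vecNormL2 (s.u (n + 1) - s.u n)),
      sq_nonneg (normGrad (s.V (n + 1) - s.V n)), sq_nonneg (normGrad (s.φ (n + 1) - s.φ n))]
  · exact seqSup_le_sqrt fun n hn => (normGrad_φ_sq_le_energySize s n).trans (hE n hn)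
  · refine seqHalf_le_sqrt (fun n => ?_) hJ
    rw [hjump]
    linarith [sq_nonneg (vecNormL2 (s.u (n + 1) - s.u n)),
      sq_nonneg (normGrad (s.V (n + 1) - s.V n)), sq_nonneg (normL2 (s.q (n + 1) - s.q n))]
  · exact seqSup_le fun n hn => (integral_abs_W_le_energySize s n).trans (hE n hn)
  · exact seqSup_le_sqrt fun n hn => (normGrad_V_sq_le_energySize s n).trans (hE n hn)
  · refine seqHalf_le_sqrt (fun n => ?_) hJ
    rw [hjump]
    linarith [sq_nonneg (vecNormL2 (s.u (n + 1) - s.u n)),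
      sq_nonneg (normGrad (s.φ (n + 1) - s.φ n)), sq_nonneg (normL2 (s.q (n + 1) - s.q n))]
  · refine Real.sqrt_le_sqrt (le_trans (mul_le_mul_of_nonneg_left ?_ hdt.le) hD)
    exact Finset.sum_le_sum fun n _ => (hdiss n).1
  · exact seqSup_le fun n _ => abs_integral_Theta_le P.θ (s.φ n)
  · refine seqL2_le_sqrt hdt.le ?_ (fun n _ => (hdiss n).2.1) hD
    rw [H.μ_zero, normGrad_zero]
    simp
  · refine seqL2_le_sqrt hdt.le ?_ (fun n _ => (hdiss n).2.2) hD
    change dt * fluxNorm P (s.q 0) (s.V 0) ^ 2 ≤ _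
    -- At level `0` the flux reduces to `λ ∇q⁰`, which the data control with the weight `√dt`.
    rw [H.V_zero, fluxNorm_zero_right]
    have h1 := pow_le_pow_left₀ (mul_nonneg (Real.sqrt_nonneg _) (normGrad_nonneg _)) hq0 2
    rw [mul_pow, Real.sq_sqrt hdt.le] at h1
    have h2 := mul_le_mul_of_nonneg_left h1 (sq_nonneg P.lam)
    linarith
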